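/- Fix $\zeta\in\mathbb C^*$ and let $w=1/z$ on $C=\mathbb{CP}^1$, $H=\mathrm{diag}(1,-1)$, and $$\alpha_0=\alpha_0(m,m^{(3)})=-\zeta^{-1}\tfrac{dw}{w^3}-\zeta\tfrac{d\bar w}{\bar w^3}-\big(\zeta^{-1}m-\tfrac12m^{(3)}\big)\tfrac{dw}{w}-\big(\zeta\bar m+\tfrac12m^{(3)}\big)\tfrac{d\bar w}{\bar w}.$$ *Framed connections.* Let $\mathcal A^{\mathrm{fr}}_\zeta$ be the set of flat $SL(2,\mathbb C)$-connections $(E,\nabla,g)$ on $\mathbb{CP}^1$, singular only at $z=\infty$, with a unimodular frame $g$ near $\infty$ in which $\nabla=d+\alpha_0(m,m^{(3)})H+(\text{terms smooth at }w=0)$ for some $m\in\mathbb C$, $m^{(3)}\in\mathbb R$. Variations $\dot\nabla$ are derivatives at $t=0$ of smooth paths $\nabla_t$ in $\mathcal A^{\mathrm{fr}}_\zeta$, written in global frames extending $g$, the regular terms being jointly smooth in $(t,w)$ near $w=0$. *Spectral data.* For $m\neq0$ let $\pi:\Sigma=\{(z,s):s^2=z^2+2m\}\to\mathbb C$, $(z,s)\mapsto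 z$, with punctures $\infty_-$ ($s\sim z$) and $\infty_+$ ($s\sim -z$). Fix $\eta\in\mathbb C^*$ with $\operatorname{Re}(\eta/\zeta)>0$ and $\operatorname{Re}(m/\eta)\ne0$. (The choice $\eta=\zeta$ is allowed unless $\operatorname{Re}(\zeta^{-1}m)=0$; in that case an $\eta$ near $\zeta$ gives a resolution of the double wall.) The spectral network $\mathcal W$ of phase $\arg\eta$ consists of the branch points $z^2+2m=0$ and of the walls: the curves emanating from them along which $\eta^{-2}(z^2+2m)\,dz^2>0$. *Framed abelian connections.* Let $\mathcal A^{\mathrm{fr},\mathrm{ab}}_\zeta$ be the set of framed almost-flat $GL(1)$-connections $(\mathcal L,\nabla^{\mathrm{ab}},g^{\mathrm{ab}}_\pm)$ on $\Sigma$: flat away from the two branch points, with holonomy $-1$ around each of them, and equal to $d\pm\pi^*\alpha_0(m,m^{(3)})$ near $\infty_\mp$ in the frame $g^{\mathrm{ab}}_\mp$. *Abelianization.* One has $\mathrm{ab}(\nabla)=\nabla^{\mathrm{ab}}$ if $m$ and $m^{(3)}$ are the same for both and there is an isomorphism $\iota:E\to\pi_*\mathcal L$ off $\mathcal W$ that takes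 $\nabla$ to $\pi_*\nabla^{\mathrm{ab}}$, that jumps at each wall by a unipotent $1+e$ with $e:\mathcal L_{-}\to\mathcal L_{+}$ (where $\pm$ denotes the sheet on which $\eta^{-1}s\,dz$ is positive, resp. negative, on outgoing tangent vectors), and such that $\iota^{-1}(g^{\mathrm{ab}}_-,g^{\mathrm{ab}}_+)\to g$ as $w\to0$ off $\mathcal W$. Given a path $\nabla_t$ as above with abelianizations $\nabla^{\mathrm{ab}}_t$, identify the curves $\Sigma_{m_t}$ smoothly with $\Sigma=\Sigma_{m_0}$, preserving $w$ near the punctures and matching branch points, and trivialize $\mathcal L_t$ by global frames extending $g^{\mathrm{ab}}_\pm$ in which the connection form is smooth in $t$, has its framed form on fixed neighbourhoods of the punctures, and is the fixed form $\pm d\tau/(2\tau)$ near the two branch points ($\tau$ a local coordinate). Then $\dot\nabla^{\mathrm{ab}}$ is the $t$-derivative at $t=0$ of the connection form. *Regularized forms.* In polar coordinates $w=re^{i\theta}$ write $\dot\nabla_i=(\mu_i+O(r))d\theta+(\lambda_i+O(r))\frac{dr}{r}$ with $\mu_i,\lambda_i\in\mathbb C H$, and $\dot\nabla^{\mathrm{ab}}_i=(\pm\mu^{\mathrm{ab}}_i+O(r))d\theta+(\pm\lambda^{\mathrm{ab}}_i+O(r))\frac{dr}{r}$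 near $\infty_\mp$. Put $\mathcal R=\operatorname{tr}(\mu_1\lambda_2-\mu_2\lambda_1)$, $\mathcal R^{\mathrm{ab}}=2(\mu_1^{\mathrm{ab}}\lambda_2^{\mathrm{ab}}-\mu_2^{\mathrm{ab}}\lambda_1^{\mathrm{ab}})$, $C_R=\mathbb{CP}^1\setminus\{|w|<R\}$, $\Sigma_R=\pi^{-1}(C_R)$, and $$\Omega^{\mathrm{reg}}(\dot\nabla_1,\dot\nabla_2)=\lim_{R\to0}\Big[\int_{C_R}\operatorname{tr}(\dot\nabla_1\wedge\dot\nabla_2)-2\pi\log R\cdot\mathcal R\Big],$$ $$\Omega^{\mathrm{reg},\mathrm{ab}}(\dot\nabla^{\mathrm{ab}}_1,\dot\nabla^{\mathrm{ab}}_2)=\lim_{R\to0}\Big[\int_{\Sigma_R}\dot\nabla^{\mathrm{ab}}_1\wedge\dot\nabla^{\mathrm{ab}}_2-2\pi\log R\cdot\mathcal R^{\mathrm{ab}}\Big].$$ **Proposition (abelianization is a symplectomorphism).** Let $\nabla^1_t,\nabla^2_t$ be smooth paths in $\mathcal A^{\mathrm{fr}}_\zeta$ through the same $\nabla$, with $\operatorname{Re}(m/\eta)\neq0$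 along both, with variations $\dot\nabla_1,\dot\nabla_2$ and with abelianizations through the same $\nabla^{\mathrm{ab}}=\mathrm{ab}(\nabla)$ that vary smoothly in the above sense, with variations $\dot\nabla_1^{\mathrm{ab}},\dot\nabla_2^{\mathrm{ab}}$. Then the coefficients $\mu_i,\lambda_i,\mu_i^{\mathrm{ab}},\lambda_i^{\mathrm{ab}}$ exist, the regularization terms agree, $\mathcal R=\mathcal R^{\mathrm{ab}}$, both limits exist, and $$\Omega^{\mathrm{reg}}(\dot\nabla_1,\dot\nabla_2)=\Omega^{\mathrm{reg},\mathrm{ab}}(\dot\nabla_1^{\mathrm{ab}},\dot\nabla_2^{\mathrm{ab}}),\qquad\text{i.e.}\quad \mathrm{ab}^*\Omega^{\mathrm{reg},\mathrm{ab}}=\Omega^{\mathrm{reg}}.$$ -/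

import Mathlib

open Complex Set Filter Topology MeasureTheory Asymptotics
open scoped ContDiff ComplexConjugate Matrix

noncomputable section

/-! ### One-forms in a complex coordinate

The smooth surfaces below carry a global complex coordinate, so a complex-valued (resp.
`2 × 2`-matrix-valued) one-form is a function to real-linear maps from `ℂ` to `ℂ` (resp. to
matrices; these are given by their four entries). -/

/-- Complex `2 × 2` matrices. -/
abbrev Mat2 : Type := Matrix (Fin 2) (Fin 2) ℂ

/-- Matrix-valued real-linear maps on the tangent space `ℂ`, given by their entries. -/
abbrev MatCovector : Type := Fin 2 → Fin 2 → ℂ →L[ℝ] ℂ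

/-- The value of a matrix-valued covector on a tangent vector. -/
def MatCovector.eval (a : MatCovector) (v : ℂ) : Mat2 := Matrix.of fun i j => a i j v

/-- Matrix-valued one-forms on the plane. -/
abbrev MatForm : Type := ℂ → MatCovector

/-- Complex-valued one-forms on the plane. -/
abbrev CForm : Type := ℂ → ℂ →L[ℝ] ℂ

/-- `H = diag(1, -1)`. -/
def matH : Mat2 := !![1, 0; 0, -1]

/-- The diagonal traceless matrices `ℂ · H`. -/
def cartan : Set Mat2 := {X | ∃ c : ℂ, X = c • matH}

/-- The coefficient of `dx ∧ dy` in `tr (a ∧ b)`. -/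
def trWedge (a b : MatCovector) : ℂ := (a.eval 1 * b.eval I - a.eval I * b.eval 1).trace

/-- The coefficient of `dx ∧ dy` in `a ∧ b`. -/
def wedge (a b : ℂ →L[ℝ] ℂ) : ℂ := a 1 * b I - a I * b 1

/-- The coefficient of `dx ∧ dy` in the curvature `dA + A ∧ A` of `d + A`. -/
def curvature (A : MatForm) (z : ℂ) : Mat2 :=
  MatCovector.eval (fderiv ℝ A z 1) I - MatCovector.eval (fderiv ℝ A z I) 1
    + ((A z).eval 1 * (A z).eval I - (A z).eval I * (A z).eval 1)

/-- The scalar one-form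
`-ζ⁻¹ dw/w³ - ζ dw̄/w̄³ - (ζ⁻¹ m - m₃/2) dw/w - (ζ m̄ + m₃/2) dw̄/w̄`
at the point `w`, evaluated on the tangent vector `v`. -/
def singularPart (ζ m : ℂ) (m3 : ℝ) (w v : ℂ) : ℂ :=
  -(ζ⁻¹ * (v / w ^ 3)) - ζ * (conj v / conj w ^ 3)
    - (ζ⁻¹ * m - m3 / 2) * (v / w) - (ζ * conj m + m3 / 2) * (conj v / conj w)

/-! ### Framed flat connections on the projective line -/

/-- A framed flat `SL(2)`-connection on `ℂℙ¹`, with irregular singularity at `z = ∞`.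

A smooth `SL(2, ℂ)`-bundle on `ℂℙ¹` with a unimodular frame `g` near `∞` has a global
unimodular frame that extends `g`, since `SL(2, ℂ)` is simply connected.  In such a frame the
connection is `d + A` with `A` a smooth traceless matrix-valued one-form on `ℂ`.  With
`z = 1 / w`, so `dz = - dw / w²`, the field `framed` says that
`A = singularPart · H + regular terms` near `w = 0`.  The parameter `m⁽³⁾` may be any real number;
the parabolic weights in `(-1/2, 1/2]` are the special case, and with no restriction a variation
at the end point `1/2` can have any `m⁽³⁾`-component. -/
structure FramedConnection (ζ : ℂ) where
  /-- the connection form, in the coordinate `z` -/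
  A : MatForm
  /-- the parameter `m` -/
  m : ℂ
  /-- the parameter `m⁽³⁾` -/
  m3 : ℝ
  smooth : ContDiff ℝ ∞ A
  traceless : ∀ z v, ((A z).eval v).trace = 0
  flat : ∀ z, curvature A z = 0
  framed : ∃ ρ > 0, ∃ B : MatForm, ContDiffOn ℝ ∞ B (Metric.ball 0 ρ) ∧
    ∀ w : ℂ, w ≠ 0 → ‖w‖ < ρ → ∀ v : ℂ,
      (A w⁻¹).eval (-(v / w ^ 2)) = singularPart ζ m m3 w v • matH + (B w).eval v

/-- A smooth path of framed connections through `D`, the regular terms being smooth in the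
parameter as well on a fixed neighbourhood of `w = 0`. -/
structure FramedPath {ζ : ℂ} (D : FramedConnection ζ) where
  /-- the connection at time `t` -/
  conn : ℝ → FramedConnection ζ
  base : conn 0 = D
  smooth : ContDiff ℝ ∞ (fun p : ℝ × ℂ => (conn p.1).A p.2)
  smooth_m : ContDiff ℝ ∞ (fun t => (conn t).m)
  smooth_m3 : ContDiff ℝ ∞ (fun t => (conn t).m3)
  framed : ∃ ρ > 0, ∃ B : ℝ → MatForm,
    ContDiffOn ℝ ∞ (fun p : ℝ × ℂ => B p.1 p.2) (univ ×ˢ Metric.ball 0 ρ) ∧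
    ∀ (t : ℝ) (w : ℂ), w ≠ 0 → ‖w‖ < ρ → ∀ v : ℂ,
      ((conn t).A w⁻¹).eval (-(v / w ^ 2))
        = singularPart ζ (conn t).m (conn t).m3 w v • matH + (B t w).eval v

/-- The variation (tangent vector at `t = 0`) of a path of framed connections. -/
def FramedPath.variation {ζ : ℂ} {D : FramedConnection ζ} (P : FramedPath D) : MatForm :=
  fun z => deriv (fun t => (P.conn t).A z) 0

/-! ### The spectral curve -/

/-- The spectral curve `Σ = {(z, s) : s² = z² + 2m}`, where `(z, s)` stands for the covector
`s dz` at `z`. -/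
def spectralCurve (m : ℂ) : Set (ℂ × ℂ) := {p | p.2 ^ 2 = p.1 ^ 2 + 2 * m}

/-- The point of the spectral curve with coordinate `u = z + s`. -/
def spectralPoint (m u : ℂ) : ℂ × ℂ := ((u - 2 * m / u) / 2, (u + 2 * m / u) / 2)

/-- For `m ≠ 0`, the holomorphic function `u = z + s` identifies `Σ` with `ℂ ∖ {0}`. -/
theorem spectralPoint_bijOn {m : ℂ} (hm : m ≠ 0) :
    BijOn (spectralPoint m) {0}ᶜ (spectralCurve m) := by
  refine ⟨?_, ?_, ?_⟩
  · intro u hu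
    have hu' : u ≠ 0 := hu
    simp only [spectralCurve, spectralPoint, mem_ofPred_eq]
    field_simp
    ring
  · intro u hu u' hu' h
    have h1 := congrArg (fun p : ℂ × ℂ => p.1 + p.2) h
    simp only [spectralPoint] at h1
    linear_combination h1
  · rintro ⟨z, s⟩ h
    have h' : s ^ 2 = z ^ 2 + 2 * m := h
    have hne : z + s ≠ 0 := by
      intro h0
      apply hm
      linear_combination (-(1 : ℂ) / 2) * h' + (s - z) / 2 * h0
    have hdiv : 2 * m / (z + s) = s - z := by
      rw [div_eq_iff hne]
      linear_combination -h'
    refine ⟨z + s, hne, ?_⟩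
    simp only [spectralPoint, hdiv, Prod.mk.injEq]
    constructor <;> ring

/-- The projection `π : Σ → ℂ`, `(z, s) ↦ z`, in the coordinate `u`.  The puncture `∞₋`, where
`s ∼ z`, is `u → ∞`, and the puncture `∞₊`, where `s ∼ -z`, is `u → 0`. -/
def proj (m u : ℂ) : ℂ := (spectralPoint m u).1

/-- The function `s` on `Σ`, in the coordinate `u`. -/
def sheet (m u : ℂ) : ℂ := (spectralPoint m u).2

/-- The derivative `dz/du` of the projection. -/
def projDeriv (m u : ℂ) : ℂ := (1 + 2 * m / u ^ 2) / 2

theorem hasDerivAt_proj (m : ℂ) {u : ℂ} (hu : u ≠ 0) :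
    HasDerivAt (proj m) (projDeriv m u) u := by
  have h := ((hasDerivAt_id u).sub ((hasDerivAt_inv hu).const_mul (2 * m))).div_const 2
  refine (h.congr_deriv ?_).congr_of_eventuallyEq ?_
  · simp only [projDeriv]
    field_simp
    ring
  · filter_upwards with x
    simp [proj, spectralPoint, div_eq_mul_inv]

/-- The sheet exchange `(z, s) ↦ (z, -s)`, in the coordinate `u`. -/
def deck (m u : ℂ) : ℂ := -(2 * m) / u

theorem proj_deck {m u : ℂ} (hm : m ≠ 0) (hu : u ≠ 0) :
    proj m (deck m u) = proj m u ∧ sheet m (deck m u) = -sheet m u := by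
  simp only [proj, sheet, deck, spectralPoint]
  constructor <;> · field_simp; ring

/-- The branch points `s = 0` of `Σ → ℂ`, in the coordinate `u`. -/
theorem sheet_eq_zero_iff {m u : ℂ} (hu : u ≠ 0) :
    sheet m u = 0 ↔ u ^ 2 = -(2 * m) := by
  have : sheet m u = (u ^ 2 + 2 * m) / (2 * u) := by
    simp only [sheet, spectralPoint]
    field_simp
  rw [this, div_eq_zero_iff]
  constructor
  · rintro (h | h)
    · linear_combination h
    · exact absurd h (by simpa using hu)
  · intro h
    exact Or.inl (by linear_combination h)

/-- `Σ'`, the spectral curve without its two branch points, in the coordinate `u`. -/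
def unbranched (m : ℂ) : Set ℂ := {u | u ≠ 0 ∧ u ^ 2 ≠ -(2 * m)}

/-! ### Framed almost-flat connections on the spectral curve -/

/-- The pullback to `Σ` of `singularPart` under `w = 1 / π(u)`, for which
`dw = -π'(u) du / π(u)²`. -/
def liftedSingularPart (ζ m : ℂ) (m3 : ℝ) (m₀ u v : ℂ) : ℂ :=
  singularPart ζ m m3 (proj m₀ u)⁻¹ (-(projDeriv m₀ u * v / proj m₀ u ^ 2))

/-- A framed almost-flat `GL(1)`-connection `d + α` on the spectral curve, in a global frame
that extends the given frames near the punctures: flat away from the two branch points, with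
holonomy `-1` around each of them, and equal to `d ± π^* singularPart` near `∞_∓`. -/
structure FramedAbelianConnection (ζ : ℂ) where
  /-- the parameter `m`, which also determines the spectral curve -/
  m : ℂ
  /-- the parameter `m⁽³⁾` -/
  m3 : ℝ
  /-- the connection form, in the coordinate `u` -/
  α : CForm
  m_ne_zero : m ≠ 0
  smooth : ContDiffOn ℝ ∞ α (unbranched m)
  flat : ∀ u ∈ unbranched m, fderiv ℝ α u 1 I - fderiv ℝ α u I 1 = 0
  almostFlat : ∀ b : ℂ, b ^ 2 = -(2 * m) → ∀ᶠ r : ℝ in 𝓝[>] 0,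
    exp (-∫ x : ℝ in (0 : ℝ)..2 * Real.pi,
      α (b + r * exp (x * I)) (r * I * exp (x * I))) = -1
  framed_minus : ∀ᶠ u in Bornology.cobounded ℂ, ∀ v, α u v = liftedSingularPart ζ m m3 m u v
  framed_plus : ∀ᶠ u in 𝓝[≠] (0 : ℂ), ∀ v, α u v = -liftedSingularPart ζ m m3 m u v

/-- A smooth path of framed almost-flat connections through `a`.  The spectral curves, which
move with the parameter, are identified with the curve of `a` by diffeomorphisms `φ t` that fix
the coordinate `w` near the punctures and match the branch points.  The line bundles are
trivialized by global frames in which the connection has its framed form near the punctures,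
and the fixed form `± dτ / (2τ)` near the two branch points, `τ` being a local coordinate centred
there. -/
structure AbelianPath {ζ : ℂ} (a : FramedAbelianConnection ζ) where
  /-- the connection at time `t` -/
  conn : ℝ → FramedAbelianConnection ζ
  base : conn 0 = a
  /-- the identification of the curve of `a` with the curve at time `t` -/
  φ : ℝ → ℂ → ℂ
  φ_smooth : ContDiffOn ℝ ∞ (fun p : ℝ × ℂ => φ p.1 p.2) {p | p.2 ≠ 0}
  φ_bijOn : ∀ t, BijOn (φ t) {0}ᶜ {0}ᶜ
  φ_immersion : ∀ t u, u ≠ 0 → Function.Injective (fderiv ℝ (φ t) u)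
  φ_zero : ∀ u, u ≠ 0 → φ 0 u = u
  φ_branch : ∀ t u, u ^ 2 = -(2 * a.m) → φ t u ^ 2 = -(2 * (conn t).m)
  smooth : ContDiffOn ℝ ∞
    (fun p : ℝ × ℂ => ((conn p.1).α (φ p.1 p.2)).comp (fderiv ℝ (φ p.1) p.2))
    {p | p.2 ∈ unbranched a.m}
  framed : ∃ K : ℝ, 0 < K ∧ ∀ (t : ℝ) (u : ℂ), u ≠ 0 →
    (K < ‖u‖ → proj (conn t).m (φ t u) = proj a.m u ∧
      ∀ v, (conn t).α (φ t u) (fderiv ℝ (φ t) u v)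
        = liftedSingularPart ζ (conn t).m (conn t).m3 a.m u v) ∧
    (‖u‖ < K⁻¹ → proj (conn t).m (φ t u) = proj a.m u ∧
      ∀ v, (conn t).α (φ t u) (fderiv ℝ (φ t) u v)
        = -liftedSingularPart ζ (conn t).m (conn t).m3 a.m u v)
  branch : ∃ b : ℂ, b ^ 2 = -(2 * a.m) ∧ ∃ r : ℝ, 0 < r ∧ ∀ (t : ℝ) (τ : ℂ),
    τ ≠ 0 → ‖τ‖ < r → ∀ v,
      (conn t).α (φ t (b + τ)) (fderiv ℝ (φ t) (b + τ) v) = v / (2 * τ) ∧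
      (conn t).α (φ t (-b + τ)) (fderiv ℝ (φ t) (-b + τ) v) = -(v / (2 * τ))

/-- The variation (tangent vector at `t = 0`) of a path of framed almost-flat connections, as a
one-form on the spectral curve of `a`. -/
def AbelianPath.variation {ζ : ℂ} {a : FramedAbelianConnection ζ} (Q : AbelianPath a) : CForm :=
  fun u => deriv (fun t => ((Q.conn t).α (Q.φ t u)).comp (fderiv ℝ (Q.φ t) u)) 0

/-! ### The spectral network and abelianization -/

/-- `γ`, restricted to `(0, 1]`, runs along a trajectory of phase `arg η` of the quadratic
differential `(z² + 2m) dz²`, and starts at a zero of that differential. -/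
def IsWallArc (η m : ℂ) (γ : ℝ → ℂ) : Prop :=
  ContinuousOn γ (Icc 0 1) ∧ γ 0 ^ 2 + 2 * m = 0 ∧
  ∀ t ∈ Ioc (0 : ℝ) 1, DifferentiableAt ℝ γ t ∧
    ∃ c : ℝ, 0 < c ∧ (γ t ^ 2 + 2 * m) * deriv γ t ^ 2 / η ^ 2 = c

/-- The spectral network of phase `arg η`, as a subset of `ℂ`: the zeros of `z² + 2m` and all
trajectories that emanate from them. -/
def network (η m : ℂ) : Set ℂ :=
  {z | z ^ 2 + 2 * m = 0 ∨ ∃ γ, IsWallArc η m γ ∧ γ 1 = z}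

/-- `v` is a tangent vector at `z` of a wall, oriented away from the branch point. -/
def IsWallTangent (η m z v : ℂ) : Prop :=
  ∃ γ, IsWallArc η m γ ∧ γ 1 = z ∧ deriv γ 1 = v

/-- The part of `Σ` that does not lie over the network, in the coordinate `u`. -/
def offNetwork (η m : ℂ) : Set ℂ := {u | u ≠ 0 ∧ proj m u ∉ network η m}

/-- The tangent vector `v` of `ℂ` at `π(u)`, lifted to `Σ`, in the coordinate `u`. -/
def liftVec (m u v : ℂ) : ℂ := v / projDeriv m u

/-- `(Σ, d + α)` with its frames at the punctures is the framed abelianization of `D` with respect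
to the spectral network of phase `arg η`.

The isomorphism `ι : E → π_* L` off the network is given through the images `e(u) ∈ E_{π(u)} = ℂ²`
under `ι⁻¹` of the global frame of `L`:
* `iso`: the values of `e` at the two points over `z` form a basis, so `ι` is an isomorphism;
* `parallel`: `ι` takes `∇` to `π_* ∇^ab`, that is, `∇ e = α e`;
* `jump`: let `v` be an outgoing tangent vector of a wall, and let `u` be the point over it with
  `s v / η > 0`, so that the other point `deck m u` has `s v / η < 0`.  Then `e` takes the same
  limit `x` on the two sides of the wall at `u`, and its limits at `deck m u` differ by a
  multiple of `x`.  So `ι` jumps by `1 + (a map from the negative to the positive sheet)`;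
* `frame_minus`, `frame_plus`: the frames near the punctures are induced by the frame `g` of `E`:
  in every cell the pair of values of `e` on the two sheets converges to `g` at `z = ∞`.  This
  forces the line on each sheet to consist of the small flat sections at the end of the adjacent
  walls of the cell. -/
structure AbelianizationData {ζ : ℂ} (η : ℂ) (D : FramedConnection ζ)
    (a : FramedAbelianConnection ζ) (e : ℂ → Fin 2 → ℂ) : Prop where
  smooth : ∀ u ∈ offNetwork η D.m, ContDiffAt ℝ ∞ e u
  iso : ∀ u ∈ offNetwork η D.m, LinearIndependent ℂ ![e u, e (deck D.m u)]
  parallel : ∀ u ∈ offNetwork η D.m, ∀ v : ℂ,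
    fderiv ℝ e u v + (D.A (proj D.m u)).eval (projDeriv D.m u * v) *ᵥ e u = a.α u v • e u
  jump : ∀ u v : ℂ, u ≠ 0 → IsWallTangent η D.m (proj D.m u) v →
    (∃ c : ℝ, 0 < c ∧ sheet D.m u * v / η = c) →
    ∃ (x y y' : Fin 2 → ℂ) (k : ℂ),
      Tendsto (fun δ : ℝ => e (u + δ * I * liftVec D.m u v)) (𝓝[>] 0) (𝓝 x) ∧
      Tendsto (fun δ : ℝ => e (u - δ * I * liftVec D.m u v)) (𝓝[>] 0) (𝓝 x) ∧
      Tendsto (fun δ : ℝ => e (deck D.m u + δ * I * liftVec D.m (deck D.m u) v))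
        (𝓝[>] 0) (𝓝 y) ∧
      Tendsto (fun δ : ℝ => e (deck D.m u - δ * I * liftVec D.m (deck D.m u) v))
        (𝓝[>] 0) (𝓝 y') ∧
      y' = y + k • x
  frame_minus : Tendsto e (Bornology.cobounded ℂ ⊓ 𝓟 (offNetwork η D.m)) (𝓝 ![1, 0])
  frame_plus : Tendsto e (𝓝[offNetwork η D.m] 0) (𝓝 ![0, 1])

/-- `a = ab(D)`, for the spectral network of phase `arg η`. -/
def IsFramedAbelianization {ζ : ℂ} (η : ℂ) (D : FramedConnection ζ)
    (a : FramedAbelianConnection ζ) : Prop :=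
  a.m = D.m ∧ a.m3 = D.m3 ∧ ∃ e : ℂ → Fin 2 → ℂ, AbelianizationData η D a e

/-! ### The regularized Atiyah–Bott forms -/

/-- `β = (μ + O(r)) dθ + (ν + O(r)) dr/r` near `w = 0`, with `μ, ν ∈ ℂ · H`, where
`w = 1/z = r e^{iθ}`.  The vector fields `∂_θ` and `r ∂_r` are `i w` and `w` in the coordinate `w`,
and `dz = -dw/w²`. -/
def HasPolarCoeffs (β : MatForm) (μ ν : Mat2) : Prop :=
  μ ∈ cartan ∧ ν ∈ cartan ∧
  ∀ i j : Fin 2,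
    (fun w : ℂ => (β w⁻¹).eval (-(I * w / w ^ 2)) i j - μ i j) =O[𝓝[≠] 0] (fun w : ℂ => ‖w‖) ∧
    (fun w : ℂ => (β w⁻¹).eval (-(w / w ^ 2)) i j - ν i j) =O[𝓝[≠] 0] (fun w : ℂ => ‖w‖)

/-- `β = (± μ + O(r)) dθ + (± ν + O(r)) dr/r` near the puncture `∞_∓` of `Σ`, where
`w = 1/π = r e^{iθ}`.  The vector fields `∂_θ` and `r ∂_r` are `-i π/π'` and `-π/π'` in the
coordinate `u`. -/
def HasPolarCoeffsAb (m : ℂ) (β : CForm) (μ ν : ℂ) : Prop :=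
  (fun u : ℂ => β u (-(I * proj m u / projDeriv m u)) - μ)
      =O[Bornology.cobounded ℂ] (fun u : ℂ => ‖proj m u‖⁻¹) ∧
  (fun u : ℂ => β u (-(proj m u / projDeriv m u)) - ν)
      =O[Bornology.cobounded ℂ] (fun u : ℂ => ‖proj m u‖⁻¹) ∧
  (fun u : ℂ => β u (-(I * proj m u / projDeriv m u)) + μ)
      =O[𝓝[≠] 0] (fun u : ℂ => ‖proj m u‖⁻¹) ∧
  (fun u : ℂ => β u (-(proj m u / projDeriv m u)) + ν)
      =O[𝓝[≠] 0] (fun u : ℂ => ‖proj m u‖⁻¹)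

/-- `ρ = 𝓡(β₁, β₂) = tr (μ₁ λ₂ - μ₂ λ₁)`. -/
def IsRegTerm (β₁ β₂ : MatForm) (ρ : ℂ) : Prop :=
  ∃ μ₁ ν₁ μ₂ ν₂ : Mat2, HasPolarCoeffs β₁ μ₁ ν₁ ∧ HasPolarCoeffs β₂ μ₂ ν₂ ∧
    ρ = (μ₁ * ν₂ - μ₂ * ν₁).trace

/-- `ρ = 𝓡^ab(β₁, β₂) = 2 (μ₁ λ₂ - μ₂ λ₁)`. -/
def IsRegTermAb (m : ℂ) (β₁ β₂ : CForm) (ρ : ℂ) : Prop :=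
  ∃ μ₁ ν₁ μ₂ ν₂ : ℂ, HasPolarCoeffsAb m β₁ μ₁ ν₁ ∧ HasPolarCoeffsAb m β₂ μ₂ ν₂ ∧
    ρ = 2 * (μ₁ * ν₂ - μ₂ * ν₁)

/-- The integral of `tr (β₁ ∧ β₂)` over `C_R = {|w| ≥ R} = {|z| ≤ 1/R}`. -/
def cutoffIntegral (β₁ β₂ : MatForm) (R : ℝ) : ℂ :=
  ∫ z in Metric.closedBall (0 : ℂ) R⁻¹, trWedge (β₁ z) (β₂ z)

/-- The integral of `β₁ ∧ β₂` over `Σ_R = π⁻¹(C_R)`. -/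
def cutoffIntegralAb (m : ℂ) (β₁ β₂ : CForm) (R : ℝ) : ℂ :=
  ∫ u in {u : ℂ | u ≠ 0 ∧ ‖proj m u‖ ≤ R⁻¹}, wedge (β₁ u) (β₂ u)

/-- The limit that defines `Ω^reg(β₁, β₂)` exists and equals `Ω`. -/
def IsRegularizedForm (β₁ β₂ : MatForm) (Ω : ℂ) : Prop :=
  ∃ ρ : ℂ, IsRegTerm β₁ β₂ ρ ∧
    Tendsto (fun R : ℝ => cutoffIntegral β₁ β₂ R - 2 * Real.pi * Real.log R * ρ)
      (𝓝[>] 0) (𝓝 Ω)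

/-- The limit that defines `Ω^{reg,ab}(β₁, β₂)`, on the spectral curve with parameter `m`, exists
and equals `Ω`. -/
def IsRegularizedFormAb (m : ℂ) (β₁ β₂ : CForm) (Ω : ℂ) : Prop :=
  ∃ ρ : ℂ, IsRegTermAb m β₁ β₂ ρ ∧
    Tendsto (fun R : ℝ => cutoffIntegralAb m β₁ β₂ R - 2 * Real.pi * Real.log R * ρ)
      (𝓝[>] 0) (𝓝 Ω)

end

noncomputable section

open scoped Real
open Metric (ball closedBall)

variable {A A' β : MatForm} {c1 c2 a b a' b' u Y lam m k x c a1 b1 a2 b2 η y z ξ n k1 k2 ζ : ℂ}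
  {s1 C κ θ θc T s K t r m0 Θ y0 s0 δ θ' φ s1' C' θ0 y1 y2 : ℝ} {ψ χ p q : ℂ → Fin 2 → ℂ}
  {j i : Fin 2} {F E O G f : ℂ → ℂ}

/-! ### Linear differential equations and flat sections -/

section LinearODE

variable {E : Type*} [NormedAddCommGroup E] [NormedSpace ℝ E]

theorem isPicardLindelof_linear {M : ℝ → E →L[ℝ] E} (hM : Continuous M) {K : NNReal} (h01 : s0 ≤ s1)
    (hK : ∀ s ∈ Icc s0 s1, ‖M s‖ ≤ K) (hlen : K * (s1 - s0) ≤ 1 / 2) (x0 : E) : IsPicardLindelof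
    (fun s x => M s x) (⟨s0, left_mem_Icc.2 h01⟩ : Icc s0 s1) x0 (‖x0‖₊ + 1) 0 (K * (2 * ‖x0‖₊ + 1))
    K where
  lipschitzOnWith := by
    intro s hs
    refine (LipschitzWith.weaken (M s).lipschitz ?_).lipschitzOnWith
    exact hK s hs
  continuousOn := fun x _ => (hM.clm_apply continuous_const).continuousOn
  norm_le := by
    intro s hs x hx
    have h1 : ‖x‖ ≤ 2 * ‖x0‖ + 1 := by
      have := norm_le_of_mem_closedBall hx
      push_cast at this
      linarith
    refine ((M s).le_opNorm x).trans ?_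
    push_cast
    exact mul_le_mul (hK s hs) h1 (norm_nonneg _) K.2
  mul_max_le := by
    push_cast
    simp only [sub_self, sub_zero]
    rw [max_eq_left (by linarith)]
    nlinarith [norm_nonneg x0, mul_nonneg K.2 (sub_nonneg.2 h01)]

theorem exists_solution_linear [CompleteSpace E] {M : ℝ → E →L[ℝ] E} (hM : Continuous M) (x0 : E) :
    ∃ f : ℝ → E, f 0 = x0 ∧ ContinuousOn f (Icc 0 1) ∧
      ∀ s ∈ Ico (0 : ℝ) 1, HasDerivWithinAt f (M s (f s)) (Ici s) s := by
  obtain ⟨K, hK⟩ := (isCompact_Icc (a := (0 : ℝ)) (b := 1)).exists_bound_of_continuousOn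
    hM.continuousOn
  have hK0 : 0 ≤ K := (norm_nonneg _).trans (hK 0 (by simp))
  obtain ⟨n, hn⟩ := exists_nat_gt (2 * K)
  have hn0 : (0 : ℝ) < n := by linarith
  have key : ∀ k : ℕ, k ≤ n → ∃ f : ℝ → E, f 0 = x0 ∧
      ∀ s ∈ Icc (0 : ℝ) (k / n), HasDerivWithinAt f (M s (f s)) (Icc 0 (k / n)) s := by
    intro k
    induction k with
    | zero =>
      intro _
      refine ⟨fun _ => x0, rfl, fun s _ => ?_⟩
      simp only [Nat.cast_zero, zero_div, Icc_self]
      exact HasFDerivWithinAt.of_subsingleton subsingleton_singleton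
    | succ k ih =>
      intro hk
      obtain ⟨f, hf0, hf⟩ := ih (by omega)
      have hle : (k : ℝ) / n ≤ (k + 1 : ℕ) / n := by gcongr; simp
      have h1 : ((k + 1 : ℕ) : ℝ) / n ≤ 1 := by rw [div_le_one hn0]; exact_mod_cast hk
      have hk0 : (0 : ℝ) ≤ k / n := by positivity
      have hpl := isPicardLindelof_linear hM (K := ⟨K, hK0⟩) hle
        (fun s hs => hK s ⟨hk0.trans hs.1, hs.2.trans h1⟩)
        (by
          have : ((k + 1 : ℕ) : ℝ) / n - k / n = 1 / n := by push_cast; ring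
          rw [this, mul_one_div, div_le_iff₀ hn0]
          change K ≤ _
          linarith) (f (k / n))
      obtain ⟨α, hα0, hα⟩ := hpl.exists_eq_forall_mem_Icc_hasDerivWithinAt₀
      simp only at hα0
      refine ⟨fun s => if s ≤ k / n then f s else α s, by simp [hk0, hf0], fun s hs => ?_⟩
      have hunion : Icc (0 : ℝ) ((k + 1 : ℕ) / n)
          = Icc 0 ((k : ℝ) / n) ∪ Icc ((k : ℝ) / n) ((k + 1 : ℕ) / n) :=
        (Icc_union_Icc_eq_Icc hk0 hle).symm
      have e1 : ∀ x ∈ Icc (0 : ℝ) (k / n), (if x ≤ k / n then f x else α x) = f x := by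
        intro x hx; simp [hx.2]
      have e2 : ∀ x ∈ Icc ((k : ℝ) / n) ((k + 1 : ℕ) / n),
          (if x ≤ k / n then f x else α x) = α x := by
        intro x hx
        rcases eq_or_lt_of_le hx.1 with h | h
        · simp [← h, hα0]
        · simp [not_le.2 h]
      rw [hunion]
      rcases lt_trichotomy s (k / n) with h | h | h
      · have hs' : s ∈ Icc (0 : ℝ) (k / n) := ⟨hs.1, h.le⟩
        have := (hf s hs').congr e1 (e1 s hs')
        simp only [h.le, if_true]
        refine this.union ?_
        refine HasFDerivWithinAt.of_notMem_closure ?_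
        rw [isClosed_Icc.closure_eq]
        exact fun h2 => absurd h2.1 (not_le.2 h)
      · have hs' : s ∈ Icc (0 : ℝ) (k / n) := ⟨hs.1, h.le⟩
        have hs'' : s ∈ Icc ((k : ℝ) / n) ((k + 1 : ℕ) / n) := ⟨h.ge, hs.2⟩
        have d1 := (hf s hs').congr e1 (e1 s hs')
        have d2 := (hα s hs'').congr e2 (e2 s hs'')
        have hval : α s = f s := by rw [h, hα0]
        rw [hval] at d2
        simp only [h.le, if_true]
        exact d1.union d2
      · have hs'' : s ∈ Icc ((k : ℝ) / n) ((k + 1 : ℕ) / n) := ⟨h.le, hs.2⟩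
        have d2 := (hα s hs'').congr e2 (e2 s hs'')
        simp only [not_le.2 h, if_false]
        refine HasDerivWithinAt.union ?_ d2
        refine HasFDerivWithinAt.of_notMem_closure ?_
        rw [isClosed_Icc.closure_eq]
        exact fun h2 => absurd h2.2 (not_le.2 h)
  obtain ⟨f, hf0, hf⟩ := key n le_rfl
  rw [div_self hn0.ne'] at hf
  exact ⟨f, hf0, fun s hs => (hf s hs).continuousWithinAt, fun s hs =>
    (hf s ⟨hs.1, hs.2.le⟩).mono_of_mem_nhdsWithin (Icc_mem_nhdsGE_of_mem hs)⟩

set_option maxSynthPendingDepth 3 in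
theorem exists_flat_section {X : Type*} [NormedAddCommGroup X] [NormedSpace ℝ X] [ProperSpace X]
    [CompleteSpace E] {A : X → X →L[ℝ] E →L[ℝ] E} (hA : ContDiff ℝ 1 A)
    (hflat : ∀ x h k, fderiv ℝ A x h k - fderiv ℝ A x k h
      + ((A x h).comp (A x k) - (A x k).comp (A x h)) = 0) (p : E) :
    ∃ f : X → E, f 0 = p ∧ ∀ x, HasFDerivAt f (-((A x).flip (f x))) x := by
  have hAc : Continuous A := hA.continuous
  have hM : ∀ x : X, Continuous fun s : ℝ => -(A (s • x) x) := fun x =>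
    ((hAc.comp (continuous_id.smul continuous_const)).clm_apply continuous_const).neg
  choose F hF0 hFc hF using fun x => exists_solution_linear (hM x) p
  refine ⟨fun x => F x 1, ?_, fun x => ?_⟩
  · have hconst : ∀ s ∈ Icc (0 : ℝ) 1, F 0 s = F 0 0 := by
      refine constant_of_has_deriv_right_zero (hFc 0) ?_
      intro s hs
      simpa using hF 0 s hs
    simpa [hF0] using hconst 1 (by simp)
  have hd : ∀ y, HasFDerivAt A (fderiv ℝ A y) y := fun y =>
    (hA.differentiable one_ne_zero y).hasFDerivAt
  have hdc : Continuous (fderiv ℝ A) := hA.continuous_fderiv one_ne_zero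
  set B := closedBall (0 : X) (‖x‖ + 1) with hB
  have hBc : IsCompact B := isCompact_closedBall _ _
  obtain ⟨a0, ha0⟩ := hBc.exists_bound_of_continuousOn (f := A) hAc.continuousOn
  obtain ⟨a1, ha1⟩ := hBc.exists_bound_of_continuousOn (f := fderiv ℝ A) hdc.continuousOn
  obtain ⟨f0, hf0⟩ := isCompact_Icc.exists_bound_of_continuousOn (hFc x)
  have h0B : (0 : X) ∈ B := by simp [hB]; positivity
  have ha₀0 : 0 ≤ a0 := (norm_nonneg _).trans (ha0 0 h0B)
  have ha₁0 : 0 ≤ a1 := (norm_nonneg _).trans (ha1 0 h0B)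
  have hf₀0 : 0 ≤ f0 := (norm_nonneg _).trans (hf0 0 (by simp))
  set n := ‖x‖ + 1 with hn
  have hn1 : 1 ≤ n := by simp [hn]
  set K := a0 * n + 1 with hK
  have hK0 : 0 < K := by positivity
  set c1 := a1 + a1 * n * a0 + a0 * a0 with hc1
  have hc₁0 : 0 ≤ c1 := by positivity
  set G := (rexp K - 1) / K with hG
  have hG0 : 0 ≤ G := div_nonneg (by linarith [Real.add_one_le_exp K]) hK0.le
  rw [hasFDerivAt_iff_isLittleO_nhds_zero, isLittleO_iff]
  intro c hc
  obtain ⟨ε, hε, hεc⟩ : ∃ ε > 0, (ε * n + c1 * ε) * f0 * G ≤ c := by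
    refine ⟨c / ((n + c1) * f0 * G + 1), by positivity, ?_⟩
    have : (c / ((n + c1) * f0 * G + 1) * n + c1 * (c / ((n + c1) * f0 * G + 1))) * f0 * G
        = c * (((n + c1) * f0 * G) / ((n + c1) * f0 * G + 1)) := by ring
    rw [this]
    refine mul_le_of_le_one_right hc.le ?_
    rw [div_le_one (by positivity)]
    linarith
  obtain ⟨δ, hδ, hδu⟩ := Metric.uniformContinuousOn_iff.1
    (hBc.uniformContinuousOn_of_continuous hdc.continuousOn) ε hε
  have hmem : ∀ᶠ h in 𝓝 (0 : X), ‖h‖ < min (min δ 1) ε :=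
    (continuous_norm.tendsto' 0 0 norm_zero).eventually_lt_const (by positivity)
  filter_upwards [hmem] with h hh
  have hhδ : ‖h‖ < δ := hh.trans_le ((min_le_left _ _).trans (min_le_left _ _))
  have hh1 : ‖h‖ ≤ 1 := (hh.trans_le ((min_le_left _ _).trans (min_le_right _ _))).le
  have hhε : ‖h‖ ≤ ε := (hh.trans_le (min_le_right _ _)).le
  have hin : ∀ s ∈ Icc (0 : ℝ) 1, ∀ k : X, ‖k‖ ≤ ‖h‖ → s • x + k ∈ B := by
    intro s hs k hk
    rw [hB, mem_closedBall_zero_iff]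
    refine (norm_add_le _ _).trans (add_le_add ?_ (hk.trans hh1))
    rw [norm_smul, Real.norm_of_nonneg hs.1]
    exact mul_le_of_le_one_left (norm_nonneg _) hs.2
  have hsh : ∀ s ∈ Icc (0 : ℝ) 1, ‖s • h‖ ≤ ‖h‖ := by
    intro s hs
    rw [norm_smul, Real.norm_of_nonneg hs.1]
    exact mul_le_of_le_one_left (norm_nonneg _) hs.2
  have hrem : ∀ s ∈ Icc (0 : ℝ) 1,
      ‖A (s • x + s • h) - A (s • x) - fderiv ℝ A (s • x) (s • h)‖ ≤ ε * ‖h‖ := by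
    intro s hs
    have hseg : ∀ y ∈ segment ℝ (s • x) (s • x + s • h), ∃ k : X, ‖k‖ ≤ ‖h‖ ∧ y = s • x + k := by
      intro y hy
      rw [segment_eq_image'] at hy
      obtain ⟨θ, hθ, rfl⟩ := hy
      refine ⟨θ • (s • h), ?_, by simp⟩
      rw [norm_smul, Real.norm_of_nonneg hθ.1]
      exact (mul_le_of_le_one_left (norm_nonneg _) hθ.2).trans (hsh s hs)
    have := (convex_segment (s • x) (s • x + s • h)).norm_image_sub_le_of_norm_hasFDerivWithin_le' (f := A) (f' := fderiv ℝ A)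
      (φ := fderiv ℝ A (s • x)) (C := ε) (fun y _ => (hd y).hasFDerivWithinAt) (by
        intro y hy
        obtain ⟨k, hk, rfl⟩ := hseg y hy
        rw [← dist_eq_norm]
        refine (hδu _ (hin s hs k hk) _ ?_ ?_).le
        · simpa using hin s hs 0 (by simp)
        · rw [dist_eq_norm]; simpa using hk.trans_lt hhδ)
      (left_mem_segment ℝ _ _) (right_mem_segment ℝ _ _)
    simp only [add_sub_cancel_left] at this
    exact this.trans (by gcongr; exact hsh s hs)
  have hA1 : ∀ s ∈ Icc (0 : ℝ) 1, ‖A (s • x + s • h) - A (s • x)‖ ≤ a1 * ‖h‖ := by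
    intro s hs
    have := (convex_closedBall (0 : X) (‖x‖ + 1)).norm_image_sub_le_of_norm_hasFDerivWithin_le
      (f := A) (f' := fderiv ℝ A) (fun y _ => (hd y).hasFDerivWithinAt) (fun y hy => ha1 y hy)
      (by simpa using hin s hs 0 (by simp)) (hin s hs (s • h) (hsh s hs))
    simp only [add_sub_cancel_left] at this
    exact this.trans (by gcongr; exact hsh s hs)
  set f := F x with hfdef
  set g := F (x + h) with hgdef
  set D : ℝ → E := fun s => g s - f s + s • A (s • x) h (f s) with hD
  have hADeriv : ∀ s : ℝ, HasDerivAt (fun s : ℝ => A (s • x)) (fderiv ℝ A (s • x) x) s := by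
    intro s
    have := (hd (s • x)).comp_hasDerivAt s ((hasDerivAt_id s).smul_const x)
    rwa [one_smul] at this
  set D' : ℝ → E := fun s => -(A (s • (x + h)) (x + h) (g s)) + A (s • x) x (f s)
    + (A (s • x) h (f s)
      + s • (fderiv ℝ A (s • x) x h (f s) - A (s • x) h (A (s • x) x (f s)))) with hD'
  have hDc : ContinuousOn D (Icc 0 1) := by
    refine ((hFc (x + h)).sub (hFc x)).add (continuousOn_id.smul ?_)
    refine ContinuousOn.clm_apply ?_ (hFc x)
    exact ((hAc.comp (continuous_id.smul continuous_const)).clm_apply continuous_const).continuousOn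
  have hDd : ∀ s ∈ Ico (0 : ℝ) 1, HasDerivWithinAt D (D' s) (Ici s) s := by
    intro s hs
    have e1 := hF (x + h) s hs
    have e2 := hF x s hs
    have e3 : HasDerivWithinAt (fun s : ℝ => A (s • x) h (f s))
        (fderiv ℝ A (s • x) x h (f s) + A (s • x) h (-(A (s • x) x) (f s))) (Ici s) s := by
      simpa using (((hADeriv s).hasDerivWithinAt (s := Ici s)).clm_apply
        (hasDerivWithinAt_const s (Ici s) h)).clm_apply e2
    have e4 := (e1.sub e2).add ((hasDerivWithinAt_id s (Ici s)).smul e3)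
    refine e4.congr_deriv ?_
    simp only [hD', id, one_smul, map_neg, neg_apply, ← sub_eq_add_neg, sub_neg_eq_add]
    abel
  have hbound : ∀ s ∈ Ico (0 : ℝ) 1, ‖D' s‖ ≤ K * ‖D s‖ + (ε * n + c1 * ‖h‖) * f0 * ‖h‖ := by
    intro s hs
    have hs' : s ∈ Icc (0 : ℝ) 1 := ⟨hs.1, hs.2.le⟩
    have hfl := congrArg (fun L => L (f s)) (hflat (s • x) x h)
    simp only [add_apply, sub_apply, ContinuousLinearMap.comp_apply, zero_apply] at hfl
    set R := A (s • x + s • h) - A (s • x) - fderiv ℝ A (s • x) (s • h) with hR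
    set T := A (s • x + s • h) - A (s • x) with hT
    have hAh : A (s • (x + h)) = A (s • x) + T := by rw [hT, smul_add]; abel
    have hT' : T = R + s • fderiv ℝ A (s • x) h := by rw [hR, map_smul]; abel
    have hg : g s = D s + f s - s • A (s • x) h (f s) := by simp only [hD]; abel
    have hsplit : D' s = -((A (s • (x + h)) (x + h)) (D s))
        + (-(R (x + h) (f s)) - s • (fderiv ℝ A (s • x) h h (f s))
          + s • (T (x + h) (A (s • x) h (f s))) + s • (A (s • x) h (A (s • x) h (f s)))) := by
      have hfl' : s • (fderiv ℝ A (s • x) x h (f s)) = s • (fderiv ℝ A (s • x) h x (f s))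
          - s • (A (s • x) x (A (s • x) h (f s))) + s • (A (s • x) h (A (s • x) x (f s))) := by
        rw [← smul_sub, ← smul_add]
        congr 1
        rw [← sub_eq_zero, ← hfl]
        abel
      have hTx : T (x + h) (f s) = R (x + h) (f s) + s • fderiv ℝ A (s • x) h x (f s)
          + s • fderiv ℝ A (s • x) h h (f s) := by
        rw [hT']
        simp only [add_apply, smul_apply, map_add]
        abel
      simp only [hD', smul_sub, hfl']
      rw [hg]
      simp only [map_add, map_sub, map_smul, hAh, add_apply] at hTx ⊢
      rw [← sub_eq_zero] at hTx ⊢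
      rw [← neg_eq_zero, ← hTx]
      simp only [smul_add]
      abel
    have hxh : ‖x + h‖ ≤ n := (norm_add_le _ _).trans (by simp only [hn]; linarith)
    have hsn : ‖s‖ ≤ 1 := by rw [Real.norm_of_nonneg hs.1]; exact hs.2.le
    have hxB : s • x ∈ B := by simpa using hin s hs' 0 (by simp)
    have hxhB : s • (x + h) ∈ B := by rw [smul_add]; exact hin s hs' _ (hsh s hs')
    have hfs := hf0 s hs'
    have hsm : ∀ y : E, ‖s • y‖ ≤ ‖y‖ := fun y => by
      rw [norm_smul]; exact mul_le_of_le_one_left (norm_nonneg _) hsn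
    have b0 : ‖(A (s • (x + h)) (x + h)) (D s)‖ ≤ K * ‖D s‖ :=
      ((A _).le_of_opNorm₂_le_of_le (ha0 _ hxhB) hxh le_rfl).trans (by gcongr; simp [hK])
    have b1 : ‖R (x + h) (f s)‖ ≤ ε * ‖h‖ * n * f0 := R.le_of_opNorm₂_le_of_le (hrem s hs') hxh hfs
    have b2 : ‖s • (fderiv ℝ A (s • x) h h (f s))‖ ≤ a1 * ‖h‖ * ‖h‖ * f0 :=
      (hsm _).trans (ContinuousLinearMap.le_of_opNorm₂_le_of_le _
        ((fderiv ℝ A (s • x)).le_of_opNorm_le (ha1 _ hxB) _) le_rfl hfs)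
    have hAh' : ‖A (s • x) h (f s)‖ ≤ a0 * ‖h‖ * f0 :=
      (A _).le_of_opNorm₂_le_of_le (ha0 _ hxB) le_rfl hfs
    have b3 : ‖s • (T (x + h) (A (s • x) h (f s)))‖ ≤ a1 * ‖h‖ * n * (a0 * ‖h‖ * f0) :=
      (hsm _).trans (T.le_of_opNorm₂_le_of_le (hA1 s hs') hxh hAh')
    have b4 : ‖s • (A (s • x) h (A (s • x) h (f s)))‖ ≤ a0 * ‖h‖ * (a0 * ‖h‖ * f0) :=
      (hsm _).trans ((A _).le_of_opNorm₂_le_of_le (ha0 _ hxB) le_rfl hAh')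
    rw [hsplit]
    refine (norm_add_le _ _).trans ?_
    rw [norm_neg]
    refine add_le_add b0 ((norm_add_le _ _).trans ((add_le_add ((norm_add_le _ _).trans (add_le_add
      ((norm_sub_le _ _).trans (add_le_add ((norm_neg _).le.trans b1) b2)) b3)) b4).trans_eq
      (by rw [hc1]; ring)))
  have hgr := norm_le_gronwallBound_of_norm_deriv_right_le hDc hDd (δ := 0)
    (by simp [hD, hgdef, hfdef, hF0]) hbound 1 (by simp)
  have hfin : F (x + h) 1 - F x 1 - (-((A x).flip (F x 1))) h = D 1 := by simp [hD, hgdef, hfdef]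
  rw [hfin]
  refine hgr.trans ?_
  rw [gronwallBound_of_K_ne_0 hK0.ne']
  simp only [zero_mul, zero_add, sub_zero, mul_one]
  have : (ε * n + c1 * ‖h‖) * f0 * ‖h‖ / K * (rexp K - 1)
      = (ε * n + c1 * ‖h‖) * f0 * G * ‖h‖ := by rw [hG]; ring
  rw [this]
  refine mul_le_mul_of_nonneg_right (le_trans ?_ hεc) (norm_nonneg _)
  gcongr

end LinearODE

/-! ### Flat sections of matrix connections -/

/-- `ψ` is a flat section of `d + A`. -/
def IsFlat (A : MatForm) (ψ : ℂ → Fin 2 → ℂ) : Prop :=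
  ∀ z i, HasFDerivAt (fun z => ψ z i) (-(ψ z 0 • A z i 0 + ψ z 1 • A z i 1)) z

/-- The determinant of two vectors of `ℂ²`. -/
def wr (x y : Fin 2 → ℂ) : ℂ := x 0 * y 1 - x 1 * y 0

/-- A matrix-valued covector as an operator-valued one. -/
def connOp : MatCovector →L[ℝ] ℂ →L[ℝ] (Fin 2 → ℂ) →L[ℝ] (Fin 2 → ℂ) :=
  LinearMap.toContinuousBilinearMap (LinearMap.mk₂ ℝ
    (fun (a : MatCovector) (v : ℂ) => (ContinuousLinearMap.pi fun i =>
      (a i 0 v • ContinuousLinearMap.proj 0 + a i 1 v • ContinuousLinearMap.proj 1 :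
        (Fin 2 → ℂ) →L[ℝ] ℂ)))
    (fun a b v => by ext x i; simp; ring) (fun c a v => by ext x i; simp; ring)
    (fun a v w => by ext x i; simp; ring)
    (fun c a v => by ext x i; simp [-real_smul, smul_add]))

theorem connOp_apply (a : MatCovector) (v : ℂ) (x : Fin 2 → ℂ) (i : Fin 2) :
    connOp a v x i = a i 0 v * x 0 + a i 1 v * x 1 := by
  simp [connOp]

theorem isFlat_iff : IsFlat A ψ ↔ ∀ z, HasFDerivAt ψ (-((connOp (A z)).flip (ψ z))) z := by
  unfold IsFlat
  refine forall_congr' fun z => ?_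
  rw [hasFDerivAt_pi']
  refine forall_congr' fun i => ?_
  have : ContinuousLinearMap.comp (ContinuousLinearMap.proj i) (-((connOp (A z)).flip (ψ z)))
      = -(ψ z 0 • A z i 0 + ψ z 1 • A z i 1) := by
    ext v
    simp [connOp_apply]
    ring
  rw [this]

theorem antisymm_eq_zero {B : ℂ → ℂ → ℂ}
    (hadd : ∀ x y z, B (x + y) z = B x z + B y z) (hsmul : ∀ (c : ℝ) x z, B (c • x) z = c • B x z)
    (hanti : ∀ x y, B x y = -B y x) (h : B 1 I = 0) (x y : ℂ) : B x y = 0 := by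
  have h1 : ∀ x, B x x = 0 := fun x => self_eq_neg.1 (hanti x x)
  have hI : B I 1 = 0 := by rw [hanti, h, neg_zero]
  have dec : ∀ x : ℂ, x = x.re • (1 : ℂ) + x.im • I := by intro x; apply Complex.ext <;> simp
  have e1 : ∀ y, B 1 y = 0 := by intro y; rw [hanti, dec y, hadd, hsmul, hsmul, h1, hI]; simp
  have e2 : ∀ y, B I y = 0 := by intro y; rw [hanti, dec y, hadd, hsmul, hsmul, h1, h]; simp
  rw [dec x, hadd, hsmul, hsmul, e1, e2]; simp

set_option maxSynthPendingDepth 3 in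
theorem exists_isFlat (hA : ContDiff ℝ ∞ A) (hflat : ∀ z, curvature A z = 0) (p : Fin 2 → ℂ) : ∃ ψ,
    IsFlat A ψ ∧ ψ 0 = p := by
  have hA1 : ContDiff ℝ 1 A := hA.of_le (by norm_cast)
  obtain ⟨ψ, h0, hψ⟩ := exists_flat_section (A := fun z => connOp (A z))
    (connOp.contDiff.comp hA1) (by
      intro z
      have hd : fderiv ℝ (fun z => connOp (A z)) z = connOp.comp (fderiv ℝ A z) :=
        (connOp.hasFDerivAt.comp z (hA1.differentiable one_ne_zero z).hasFDerivAt).fderiv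
      rw [hd]
      intro h k
      ext u i
      refine antisymm_eq_zero (B := fun h k => ((connOp.comp (fderiv ℝ A z)) h k
        - (connOp.comp (fderiv ℝ A z)) k h + ((connOp (A z) h).comp (connOp (A z) k)
        - (connOp (A z) k).comp (connOp (A z) h))) u i) ?_ ?_ ?_ ?_ h k
      · intro x y w; simp [connOp_apply]; ring
      · intro c x w; simp [-real_smul, connOp_apply, smul_add, smul_sub]
      · intro x y; simp; ring
      · have := hflat z
        have e : ∀ i j, curvature A z i j = 0 := fun i j => by rw [this]; rfl
        have e0 := e i 0
        have e1 := e i 1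
        simp [curvature, MatCovector.eval, Matrix.mul_apply, Fin.sum_univ_two] at e0 e1
        simp [connOp_apply]
        linear_combination u 0 * e0 + u 1 * e1) p
  exact ⟨ψ, isFlat_iff.2 hψ, h0⟩

theorem IsFlat.continuous (h : IsFlat A ψ) : Continuous ψ :=
  continuous_iff_continuousAt.2 fun z => (isFlat_iff.1 h z).continuousAt

theorem IsFlat.comb (h : IsFlat A ψ) (h' : IsFlat A χ) (a b : ℂ) : IsFlat A
    (fun z => a • ψ z + b • χ z) := by
  intro z i
  refine (((h z i).const_mul a).add ((h' z i).const_mul b)).congr_fderiv ?_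
  ext v
  simp
  ring

theorem hasFDerivAt_wr {B : MatForm} (h : IsFlat A ψ) (h' : IsFlat B χ)
    (hB : ∀ z v, B z 0 0 v + B z 1 1 v = 0) (z : ℂ) : HasFDerivAt (fun z => wr (ψ z) (χ z)) (-((ψ z
    0 * χ z 1) • (A z 0 0 - B z 0 0) + (ψ z 1 * χ z 1) • (A z 0 1 - B z 0 1) - (ψ z 0 * χ z 0) • (A
    z 1 0 - B z 1 0) - (ψ z 1 * χ z 0) • (A z 1 1 - B z 1 1))) z := by
  refine (((h z 0).mul (h' z 1)).sub ((h z 1).mul (h' z 0))).congr_fderiv ?_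
  ext v
  simp
  linear_combination (ψ z 1 * χ z 0 - ψ z 0 * χ z 1) * hB z v

theorem wr_const (h : IsFlat A ψ) (h' : IsFlat A χ) (hA : ∀ z v, A z 0 0 v + A z 1 1 v = 0)
    (z w : ℂ) : wr (ψ z) (χ z) = wr (ψ w) (χ w) := by
  refine is_const_of_fderiv_eq_zero (𝕜 := ℝ)
    (fun z => (hasFDerivAt_wr h h' hA z).differentiableAt) (fun z => ?_) z w
  rw [(hasFDerivAt_wr h h' hA z).fderiv]
  simp

theorem IsFlat.hasDerivAt_ray (h : IsFlat A ψ) (z : ℂ) (s : ℝ) : HasDerivAt (fun s : ℝ => ψ (s * z))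
    (-(connOp (A (s * z)) z (ψ (s * z)))) s := by
  have h1 : HasDerivAt (fun s : ℝ => (s : ℂ) * z) z s := by
    simpa using (ofRealCLM.hasDerivAt (x := s)).mul_const z
  exact (isFlat_iff.1 h (s * z)).comp_hasDerivAt s h1

set_option maxSynthPendingDepth 3 in
theorem exists_norm_connOp_le {A : ℝ → MatForm} (hA : Continuous fun p : ℝ × ℂ => A p.1 p.2)
    (R : ℝ) : ∃ K, 0 ≤ K ∧ ∀ t ∈ Icc (-1 : ℝ) 1, ∀ z : ℂ, ‖z‖ ≤ R → ‖connOp (A t z)‖ ≤ K := by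
  obtain ⟨K, hK⟩ := ((isCompact_Icc (a := (-1 : ℝ)) (b := 1)).prod
    (isCompact_closedBall (0 : ℂ) R)).exists_bound_of_continuousOn
    (f := fun p : ℝ × ℂ => connOp (A p.1 p.2)) (connOp.continuous.comp hA).continuousOn
  refine ⟨max K 0, le_max_right _ _, fun t ht z hz => (hK (t, z) ⟨ht, ?_⟩).trans (le_max_left _ _)⟩
  simpa using hz

theorem norm_ofReal_mul_le {R : ℝ} (hs : s ∈ Icc (0 : ℝ) 1) (hz : ‖z‖ ≤ R) : ‖(s : ℂ) * z‖ ≤ R := by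
  rw [norm_mul, norm_real, Real.norm_of_nonneg hs.1]
  exact (mul_le_of_le_one_left (norm_nonneg _) hs.2).trans hz

theorem norm_flat_le {A : ℝ → MatForm} (hA : Continuous fun p : ℝ × ℂ => A p.1 p.2)
    {ψ : ℝ → ℂ → Fin 2 → ℂ} (hψ : ∀ t, IsFlat (A t) (ψ t)) {p : Fin 2 → ℂ}
    (hp : ∀ t, ψ t 0 = p) (R : ℝ) :
    ∃ C, ∀ t ∈ Icc (-1 : ℝ) 1, ∀ z : ℂ, ‖z‖ ≤ R → ‖ψ t z‖ ≤ C := by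
  obtain ⟨K, hK0, hK⟩ := exists_norm_connOp_le hA R
  refine ⟨‖p‖ * rexp (K * R), fun t ht z hz => ?_⟩
  have h := norm_le_gronwallBound_of_norm_deriv_right_le (a := 0) (b := 1) (δ := ‖p‖)
    (K := K * R) (ε := 0) (f := fun s : ℝ => ψ t (s * z))
    (fun s _ => ((hψ t).hasDerivAt_ray z s).continuousAt.continuousWithinAt)
    (fun s _ => ((hψ t).hasDerivAt_ray z s).hasDerivWithinAt) (by simp [hp]) (by
      intro s hs
      rw [norm_neg, add_zero]
      refine ((connOp (A t (s * z))).le_opNorm₂ _ _).trans ?_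
      gcongr
      exact hK t ht _ (norm_ofReal_mul_le ⟨hs.1, hs.2.le⟩ hz)) 1 (by simp)
  rw [gronwallBound_ε0] at h
  simpa using h

set_option maxSynthPendingDepth 3 in
theorem tendsto_flat {A : ℝ → MatForm} (hA : Continuous fun p : ℝ × ℂ => A p.1 p.2)
    {ψ : ℝ → ℂ → Fin 2 → ℂ} (hψ : ∀ t, IsFlat (A t) (ψ t)) {p : Fin 2 → ℂ}
    (hp : ∀ t, ψ t 0 = p) (z : ℂ) :
    Tendsto (fun t => ψ t z) (𝓝 0) (𝓝 (ψ 0 z)) := by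
  obtain ⟨K, hK0, hK⟩ := exists_norm_connOp_le hA ‖z‖
  obtain ⟨C, hC⟩ := norm_flat_le hA hψ hp ‖z‖
  have hlim : Tendsto (fun ε => gronwallBound 0 (K * ‖z‖) (ε * ‖z‖ * C) 1) (𝓝 0) (𝓝 0) := by
    have h1 := (gronwallBound_continuous_ε 0 (K * ‖z‖) 1).tendsto (0 * ‖z‖ * C)
    have h2 : Tendsto (fun ε : ℝ => ε * ‖z‖ * C) (𝓝 0) (𝓝 (0 * ‖z‖ * C)) := by
      apply Continuous.tendsto; fun_prop
    have h3 := h1.comp h2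
    simp only [zero_mul, gronwallBound_ε0_δ0] at h3
    exact h3
  rw [Metric.tendsto_nhds]
  intro c hc
  obtain ⟨ε, hεc, hε⟩ : ∃ ε, gronwallBound 0 (K * ‖z‖) (ε * ‖z‖ * C) 1 < c ∧ 0 < ε :=
    (((hlim.eventually_lt_const hc).filter_mono nhdsWithin_le_nhds).and
      (self_mem_nhdsWithin (s := Ioi (0 : ℝ)))).exists
  have hcomp : IsCompact (Icc (-1 : ℝ) 1 ×ˢ Icc (0 : ℝ) 1) := isCompact_Icc.prod isCompact_Icc
  have hcont : Continuous fun q : ℝ × ℝ => connOp (A q.1 (q.2 * z)) := by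
    refine connOp.continuous.comp (hA.comp (f := fun q : ℝ × ℝ => (q.1, (q.2 : ℂ) * z)) ?_)
    fun_prop
  obtain ⟨δ, hδ, hδu⟩ := Metric.uniformContinuousOn_iff.1
    (hcomp.uniformContinuousOn_of_continuous hcont.continuousOn) ε hε
  filter_upwards [Metric.ball_mem_nhds (0 : ℝ) (lt_min hδ one_pos)] with t ht
  rw [mem_ball_zero_iff] at ht
  have ht1 : t ∈ Icc (-1 : ℝ) 1 := abs_le.1 (ht.trans_le (min_le_right _ _)).le
  have hgr := norm_le_gronwallBound_of_norm_deriv_right_le (a := 0) (b := 1) (δ := 0)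
    (K := K * ‖z‖) (ε := ε * ‖z‖ * C) (f := fun s : ℝ => ψ t (s * z) - ψ 0 (s * z))
    (fun s _ => (((hψ t).hasDerivAt_ray z s).sub
      ((hψ 0).hasDerivAt_ray z s)).continuousAt.continuousWithinAt)
    (fun s _ => (((hψ t).hasDerivAt_ray z s).sub
      ((hψ 0).hasDerivAt_ray z s)).hasDerivWithinAt) (by simp [hp]) (by
      intro s hs
      have hs' : s ∈ Icc (0 : ℝ) 1 := ⟨hs.1, hs.2.le⟩
      have hsz := norm_ofReal_mul_le hs' (le_refl ‖z‖)
      have e : -(connOp (A t (s * z)) z (ψ t (s * z))) - -(connOp (A 0 (s * z)) z (ψ 0 (s * z)))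
          = -(connOp (A 0 (s * z)) z (ψ t (s * z) - ψ 0 (s * z)))
            - (connOp (A t (s * z)) - connOp (A 0 (s * z))) z (ψ t (s * z)) := by
        simp only [map_sub, sub_apply]
        abel
      rw [e]
      refine (norm_sub_le _ _).trans (add_le_add ?_ ?_)
      · rw [norm_neg]
        refine ((connOp (A 0 (s * z))).le_opNorm₂ _ _).trans ?_
        gcongr
        exact hK 0 (by simp) _ hsz
      · refine (ContinuousLinearMap.le_opNorm₂ _ _ _).trans ?_
        have h1 : ‖connOp (A t (s * z)) - connOp (A 0 (s * z))‖ ≤ ε := by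
          rw [← dist_eq_norm]
          refine (hδu (t, s) ⟨ht1, hs'⟩ (0, s) ⟨by simp, hs'⟩ ?_).le
          rw [Prod.dist_eq, dist_self, max_eq_left dist_nonneg, dist_zero_right]
          exact ht.trans_le (min_le_left _ _)
        exact mul_le_mul (mul_le_mul_of_nonneg_right h1 (norm_nonneg _)) (hC t ht1 _ hsz)
          (norm_nonneg _) (by positivity)) 1 (by simp)
  rw [dist_eq_norm]
  simp only [ofReal_one, one_mul, sub_zero] at hgr
  exact hgr.trans_lt hεc

/-! ### Asymptotics of flat sections -/

/-- The diagonal entries of `H`. -/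
def sg (j : Fin 2) : ℝ := if j = 0 then 1 else -1

theorem sg_mul_self (j : Fin 2) : sg j * sg j = 1 := by
  fin_cases j <;> simp [sg]

/-- The exponent `g` in the formal solution `exp (-g H)`, in the coordinate `ξ = log z`. -/
def expo (c1 c2 a b ξ : ℂ) : ℂ :=
  (c1 * exp (2 * ξ) + c2 * exp (2 * conj ξ)) / 2 + (a * ξ + b * conj ξ)

/-- The derivative of `expo`. -/
def expoD (c1 c2 a b ξ v : ℂ) : ℂ :=
  c1 * exp (2 * ξ) * v + c2 * exp (2 * conj ξ) * conj v + (a * v + b * conj v)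

theorem hasDerivAt_expo (c1 c2 a b : ℂ) {c : ℝ → ℂ} {c' : ℂ} (h : HasDerivAt c c' s) : HasDerivAt
    (fun s => expo c1 c2 a b (c s)) (expoD c1 c2 a b (c s) c') s := by
  have hc : HasDerivAt (fun s => conj (c s)) (conj c') s := h.star
  have e1 := ((h.const_mul 2).cexp.const_mul c1).add ((hc.const_mul 2).cexp.const_mul c2)
  refine ((e1.div_const 2).add ((h.const_mul a).add (hc.const_mul b))).congr_deriv ?_
  simp only [expoD]
  ring

/-- `d + A` is `d + dg · H + O(e^{-s})` in the coordinate `ξ = s + iθ = log z`. -/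
def HasAsymp (A : MatForm) (c1 c2 a b : ℂ) (s0 C : ℝ) : Prop := ∀ ξ : ℂ, s0 ≤ ξ.re → ∀ v i j,
    ‖A (exp ξ) i j (exp ξ * v) - expoD c1 c2 a b ξ v * matH i j‖ ≤ C * rexp (-ξ.re) * ‖v‖

theorem transport_bound {x y γ X Y γ' : ℝ → ℂ} {d Δ : ℝ → ℝ} (hT : 0 ≤ T) (hK : 1 ≤ K)
    (hx : ∀ τ ∈ Icc 0 T, HasDerivAt x (X τ) τ)
    (hy : ∀ τ ∈ Icc 0 T, HasDerivAt y (2 * γ' τ * y τ + Y τ) τ)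
    (hγ : ∀ τ ∈ Icc 0 T, HasDerivAt γ (γ' τ) τ) (hmono : ∀ τ ∈ Icc 0 T, ∀ τ' ∈ Icc 0 τ, rexp (2 *
    ((γ τ).re - (γ τ').re)) ≤ K) (hX : ∀ τ ∈ Icc 0 T, ‖X τ‖ ≤ d τ * (‖x τ‖ + ‖y τ‖))
    (hY : ∀ τ ∈ Icc 0 T, ‖Y τ‖ ≤ d τ * (‖x τ‖ + ‖y τ‖)) (hd : ∀ τ ∈ Icc 0 T, 0 ≤ d τ)
    (hΔ : ∀ τ ∈ Icc 0 T, HasDerivAt Δ (d τ) τ) (hδ : ∀ τ ∈ Icc 0 T, Δ τ - Δ 0 ≤ δ)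
    (hKδ : 4 * K * δ ≤ 1) : ∀ τ ∈ Icc 0 T, ‖x τ - x 0‖ ≤ 2 * K * δ * (‖x 0‖ + ‖y 0‖) ∧ ‖y τ‖ ≤ K *
    ‖y 0‖ + 2 * K ^ 2 * δ * (‖x 0‖ + ‖y 0‖) := by
  have h0T : (0 : ℝ) ∈ Icc 0 T := ⟨le_rfl, hT⟩
  have hδ0 : 0 ≤ δ := by simpa using hδ 0 h0T
  obtain ⟨τm, hτm, hmax⟩ := isCompact_Icc.exists_isMaxOn (f := fun τ => ‖x τ‖ + ‖y τ‖)
    (nonempty_Icc.2 hT)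
    (fun τ hτ => ((hx τ hτ).continuousAt.norm.add (hy τ hτ).continuousAt.norm).continuousWithinAt)
  set M := ‖x τm‖ + ‖y τm‖ with hM
  have hM0 : 0 ≤ M := by positivity
  have hle : ∀ τ ∈ Icc 0 T, ‖x τ‖ + ‖y τ‖ ≤ M := fun τ hτ => hmax hτ
  have bx : ∀ τ ∈ Icc 0 T, ‖x τ - x 0‖ ≤ M * δ := by
    intro τ hτ
    have := image_norm_le_of_norm_deriv_right_le_deriv_boundary' (a := 0) (b := T)
      (f := fun τ => x τ - x 0) (f' := X) (B := fun τ => M * (Δ τ - Δ 0))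
      (B' := fun τ => M * d τ)
      (fun τ hτ => ((hx τ hτ).sub_const _).continuousAt.continuousWithinAt)
      (fun τ hτ => ((hx τ ⟨hτ.1, hτ.2.le⟩).sub_const _).hasDerivWithinAt)
      (by simp)
      (fun τ hτ => (((hΔ τ hτ).sub_const _).const_mul M).continuousAt.continuousWithinAt)
      (fun τ hτ => (((hΔ τ ⟨hτ.1, hτ.2.le⟩).sub_const _).const_mul M).hasDerivWithinAt)
      (fun τ hτ => by
        have hτ' : τ ∈ Icc 0 T := ⟨hτ.1, hτ.2.le⟩
        rw [mul_comm]
        exact (hX τ hτ').trans (mul_le_mul_of_nonneg_left (hle τ hτ') (hd τ hτ'))) hτ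
    exact this.trans (mul_le_mul_of_nonneg_left (hδ τ hτ) hM0)
  have byy : ∀ τ ∈ Icc 0 T, ‖y τ‖ ≤ K * ‖y 0‖ + K * (M * δ) := by
    intro τ hτ
    have sub : ∀ σ ∈ Icc 0 τ, σ ∈ Icc 0 T := fun σ hσ => ⟨hσ.1, hσ.2.trans hτ.2⟩
    set N := K * rexp (-2 * (γ τ).re) with hN
    have hN0 : 0 ≤ N := by positivity
    have hder : ∀ σ ∈ Icc 0 T, HasDerivAt (fun σ => exp (-(2 * γ σ)) * y σ)
        (exp (-(2 * γ σ)) * Y σ) σ := by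
      intro σ hσ
      refine ((((hγ σ hσ).const_mul 2).fun_neg.cexp).mul (hy σ hσ)).congr_deriv ?_
      ring
    have := image_norm_le_of_norm_deriv_right_le_deriv_boundary' (a := 0) (b := τ)
      (f := fun σ => exp (-(2 * γ σ)) * y σ - exp (-(2 * γ 0)) * y 0)
      (f' := fun σ => exp (-(2 * γ σ)) * Y σ) (B := fun σ => N * M * (Δ σ - Δ 0))
      (B' := fun σ => N * M * d σ)
      (fun σ hσ => ((hder σ (sub σ hσ)).sub_const _).continuousAt.continuousWithinAt)
      (fun σ hσ => ((hder σ (sub σ ⟨hσ.1, hσ.2.le⟩)).sub_const _).hasDerivWithinAt)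
      (by simp)
      (fun σ hσ => (((hΔ σ (sub σ hσ)).sub_const _).const_mul _).continuousAt.continuousWithinAt)
      (fun σ hσ =>
        (((hΔ σ (sub σ ⟨hσ.1, hσ.2.le⟩)).sub_const _).const_mul _).hasDerivWithinAt)
      (fun σ hσ => by
        have hσ' : σ ∈ Icc 0 τ := ⟨hσ.1, hσ.2.le⟩
        have hσT := sub σ hσ'
        rw [norm_mul, norm_exp]
        have h1 : rexp (-(2 * γ σ)).re ≤ N := by
          have := hmono τ hτ σ hσ'
          have e : rexp (-(2 * γ σ)).re
              = rexp (2 * ((γ τ).re - (γ σ).re)) * rexp (-2 * (γ τ).re) := by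
            rw [← Real.exp_add]; congr 1; simp; ring
          rw [e]
          exact mul_le_mul_of_nonneg_right this (Real.exp_pos _).le
        rw [mul_assoc]
        refine mul_le_mul h1 ?_ (norm_nonneg _) hN0
        rw [mul_comm]
        exact (hY σ hσT).trans (mul_le_mul_of_nonneg_left (hle σ hσT) (hd σ hσT)))
      (right_mem_Icc.2 hτ.1)
    have hyτ : y τ = exp (2 * γ τ) * (exp (-(2 * γ τ)) * y τ - exp (-(2 * γ 0)) * y 0)
        + exp (2 * γ τ) * exp (-(2 * γ 0)) * y 0 := by
      have : exp (2 * γ τ) * exp (-(2 * γ τ)) = 1 := by rw [← exp_add]; simp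
      linear_combination (-y τ) * this
    rw [hyτ]
    refine (norm_add_le _ _).trans ?_
    rw [add_comm]
    refine add_le_add ?_ ?_
    · rw [norm_mul, ← exp_add, norm_exp]
      refine mul_le_mul_of_nonneg_right ?_ (norm_nonneg _)
      refine le_trans (le_of_eq ?_) (hmono τ hτ 0 ⟨le_rfl, hτ.1⟩)
      congr 1; simp; ring
    · rw [norm_mul, norm_exp]
      refine (mul_le_mul_of_nonneg_left this (Real.exp_pos _).le).trans ?_
      have e : rexp (2 * γ τ).re * rexp (-2 * (γ τ).re) = 1 := by rw [← Real.exp_add]; simp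
      have e2 : rexp (2 * γ τ).re * (N * M * (Δ τ - Δ 0)) = K * (M * (Δ τ - Δ 0)) := by
        rw [hN]; linear_combination (K * M * (Δ τ - Δ 0)) * e
      rw [e2]
      have := hδ τ hτ
      gcongr
  have hMle : M ≤ 2 * K * (‖x 0‖ + ‖y 0‖) := by
    have h1 := bx τm hτm
    have h2 := byy τm hτm
    have h3 : ‖x τm‖ ≤ ‖x τm - x 0‖ + ‖x 0‖ := by simpa using norm_add_le (x τm - x 0) (x 0)
    have h4 : M * δ ≤ K * (M * δ) := le_mul_of_one_le_left (by positivity) hK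
    have h5 : ‖x 0‖ ≤ K * ‖x 0‖ := le_mul_of_one_le_left (norm_nonneg _) hK
    have h6 : K * (M * δ) ≤ M / 4 := by nlinarith
    rw [hM] at *
    linarith
  intro τ hτ
  have h1 : M * δ ≤ 2 * K * δ * (‖x 0‖ + ‖y 0‖) := by
    calc M * δ ≤ 2 * K * (‖x 0‖ + ‖y 0‖) * δ := by gcongr
      _ = _ := by ring
  refine ⟨(bx τ hτ).trans h1, (byy τ hτ).trans ?_⟩
  have : K * (M * δ) ≤ K * (2 * K * δ * (‖x 0‖ + ‖y 0‖)) := by gcongr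
  linarith

/-- The section `ψ` in the gauge in which its dominant component is neutral. -/
def gauged (g : ℂ → ℂ) (j : Fin 2) (ψ : ℂ → Fin 2 → ℂ) (ξ : ℂ) (i : Fin 2) : ℂ :=
  exp (sg j * g ξ) * ψ (exp ξ) i

/-- The remainder matrix. -/
def remd (A : MatForm) (c1 c2 a b ξ v : ℂ) (i j : Fin 2) : ℂ :=
  A (exp ξ) i j (exp ξ * v) - expoD c1 c2 a b ξ v * matH i j

theorem hasDerivAt_gauged (hψ : IsFlat A ψ) (c1 c2 a b : ℂ) (j i : Fin 2) {c : ℝ → ℂ} {c' : ℂ}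
    (h : HasDerivAt c c' s) : HasDerivAt (fun s => gauged (expo c1 c2 a b) j ψ (c s) i) ((sg j - sg
    i) * expoD c1 c2 a b (c s) c' * gauged (expo c1 c2 a b) j ψ (c s) i - (remd A c1 c2 a b (c s) c'
    i 0 * gauged (expo c1 c2 a b) j ψ (c s) 0 + remd A c1 c2 a b (c s) c' i 1 * gauged (expo c1 c2 a
    b) j ψ (c s) 1)) s := by
  have h1 := (hψ (exp (c s)) i).comp_hasDerivAt s h.cexp
  have h2 := ((hasDerivAt_expo c1 c2 a b h).const_mul (sg j : ℂ)).cexp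
  refine (h2.mul h1).congr_deriv ?_
  simp only [gauged, remd, neg_apply, add_apply, smul_apply, smul_eq_mul, Function.comp_apply]
  fin_cases i
  · simp [matH, sg]; ring
  · simp [matH, sg]; ring

theorem flat_transport (hψ : IsFlat A ψ) (hA : HasAsymp A c1 c2 a b s0 C) (hC : 0 ≤ C) (j : Fin 2)
    {c c' : ℝ → ℂ} {Δ : ℝ → ℝ} (hT : 0 ≤ T) (hK : 1 ≤ K) (hc : ∀ τ ∈ Icc 0 T, HasDerivAt c (c' τ) τ)
    (hs : ∀ τ ∈ Icc 0 T, s0 ≤ (c τ).re) (hmono : ∀ τ ∈ Icc 0 T, ∀ τ' ∈ Icc 0 τ, rexp (2 * (sg j *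
    (expo c1 c2 a b (c τ)).re - sg j * (expo c1 c2 a b (c τ')).re)) ≤ K)
    (hΔ : ∀ τ ∈ Icc 0 T, HasDerivAt Δ (C * rexp (-(c τ).re) * ‖c' τ‖) τ)
    (hδ : ∀ τ ∈ Icc 0 T, Δ τ - Δ 0 ≤ δ) (hKδ : 4 * K * δ ≤ 1) : ∀ τ ∈ Icc 0 T, ‖gauged
    (expo c1 c2 a b) j ψ (c τ) j - gauged (expo c1 c2 a b) j ψ (c 0) j‖ ≤ 2 * K * δ * (‖gauged (expo
    c1 c2 a b) j ψ (c 0) j‖ + ‖gauged (expo c1 c2 a b) j ψ (c 0) (j + 1)‖) ∧ ‖gauged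
    (expo c1 c2 a b) j ψ (c τ) (j + 1)‖ ≤ K * ‖gauged (expo c1 c2 a b) j ψ (c 0) (j + 1)‖ + 2 * K ^
    2 * δ * (‖gauged (expo c1 c2 a b) j ψ (c 0) j‖ + ‖gauged (expo c1 c2 a b) j ψ (c 0) (j + 1)‖) :=
    by
  set e := gauged (expo c1 c2 a b) j ψ with he
  have hrem : ∀ τ ∈ Icc 0 T, ∀ i, ‖-(remd A c1 c2 a b (c τ) (c' τ) i 0 * e (c τ) 0
      + remd A c1 c2 a b (c τ) (c' τ) i 1 * e (c τ) 1)‖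
      ≤ C * rexp (-(c τ).re) * ‖c' τ‖ * (‖e (c τ) j‖ + ‖e (c τ) (j + 1)‖) := by
    intro τ hτ i
    have h0 := hA (c τ) (hs τ hτ) (c' τ) i 0
    have h1 := hA (c τ) (hs τ hτ) (c' τ) i 1
    have hsum : ‖e (c τ) j‖ + ‖e (c τ) (j + 1)‖ = ‖e (c τ) 0‖ + ‖e (c τ) 1‖ := by
      fin_cases j
      · rfl
      · exact add_comm _ _
    rw [norm_neg, hsum, mul_add]
    refine (norm_add_le _ _).trans (add_le_add ?_ ?_)
    · rw [norm_mul]; exact mul_le_mul_of_nonneg_right h0 (norm_nonneg _)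
    · rw [norm_mul]; exact mul_le_mul_of_nonneg_right h1 (norm_nonneg _)
  refine transport_bound (x := fun τ => e (c τ) j) (y := fun τ => e (c τ) (j + 1))
    (γ := fun τ => sg j * expo c1 c2 a b (c τ)) hT hK
    (fun τ hτ => (hasDerivAt_gauged hψ c1 c2 a b j j (hc τ hτ)).congr_deriv ?_)
    (fun τ hτ => (hasDerivAt_gauged hψ c1 c2 a b j (j + 1) (hc τ hτ)).congr_deriv ?_)
    (fun τ hτ => (hasDerivAt_expo c1 c2 a b (hc τ hτ)).const_mul (sg j : ℂ))
    ?_ (fun τ hτ => hrem τ hτ j) (fun τ hτ => hrem τ hτ (j + 1)) (fun τ hτ => by positivity)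
    hΔ hδ hKδ
  · simp [he]
  · have : (sg (j + 1) : ℂ) = -sg j := by fin_cases j <;> simp [sg]
    rw [this]
    ring
  · simpa using hmono

/-- `ψ` is the flat section that decays along the ray of angle `θc`, normalized by its `j`-th
component. -/
def IsDom (A : MatForm) (c1 c2 a b : ℂ) (j : Fin 2) (θc s1 C : ℝ) (ψ : ℂ → Fin 2 → ℂ) : Prop :=
  IsFlat A ψ ∧ ∀ ξ : ℂ, s1 ≤ ξ.re → |ξ.im - θc| ≤ π / 2 →
    ‖gauged (expo c1 c2 a b) j ψ ξ j - 1‖ ≤ C * rexp (-ξ.re) ∧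
    ‖gauged (expo c1 c2 a b) j ψ ξ (j + 1)‖ ≤ C * rexp (-ξ.re)

/-- The real part of the exponent decays along the rays through the centre `θc`. -/
def IsRay (c1 c2 : ℂ) (κ : ℝ) (j : Fin 2) (θc : ℝ) : Prop :=
  ∀ s ϑ : ℝ, sg j * ((c1 * exp (2 * (s + (θc + ϑ) * I))
    + c2 * exp (2 * conj (s + (θc + ϑ) * I : ℂ))) / 2).re = κ * rexp (2 * s) * Real.cos (2 * ϑ)

theorem re_expo_of_isRay (h : IsRay c1 c2 κ j θc) (a b : ℂ) (s ϑ : ℝ) : sg j *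
    (expo c1 c2 a b (s + (θc + ϑ) * I)).re = κ * rexp (2 * s) * Real.cos (2 * ϑ) + sg j *
    ((a + b).re * s - (a - b).im * (θc + ϑ)) := by
  rw [expo, add_re, mul_add, h s ϑ]
  congr 2
  simp
  ring

theorem exists_sign_mul_abs (x : ℝ) : ∃ ς : ℝ, (ς = 1 ∨ ς = -1) ∧ ς * |x| = x := by
  rcases le_total 0 x with h | h
  · exact ⟨1, Or.inl rfl, by rw [abs_of_nonneg h, one_mul]⟩
  · exact ⟨-1, Or.inr rfl, by rw [abs_of_nonpos h]; ring⟩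

/-- Two flat sections with determinant `1`. -/
structure FundPair (A : MatForm) (φ0 φ1 : ℂ → Fin 2 → ℂ) : Prop where
  flat₀ : IsFlat A φ0
  flat₁ : IsFlat A φ1
  wr_eq : ∀ z, wr (φ0 z) (φ1 z) = 1

/-- The flat section with coefficients `p`. -/
def sec (φ0 φ1 : ℂ → Fin 2 → ℂ) (p : Fin 2 → ℂ) (z : ℂ) : Fin 2 → ℂ := p 0 • φ0 z + p 1 • φ1 z

theorem FundPair.isFlat_sec {φ0 φ1 : ℂ → Fin 2 → ℂ} (h : FundPair A φ0 φ1) (p : Fin 2 → ℂ) : IsFlat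
    A (sec φ0 φ1 p) :=
  h.flat₀.comb h.flat₁ _ _

/-- The coefficients of the flat section with value `w` at `z`. -/
def coeffs (φ0 φ1 : ℂ → Fin 2 → ℂ) (z : ℂ) (w : Fin 2 → ℂ) : Fin 2 → ℂ :=
  ![wr w (φ1 z), -wr w (φ0 z)]

theorem FundPair.sec_coeffs {φ0 φ1 : ℂ → Fin 2 → ℂ} (h : FundPair A φ0 φ1) (z : ℂ) (w : Fin 2 → ℂ) :
    sec φ0 φ1 (coeffs φ0 φ1 z w) z = w := by
  have := h.wr_eq z
  simp only [wr] at this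
  ext i
  fin_cases i
  · simp [sec, coeffs, wr]; linear_combination w 0 * this
  · simp [sec, coeffs, wr]; linear_combination w 1 * this

theorem FundPair.eq_sec {φ0 φ1 : ℂ → Fin 2 → ℂ} (h : FundPair A φ0 φ1)
    (hA : ∀ z v, A z 0 0 v + A z 1 1 v = 0) (hψ : IsFlat A ψ) (z : ℂ) : ψ = sec φ0 φ1
    (coeffs φ0 φ1 z (ψ z)) := by
  funext w
  have h1 := wr_const hψ h.flat₁ hA z w
  have h0 := wr_const hψ h.flat₀ hA z w
  rw [coeffs, h1, h0]
  exact (h.sec_coeffs w (ψ w)).symm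

theorem exists_fundPair (hA : ContDiff ℝ ∞ A) (hflat : ∀ z, curvature A z = 0)
    (htr : ∀ z v, A z 0 0 v + A z 1 1 v = 0) : ∃ φ0 φ1, FundPair A φ0 φ1 ∧ φ0 0 = ![1, 0] ∧ φ1 0 =
    ![0, 1] := by
  obtain ⟨φ0, h0, e0⟩ := exists_isFlat hA hflat ![1, 0]
  obtain ⟨φ1, h1, e1⟩ := exists_isFlat hA hflat ![0, 1]
  refine ⟨φ0, φ1, ⟨h0, h1, fun z => ?_⟩, e0, e1⟩
  rw [wr_const h0 h1 htr z 0, e0, e1]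
  simp [wr]

theorem dom_ray (hψ : IsFlat A ψ) {S : ℝ} (hA : HasAsymp A c1 c2 a b s0 C) (hC : 0 ≤ C)
    (hray : IsRay c1 c2 κ j θc) (hκ : 0 < κ) (ha : ‖a‖ ≤ m0) (hb : ‖b‖ ≤ m0) (hs : s0 ≤ s1)
    (hκs : m0 ≤ κ * rexp (2 * s1)) (hCs : 4 * (C * rexp (-s1)) ≤ 1)
    (h1 : gauged (expo c1 c2 a b) j ψ (S + θc * I) j = 1)
    (h0 : gauged (expo c1 c2 a b) j ψ (S + θc * I) (j + 1) = 0) (hs1 : s1 ≤ s) (hsS : s ≤ S) :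
    ‖gauged (expo c1 c2 a b) j ψ (s + θc * I) j - 1‖ ≤ 2 * C * rexp (-s) ∧ ‖gauged (expo c1 c2 a b)
    j ψ (s + θc * I) (j + 1)‖ ≤ 2 * C * rexp (-s) := by
  have hre : ∀ τ : ℝ, (((S - τ : ℝ) : ℂ) + θc * I).re = S - τ := by intro τ; simp
  have key := flat_transport hψ hA hC j (c := fun τ => ((S - τ : ℝ) : ℂ) + θc * I)
    (c' := fun _ => -1) (T := S - s) (δ := C * rexp (-s)) (K := 1)
    (Δ := fun τ => C * rexp (-(S - τ))) (by linarith) le_rfl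
    (by
      intro τ _
      have : HasDerivAt (fun τ : ℝ => S - τ) (-1) τ := by simpa using (hasDerivAt_id τ).const_sub S
      simpa using this.ofReal_comp.add_const (θc * I))
    (by intro τ hτ; rw [hre]; linarith [hτ.2])
    (by
      intro τ hτ τ' hτ'
      rw [Real.exp_le_one_iff]
      have e := re_expo_of_isRay hray a b
      have e1 := e (S - τ) 0
      have e2 := e (S - τ') 0
      simp only [ofReal_zero, add_zero, mul_zero, Real.cos_zero, mul_one] at e1 e2
      rw [e1, e2]
      have hab : |sg j * (a + b).re| ≤ 2 * m0 := by
        have : |sg j| = 1 := by fin_cases j <;> simp [sg]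
        rw [abs_mul, this, one_mul]
        exact (abs_re_le_norm _).trans ((norm_add_le _ _).trans (by linarith))
      have h3 := abs_le.1 hab
      have hle : S - τ ≤ S - τ' := by linarith [hτ'.2]
      have h4 : rexp (2 * (S - τ)) * (2 * (τ - τ')) ≤ rexp (2 * (S - τ')) - rexp (2 * (S - τ)) := by
        have := Real.add_one_le_exp (2 * (τ - τ'))
        have e : rexp (2 * (S - τ')) = rexp (2 * (S - τ)) * rexp (2 * (τ - τ')) := by
          rw [← Real.exp_add]; congr 1; ring
        rw [e]
        nlinarith [Real.exp_pos (2 * (S - τ))]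
      have h5 : m0 ≤ κ * rexp (2 * (S - τ)) := by
        refine hκs.trans (mul_le_mul_of_nonneg_left ?_ hκ.le)
        apply Real.exp_le_exp.2
        linarith [hτ.2]
      have h6 : 0 ≤ τ - τ' := by linarith [hτ'.2]
      have h7 := mul_le_mul_of_nonneg_left h4 hκ.le
      have h8 := mul_le_mul_of_nonneg_right h5 h6
      nlinarith [mul_le_mul_of_nonneg_right h3.2 h6, mul_le_mul_of_nonneg_right h3.1 h6])
    (by
      intro τ _
      have : HasDerivAt (fun τ : ℝ => -(S - τ)) 1 τ := by
        simpa using ((hasDerivAt_id τ).const_sub S).fun_neg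
      have := (this.exp).const_mul C
      refine this.congr_deriv ?_
      rw [hre]; simp)
    (by
      intro τ hτ
      have h1 : rexp (-(S - τ)) ≤ rexp (-s) := Real.exp_le_exp.2 (by linarith [hτ.2])
      have h2 : 0 ≤ C * rexp (-(S - 0)) := by positivity
      have h3 := mul_le_mul_of_nonneg_left h1 hC
      linarith)
    (by
      have : rexp (-s) ≤ rexp (-s1) := Real.exp_le_exp.2 (by linarith)
      have := mul_le_mul_of_nonneg_left this hC
      linarith) (S - s) ⟨by linarith, le_rfl⟩
  have es : ((S - (S - s) : ℝ) : ℂ) = s := by push_cast; ring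
  simp only [es, sub_zero, h1, h0, norm_one, norm_zero, add_zero, mul_one, one_pow, mul_zero,
    zero_add] at key
  rw [mul_assoc]
  exact key

theorem dom_arc (hψ : IsFlat A ψ) (hA : HasAsymp A c1 c2 a b s0 C) (hC : 0 ≤ C)
    (hray : IsRay c1 c2 κ j θc) (hκ : 0 < κ) (ha : ‖a‖ ≤ m0) (hb : ‖b‖ ≤ m0)
    (hK : K = rexp (2 * (π * m0))) (hs : s0 ≤ s) (hCs : 8 * K * (C * rexp (-s)) ≤ 1) (h1 : ‖gauged
    (expo c1 c2 a b) j ψ (s + θc * I) j - 1‖ ≤ 2 * C * rexp (-s)) (h0 : ‖gauged (expo c1 c2 a b) j ψ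
    (s + θc * I) (j + 1)‖ ≤ 2 * C * rexp (-s)) {ϑ : ℝ} (hϑ : |ϑ| ≤ π / 2) : ‖gauged (expo c1 c2 a b)
    j ψ (s + (θc + ϑ) * I) j - 1‖ ≤ 10 * K ^ 2 * C * rexp (-s) ∧ ‖gauged (expo c1 c2 a b) j ψ
    (s + (θc + ϑ) * I) (j + 1)‖ ≤ 10 * K ^ 2 * C * rexp (-s) := by
  have hm : 0 ≤ m0 := (norm_nonneg a).trans ha
  have hK1 : 1 ≤ K := by rw [hK, Real.one_le_exp_iff]; positivity
  set E := C * rexp (-s) with hE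
  have hE0 : 0 ≤ E := by positivity
  obtain ⟨ς, hς, hςϑ⟩ := exists_sign_mul_abs ϑ
  have hς1 : |ς| = 1 := by rcases hς with rfl | rfl <;> simp
  have hre : ∀ τ : ℝ, ((s : ℂ) + (θc + (ς * τ : ℝ)) * I).re = s := by intro τ; simp
  have key := flat_transport hψ hA hC j (c := fun τ => (s : ℂ) + (θc + (ς * τ : ℝ)) * I)
    (c' := fun _ => ς * I) (T := π / 2) (δ := 2 * E) (K := K)
    (Δ := fun τ => E * τ) (by positivity) hK1
    (by
      intro τ _
      have h1 : HasDerivAt (fun τ : ℝ => ς * τ) ς τ := by simpa using (hasDerivAt_id τ).const_mul ς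
      exact ((h1.ofReal_comp.const_add (θc : ℂ)).mul_const I).const_add (s : ℂ))
    (by intro τ hτ; rw [hre]; exact hs)
    (by
      intro τ hτ τ' hτ'
      rw [hK, Real.exp_le_exp]
      have e := re_expo_of_isRay hray a b s
      have e1 := e (ς * τ)
      have e2 := e (ς * τ')
      rw [e1, e2]
      have hcos : ∀ x : ℝ, Real.cos (2 * (ς * x)) = Real.cos (2 * x) := by
        intro x
        rcases hς with rfl | rfl
        · simp
        · rw [← Real.cos_neg]; congr 1; ring
      rw [hcos, hcos]
      have hc : Real.cos (2 * τ) ≤ Real.cos (2 * τ') :=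
        Real.cos_le_cos_of_nonneg_of_le_pi (by linarith [hτ'.1]) (by linarith [hτ.2])
          (by linarith [hτ'.2])
      have hc' : κ * rexp (2 * s) * Real.cos (2 * τ) ≤ κ * rexp (2 * s) *
        Real.cos (2 * τ') := mul_le_mul_of_nonneg_left hc (by positivity)
      have hab : |sg j * (a - b).im * (ς * (τ - τ'))| ≤ 2 * m0 * (π / 2) := by
        have : |sg j| = 1 := by fin_cases j <;> simp [sg]
        rw [abs_mul, abs_mul, abs_mul, this, hς1, one_mul, one_mul]
        refine mul_le_mul ((abs_im_le_norm _).trans ((norm_sub_le _ _).trans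
          (by linarith))) ?_ (abs_nonneg _) (by positivity)
        rw [abs_of_nonneg (by linarith [hτ'.2])]
        linarith [hτ.2, hτ'.1]
      have h3 := (abs_le.1 hab).1
      nlinarith)
    (by intro τ _; refine ((hasDerivAt_id τ).const_mul E).congr_deriv ?_; rw [hre]; simp [hς1, hE])
    (by
      intro τ hτ
      have : E * τ ≤ E * 2 := mul_le_mul_of_nonneg_left (by linarith [hτ.2, Real.pi_le_four]) hE0
      simp only [mul_zero, sub_zero]
      linarith)
    (by linarith) |ϑ| ⟨abs_nonneg _, hϑ⟩
  have e1 : ((s : ℂ) + (θc + (ς * |ϑ| : ℝ)) * I) = s + (θc + ϑ) * I := by rw [hςϑ]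
  have e0 : ((s : ℂ) + (θc + (ς * (0 : ℝ) : ℝ)) * I) = s + θc * I := by simp
  simp only [e1, e0] at key
  set x0 := gauged (expo c1 c2 a b) j ψ (s + θc * I) j
  set y0 := gauged (expo c1 c2 a b) j ψ (s + θc * I) (j + 1)
  have hE2 : 2 * C * rexp (-s) = 2 * E := by rw [hE]; ring
  have hE10 : 10 * K ^ 2 * C * rexp (-s) = 10 * K ^ 2 * E := by rw [hE]; ring
  rw [hE2] at h1 h0
  rw [hE10]
  have hKK : K ≤ K ^ 2 := by nlinarith
  have hKE : K * E ≤ K ^ 2 * E := mul_le_mul_of_nonneg_right hKK hE0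
  have hEK : E ≤ K * E := le_mul_of_one_le_left hE0 hK1
  have hx0 : ‖x0‖ ≤ 1 + 2 * E := by
    have := norm_add_le (x0 - 1) 1
    simp only [sub_add_cancel, norm_one] at this
    linarith
  have hsum : ‖x0‖ + ‖y0‖ ≤ 2 := by nlinarith
  constructor
  · have h2 := norm_add_le (gauged (expo c1 c2 a b) j ψ (s + (θc + ϑ) * I) j - x0) (x0 - 1)
    simp only [sub_add_sub_cancel] at h2
    have h3 : 2 * K * (2 * E) * (‖x0‖ + ‖y0‖) ≤ 2 * K * (2 * E) * 2 := by gcongr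
    have := key.1
    nlinarith
  · have h3 : 2 * K ^ 2 * (2 * E) * (‖x0‖ + ‖y0‖) ≤ 2 * K ^ 2 * (2 * E) * 2 := by gcongr
    have h4 : K * ‖y0‖ ≤ K * (2 * E) := by gcongr
    have := key.2
    nlinarith

theorem continuous_wr {X : Type*} [TopologicalSpace X] {f g : X → Fin 2 → ℂ} (hf : Continuous f)
    (hg : Continuous g) : Continuous fun x => wr (f x) (g x) := by
  unfold wr; fun_prop

theorem norm_wr_le (x y : Fin 2 → ℂ) : ‖wr x y‖ ≤ 2 * (‖x‖ * ‖y‖) := by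
  rw [wr, two_mul]
  refine (norm_sub_le _ _).trans (add_le_add ?_ ?_) <;> rw [norm_mul] <;>
  exact mul_le_mul (norm_le_pi_norm _ _) (norm_le_pi_norm _ _) (norm_nonneg _) (norm_nonneg _)

theorem norm_le_of_pair {x : Fin 2 → ℂ} (h : ‖x j‖ ≤ r) (h' : ‖x (j + 1)‖ ≤ r) : ‖x‖ ≤ r := by
  refine (pi_norm_le_iff_of_nonneg ((norm_nonneg _).trans h)).2 fun i => ?_
  fin_cases j <;> fin_cases i <;> assumption

theorem norm_coeffs_le (φ0 φ1 : ℂ → Fin 2 → ℂ) (z : ℂ) (w : Fin 2 → ℂ) :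
    ‖coeffs φ0 φ1 z w‖ ≤ 2 * (‖w‖ * (‖φ0 z‖ + ‖φ1 z‖)) := by
  refine norm_le_of_pair (j := 0) ?_ ?_
  · refine (norm_wr_le w (φ1 z)).trans ?_; gcongr; exact le_add_of_nonneg_left (norm_nonneg _)
  · change ‖-wr w (φ0 z)‖ ≤ _
    rw [norm_neg]
    refine (norm_wr_le w (φ0 z)).trans ?_
    gcongr
    exact le_add_of_nonneg_right (norm_nonneg _)

theorem norm_le_gauged (g : ℂ → ℂ) (j : Fin 2) (ψ : ℂ → Fin 2 → ℂ) (ξ : ℂ)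
    (h : ‖gauged g j ψ ξ j - 1‖ ≤ r) (h' : ‖gauged g j ψ ξ (j + 1)‖ ≤ r) : ‖ψ (exp ξ)‖ ≤ rexp
    (-(sg j * (g ξ).re)) * (1 + r) := by
  have hE : ∀ i, ‖ψ (exp ξ) i‖ = rexp (-(sg j * (g ξ).re)) * ‖gauged g j ψ ξ i‖ := by
    intro i
    rw [gauged, norm_mul, norm_exp, ← mul_assoc, ← Real.exp_add]
    simp
  have hr : 0 ≤ r := (norm_nonneg _).trans h
  refine norm_le_of_pair (j := j) ?_ ?_
  · rw [hE]
    gcongr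
    have := norm_add_le (gauged g j ψ ξ j - 1) 1
    simp only [sub_add_cancel, norm_one] at this
    linarith
  · rw [hE]; gcongr; linarith

theorem continuous_gauged_sec (g : ℂ → ℂ) (j i : Fin 2) (φ0 φ1 : ℂ → Fin 2 → ℂ) (ξ : ℂ) :
    Continuous fun p => gauged g j (sec φ0 φ1 p) ξ i := by
  unfold gauged sec
  simp only [Pi.add_apply, Pi.smul_apply, smul_eq_mul]
  fun_prop

theorem eq_add_mul_I (ξ : ℂ) (θ : ℝ) : ξ = (ξ.re : ℂ) + (θ + (ξ.im - θ : ℝ)) * I := by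
  apply Complex.ext <;> simp

theorem exists_dom (hs : ContDiff ℝ ∞ A) (hflat : ∀ z, curvature A z = 0)
    (htr : ∀ z v, A z 0 0 v + A z 1 1 v = 0) (hA : HasAsymp A c1 c2 a b s0 C) (hC : 0 ≤ C)
    (hray : IsRay c1 c2 κ j θc) (hκ : 0 < κ) (ha : ‖a‖ ≤ m0) (hb : ‖b‖ ≤ m0) (hs₁ : s0 ≤ s1)
    (hK : K = rexp (2 * (π * m0))) (hκs : m0 ≤ κ * rexp (2 * s1))
    (hCs : 8 * K * (C * rexp (-s1)) ≤ 1) : ∃ ψ, IsDom A c1 c2 a b j θc s1 (10 * K ^ 2 * C) ψ := by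
  obtain ⟨φ0, φ1, hφ, -, -⟩ := exists_fundPair hs hflat htr
  have hm : 0 ≤ m0 := (norm_nonneg a).trans ha
  have hK1 : 1 ≤ K := by rw [hK, Real.one_le_exp_iff]; positivity
  have hCs4 : 4 * (C * rexp (-s1)) ≤ 1 := by
    have : 0 ≤ C * rexp (-s1) := by positivity
    nlinarith
  set g := expo c1 c2 a b with hg
  let ξn : ℕ → ℂ := fun n => ((s1 + n : ℝ) : ℂ) + θc * I
  let wn : ℕ → Fin 2 → ℂ := fun n i => if i = j then exp (-(sg j * g (ξn n))) else 0
  let pn : ℕ → Fin 2 → ℂ := fun n => coeffs φ0 φ1 (exp (ξn n)) (wn n)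
  have hval : ∀ n, sec φ0 φ1 (pn n) (exp (ξn n)) = wn n := fun n => hφ.sec_coeffs _ _
  have hj1 : j + 1 ≠ j := by fin_cases j <;> decide
  have hray' : ∀ n : ℕ, ∀ s : ℝ, s1 ≤ s → s ≤ s1 + n →
      ‖gauged g j (sec φ0 φ1 (pn n)) (s + θc * I) j - 1‖ ≤ 2 * C * rexp (-s) ∧
      ‖gauged g j (sec φ0 φ1 (pn n)) (s + θc * I) (j + 1)‖ ≤ 2 * C * rexp (-s) := by
    intro n s h1 h2
    refine dom_ray (hφ.isFlat_sec (pn n)) hA hC hray hκ ha hb hs₁ hκs hCs4 ?_ ?_ h1 h2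
    · change exp _ * sec φ0 φ1 (pn n) (exp (ξn n)) j = 1
      rw [hval]
      simp only [wn, if_true, ξn]
      rw [← exp_add, ← hg, add_neg_cancel, exp_zero]
    · change exp _ * sec φ0 φ1 (pn n) (exp (ξn n)) (j + 1) = 0; rw [hval]; simp [wn, hj1]
  obtain ⟨R, hR⟩ : ∃ R, ∀ n, pn n ∈ closedBall (0 : Fin 2 → ℂ) R := by
    refine ⟨2 * (rexp (-(sg j * (g (s1 + θc * I)).re)) * (1 + 2 * C * rexp (-s1))
      * (‖φ0 (exp (s1 + θc * I))‖ + ‖φ1 (exp (s1 + θc * I))‖)), fun n => ?_⟩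
    rw [mem_closedBall_zero_iff]
    obtain ⟨e1, e0⟩ := hray' n s1 le_rfl (by simp)
    have hb' := norm_le_gauged g j _ _ e1 e0
    have hp : pn n = coeffs φ0 φ1 (exp (s1 + θc * I)) (sec φ0 φ1 (pn n) (exp (s1 + θc * I))) := by
      have h1 := wr_const (hφ.isFlat_sec (pn n)) hφ.flat₁ htr (exp (ξn n)) (exp (s1 + θc * I))
      have h0 := wr_const (hφ.isFlat_sec (pn n)) hφ.flat₀ htr (exp (ξn n)) (exp (s1 + θc * I))
      rw [hval] at h1 h0
      rw [coeffs, ← h1, ← h0]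
      rfl
    rw [hp]
    refine (norm_coeffs_le _ _ _ _).trans ?_
    gcongr
  obtain ⟨p, -, k, hk, hlim⟩ := (isCompact_closedBall (0 : Fin 2 → ℂ) R).tendsto_subseq hR
  refine ⟨sec φ0 φ1 p, hφ.isFlat_sec p, fun ξ hξ hϑ => ?_⟩
  have hcl : ∀ i, Tendsto (fun n => gauged g j (sec φ0 φ1 (pn (k n))) (ξ.re + θc * I) i) atTop
      (𝓝 (gauged g j (sec φ0 φ1 p) (ξ.re + θc * I) i)) := fun i =>
    ((continuous_gauged_sec g j i φ0 φ1 _).tendsto p).comp hlim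
  have hev : ∀ᶠ n in atTop, ξ.re ≤ s1 + k n := by
    have : Tendsto (fun n => s1 + (k n : ℝ)) atTop atTop :=
      tendsto_atTop_add_const_left _ _ (tendsto_natCast_atTop_atTop.comp hk.tendsto_atTop)
    exact this.eventually_ge_atTop _
  have h1 := le_of_tendsto ((hcl j).sub_const 1).norm
    (hev.mono fun n hn => (hray' (k n) ξ.re hξ hn).1)
  have h0 := le_of_tendsto (hcl (j + 1)).norm (hev.mono fun n hn => (hray' (k n) ξ.re hξ hn).2)
  have hCs' : 8 * K * (C * rexp (-ξ.re)) ≤ 1 := by refine le_trans ?_ hCs; gcongr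
  have := dom_arc (hφ.isFlat_sec p) hA hC hray hκ ha hb hK (hs₁.trans hξ) hCs' h1 h0 hϑ
  rw [← eq_add_mul_I ξ θc] at this
  exact this

theorem sg_succ (j : Fin 2) : sg (j + 1) = -sg j := by fin_cases j <;> simp [sg]

theorem wr_gauged (g : ℂ → ℂ) (j : Fin 2) (ψ χ : ℂ → Fin 2 → ℂ) (ξ : ℂ) :
    wr (gauged g j ψ ξ) (gauged g (j + 1) χ ξ) = wr (ψ (exp ξ)) (χ (exp ξ)) := by
  have : exp (sg j * g ξ) * exp (sg (j + 1) * g ξ) = 1 := by rw [← exp_add, sg_succ]; simp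
  simp only [wr, gauged]
  linear_combination (ψ (exp ξ) 0 * χ (exp ξ) 1 - ψ (exp ξ) 1 * χ (exp ξ) 0) * this

theorem tendsto_C_exp_neg (C : ℝ) : Tendsto (fun s : ℝ => C * rexp (-s)) atTop (𝓝 0) := by
  simpa using (Real.tendsto_exp_neg_atTop_nhds_zero).const_mul C

theorem IsDom.tendsto (h : IsDom A c1 c2 a b j θc s1 C ψ) (hθ : |θ - θc| ≤ π / 2) : Tendsto
    (fun s : ℝ => gauged (expo c1 c2 a b) j ψ (s + θ * I) j) atTop (𝓝 1) ∧ Tendsto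
    (fun s : ℝ => gauged (expo c1 c2 a b) j ψ (s + θ * I) (j + 1)) atTop (𝓝 0) := by
  have hb : ∀ᶠ s : ℝ in atTop, ‖gauged (expo c1 c2 a b) j ψ (s + θ * I) j - 1‖ ≤ C * rexp (-s) ∧
      ‖gauged (expo c1 c2 a b) j ψ (s + θ * I) (j + 1)‖ ≤ C * rexp (-s) := by
    filter_upwards [eventually_ge_atTop s1] with s hs
    simpa using h.2 (s + θ * I) (by simpa using hs) (by simpa using hθ)
  constructor
  · rw [tendsto_iff_norm_sub_tendsto_zero]
    exact squeeze_zero' (Eventually.of_forall fun _ => norm_nonneg _) (hb.mono fun _ h => h.1)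
      (tendsto_C_exp_neg C)
  · rw [tendsto_zero_iff_norm_tendsto_zero]
    exact squeeze_zero' (Eventually.of_forall fun _ => norm_nonneg _) (hb.mono fun _ h => h.2)
      (tendsto_C_exp_neg C)

theorem wr_pair (j : Fin 2) (x y : Fin 2 → ℂ) :
    wr x y = sg j * (x j * y (j + 1) - x (j + 1) * y j) := by
  fin_cases j <;> simp [wr, sg]

theorem IsDom.wr_adjacent (htr : ∀ z v, A z 0 0 v + A z 1 1 v = 0)
    (h : IsDom A c1 c2 a b j θ s1 C ψ) (h' : IsDom A c1 c2 a b (j + 1) θ' s1' C' χ)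
    (hθ : |θc - θ| ≤ π / 2) (hθ' : |θc - θ'| ≤ π / 2) (z : ℂ) : wr (ψ z) (χ z) = sg j := by
  obtain ⟨t1, t0⟩ := h.tendsto hθ
  obtain ⟨u1, u0⟩ := h'.tendsto hθ'
  have e : j + 1 + 1 = j := by fin_cases j <;> rfl
  rw [e] at u0
  have hlim : Tendsto (fun s : ℝ => wr (gauged (expo c1 c2 a b) j ψ (s + θc * I))
      (gauged (expo c1 c2 a b) (j + 1) χ (s + θc * I))) atTop (𝓝 (sg j)) := by
    have := ((t1.mul u1).sub (t0.mul u0)).const_mul (sg j : ℂ)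
    simp only [mul_one, mul_zero, sub_zero] at this
    simpa only [wr_pair j] using this
  refine tendsto_nhds_unique (tendsto_const_nhds.congr fun s => ?_) hlim
  rw [wr_gauged]
  exact wr_const h.1 h'.1 htr _ _

theorem tendsto_expo_ray (h : IsRay c1 c2 κ j θc) (hκ : 0 < κ) (a b : ℂ) (θ : ℝ)
    (hc : 0 < Real.cos (2 * (θ - θc))) : Tendsto
    (fun s : ℝ => sg j * (expo c1 c2 a b (s + θ * I)).re) atTop atTop := by
  set k := κ * Real.cos (2 * (θ - θc))
  have hk0 : 0 < k := by positivity
  set B := sg j * (a + b).re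
  set B' := sg j * (a - b).im * θ
  have e : ∀ s : ℝ, sg j * (expo c1 c2 a b (s + θ * I)).re = k * rexp (2 * s) + (B * s - B') := by
    intro s
    have := re_expo_of_isRay h a b s (θ - θc)
    have e1 : (s : ℂ) + ((θc : ℂ) + ((θ - θc : ℝ) : ℂ)) * I = s + θ * I := by push_cast; ring
    rw [e1] at this
    rw [this]
    ring
  simp only [e]
  have h1 : Tendsto (fun s : ℝ => rexp (2 * s) / (2 * s)) atTop atTop := by
    have := (Real.tendsto_exp_div_pow_atTop 1).comp
      (Tendsto.const_mul_atTop (show (0 : ℝ) < 2 by norm_num) tendsto_id)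
    simpa [Function.comp_def] using this
  have h2 : Tendsto (fun s : ℝ => s * (2 * k * (rexp (2 * s) / (2 * s)) + B) - B') atTop atTop := by
    refine tendsto_atTop_add_const_right _ _ (tendsto_id.atTop_mul_atTop₀ ?_)
    exact tendsto_atTop_add_const_right _ _ (h1.const_mul_atTop (by positivity))
  refine h2.congr' ?_
  filter_upwards [eventually_gt_atTop 0] with s hs
  field_simp
  ring

theorem IsDom.wr_self (htr : ∀ z v, A z 0 0 v + A z 1 1 v = 0) (hray : IsRay c1 c2 κ j θc)
    (hκ : 0 < κ) (h : IsDom A c1 c2 a b j θc s1 C ψ) (h' : IsDom A c1 c2 a b j θc s1' C' χ) (z : ℂ)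
    : wr (ψ z) (χ z) = 0 := by
  have hπ : |θc - θc| ≤ π / 2 := by rw [sub_self, abs_zero]; positivity
  obtain ⟨t1, t0⟩ := h.tendsto hπ
  obtain ⟨u1, u0⟩ := h'.tendsto hπ
  have hw : Tendsto (fun s : ℝ => wr (gauged (expo c1 c2 a b) j ψ (s + θc * I))
      (gauged (expo c1 c2 a b) j χ (s + θc * I))) atTop (𝓝 0) := by
    have := ((t1.mul u0).sub (t0.mul u1)).const_mul (sg j : ℂ)
    simp only [mul_one, mul_zero, sub_zero] at this
    simpa only [wr_pair j] using this
  have hg := tendsto_expo_ray hray hκ a b θc (by simp)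
  have hexp : Tendsto (fun s : ℝ => exp (-(2 * (sg j * expo c1 c2 a b (s + θc * I))))) atTop
      (𝓝 0) := by
    rw [tendsto_zero_iff_norm_tendsto_zero]
    simp only [norm_exp]
    refine Real.tendsto_exp_neg_atTop_nhds_zero.comp (f := fun s : ℝ => 2 * (sg j *
      (expo c1 c2 a b (s + θc * I)).re)) (hg.const_mul_atTop two_pos) |>.congr fun s => ?_
    simp
  have hlim := hexp.mul hw
  rw [mul_zero] at hlim
  refine tendsto_nhds_unique (tendsto_const_nhds.congr fun s => ?_) hlim
  rw [wr_const h.1 h'.1 htr z (exp (s + θc * I))]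
  simp only [wr, gauged]
  set x := exp (sg j * expo c1 c2 a b (s + θc * I)) with hx
  have : exp (-(2 * (sg j * expo c1 c2 a b (s + θc * I)))) * (x * x) = 1 := by
    rw [hx, ← exp_add, ← exp_add, exp_eq_one_iff]
    exact ⟨0, by simp; ring⟩
  linear_combination -(ψ (exp (s + θc * I)) 0 * χ (exp (s + θc * I)) 1
    - ψ (exp (s + θc * I)) 1 * χ (exp (s + θc * I)) 0) * this

theorem IsDom.unique (hs : ContDiff ℝ ∞ A) (hflat : ∀ z, curvature A z = 0)
    (htr : ∀ z v, A z 0 0 v + A z 1 1 v = 0) (hray : IsRay c1 c2 κ j θc) (hκ : 0 < κ)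
    (h : IsDom A c1 c2 a b j θc s1 C ψ) (h' : IsDom A c1 c2 a b j θc s1' C' χ) : ψ = χ := by
  have hπ : |θc - θc| ≤ π / 2 := by rw [sub_self, abs_zero]; positivity
  obtain ⟨t1, t0⟩ := h.tendsto hπ
  obtain ⟨u1, u0⟩ := h'.tendsto hπ
  obtain ⟨φ0, φ1, hφ, -, -⟩ := exists_fundPair hs hflat htr
  have hne : ∀ᶠ s : ℝ in atTop, gauged (expo c1 c2 a b) j χ (s + θc * I) j ≠ 0 :=
    u1.eventually_ne one_ne_zero
  obtain ⟨S, hS⟩ := hne.exists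
  set z := exp (S + θc * I) with hz
  have hχ : χ z j ≠ 0 := fun h0 => hS (by rw [gauged, ← hz, h0, mul_zero])
  set c := ψ z j / χ z j with hc
  have hflat' : IsFlat A (fun w => (1 : ℂ) • ψ w + (-c) • χ w) := h.1.comb h'.1 _ _
  have hzero : (1 : ℂ) • ψ z + (-c) • χ z = 0 := by
    have hw := IsDom.wr_self htr hray hκ h h' z
    rw [wr_pair j] at hw
    have hsg : (sg j : ℂ) ≠ 0 := by fin_cases j <;> simp [sg]
    have hw' := (mul_eq_zero.1 hw).resolve_left hsg
    have e0 : ψ z j - c * χ z j = 0 := by rw [hc, div_mul_cancel₀ _ hχ, sub_self]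
    have e1 : ψ z (j + 1) - c * χ z (j + 1) = 0 := by
      rw [hc, div_mul_eq_mul_div, sub_eq_zero, eq_div_iff hχ]
      linear_combination -hw'
    have hr : ‖(1 : ℂ) • ψ z + (-c) • χ z‖ ≤ 0 := by
      refine norm_le_of_pair (j := j) ?_ ?_
      · simp [← sub_eq_add_neg, e0]
      · simp [← sub_eq_add_neg, e1]
    simpa using hr
  have hall : ∀ w, ψ w = c • χ w := by
    intro w
    have := congrFun (hφ.eq_sec htr hflat' z) w
    simp only [hzero] at this
    have h2 : sec φ0 φ1 (coeffs φ0 φ1 z 0) w = 0 := by funext i; simp [sec, coeffs, wr]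
    rw [h2] at this
    rw [one_smul, neg_smul, ← sub_eq_add_neg, sub_eq_zero] at this
    exact this
  have hc1 : c = 1 := by
    have : Tendsto (fun s : ℝ => gauged (expo c1 c2 a b) j ψ (s + θc * I) j) atTop (𝓝 (c * 1)) := by
      refine (u1.const_mul c).congr fun s => ?_
      simp only [gauged, hall, Pi.smul_apply, smul_eq_mul]
      ring
    rw [mul_one] at this
    exact tendsto_nhds_unique this t1
  funext w
  rw [hall, hc1, one_smul]

theorem tendsto_dom {A : ℝ → MatForm} (hA : Continuous fun p : ℝ × ℂ => A p.1 p.2)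
    (hs : ∀ t, ContDiff ℝ ∞ (A t)) (hflat : ∀ t z, curvature (A t) z = 0)
    (htr : ∀ t z v, A t z 0 0 v + A t z 1 1 v = 0) {a b : ℝ → ℂ} (ha : ContinuousAt a 0)
    (hb : ContinuousAt b 0) (hray : IsRay c1 c2 κ j θc) (hκ : 0 < κ) {ψ : ℝ → ℂ → Fin 2 → ℂ} (hψ : ∀
    t ∈ Icc (-1 : ℝ) 1, IsDom (A t) c1 c2 (a t) (b t) j θc s1 C (ψ t)) (z : ℂ) : Tendsto
    (fun t => ψ t z) (𝓝 0) (𝓝 (ψ 0 z)) := by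
  choose φ0 φ1 hφ e0 e1 using fun t => exists_fundPair (hs t) (hflat t) (htr t)
  have cφ0 : ∀ w, Tendsto (fun t => φ0 t w) (𝓝 0) (𝓝 (φ0 0 w)) :=
    fun w => tendsto_flat hA (fun t => (hφ t).flat₀) e0 w
  have cφ1 : ∀ w, Tendsto (fun t => φ1 t w) (𝓝 0) (𝓝 (φ1 0 w)) :=
    fun w => tendsto_flat hA (fun t => (hφ t).flat₁) e1 w
  have hg : ∀ ξ, Tendsto (fun t => expo c1 c2 (a t) (b t) ξ) (𝓝 0)
      (𝓝 (expo c1 c2 (a 0) (b 0) ξ)) := fun ξ =>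
    ((ha.mul_const ξ).add (hb.mul_const _)).const_add _
  set z1 : ℂ := exp (s1 + θc * I)
  have hpe : ∀ t, ψ t = sec (φ0 t) (φ1 t) (coeffs (φ0 t) (φ1 t) z1 (ψ t z1)) ∨ t ∉ Icc (-1:ℝ) 1 := by
    intro t
    by_cases ht : t ∈ Icc (-1 : ℝ) 1
    · exact Or.inl ((hφ t).eq_sec (htr t) (hψ t ht).1 z1)
    · exact Or.inr ht
  have hI : ∀ᶠ t : ℝ in 𝓝 0, t ∈ Icc (-1 : ℝ) 1 := Icc_mem_nhds (by norm_num) (by norm_num)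
  set p : ℝ → Fin 2 → ℂ := fun t => coeffs (φ0 t) (φ1 t) z1 (ψ t z1) with hp
  obtain ⟨R, hR⟩ : ∃ R, ∀ᶠ t in 𝓝 (0 : ℝ), p t ∈ closedBall (0 : Fin 2 → ℂ) R := by
    have h0 := ((cφ0 z1).norm.eventually_le_const (lt_add_one _))
    have h1 := ((cφ1 z1).norm.eventually_le_const (lt_add_one _))
    have h2 : ∀ᶠ t in 𝓝 (0 : ℝ), rexp (-(sg j * (expo c1 c2 (a t) (b t) (s1 + θc * I)).re))
        ≤ rexp (-(sg j * (expo c1 c2 (a 0) (b 0) (s1 + θc * I)).re)) + 1 := by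
      refine Tendsto.eventually_le_const (lt_add_one _) ?_
      exact (Real.continuous_exp.tendsto _).comp
        (((continuous_re.tendsto _).comp (hg _)).const_mul (sg j)).neg
    refine ⟨2 * (((rexp (-(sg j * (expo c1 c2 (a 0) (b 0) (s1 + θc * I)).re)) + 1)
      * (1 + C * rexp (-s1))) * ((‖φ0 0 z1‖ + 1) + (‖φ1 0 z1‖ + 1))), ?_⟩
    filter_upwards [h0, h1, h2, hI] with t h0 h1 h2 ht
    rw [mem_closedBall_zero_iff]
    refine (norm_coeffs_le _ _ _ _).trans ?_
    obtain ⟨b1, b0⟩ := (hψ t ht).2 (s1 + θc * I) (by simp) (by simp; positivity)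
    have hC0 : 0 ≤ C * rexp (-s1) := by simpa using (norm_nonneg _).trans b0
    have := norm_le_gauged _ j _ _ b1 b0
    simp only [add_re, ofReal_re, mul_re, I_re, mul_zero, ofReal_im, I_im, mul_one, sub_self,
      add_zero] at this
    gcongr
    refine this.trans ?_
    gcongr
  have hu0 : ψ 0 = sec (φ0 0) (φ1 0) (p 0) := (hpe 0).resolve_right (by simp)
  have hplim : Tendsto p (𝓝 0) (𝓝 (p 0)) := by
    refine tendsto_of_seq_tendsto fun x hx => ?_
    refine tendsto_of_subseq_tendsto fun ns hns => ?_
    have hx' := hx.comp hns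
    obtain ⟨q, -, k, hk, hq⟩ := (isCompact_closedBall (0 : Fin 2 → ℂ) R).tendsto_subseq'
      ((hx'.eventually hR).frequently)
    refine ⟨k, ?_⟩
    have hxk := hx'.comp hk.tendsto_atTop
    have hlim : ∀ w, Tendsto (fun n => ψ (x (ns (k n))) w) atTop (𝓝 (sec (φ0 0) (φ1 0) q w)) := by
      intro w
      have hq' : ∀ i, Tendsto (fun n => p (x (ns (k n))) i) atTop (𝓝 (q i)) :=
        fun i => ((continuous_apply i).tendsto q).comp hq
      refine (((hq' 0).smul ((cφ0 w).comp hxk)).add ((hq' 1).smul ((cφ1 w).comp hxk))).congr' ?_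
      filter_upwards [hxk.eventually hI] with n hn
      exact (congrFun ((hpe _).resolve_right (fun h => h hn)) w).symm
    have hdom : IsDom (A 0) c1 c2 (a 0) (b 0) j θc s1 C (sec (φ0 0) (φ1 0) q) := by
      refine ⟨(hφ 0).isFlat_sec q, fun ξ hξ hϑ => ?_⟩
      have hga : ∀ i, Tendsto (fun n => gauged (expo c1 c2 (a (x (ns (k n)))) (b (x (ns (k n))))) j
          (ψ (x (ns (k n)))) ξ i) atTop
          (𝓝 (gauged (expo c1 c2 (a 0) (b 0)) j (sec (φ0 0) (φ1 0) q) ξ i)) := by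
        intro i
        refine Tendsto.mul ?_ (((continuous_apply i).tendsto _).comp (hlim _))
        exact (continuous_exp.tendsto _).comp ((((hg ξ).comp hxk)).const_mul _)
      have hb' := (hxk.eventually hI).mono fun n hn => (hψ _ hn).2 ξ hξ hϑ
      exact ⟨le_of_tendsto ((hga j).sub_const 1).norm (hb'.mono fun _ h => h.1),
        le_of_tendsto (hga (j + 1)).norm (hb'.mono fun _ h => h.2)⟩
    have heq := IsDom.unique (hs 0) (hflat 0) (htr 0) hray hκ hdom (hψ 0 (by simp))
    have : p 0 = q := by
      rw [hp]
      simp only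
      rw [← heq]
      have h0 := (hφ 0).wr_eq z1
      funext i
      fin_cases i
      · simp [coeffs, sec, wr] at h0 ⊢; linear_combination (q 0) * h0
      · simp [coeffs, sec, wr] at h0 ⊢; linear_combination (q 1) * h0
    rw [this]
    exact hq
  rw [hu0]
  have hq' : ∀ i, Tendsto (fun t => p t i) (𝓝 0) (𝓝 (p 0 i)) :=
    fun i => ((continuous_apply i).tendsto _).comp hplim
  refine (((hq' 0).smul (cφ0 z)).add ((hq' 1).smul (cφ1 z))).congr' ?_
  filter_upwards [hI] with t ht
  exact (congrFun ((hpe t).resolve_right (fun h => h ht)) z).symm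

/-! ### Variations of flat connections -/

section Slice

variable {E F : Type*} [NormedAddCommGroup E] [NormedSpace ℝ E] [NormedAddCommGroup F]
  [NormedSpace ℝ F] {f : ℝ × E → F} {x : E}

theorem eventually_hasFDerivAt {X : Type*} [NormedAddCommGroup X] [NormedSpace ℝ X] {f : X → F}
    {p : X} (hf : ContDiffAt ℝ ∞ f p) : ∀ᶠ q in 𝓝 p, HasFDerivAt f (fderiv ℝ f q) q := by
  have h1 : ContDiffAt ℝ 1 f p := hf.of_le (by norm_cast)
  filter_upwards [h1.eventually (by simp)] with q hq
  exact (hq.differentiableAt one_ne_zero).hasFDerivAt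

theorem hasDerivAt_slice_left {L : ℝ × E →L[ℝ] F} (h : HasFDerivAt f L (t, x)) : HasDerivAt
    (fun t => f (t, x)) (L (1, 0)) t :=
  h.comp_hasDerivAt t ((hasDerivAt_id t).prodMk (hasDerivAt_const t x))

theorem hasFDerivAt_slice_right {L : ℝ × E →L[ℝ] F} (h : HasFDerivAt f L (t, x)) : HasFDerivAt
    (fun y => f (t, y)) (L.comp (ContinuousLinearMap.inr ℝ ℝ E)) x :=
  h.comp x ((hasFDerivAt_const t x).prodMk (hasFDerivAt_id x))

theorem deriv_slice_eventuallyEq (hf : ContDiffAt ℝ ∞ f (0, x)) :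
    (fun y => deriv (fun t => f (t, y)) 0) =ᶠ[𝓝 x] fun y => fderiv ℝ f (0, y) (1, 0) := by
  have hc : Tendsto (fun y : E => ((0 : ℝ), y)) (𝓝 x) (𝓝 (0, x)) :=
    (Continuous.prodMk_right (0 : ℝ)).tendsto x
  filter_upwards [hc.eventually (eventually_hasFDerivAt hf)] with y hy
  exact (hasDerivAt_slice_left hy).deriv

theorem hasDerivAt_slice (hf : ContDiffAt ℝ ∞ f (0, x)) :
    HasDerivAt (fun t => f (t, x)) (deriv (fun t => f (t, x)) 0) 0 :=
  (hasDerivAt_slice_left (eventually_hasFDerivAt hf).self_of_nhds).differentiableAt.hasDerivAt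

theorem contDiffAt_deriv_slice (hf : ContDiffAt ℝ ∞ f (0, x)) :
    ContDiffAt ℝ ∞ (fun y => deriv (fun t => f (t, y)) 0) x := by
  refine ContDiffAt.congr_of_eventuallyEq ?_ (deriv_slice_eventuallyEq hf)
  have h1 : ContDiffAt ℝ ∞ (fderiv ℝ f) (0, x) := hf.fderiv_right (by simp)
  have h2 : ContDiffAt ℝ ∞ (fun y : E => fderiv ℝ f ((0 : ℝ), y)) x :=
    h1.comp x (contDiffAt_const.prodMk contDiffAt_id)
  exact h2.clm_apply contDiffAt_const

theorem hasDerivAt_fderiv_slice (hf : ContDiffAt ℝ ∞ f (0, x)) (v : E) :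
    HasDerivAt (fun t => fderiv ℝ (fun y => f (t, y)) x v)
      (fderiv ℝ (fun y => deriv (fun t => f (t, y)) 0) x v) 0 := by
  have hc : Tendsto (fun t : ℝ => (t, x)) (𝓝 0) (𝓝 (0, x)) := (Continuous.prodMk_left x).tendsto 0
  have h1 : (fun t => fderiv ℝ (fun y => f (t, y)) x v) =ᶠ[𝓝 0]
      fun t => fderiv ℝ f (t, x) (0, v) := by
    filter_upwards [hc.eventually (eventually_hasFDerivAt hf)] with t ht
    rw [(hasFDerivAt_slice_right ht).fderiv]
    simp
  have hf' : ContDiffAt ℝ ∞ (fderiv ℝ f) (0, x) := hf.fderiv_right (by simp)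
  have h2 := (eventually_hasFDerivAt hf').self_of_nhds
  have h3 : HasDerivAt (fun t => fderiv ℝ f (t, x) (0, v))
      (fderiv ℝ (fderiv ℝ f) (0, x) (1, 0) (0, v)) 0 := by
    simpa using (hasDerivAt_slice_left h2).clm_apply (hasDerivAt_const (0 : ℝ) ((0 : ℝ), v))
  have h4 : fderiv ℝ (fun y => deriv (fun t => f (t, y)) 0) x v
      = fderiv ℝ (fderiv ℝ f) (0, x) (0, v) (1, 0) := by
    rw [(deriv_slice_eventuallyEq hf).fderiv_eq]
    have := (hasFDerivAt_slice_right h2).clm_apply (hasFDerivAt_const ((1 : ℝ), (0 : E)) x)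
    rw [this.fderiv]
    simp
  rw [h4, (hf.isSymmSndFDerivAt (by
    rw [minSmoothness_of_isRCLikeNormedField]; exact WithTop.coe_le_coe.2 le_top)).eq (0, v) (1, 0)]
  exact h3.congr_of_eventuallyEq h1

end Slice

/-- The variation of a path of connections. -/
def dotForm (A : ℝ → MatForm) : MatForm := fun z => deriv (fun t => A t z) 0

theorem hasDerivAt_entry {A : ℝ → MatForm} (hA : ContDiff ℝ ∞ fun p : ℝ × ℂ => A p.1 p.2) (z : ℂ)
    (i j : Fin 2) (v : ℂ) : HasDerivAt (fun t => A t z i j v) (dotForm A z i j v) 0 := by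
  have h := hasDerivAt_slice (f := fun p : ℝ × ℂ => A p.1 p.2) (x := z) hA.contDiffAt
  have h1 := hasDerivAt_pi.1 (hasDerivAt_pi.1 h i) j
  exact (h1.clm_apply (hasDerivAt_const (0 : ℝ) v)).congr_deriv (by simp [dotForm])

theorem contDiff_dotForm {A : ℝ → MatForm} (hA : ContDiff ℝ ∞ fun p : ℝ × ℂ => A p.1 p.2) :
    ContDiff ℝ ∞ (dotForm A) :=
  contDiff_iff_contDiffAt.2 fun z =>
    contDiffAt_deriv_slice (f := fun p : ℝ × ℂ => A p.1 p.2) (x := z) hA.contDiffAt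

theorem dotForm_traceless {A : ℝ → MatForm} (hA : ContDiff ℝ ∞ fun p : ℝ × ℂ => A p.1 p.2)
    (htr : ∀ t z v, A t z 0 0 v + A t z 1 1 v = 0) (z v : ℂ) :
    dotForm A z 0 0 v + dotForm A z 1 1 v = 0 := by
  have h := (hasDerivAt_entry hA z 0 0 v).add (hasDerivAt_entry hA z 1 1 v)
  refine h.unique ?_
  refine (hasDerivAt_const (0 : ℝ) (0 : ℂ)).congr_of_eventuallyEq ?_
  filter_upwards with t
  exact htr t z v

theorem dotForm_closed {A : ℝ → MatForm} (hA : ContDiff ℝ ∞ fun p : ℝ × ℂ => A p.1 p.2)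
    (hflat : ∀ t z, curvature (A t) z = 0) (z : ℂ) (i j : Fin 2) :
    fderiv ℝ (dotForm A) z 1 i j I - fderiv ℝ (dotForm A) z I i j 1
      + (dotForm A z i 0 1 * A 0 z 0 j I + A 0 z i 0 1 * dotForm A z 0 j I
        + (dotForm A z i 1 1 * A 0 z 1 j I + A 0 z i 1 1 * dotForm A z 1 j I)
        - (dotForm A z i 0 I * A 0 z 0 j 1 + A 0 z i 0 I * dotForm A z 0 j 1
        + (dotForm A z i 1 I * A 0 z 1 j 1 + A 0 z i 1 I * dotForm A z 1 j 1))) = 0 := by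
  have hfd : ∀ v w : ℂ, HasDerivAt (fun t => fderiv ℝ (A t) z v i j w)
      (fderiv ℝ (dotForm A) z v i j w) 0 := by
    intro v w
    have h := hasDerivAt_fderiv_slice (f := fun p : ℝ × ℂ => A p.1 p.2) (x := z) hA.contDiffAt v
    have h1 := hasDerivAt_pi.1 (hasDerivAt_pi.1 h i) j
    exact (h1.clm_apply (hasDerivAt_const (0 : ℝ) w)).congr_deriv (by simp; rfl)
  have he := hasDerivAt_entry hA z
  have h := ((hfd 1 I).sub (hfd I 1)).add
    ((((he i 0 1).mul (he 0 j I)).add ((he i 1 1).mul (he 1 j I))).sub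
      (((he i 0 I).mul (he 0 j 1)).add ((he i 1 I).mul (he 1 j 1))))
  refine h.unique ?_
  refine (hasDerivAt_const (0 : ℝ) (0 : ℂ)).congr_of_eventuallyEq ?_
  filter_upwards with t
  have := congrFun (congrFun (hflat t z) i) j
  simp [curvature, MatCovector.eval, Matrix.mul_apply, Fin.sum_univ_two] at this
  simpa using this

/-- The one-form `(β p) ∧ q`. -/
def dform (β : MatForm) (p q : ℂ → Fin 2 → ℂ) : CForm := fun z =>
  (p z 0 * q z 1) • β z 0 0 + (p z 1 * q z 1) • β z 0 1 - (p z 0 * q z 0) • β z 1 0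
    - (p z 1 * q z 0) • β z 1 1

theorem differentiable_dform (hβ : Differentiable ℝ β) (hp : IsFlat A p) (hq : IsFlat A q) :
    Differentiable ℝ (dform β p q) := by
  have hp' : ∀ i, Differentiable ℝ fun z => p z i := fun i z => (hp z i).differentiableAt
  have hq' : ∀ i, Differentiable ℝ fun z => q z i := fun i z => (hq z i).differentiableAt
  have hb : ∀ i j, Differentiable ℝ fun z => β z i j := fun i j z =>
    differentiableAt_pi.1 (differentiableAt_pi.1 (hβ z) i) j
  exact (((((hp' 0).mul (hq' 1)).smul (hb 0 0)).add (((hp' 1).mul (hq' 1)).smul (hb 0 1))).sub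
    (((hp' 0).mul (hq' 0)).smul (hb 1 0))).sub (((hp' 1).mul (hq' 0)).smul (hb 1 1))

theorem fderiv_dform (hβ : Differentiable ℝ β) (hp : IsFlat A p) (hq : IsFlat A q) (z v w : ℂ) :
    fderiv ℝ (dform β p q) z v w = (-(p z 0 * A z 0 0 v + p z 1 * A z 0 1 v) * q z 1 - p z 0 * (q z
    0 * A z 1 0 v + q z 1 * A z 1 1 v)) * β z 0 0 w + p z 0 * q z 1 * fderiv ℝ β z v 0 0 w + ((-(p z
    0 * A z 1 0 v + p z 1 * A z 1 1 v) * q z 1 - p z 1 * (q z 0 * A z 1 0 v + q z 1 * A z 1 1 v)) *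
    β z 0 1 w + p z 1 * q z 1 * fderiv ℝ β z v 0 1 w) - ((-(p z 0 * A z 0 0 v + p z 1 * A z 0 1 v) *
    q z 0 - p z 0 * (q z 0 * A z 0 0 v + q z 1 * A z 0 1 v)) * β z 1 0 w + p z 0 * q z 0 * fderiv ℝ
    β z v 1 0 w) - ((-(p z 0 * A z 1 0 v + p z 1 * A z 1 1 v) * q z 0 - p z 1 * (q z 0 * A z 0 0 v +
    q z 1 * A z 0 1 v)) * β z 1 1 w + p z 1 * q z 0 * fderiv ℝ β z v 1 1 w) := by
  have hb : ∀ i j, HasFDerivAt (fun z => β z i j w)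
      ((ContinuousLinearMap.apply ℝ ℂ w).comp ((ContinuousLinearMap.proj j).comp
        ((ContinuousLinearMap.proj i).comp (fderiv ℝ β z)))) z := by
    intro i j
    have h1 := hasFDerivAt_pi'.1 (hasFDerivAt_pi'.1 (hβ z).hasFDerivAt i) j
    exact (ContinuousLinearMap.apply ℝ ℂ w).hasFDerivAt.comp z h1
  have hd := (differentiable_dform hβ hp hq z).hasFDerivAt
  have hd' := (ContinuousLinearMap.apply ℝ ℂ w).hasFDerivAt.comp z hd
  have h := ((((((hp z 0).mul (hq z 1)).mul (hb 0 0)).add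
    (((hp z 1).mul (hq z 1)).mul (hb 0 1))).sub
    (((hp z 0).mul (hq z 0)).mul (hb 1 0))).sub (((hp z 1).mul (hq z 0)).mul (hb 1 1)))
  have heq := congrArg (fun L => L v) (hd'.unique (h.congr_of_eventuallyEq ?_))
  · simp at heq; rw [heq]; ring
  · filter_upwards with y; simp [dform]

theorem exists_primitive_dform (hβ : Differentiable ℝ β) (hp : IsFlat A p) (hq : IsFlat A q)
    (htrA : ∀ z v, A z 0 0 v + A z 1 1 v = 0) (htr : ∀ z v, β z 0 0 v + β z 1 1 v = 0) (hcl : ∀ z i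
    j, fderiv ℝ β z 1 i j I - fderiv ℝ β z I i j 1 + (β z i 0 1 * A z 0 j I + A z i 0 1 * β z 0 j I
    + (β z i 1 1 * A z 1 j I + A z i 1 1 * β z 1 j I) - (β z i 0 I * A z 0 j 1 + A z i 0 I * β z 0 j
    1 + (β z i 1 I * A z 1 j 1 + A z i 1 I * β z 1 j 1))) = 0) : ∃ F : ℂ → ℂ, ∀ z, HasFDerivAt F
    (dform β p q z) z := by
  obtain ⟨F, hF⟩ := convex_univ.exists_forall_hasFDerivAt_of_fderiv_symmetric isOpen_univ
    (differentiable_dform hβ hp hq).differentiableOn (by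
      intro z _ x y
      rw [← sub_eq_zero]
      refine antisymm_eq_zero (B := fun x y => fderiv ℝ (dform β p q) z x y
        - fderiv ℝ (dform β p q) z y x) ?_ ?_ ?_ ?_ x y
      · intro x y w; simp; ring
      · intro c x w; simp [-real_smul, smul_sub]
      · intro x y; ring
      · simp only [fderiv_dform hβ hp hq]
        have t1 := htrA z 1
        have t2 := htrA z I
        have s1 : β z 1 1 1 = -β z 0 0 1 := by linear_combination htr z 1
        have s2 : β z 1 1 I = -β z 0 0 I := by linear_combination htr z I
        have a1 : A z 1 1 1 = -A z 0 0 1 := by linear_combination t1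
        have a2 : A z 1 1 I = -A z 0 0 I := by linear_combination t2
        have h00 := hcl z 0 0
        have h01 := hcl z 0 1
        have h10 := hcl z 1 0
        have h11 := hcl z 1 1
        simp only [s1, s2, a1, a2] at h00 h01 h10 h11 ⊢
        linear_combination (p z 0 * q z 1) * h00 + (p z 1 * q z 1) * h01
          - (p z 0 * q z 0) * h10 - (p z 1 * q z 0) * h11)
  exact ⟨F, fun z => hF z (mem_univ z)⟩

theorem dform_symm (htr : ∀ z v, β z 0 0 v + β z 1 1 v = 0) (p q : ℂ → Fin 2 → ℂ) : dform β p q =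
    dform β q p := by
  funext z
  ext v
  simp only [dform, sub_apply, add_apply, smul_apply, smul_eq_mul]
  linear_combination (p z 0 * q z 1 - p z 1 * q z 0) * htr z v

/-! ### Stokes' theorem on rectangles and discs -/

theorem stokes_rect {F G : ℝ × ℝ → ℂ} (hF : ContDiff ℝ 1 F) (hG : ContDiff ℝ 2 G)
    (a1 b₁ a2 b₂ : ℝ) :
    (∫ x in a1..b₁, ∫ y in a2..b₂, (fderiv ℝ F (x, y) (1, 0) * fderiv ℝ G (x, y) (0, 1)
      - fderiv ℝ F (x, y) (0, 1) * fderiv ℝ G (x, y) (1, 0)))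
    = (∫ y in a2..b₂, F (b₁, y) * fderiv ℝ G (b₁, y) (0, 1))
      - (∫ y in a2..b₂, F (a1, y) * fderiv ℝ G (a1, y) (0, 1))
      - (∫ x in a1..b₁, F (x, b₂) * fderiv ℝ G (x, b₂) (1, 0))
      + ∫ x in a1..b₁, F (x, a2) * fderiv ℝ G (x, a2) (1, 0) := by
  have hG' : ContDiff ℝ 1 (fderiv ℝ G) := hG.fderiv_right (by norm_num)
  have hFd : ∀ p, HasFDerivAt F (fderiv ℝ F p) p := fun p =>
    (hF.differentiable one_ne_zero p).hasFDerivAt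
  have hGd : ∀ p, HasFDerivAt (fderiv ℝ G) (fderiv ℝ (fderiv ℝ G) p) p := fun p =>
    (hG'.differentiable one_ne_zero p).hasFDerivAt
  have hGv : ∀ v p, HasFDerivAt (fun p => fderiv ℝ G p v) ((fderiv ℝ (fderiv ℝ G) p).flip v) p := by
    intro v p
    refine ((hGd p).clm_apply (hasFDerivAt_const v p)).congr_fderiv ?_
    simp
  have cF : Continuous F := hF.continuous
  have cG : Continuous (fderiv ℝ G) := hG'.continuous
  have cGv : ∀ v, Continuous fun p => fderiv ℝ G p v := fun v => cG.clm_apply continuous_const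
  have cF' : Continuous (fderiv ℝ F) := hF.continuous_fderiv one_ne_zero
  have cFv : ∀ v, Continuous fun p => fderiv ℝ F p v := fun v => cF'.clm_apply continuous_const
  have h1 := fun p => (hFd p).mul (hGv (0, 1) p)
  have h2 := fun p => ((hFd p).mul (hGv (1, 0) p)).neg
  have hsum : ∀ p : ℝ × ℝ,
      (F p • (fderiv ℝ (fderiv ℝ G) p).flip (0, 1) + (fderiv ℝ G p (0, 1)) • fderiv ℝ F p) (1, 0)
      + (-(F p • (fderiv ℝ (fderiv ℝ G) p).flip (1, 0)
        + (fderiv ℝ G p (1, 0)) • fderiv ℝ F p)) (0, 1)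
      = fderiv ℝ F p (1, 0) * fderiv ℝ G p (0, 1) - fderiv ℝ F p (0, 1) * fderiv ℝ G p (1, 0) := by
    intro p
    have := (hG.contDiffAt (x := p)).isSymmSndFDerivAt (by
      rw [minSmoothness_of_isRCLikeNormedField]) |>.eq (1, 0) (0, 1)
    simp [this]
    ring
  have key := integral2_divergence_prod_of_hasFDerivAt
    (fun p => F p * fderiv ℝ G p (0, 1)) (fun p => -(F p * fderiv ℝ G p (1, 0)))
    (fun p => F p • (fderiv ℝ (fderiv ℝ G) p).flip (0, 1) + (fderiv ℝ G p (0, 1)) • fderiv ℝ F p)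
    (fun p => -(F p • (fderiv ℝ (fderiv ℝ G) p).flip (1, 0)
        + (fderiv ℝ G p (1, 0)) • fderiv ℝ F p)) a1 a2 b₁ b₂
    (cF.mul (cGv _)).continuousOn (cF.mul (cGv _)).neg.continuousOn
    (fun p _ => h1 p) (fun p _ => h2 p) (by
      simp only [hsum]
      refine ContinuousOn.integrableOn_compact (isCompact_uIcc.prod isCompact_uIcc) ?_
      exact (((cFv _).mul (cGv _)).sub ((cFv _).mul (cGv _))).continuousOn)
  simp only [hsum] at key
  rw [key]
  simp only [intervalIntegral.integral_neg]
  ring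

/-- The polar coordinate map. -/
def polarMap (p : ℝ × ℝ) : ℂ := p.1 * exp (p.2 * I)

theorem contDiff_polarMap : ContDiff ℝ ∞ polarMap := by
  unfold polarMap
  have h1 : ContDiff ℝ ∞ fun p : ℝ × ℝ => (p.1 : ℂ) := ofRealCLM.contDiff.comp contDiff_fst
  have h2 : ContDiff ℝ ∞ fun p : ℝ × ℝ => (p.2 : ℂ) := ofRealCLM.contDiff.comp contDiff_snd
  exact h1.mul (h2.mul contDiff_const).cexp

theorem fderiv_polarMap (r θ : ℝ) : fderiv ℝ polarMap (r, θ) (1, 0) = exp (θ * I) ∧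
    fderiv ℝ polarMap (r, θ) (0, 1) = I * polarMap (r, θ) := by
  have hd := (contDiff_polarMap.differentiable (by simp) (r, θ)).hasFDerivAt
  constructor
  · refine (hasDerivAt_slice_left hd).unique ?_
    simpa [polarMap] using (ofRealCLM.hasDerivAt (x := r)).mul_const (exp (θ * I))
  · have h1 : HasDerivAt (fun θ : ℝ => polarMap (r, θ)) (fderiv ℝ polarMap (r, θ) (0, 1)) θ :=
      hd.comp_hasDerivAt θ ((hasDerivAt_const θ r).prodMk (hasDerivAt_id θ))
    refine h1.unique ?_
    refine ((((ofRealCLM.hasDerivAt (x := θ)).mul_const I).cexp).const_mul (r : ℂ)).congr_deriv ?_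
    simp [polarMap]
    ring

theorem wedge_mul (L M : ℂ →L[ℝ] ℂ) (u : ℂ) (r : ℝ) :
    L u * M (I * (r * u)) - L (I * (r * u)) * M u = r * (‖u‖ ^ 2 * wedge L M) := by
  have dec : ∀ (L : ℂ →L[ℝ] ℂ) (x : ℂ), L x = x.re * L 1 + x.im * L I := by
    intro L x
    have : x = x.re • (1 : ℂ) + x.im • I := by apply Complex.ext <;> simp
    have h := congrArg L this
    rw [map_add, map_smul, map_smul] at h
    simpa using h
  have hn : (u.re : ℂ) * u.re + u.im * u.im = ‖u‖ ^ 2 := by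
    exact_mod_cast (normSq_apply u).symm.trans (normSq_eq_norm_sq u)
  rw [dec L u, dec M u, dec L (I * (r * u)), dec M (I * (r * u)), wedge]
  simp
  linear_combination (r * (L 1 * M I - L I * M 1)) * hn

theorem continuous_wedge {L M : CForm} (hL : Continuous L) (hM : Continuous M) :
    Continuous fun z => wedge (L z) (M z) := by
  unfold wedge
  exact ((hL.clm_apply continuous_const).mul (hM.clm_apply continuous_const)).sub
    ((hL.clm_apply continuous_const).mul (hM.clm_apply continuous_const))

theorem stokes_disc (hF : ContDiff ℝ 1 F) (hG : ContDiff ℝ 2 G) {R : ℝ} (hR : 0 ≤ R) : (∫ z in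
    closedBall (0 : ℂ) R, wedge (fderiv ℝ F z) (fderiv ℝ G z)) = ∫ θ in -π..π, F
    (R * exp (θ * I)) * fderiv ℝ G (R * exp (θ * I)) (I * (R * exp (θ * I))) := by
  have cw : Continuous fun z => wedge (fderiv ℝ F z) (fderiv ℝ G z) :=
    continuous_wedge (hF.continuous_fderiv one_ne_zero) (hG.continuous_fderiv two_ne_zero)
  have hπ : -π ≤ π := by linarith [Real.pi_pos]
  have e1 : (∫ z in closedBall (0 : ℂ) R, wedge (fderiv ℝ F z) (fderiv ℝ G z))
      = ∫ r in (0 : ℝ)..R, ∫ θ in -π..π,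
        (r : ℂ) * wedge (fderiv ℝ F (polarMap (r, θ))) (fderiv ℝ G (polarMap (r, θ))) := by
    rw [← integral_indicator Metric.isClosed_closedBall.measurableSet,
      ← Complex.integral_comp_polarCoord_symm]
    have hint : IntegrableOn (fun p : ℝ × ℝ => (p.1 : ℂ) *
        wedge (fderiv ℝ F (polarMap p)) (fderiv ℝ G (polarMap p)))
        (Ioc 0 R ×ˢ Ioc (-π) π) := by
      have : IntegrableOn (fun p : ℝ × ℝ => (p.1 : ℂ) *
        wedge (fderiv ℝ F (polarMap p)) (fderiv ℝ G (polarMap p)))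
        (Icc 0 R ×ˢ Icc (-π) π) := by
        refine ContinuousOn.integrableOn_compact (isCompact_Icc.prod isCompact_Icc) ?_
        exact ((continuous_ofReal.comp continuous_fst).mul
          (cw.comp contDiff_polarMap.continuous)).continuousOn
      exact this.mono_set (prod_mono Ioc_subset_Icc_self Ioc_subset_Icc_self)
    rw [intervalIntegral.integral_of_le hR]
    simp_rw [intervalIntegral.integral_of_le hπ]
    rw [← setIntegral_prod (f := fun p : ℝ × ℝ => (p.1 : ℂ) *
        wedge (fderiv ℝ F (polarMap p)) (fderiv ℝ G (polarMap p))) hint]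
    have hset : (Ioc 0 R ×ˢ Ioc (-π) π : Set (ℝ × ℝ))
        =ᵐ[volume] (Ioc 0 R ×ˢ Ioo (-π) π : Set (ℝ × ℝ)) :=
      Measure.set_prod_ae_eq (ae_eq_refl _) Ioo_ae_eq_Ioc.symm
    have hvol : (volume : Measure (ℝ × ℝ)) = (volume : Measure ℝ).prod volume := rfl
    rw [← hvol, setIntegral_congr_set hset, ← integral_indicator
      (polarCoord.open_target.measurableSet), ← integral_indicator
      (measurableSet_Ioc.prod measurableSet_Ioo)]
    congr 1
    funext ⟨r, θ⟩
    by_cases hp : (r, θ) ∈ polarCoord.target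
    · have hr : 0 < r := hp.1
      have hθ : θ ∈ Ioo (-π) π := hp.2
      have hpm : Complex.polarCoord.symm (r, θ) = polarMap (r, θ) := by
        rw [Complex.polarCoord_symm_apply, polarMap, exp_mul_I]
        push_cast; ring
      have hnorm : ‖polarMap (r, θ)‖ = r := by
        rw [polarMap, norm_mul, norm_exp_ofReal_mul_I, mul_one, norm_real,
          Real.norm_of_nonneg hr.le]
      rw [indicator_of_mem hp, hpm]
      by_cases hrR : r ≤ R
      · rw [indicator_of_mem, indicator_of_mem]
        · simp
        · exact ⟨⟨hr, hrR⟩, hθ⟩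
        · simpa [hnorm] using hrR
      · rw [indicator_of_notMem, indicator_of_notMem]
        · simp
        · exact fun h => hrR h.1.2
        · simpa [hnorm] using hrR
    · rw [indicator_of_notMem hp, indicator_of_notMem]; exact fun h => hp ⟨h.1.1, h.2⟩
  rw [e1]
  have hp1 : ContDiff ℝ 1 polarMap := contDiff_polarMap.of_le (by norm_cast)
  have hp2 : ContDiff ℝ 2 polarMap := contDiff_polarMap.of_le (WithTop.coe_le_coe.2 le_top)
  have key := stokes_rect (hF.comp hp1) (hG.comp hp2) 0 R (-π) π
  have dF : ∀ p v, fderiv ℝ (F ∘ polarMap) p v = fderiv ℝ F (polarMap p) (fderiv ℝ polarMap p v) := by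
    intro p v
    rw [fderiv_comp _ (hF.differentiable one_ne_zero _) (hp1.differentiable one_ne_zero _)]
    rfl
  have dG : ∀ p v, fderiv ℝ (G ∘ polarMap) p v = fderiv ℝ G (polarMap p) (fderiv ℝ polarMap p v) := by
    intro p v
    rw [fderiv_comp _ (hG.differentiable two_ne_zero _) (hp1.differentiable one_ne_zero _)]
    rfl
  simp only [dF, dG, (fderiv_polarMap _ _).1, (fderiv_polarMap _ _).2] at key
  have hw : ∀ r θ : ℝ, fderiv ℝ F (polarMap (r, θ)) (exp (θ * I))
      * fderiv ℝ G (polarMap (r, θ)) (I * polarMap (r, θ))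
      - fderiv ℝ F (polarMap (r, θ)) (I * polarMap (r, θ))
      * fderiv ℝ G (polarMap (r, θ)) (exp (θ * I))
      = r * wedge (fderiv ℝ F (polarMap (r, θ))) (fderiv ℝ G (polarMap (r, θ))) := by
    intro r θ
    refine (wedge_mul _ _ (exp (θ * I)) r).trans ?_
    rw [norm_exp_ofReal_mul_I, ofReal_one, one_pow, one_mul]
  simp only [hw] at key
  rw [key]
  have hper : ∀ x : ℝ, polarMap (x, -π) = polarMap (x, π) := by intro x; simp [polarMap, exp_neg]
  have hexp : exp ((-π : ℝ) * I) = exp (π * I) := by push_cast; rw [neg_mul, exp_neg]; simp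
  have h0 : ∀ y : ℝ, polarMap (0, y) = 0 := by intro y; simp [polarMap]
  simp only [Function.comp, hper, hexp, h0]
  simp [polarMap]

/-! ### Asymptotics of the variation in decaying flat frames -/

/-- `β` is a variation of the flat connection `A`, asymptotic to `(a' dξ + b' dξ̄) H`. -/
structure IsVariation (A β : MatForm) (a' b' : ℂ) (s1 C : ℝ) : Prop where
  smooth : ContDiff ℝ ∞ β
  traceless : ∀ z v, β z 0 0 v + β z 1 1 v = 0
  closed : ∀ z i j, fderiv ℝ β z 1 i j I - fderiv ℝ β z I i j 1
      + (β z i 0 1 * A z 0 j I + A z i 0 1 * β z 0 j I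
        + (β z i 1 1 * A z 1 j I + A z i 1 1 * β z 1 j I)
        - (β z i 0 I * A z 0 j 1 + A z i 0 I * β z 0 j 1
        + (β z i 1 I * A z 1 j 1 + A z i 1 I * β z 1 j 1))) = 0
  asymp : ∀ ξ : ℂ, s1 ≤ ξ.re → ∀ v i j,
    ‖β (exp ξ) i j (exp ξ * v) - (a' * v + b' * conj v) * matH i j‖ ≤ C * rexp (-ξ.re) * ‖v‖

theorem dform_gauged (β : MatForm) (g : ℂ → ℂ) (j k : Fin 2) (p q : ℂ → Fin 2 → ℂ) (ξ w : ℂ) :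
    dform β p q (exp ξ) w = exp (-(sg j + sg k) * g ξ) *
      (gauged g j p ξ 0 * gauged g k q ξ 1 * β (exp ξ) 0 0 w
        + gauged g j p ξ 1 * gauged g k q ξ 1 * β (exp ξ) 0 1 w
        - gauged g j p ξ 0 * gauged g k q ξ 0 * β (exp ξ) 1 0 w
        - gauged g j p ξ 1 * gauged g k q ξ 0 * β (exp ξ) 1 1 w) := by
  have : exp (-(sg j + sg k) * g ξ) * (exp (sg j * g ξ) * exp (sg k * g ξ)) = 1 := by
    rw [← exp_add, ← exp_add, exp_eq_one_iff]
    exact ⟨0, by simp; ring⟩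
  simp only [dform, gauged, sub_apply, add_apply, smul_apply, smul_eq_mul]
  linear_combination -(p (exp ξ) 0 * q (exp ξ) 1 * β (exp ξ) 0 0 w
        + p (exp ξ) 1 * q (exp ξ) 1 * β (exp ξ) 0 1 w
        - p (exp ξ) 0 * q (exp ξ) 0 * β (exp ξ) 1 0 w
        - p (exp ξ) 1 * q (exp ξ) 0 * β (exp ξ) 1 1 w) * this

theorem norm_mul_sub_le {L : ℂ} {E m : ℝ} (hx : ‖x - 1‖ ≤ E) (hy : ‖y - 1‖ ≤ E) {V : ℝ}
    (hL : ‖L‖ ≤ m * V) (hz : ‖z - L‖ ≤ E * V) (hE : E ≤ 1) (hV : 0 ≤ V) : ‖x * y * z - L‖ ≤ E * V *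
    (3 * m + 4) := by
  have hE0 : 0 ≤ E := (norm_nonneg _).trans hx
  have e : x * y * z - L = ((x - 1) * y + (y - 1)) * z + (z - L) := by ring
  have hy2 : ‖y‖ ≤ 2 := by
    have := norm_add_le (y - 1) 1
    simp only [sub_add_cancel, norm_one] at this
    linarith
  have hz2 : ‖z‖ ≤ (m + 1) * V := by
    have := norm_add_le (z - L) L
    simp only [sub_add_cancel] at this
    nlinarith
  rw [e]
  refine (norm_add_le _ _).trans ?_
  rw [norm_mul]
  have h1 : ‖(x - 1) * y + (y - 1)‖ ≤ 3 * E := by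
    refine (norm_add_le _ _).trans ?_
    rw [norm_mul]
    nlinarith [norm_nonneg y, norm_nonneg (x - 1)]
  have h2 : ‖(x - 1) * y + (y - 1)‖ * ‖z‖ ≤ 3 * E * ((m + 1) * V) := by gcongr
  nlinarith

theorem norm_mul_mul_le {r1 r2 r3 : ℝ} (hx : ‖x‖ ≤ r1) (hy : ‖y‖ ≤ r2) (hz : ‖z‖ ≤ r3) : ‖x * y * z‖
    ≤ r1 * r2 * r3 := by
  rw [norm_mul, norm_mul]
  have h1 := (norm_nonneg _).trans hx
  have h2 := (norm_nonneg _).trans hy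
  gcongr

theorem norm_linear_le (a' b' v : ℂ) : ‖a' * v + b' * conj v‖ ≤ (‖a'‖ + ‖b'‖) * ‖v‖ := by
  refine (norm_add_le _ _).trans (le_of_eq ?_)
  rw [norm_mul, norm_mul, RCLike.norm_conj]
  ring

theorem norm_le_two {E : ℝ} (hx : ‖x - 1‖ ≤ E) (hE : E ≤ 1) : ‖x‖ ≤ 2 := by
  have := norm_add_le (x - 1) 1
  simp only [sub_add_cancel, norm_one] at this
  linarith

theorem IsVariation.entries (h : IsVariation A β a' b' s1 C) (hξ : s1 ≤ ξ.re)
    (hE : C * rexp (-ξ.re) ≤ 1) (v : ℂ) : ‖β (exp ξ) 0 0 (exp ξ * v) - (a' * v + b' * conj v)‖ ≤ C *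
    rexp (-ξ.re) * ‖v‖ ∧ ‖β (exp ξ) 0 1 (exp ξ * v)‖ ≤ C * rexp (-ξ.re) * ‖v‖ ∧ ‖β (exp ξ) 1 0
    (exp ξ * v)‖ ≤ C * rexp (-ξ.re) * ‖v‖ ∧ ‖β (exp ξ) 0 0 (exp ξ * v)‖ ≤ (‖a'‖ + ‖b'‖ + 1) * ‖v‖ ∧
    ‖β (exp ξ) 1 1 (exp ξ * v)‖ ≤ (‖a'‖ + ‖b'‖ + 1) * ‖v‖ := by
  have h00 := h.asymp ξ hξ v 0 0
  have h01 := h.asymp ξ hξ v 0 1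
  have h10 := h.asymp ξ hξ v 1 0
  simp [matH] at h00 h01 h10
  have hb : ‖β (exp ξ) 0 0 (exp ξ * v)‖ ≤ (‖a'‖ + ‖b'‖ + 1) * ‖v‖ := by
    have h1 := norm_add_le (β (exp ξ) 0 0 (exp ξ * v) - (a' * v + b' * conj v))
      (a' * v + b' * conj v)
    rw [sub_add_cancel] at h1
    have h2 := norm_linear_le a' b' v
    have h3 := mul_le_mul_of_nonneg_right hE (norm_nonneg v)
    linarith
  refine ⟨h00, h01, h10, hb, ?_⟩
  have : β (exp ξ) 1 1 (exp ξ * v) = -β (exp ξ) 0 0 (exp ξ * v) := by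
    linear_combination h.traceless (exp ξ) (exp ξ * v)
  rw [this, norm_neg]
  exact hb

theorem dform_offdiag_le (h : IsVariation A' β a' b' s1 C) (hC : C * rexp (-s1) ≤ 1) (hC0 : 0 ≤ C)
    (hp : IsDom A c1 c2 a b 0 θ s1 C p) (hq : IsDom A c1 c2 a b 1 θ' s1 C q) (hξ : s1 ≤ ξ.re)
    (hθ : |ξ.im - θ| ≤ π / 2) (hθ' : |ξ.im - θ'| ≤ π / 2) (v : ℂ) : ‖dform β p q (exp ξ) (exp ξ * v)
    - (a' * v + b' * conj v)‖ ≤ 10 * C * (‖a'‖ + ‖b'‖ + 1) * rexp (-ξ.re) * ‖v‖ := by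
  have hE : C * rexp (-ξ.re) ≤ 1 := by refine le_trans ?_ hC; gcongr
  obtain ⟨e00, e01, e10, -, b11⟩ := h.entries hξ hE v
  obtain ⟨p0, p1⟩ := hp.2 ξ hξ hθ
  obtain ⟨q1, q0⟩ := hq.2 ξ hξ hθ'
  rw [dform_gauged β (expo c1 c2 a b) 0 1]
  set g := expo c1 c2 a b
  set E := C * rexp (-ξ.re) with hEd
  set m := ‖a'‖ + ‖b'‖
  have hm0 : 0 ≤ m := by positivity
  have hE0 : 0 ≤ E := by positivity
  have hV := norm_nonneg v
  have hone : exp (-(sg 0 + sg 1) * g ξ) = 1 := by simp [sg]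
  rw [hone, one_mul]
  simp only [zero_add] at p1
  change ‖gauged g 1 q ξ 0‖ ≤ E at q0
  have t1 := norm_mul_sub_le p0 q1 (norm_linear_le a' b' v) e00 hE hV
  have t2 := norm_mul_mul_le p1 (norm_le_two q1 hE) e01
  have t3 := norm_mul_mul_le (norm_le_two p0 hE) q0 e10
  have t4 := norm_mul_mul_le p1 q0 b11
  have htri : ∀ x y z w L : ℂ, ‖x + y - z - w - L‖ ≤ ‖x - L‖ + ‖y‖ + ‖z‖ + ‖w‖ := by
    intro x y z w L
    have : x + y - z - w - L = (x - L) + y - z - w := by ring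
    rw [this]
    exact (norm_sub_le _ _).trans (add_le_add ((norm_sub_le _ _).trans
      (add_le_add (norm_add_le _ _) le_rfl)) le_rfl)
  refine (htri _ _ _ _ _).trans ?_
  have : 10 * C * (m + 1) * rexp (-ξ.re) * ‖v‖ = 10 * (m + 1) * (E * ‖v‖) := by rw [hEd]; ring
  rw [this]
  have hEV : 0 ≤ E * ‖v‖ := by positivity
  have hEE : E * (E * ‖v‖) ≤ E * ‖v‖ := mul_le_of_le_one_left hEV hE
  have hEE' : E * E * ((m + 1) * ‖v‖) ≤ (m + 1) * (E * ‖v‖) := by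
    calc E * E * ((m + 1) * ‖v‖) = (m + 1) * (E * (E * ‖v‖)) := by ring
      _ ≤ _ := by gcongr
  have hmEV : 0 ≤ m * (E * ‖v‖) := by positivity
  linarith

theorem dform_diag_le (h : IsVariation A' β a' b' s1 C) (hC : C * rexp (-s1) ≤ 1) (hC0 : 0 ≤ C)
    (hp : IsDom A c1 c2 a b j θ s1 C p) (hξ : s1 ≤ ξ.re) (hθ : |ξ.im - θ| ≤ π / 2) (v : ℂ) : ‖dform
    β p p (exp ξ) (exp ξ * v)‖ ≤ 10 * C * (‖a'‖ + ‖b'‖ + 1) * rexp (-ξ.re) * rexp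
    (-2 * (sg j * (expo c1 c2 a b ξ).re)) * ‖v‖ := by
  have hE : C * rexp (-ξ.re) ≤ 1 := by refine le_trans ?_ hC; gcongr
  obtain ⟨-, e01, e10, b00, b11⟩ := h.entries hξ hE v
  obtain ⟨p0, p1⟩ := hp.2 ξ hξ hθ
  rw [dform_gauged β (expo c1 c2 a b) j j]
  set g := expo c1 c2 a b
  set E := C * rexp (-ξ.re) with hEd
  set m := ‖a'‖ + ‖b'‖
  have hm0 : 0 ≤ m := by positivity
  have hE0 : 0 ≤ E := by positivity
  have hV := norm_nonneg v
  have hw : ‖exp (-(sg j + sg j) * g ξ)‖ = rexp (-2 * (sg j * (g ξ).re)) := by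
    rw [norm_exp]
    congr 1
    simp
    ring
  rw [norm_mul, hw]
  have hmain : ‖gauged g j p ξ 0 * gauged g j p ξ 1 * β (exp ξ) 0 0 (exp ξ * v)
        + gauged g j p ξ 1 * gauged g j p ξ 1 * β (exp ξ) 0 1 (exp ξ * v)
        - gauged g j p ξ 0 * gauged g j p ξ 0 * β (exp ξ) 1 0 (exp ξ * v)
        - gauged g j p ξ 1 * gauged g j p ξ 0 * β (exp ξ) 1 1 (exp ξ * v)‖
      ≤ 10 * (m + 1) * (E * ‖v‖) := by
    have htri : ∀ x y z w : ℂ, ‖x + y - z - w‖ ≤ ‖x‖ + ‖y‖ + ‖z‖ + ‖w‖ := fun x y z w =>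
      (norm_sub_le _ _).trans (add_le_add ((norm_sub_le _ _).trans
        (add_le_add (norm_add_le _ _) le_rfl)) le_rfl)
    have hEV : 0 ≤ E * ‖v‖ := by positivity
    have hEE : E * (E * ‖v‖) ≤ E * ‖v‖ := mul_le_of_le_one_left hEV hE
    have hEE2 : E * E * (E * ‖v‖) ≤ E * ‖v‖ := by
      rw [mul_assoc]
      exact (mul_le_of_le_one_left (by positivity) hE).trans hEE
    have hmEV : 0 ≤ m * (E * ‖v‖) := by positivity
    refine (htri _ _ _ _).trans ?_
    have n2 := norm_le_two p0 hE
    fin_cases j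
    · have t1 := norm_mul_mul_le n2 p1 b00
      have t2 := norm_mul_mul_le p1 p1 e01
      have t3 := norm_mul_mul_le n2 n2 e10
      have t4 := norm_mul_mul_le p1 n2 b11
      simp only [Fin.zero_eta, zero_add] at t1 t2 t3 t4 ⊢
      linarith
    · have t1 := norm_mul_mul_le p1 n2 b00
      have t2 := norm_mul_mul_le n2 n2 e01
      have t3 := norm_mul_mul_le p1 p1 e10
      have t4 := norm_mul_mul_le n2 p1 b11
      have e11 : (1 : Fin 2) + 1 = 0 := rfl
      simp only [Fin.mk_one, e11] at t1 t2 t3 t4 ⊢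
      linarith
  refine (mul_le_mul_of_nonneg_left hmain (Real.exp_pos _).le).trans (le_of_eq ?_)
  rw [hEd]
  ring

/-! ### Primitives with decaying differential on a strip -/

/-- The half strip `s ≥ s1`, `α ≤ θ - θc ≤ β`. -/
def strip (s1 θc α β : ℝ) : Set ℂ := {ξ | s1 ≤ ξ.re ∧ α ≤ ξ.im - θc ∧ ξ.im - θc ≤ β}

/-- A weight on the half strip that decreases along the central ray and increases, up to a factor
`K`, away from it. -/
structure IsWeight (w : ℂ → ℝ) (s1 θc K : ℝ) : Prop where
  nonneg : ∀ ξ, 0 ≤ w ξ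
  one_le : 1 ≤ K
  ray : ∀ s s' : ℝ, s1 ≤ s → s ≤ s' → w (s' + θc * I) ≤ w (s + θc * I)
  arc : ∀ s ς τ τ' : ℝ, s1 ≤ s → (ς = 1 ∨ ς = -1) → 0 ≤ τ' → τ' ≤ τ → τ ≤ π / 2 →
    w (s + (θc + (ς * τ' : ℝ)) * I) ≤ K * w (s + (θc + (ς * τ : ℝ)) * I)

theorem isWeight_one (s1 θc : ℝ) : IsWeight (fun _ => 1) s1 θc 1 where
  nonneg := by simp
  one_le := le_rfl
  ray := by simp
  arc := by simp

theorem exists_limit_of_decay {f' : ℂ → ℂ →L[ℝ] ℂ} {w : ℂ → ℝ} {α β : ℝ} (hw : IsWeight w s1 θc K)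
    (hC : 0 ≤ C) (hα : α ≤ 0) (hβ : 0 ≤ β) (hα' : -(π / 2) ≤ α) (hβ' : β ≤ π / 2)
    (hf : ∀ ξ ∈ strip s1 θc α β, HasFDerivAt f (f' ξ) ξ) (hb : ∀ ξ ∈ strip s1 θc α β, ∀ v, ‖f' ξ v‖
    ≤ C * rexp (-ξ.re) * w ξ * ‖v‖) : ∃ k : ℂ, ∀ ξ ∈ strip s1 θc α β, ‖f ξ - k‖ ≤ 3 * C * K * rexp
    (-ξ.re) * w ξ := by
  have hK := hw.one_le
  have hmem : ∀ s : ℝ, s1 ≤ s → (s + θc * I : ℂ) ∈ strip s1 θc α β := by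
    intro s hs
    simp [strip, hs, hα, hβ]
  have hray : ∀ s s' : ℝ, s1 ≤ s → s ≤ s' →
      ‖f (s' + θc * I) - f (s + θc * I)‖ ≤ C * rexp (-s) * w (s + θc * I) := by
    intro s s' hs hss'
    set W := w (s + θc * I)
    have hW : 0 ≤ W := hw.nonneg _
    have hd : ∀ τ : ℝ, s1 ≤ τ → HasDerivAt (fun τ : ℝ => f (τ + θc * I)) (f' (τ + θc * I) 1) τ :=
      fun τ hτ => (hf _ (hmem τ hτ)).comp_hasDerivAt τ
        (by simpa using (ofRealCLM.hasDerivAt (x := τ)).add_const (θc * I))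
    have hB : ∀ τ : ℝ, HasDerivAt (fun τ : ℝ => C * W * (rexp (-s) - rexp (-τ)))
        (C * rexp (-τ) * W) τ := fun τ =>
      (((hasDerivAt_neg τ).exp.const_sub _).const_mul (C * W)).congr_deriv (by ring)
    have := image_norm_le_of_norm_deriv_right_le_deriv_boundary' (a := s) (b := s')
      (fun τ hτ => ((hd τ (hs.trans hτ.1)).sub_const (f (s + θc * I))).continuousAt.continuousWithinAt)
      (fun τ hτ => ((hd τ (hs.trans hτ.1)).sub_const (f (s + θc * I))).hasDerivWithinAt)
      (by simp) (fun τ _ => (hB τ).continuousAt.continuousWithinAt)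
      (fun τ _ => (hB τ).hasDerivWithinAt)
      (fun τ hτ => by
        have h1 := hb _ (hmem τ (hs.trans hτ.1)) 1
        rw [show (τ + θc * I : ℂ).re = τ by simp, norm_one, mul_one] at h1
        refine h1.trans ?_
        gcongr
        exact hw.ray s τ hs hτ.1) (right_mem_Icc.2 hss')
    refine this.trans ?_
    have h1 : 0 ≤ C * W * rexp (-s') := by positivity
    linarith
  have harc : ∀ ξ ∈ strip s1 θc α β,
      ‖f ξ - f (ξ.re + θc * I)‖ ≤ 2 * C * K * rexp (-ξ.re) * w ξ := by
    intro ξ hξ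
    obtain ⟨ς, hς, hςϑ⟩ := exists_sign_mul_abs (ξ.im - θc)
    have hς1 : |ς| = 1 := by rcases hς with rfl | rfl <;> simp
    have hT : |ξ.im - θc| ≤ π / 2 := abs_le.2 ⟨hα'.trans hξ.2.1, hξ.2.2.trans hβ'⟩
    set T := |ξ.im - θc|
    set W := w ξ
    have hW : 0 ≤ W := hw.nonneg _
    set c : ℝ → ℂ := fun τ => (ξ.re : ℂ) + (θc + (ς * τ : ℝ)) * I with hc
    have hcT : c T = ξ := by rw [hc]; simp only [hςϑ]; exact (eq_add_mul_I ξ θc).symm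
    have hc0 : c 0 = ξ.re + θc * I := by simp [hc]
    have hcm : ∀ τ ∈ Icc 0 T, c τ ∈ strip s1 θc α β := by
      intro τ hτ
      have him : (c τ).im - θc = ς * τ := by simp [hc]
      have hre : (c τ).re = ξ.re := by simp [hc]
      refine ⟨by rw [hre]; exact hξ.1, ?_⟩
      rw [him]
      have h2 := hξ.2
      rw [← hςϑ] at h2
      rcases hς with rfl | rfl <;> constructor <;> nlinarith [hτ.1, hτ.2, h2.1, h2.2]
    have hcd : ∀ τ, HasDerivAt c (ς * I) τ := by
      intro τ
      have h1 : HasDerivAt (fun τ : ℝ => ς * τ) ς τ := by simpa using (hasDerivAt_id τ).const_mul ς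
      exact ((h1.ofReal_comp.const_add (θc : ℂ)).mul_const I).const_add (ξ.re : ℂ)
    have hd : ∀ τ ∈ Icc 0 T, HasDerivAt (fun τ : ℝ => f (c τ)) (f' (c τ) (ς * I)) τ :=
      fun τ hτ => (hf _ (hcm τ hτ)).comp_hasDerivAt τ (hcd τ)
    have := norm_image_sub_le_of_norm_deriv_le_segment' (a := 0) (b := T)
      (f := fun τ : ℝ => f (c τ)) (f' := fun τ : ℝ => f' (c τ) (ς * I))
      (C := C * rexp (-ξ.re) * (K * W))
      (fun τ hτ => (hd τ hτ).hasDerivWithinAt)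
      (fun τ hτ => by
        have hτ' : τ ∈ Icc 0 T := ⟨hτ.1, hτ.2.le⟩
        have h1 := hb _ (hcm τ hτ') (ς * I)
        have hn : ‖(ς : ℂ) * I‖ = 1 := by simp [hς1]
        have hre : (c τ).re = ξ.re := by simp [hc]
        rw [hn, mul_one, hre] at h1
        refine h1.trans ?_
        gcongr
        have := hw.arc ξ.re ς T τ hξ.1 hς hτ.1 hτ.2.le hT
        have e : (ξ.re : ℂ) + (θc + (ς * T : ℝ)) * I = ξ := hcT
        rw [e] at this
        exact this) T (right_mem_Icc.2 (abs_nonneg _))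
    rw [hcT, hc0, sub_zero] at this
    refine this.trans ?_
    have hT2 : T ≤ 2 := hT.trans (by linarith [Real.pi_le_four])
    have h0 : 0 ≤ C * rexp (-ξ.re) * (K * W) := by positivity
    nlinarith
  have hcau : CauchySeq (fun n : ℕ => f ((s1 + n : ℝ) + θc * I)) := by
    refine cauchySeq_of_le_tendsto_0' (fun n : ℕ => C * rexp (-(s1 + n)) * w (s1 + θc * I))
      (fun n m hnm => ?_) ?_
    · rw [dist_comm, dist_eq_norm]
      refine (hray (s1 + n) (s1 + m) (by simp) (by gcongr)).trans ?_
      gcongr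
      exact hw.ray s1 (s1 + n) le_rfl (by simp)
    · have : Tendsto (fun n : ℕ => C * rexp (-(s1 + n))) atTop (𝓝 0) :=
        (tendsto_C_exp_neg C).comp (tendsto_atTop_add_const_left _ _ tendsto_natCast_atTop_atTop)
      simpa using this.mul_const (w (s1 + θc * I))
  obtain ⟨k, hk⟩ := cauchySeq_tendsto_of_complete hcau
  refine ⟨k, fun ξ hξ => ?_⟩
  have h1 : ‖k - f (ξ.re + θc * I)‖ ≤ C * rexp (-ξ.re) * w (ξ.re + θc * I) := by
    refine le_of_tendsto (hk.sub_const _).norm ?_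
    have : Tendsto (fun n : ℕ => s1 + (n : ℝ)) atTop atTop :=
      tendsto_atTop_add_const_left _ _ tendsto_natCast_atTop_atTop
    filter_upwards [this.eventually_ge_atTop ξ.re] with n hn
    exact hray _ _ hξ.1 hn
  have h2 : w (ξ.re + θc * I) ≤ K * w ξ := by
    obtain ⟨ς, hς, hςϑ⟩ := exists_sign_mul_abs (ξ.im - θc)
    have := hw.arc ξ.re ς |ξ.im - θc| 0 hξ.1 hς le_rfl (abs_nonneg _)
      (abs_le.2 ⟨hα'.trans hξ.2.1, hξ.2.2.trans hβ'⟩)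
    rw [hςϑ, ← eq_add_mul_I ξ θc] at this
    simpa using this
  have h3 := harc ξ hξ
  have h4 : f ξ - k = (f ξ - f (ξ.re + θc * I)) - (k - f (ξ.re + θc * I)) := by ring
  rw [h4]
  refine (norm_sub_le _ _).trans ?_
  have h5 : C * rexp (-ξ.re) * w (ξ.re + θc * I) ≤ C * rexp (-ξ.re) * (K * w ξ) := by gcongr
  linarith

theorem IsRay.next (h : IsRay c1 c2 κ j θ) : IsRay c1 c2 κ (j + 1) (θ + π / 2) := by
  intro s ϑ
  have := h s (π / 2 + ϑ)
  have e : ((θ : ℂ) + ((π / 2 + ϑ : ℝ) : ℂ)) = ((θ + π / 2 : ℝ) : ℂ) + ϑ := by push_cast; ring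
  rw [e] at this
  have hc : Real.cos (2 * (π / 2 + ϑ)) = -Real.cos (2 * ϑ) := by
    rw [show 2 * (π / 2 + ϑ) = 2 * ϑ + π by ring, Real.cos_add_pi]
  rw [hc] at this
  rw [sg_succ, neg_mul, this]
  ring

/-- The weight of the `j`-th diagonal of the formal solution. -/
def wt (c1 c2 a b : ℂ) (j : Fin 2) (ξ : ℂ) : ℝ := rexp (-2 * (sg j * (expo c1 c2 a b ξ).re))

theorem wt_mul (c1 c2 a b : ℂ) (j : Fin 2) (ξ : ℂ) :
    wt c1 c2 a b j ξ * wt c1 c2 a b (j + 1) ξ = 1 := by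
  rw [wt, wt, ← Real.exp_add, sg_succ, Real.exp_eq_one_iff]
  ring

theorem abs_sg (j : Fin 2) : |sg j| = 1 := by fin_cases j <;> simp [sg]

theorem isWeight_wt (hray : IsRay c1 c2 κ j θc) (hκ : 0 < κ) (ha : ‖a‖ ≤ m0) (hb : ‖b‖ ≤ m0)
    (hκs : m0 ≤ κ * rexp (2 * s1)) : IsWeight (wt c1 c2 a b j) s1 θc (rexp (2 * (π * m0))) where
  nonneg ξ := (Real.exp_pos _).le
  one_le := by have hm : 0 ≤ m0 := (norm_nonneg a).trans ha; rw [Real.one_le_exp_iff]; positivity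
  ray := by
    intro s s' hs hss
    rw [wt, wt, Real.exp_le_exp]
    have e := re_expo_of_isRay hray a b
    have e1 := e s 0
    have e2 := e s' 0
    simp only [ofReal_zero, add_zero, mul_zero, Real.cos_zero, mul_one] at e1 e2
    rw [e1, e2]
    have hab : |sg j * (a + b).re| ≤ 2 * m0 := by
      rw [abs_mul, abs_sg, one_mul]
      exact (abs_re_le_norm _).trans ((norm_add_le _ _).trans (by linarith))
    have h3 := abs_le.1 hab
    have h4 : rexp (2 * s) * (2 * (s' - s)) ≤ rexp (2 * s') - rexp (2 * s) := by
      have := Real.add_one_le_exp (2 * (s' - s))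
      have e : rexp (2 * s') = rexp (2 * s) * rexp (2 * (s' - s)) := by
        rw [← Real.exp_add]; congr 1; ring
      rw [e]
      nlinarith [Real.exp_pos (2 * s)]
    have h5 : m0 ≤ κ * rexp (2 * s) := by
      refine hκs.trans (mul_le_mul_of_nonneg_left ?_ hκ.le)
      exact Real.exp_le_exp.2 (by linarith)
    have h6 : 0 ≤ s' - s := by linarith
    have h7 := mul_le_mul_of_nonneg_left h4 hκ.le
    have h8 := mul_le_mul_of_nonneg_right h5 h6
    nlinarith [mul_le_mul_of_nonneg_right h3.2 h6, mul_le_mul_of_nonneg_right h3.1 h6]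
  arc := by
    intro s ς τ τ' hs hς h0 hττ hτ
    have hm : 0 ≤ m0 := (norm_nonneg a).trans ha
    rw [wt, wt, ← Real.exp_add, Real.exp_le_exp]
    have e := re_expo_of_isRay hray a b s
    rw [e (ς * τ), e (ς * τ')]
    have hς1 : |ς| = 1 := by rcases hς with rfl | rfl <;> simp
    have hcos : ∀ x : ℝ, Real.cos (2 * (ς * x)) = Real.cos (2 * x) := by
      intro x
      rcases hς with rfl | rfl
      · simp
      · rw [← Real.cos_neg]; congr 1; ring
    rw [hcos, hcos]
    have hc : Real.cos (2 * τ) ≤ Real.cos (2 * τ') :=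
      Real.cos_le_cos_of_nonneg_of_le_pi (by linarith) (by linarith) (by linarith)
    have hc' : κ * rexp (2 * s) * Real.cos (2 * τ) ≤ κ * rexp (2 * s) *
      Real.cos (2 * τ') := mul_le_mul_of_nonneg_left hc (by positivity)
    have hab : |sg j * (a - b).im * (ς * (τ - τ'))| ≤ 2 * m0 * (π / 2) := by
      rw [abs_mul, abs_mul, abs_mul, abs_sg, hς1, one_mul, one_mul]
      refine mul_le_mul ((abs_im_le_norm _).trans ((norm_sub_le _ _).trans
        (by linarith))) ?_ (abs_nonneg _) (by positivity)
      rw [abs_of_nonneg (by linarith)]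
      linarith
    have h3 := (abs_le.1 hab).1
    nlinarith

/-- The parity of a natural number. -/
def par : ℕ → Fin 2
  | 0 => 0
  | k + 1 => par k + 1

theorem par_add_two (k : ℕ) : par (k + 2) = par k := by
  change par k + 1 + 1 = par k
  generalize par k = i
  fin_cases i <;> rfl

theorem conj_two : conj (2 : ℂ) = 2 := map_ofNat _ 2

/-- A flat connection with its decaying sections along consecutive rays. -/
structure Sectors (A : MatForm) (c1 c2 a b : ℂ) (κ Θ m0 s1 C : ℝ) (v : ℕ → ℂ → Fin 2 → ℂ) :
    Prop where
  smooth : ContDiff ℝ ∞ A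
  flat : ∀ z, curvature A z = 0
  traceless : ∀ z v, A z 0 0 v + A z 1 1 v = 0
  κ_pos : 0 < κ
  ray : IsRay c1 c2 κ 0 Θ
  norm_a : ‖a‖ ≤ m0
  norm_b : ‖b‖ ≤ m0
  le_exp : m0 ≤ κ * rexp (2 * s1)
  C_nonneg : 0 ≤ C
  C_le : C * rexp (-s1) ≤ 1
  dom : ∀ k, IsDom A c1 c2 a b (par k) (Θ + k * (π / 2)) s1 C (v k)

namespace Sectors

variable {A : MatForm} {c1 c2 a b : ℂ} {κ Θ m0 s1 C : ℝ} {v : ℕ → ℂ → Fin 2 → ℂ}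

theorem _root_.IsRay.nat {Θ κ : ℝ} {c1 c2 : ℂ} (h : IsRay c1 c2 κ 0 Θ) (k : ℕ) :
    IsRay c1 c2 κ (par k) (Θ + k * (π / 2)) := by
  induction k with
  | zero => simpa [par] using h
  | succ k ih =>
    have := ih.next
    push_cast
    change IsRay c1 c2 κ (par k + 1) _
    rw [show Θ + ((k : ℝ) + 1) * (π / 2) = Θ + k * (π / 2) + π / 2 by ring]
    exact this

theorem weight (h : Sectors A c1 c2 a b κ Θ m0 s1 C v) (k : ℕ) :
    IsWeight (wt c1 c2 a b (par k)) s1 (Θ + k * (π / 2)) (rexp (2 * (π * m0))) :=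
  isWeight_wt (h.ray.nat k) h.κ_pos h.norm_a h.norm_b h.le_exp

theorem wr_succ (h : Sectors A c1 c2 a b κ Θ m0 s1 C v) (k : ℕ) (z : ℂ) :
    wr (v k z) (v (k + 1) z) = sg (par k) := by
  have h1 := h.dom (k + 1)
  push_cast at h1
  change IsDom A c1 c2 a b (par k + 1) _ s1 C (v (k + 1)) at h1
  have hπ := Real.pi_pos
  refine (h.dom k).wr_adjacent h.traceless h1 (θc := Θ + k * (π / 2)) ?_ ?_ z
  · rw [sub_self, abs_zero]; positivity
  · rw [show Θ + k * (π / 2) - (Θ + (k + 1) * (π / 2)) = -(π / 2) by ring,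
      abs_neg, abs_of_pos (by positivity)]

theorem exists_stokes (h : Sectors A c1 c2 a b κ Θ m0 s1 C v) (k : ℕ) :
    ∃ S : ℂ, ∀ z, v (k + 2) z = v k z + S • v (k + 1) z := by
  set ε : ℂ := (sg (par k) : ℂ) with hε
  have hεε : ε * ε = 1 := by rw [hε, ← ofReal_mul, sg_mul_self, ofReal_one]
  refine ⟨ε * wr (v k 0) (v (k + 2) 0), fun z => ?_⟩
  rw [wr_const (h.dom k).1 (h.dom (k + 2)).1 h.traceless 0 z]
  have h1 := h.wr_succ k z
  have h2 := h.wr_succ (k + 1) z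
  rw [show par (k + 1) = par k + 1 from rfl, sg_succ, ofReal_neg] at h2
  rw [← hε] at h1 h2
  have h2' : wr (v (k + 1) z) (v (k + 2) z) = -ε := h2
  simp only [wr] at h1 h2' ⊢
  funext i
  fin_cases i
  · simp only [Fin.zero_eta, Pi.add_apply, Pi.smul_apply, smul_eq_mul]
    linear_combination (v k z 0 - v (k + 2) z 0) * hεε - (ε * v (k + 2) z 0) * h1
      - (ε * v k z 0) * h2'
  · simp only [Fin.mk_one, Pi.add_apply, Pi.smul_apply, smul_eq_mul]
    linear_combination (v k z 1 - v (k + 2) z 1) * hεε - (ε * v (k + 2) z 1) * h1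
      - (ε * v k z 1) * h2'

theorem expo_add_two_pi (c1 c2 a b ξ : ℂ) :
    expo c1 c2 a b (ξ - 2 * π * I) = expo c1 c2 a b ξ - 2 * π * I * (a - b) := by
  have e1 : exp (2 * (ξ - 2 * π * I)) = exp (2 * ξ) := by
    rw [show 2 * (ξ - 2 * π * I) = 2 * ξ - 2 * π * I - 2 * π * I by ring,
      exp_periodic.sub_eq, exp_periodic.sub_eq]
  have e2 : exp (2 * conj (ξ - 2 * π * I)) = exp (2 * conj ξ) := by
    have : 2 * conj (ξ - 2 * π * I) = 2 * conj ξ + 2 * π * I + 2 * π * I := by simp [conj_two]; ring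
    rw [this, exp_periodic, exp_periodic]
  rw [expo, expo, e1, e2]
  simp [conj_two]
  ring

theorem monodromy (h : Sectors A c1 c2 a b κ Θ m0 s1 C v) (k : ℕ) :
    ∃ M : ℂ, M ≠ 0 ∧ ∀ z, v (k + 4) z = M • v k z := by
  have hk : par (k + 4) = par k := by rw [par_add_two, par_add_two]
  set M : ℂ := exp (-(sg (par k) * (2 * π * I * (a - b)))) with hM
  have hθ : Θ + ((k + 4 : ℕ) : ℝ) * (π / 2) = Θ + k * (π / 2) + 2 * π := by push_cast; ring
  have hper : ∀ ξ : ℂ, exp (ξ - 2 * π * I) = exp ξ := fun ξ => exp_periodic.sub_eq ξ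
  have hdom : IsDom A c1 c2 a b (par (k + 4)) (Θ + ((k + 4 : ℕ) : ℝ) * (π / 2)) s1 C
      (fun z => M • v k z + (0 : ℂ) • v k z) := by
    refine ⟨(h.dom k).1.comb (h.dom k).1 M 0, fun ξ hξ hϑ => ?_⟩
    have h1 := (h.dom k).2 (ξ - 2 * π * I) (by simpa using hξ) (by
      rw [hθ] at hϑ
      have : (ξ - 2 * π * I).im - (Θ + k * (π / 2))
          = ξ.im - (Θ + k * (π / 2) + 2 * π) := by simp; ring
      rw [this]; exact hϑ)
    have e : ∀ i, gauged (expo c1 c2 a b) (par k) (v k) (ξ - 2 * π * I) i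
        = gauged (expo c1 c2 a b) (par (k + 4)) (fun z => M • v k z + (0 : ℂ) • v k z) ξ i := by
      intro i
      rw [gauged, gauged, hper, expo_add_two_pi, hk]
      simp only [Pi.add_apply, Pi.smul_apply, smul_eq_mul, zero_mul, add_zero]
      rw [mul_sub, sub_eq_add_neg, exp_add, hM]
      ring
    rw [e, e, hk] at h1
    have hre : (ξ - 2 * π * I).re = ξ.re := by simp
    rw [hre] at h1
    rw [hk]
    exact h1
  have := (h.dom (k + 4)).unique h.smooth h.flat h.traceless (h.ray.nat (k + 4)) h.κ_pos hdom
  exact ⟨M, exp_ne_zero _, fun z => by rw [this]; simp⟩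

end Sectors

set_option maxSynthPendingDepth 3 in
theorem IsFlat.contDiff (hA : Continuous A) (h : IsFlat A ψ) : ContDiff ℝ 1 ψ := by
  have h' := isFlat_iff.1 h
  rw [contDiff_one_iff_fderiv]
  refine ⟨fun z => (h' z).differentiableAt, ?_⟩
  have e : fderiv ℝ ψ = fun z => -((connOp (A z)).flip (ψ z)) := funext fun z => (h' z).fderiv
  rw [e]
  have hc : Continuous fun z => connOp (A z) := connOp.continuous.comp hA
  have : Continuous fun z => (connOp (A z)).flip :=
    (ContinuousLinearMap.flipₗᵢ ℝ ℂ (Fin 2 → ℂ) (Fin 2 → ℂ)).continuous.comp hc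
  exact (this.clm_apply h.continuous).neg

theorem contDiff_dform (hA : Continuous A) (hβ : ContDiff ℝ ∞ β) (hp : IsFlat A p) (hq : IsFlat A q)
    : ContDiff ℝ 1 (dform β p q) := by
  have hp' : ∀ i, ContDiff ℝ 1 fun z => p z i := contDiff_pi.1 (hp.contDiff hA)
  have hq' : ∀ i, ContDiff ℝ 1 fun z => q z i := contDiff_pi.1 (hq.contDiff hA)
  have hb : ∀ i j, ContDiff ℝ 1 fun z => β z i j := fun i j =>
    contDiff_pi.1 (contDiff_pi.1 (hβ.of_le (by norm_cast)) i) j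
  exact (((((hp' 0).mul (hq' 1)).smul (hb 0 0)).add (((hp' 1).mul (hq' 1)).smul (hb 0 1))).sub
    (((hp' 0).mul (hq' 0)).smul (hb 1 0))).sub (((hp' 1).mul (hq' 0)).smul (hb 1 1))

theorem contDiff_primitive {F' : CForm} (h : ∀ z, HasFDerivAt F (F' z) z) (h' : ContDiff ℝ 1 F') :
    ContDiff ℝ 2 F := by
  have : fderiv ℝ F = F' := funext fun z => (h z).fderiv
  rw [show (2 : ℕ∞ω) = 1 + 1 by norm_num, contDiff_succ_iff_fderiv]
  refine ⟨fun z => (h z).differentiableAt, by simp, ?_⟩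
  rw [this]
  exact h'

/-- The real-linear function `a' ξ + b' ξ̄`. -/
def lin (a' b' ξ : ℂ) : ℂ := a' * ξ + b' * conj ξ

theorem hasFDerivAt_comp_exp {F' : CForm} (h : ∀ z, HasFDerivAt F (F' z) z) (ξ : ℂ) : HasFDerivAt
    (fun ξ => F (exp ξ)) ((F' (exp ξ)).comp (((ContinuousLinearMap.mul ℝ ℂ) (exp ξ)))) ξ := by
  refine (h (exp ξ)).comp ξ ?_
  refine ((Complex.hasDerivAt_exp ξ).hasFDerivAt.restrictScalars ℝ).congr_fderiv ?_
  ext v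
  simp [mul_comm]

theorem hasFDerivAt_lin (a' b' ξ : ℂ) : HasFDerivAt (lin a' b')
    (a' • ContinuousLinearMap.id ℝ ℂ + b' • (conjCLE : ℂ →L[ℝ] ℂ)) ξ := by
  exact ((hasFDerivAt_id ξ).const_mul a').add ((conjCLE.hasFDerivAt).const_mul b')

theorem strip_abs {α β : ℝ} (hα' : -(π / 2) ≤ α) (hβ' : β ≤ π / 2) (h : ξ ∈ strip s1 θc α β) : |ξ.im
    - θc| ≤ π / 2 :=
  abs_le.2 ⟨hα'.trans h.2.1, h.2.2.trans hβ'⟩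

theorem exists_limit_offdiag (h : IsVariation A' β a' b' s1 C) (hC : C * rexp (-s1) ≤ 1)
    (hC0 : 0 ≤ C) (hp : IsDom A c1 c2 a b 0 θ s1 C p) (hq : IsDom A c1 c2 a b 1 θ' s1 C q)
    (hF : ∀ z, HasFDerivAt F (dform β p q z) z) (hθ : ∀ ξ ∈ strip s1 θc 0 (π / 2), |ξ.im - θ| ≤ π /
    2 ∧ |ξ.im - θ'| ≤ π / 2) : ∃ k, ∀ ξ ∈ strip s1 θc 0 (π / 2), ‖F (exp ξ) - lin a' b' ξ - k‖ ≤ 30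
    * C * (‖a'‖ + ‖b'‖ + 1) * rexp (-ξ.re) := by
  have hπ := Real.pi_pos
  obtain ⟨k, hk⟩ := exists_limit_of_decay (isWeight_one s1 θc) (C := 10 * C * (‖a'‖ + ‖b'‖ + 1))
    (by positivity) (le_refl 0) (by positivity) (by linarith) le_rfl
    (f := fun ξ => F (exp ξ) - lin a' b' ξ)
    (fun ξ _ => (hasFDerivAt_comp_exp hF ξ).sub (hasFDerivAt_lin a' b' ξ)) (by
      intro ξ hξ v
      have := dform_offdiag_le h hC hC0 hp hq hξ.1 (hθ ξ hξ).1 (hθ ξ hξ).2 v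
      simpa using this)
  refine ⟨k, fun ξ hξ => (hk ξ hξ).trans (le_of_eq ?_)⟩
  ring

theorem exists_limit_diag (h : IsVariation A' β a' b' s1 C) (hC : C * rexp (-s1) ≤ 1) (hC0 : 0 ≤ C)
    (hw : IsWeight (wt c1 c2 a b j) s1 θ K) (hp : IsDom A c1 c2 a b j θ s1 C p)
    (hF : ∀ z, HasFDerivAt F (dform β p p z) z) : ∃ k, ∀ ξ ∈ strip s1 θ (-(π / 2)) (π / 2), ‖F
    (exp ξ) - k‖ ≤ 30 * C * (‖a'‖ + ‖b'‖ + 1) * K * rexp (-ξ.re) * wt c1 c2 a b j ξ := by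
  have hπ := Real.pi_pos
  obtain ⟨k, hk⟩ := exists_limit_of_decay hw (C := 10 * C * (‖a'‖ + ‖b'‖ + 1))
    (by positivity) (by linarith) (by positivity) le_rfl le_rfl
    (f := fun ξ => F (exp ξ))
    (fun ξ _ => hasFDerivAt_comp_exp hF ξ) (by
      intro ξ hξ v
      have := dform_diag_le h hC hC0 hp hξ.1 (strip_abs le_rfl le_rfl hξ) v
      simpa [wt] using this)
  refine ⟨k, fun ξ hξ => (hk ξ hξ).trans (le_of_eq ?_)⟩
  ring

/-- The behaviour of the primitives of a variation, in the decaying frame of the sector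
`θ ≤ arg z ≤ θ + π / 2`. -/
structure OnArc (c1 c2 a b a' b' : ℂ) (s1 C θ : ℝ) (Y E O : ℂ → ℂ) (k n : ℂ) : Prop where
  Y_le : ∀ ξ ∈ strip s1 θ 0 (π / 2), ‖Y (exp ξ) - lin a' b' ξ - k‖ ≤ C * rexp (-ξ.re)
  E_le : ∀ ξ ∈ strip s1 θ 0 (π / 2), ‖E (exp ξ)‖ ≤ C * rexp (-ξ.re) * wt c1 c2 a b 0 ξ
  O_le : ∀ ξ ∈ strip s1 θ 0 (π / 2), ‖O (exp ξ) - n‖ ≤ C * rexp (-ξ.re) * wt c1 c2 a b 1 ξ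
  dY_le : ∀ ξ ∈ strip s1 θ 0 (π / 2), ∀ v,
    ‖fderiv ℝ Y (exp ξ) (exp ξ * v) - lin a' b' v‖ ≤ C * rexp (-ξ.re) * ‖v‖
  dE_le : ∀ ξ ∈ strip s1 θ 0 (π / 2), ∀ v,
    ‖fderiv ℝ E (exp ξ) (exp ξ * v)‖ ≤ C * rexp (-ξ.re) * wt c1 c2 a b 0 ξ * ‖v‖
  dO_le : ∀ ξ ∈ strip s1 θ 0 (π / 2), ∀ v,
    ‖fderiv ℝ O (exp ξ) (exp ξ * v)‖ ≤ C * rexp (-ξ.re) * wt c1 c2 a b 1 ξ * ‖v‖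

theorem onArc_of_dom (h : IsVariation A' β a' b' s1 C) (hC : C * rexp (-s1) ≤ 1) (hC0 : 0 ≤ C)
    (hp : IsDom A c1 c2 a b 0 θ s1 C p) (hq : IsDom A c1 c2 a b 1 θ' s1 C q)
    (hw : IsWeight (wt c1 c2 a b 0) s1 θ K) (hw' : IsWeight (wt c1 c2 a b 1) s1 θ' K) {Y : ℂ → ℂ}
    (hY : ∀ z, HasFDerivAt Y (dform β p q z) z) (hE : ∀ z, HasFDerivAt E (dform β p p z) z)
    (hO : ∀ z, HasFDerivAt O (dform β q q z) z) (hθ : ∀ ξ ∈ strip s1 θc 0 (π / 2), |ξ.im - θ| ≤ π /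
    2 ∧ |ξ.im - θ'| ≤ π / 2) : ∃ k e n, (∀ ξ ∈ strip s1 θ (-(π / 2)) (π / 2), ‖E (exp ξ) - e‖ ≤ 30 *
    C * (‖a'‖ + ‖b'‖ + 1) * K * rexp (-ξ.re) * wt c1 c2 a b 0 ξ) ∧ OnArc c1 c2 a b a' b' s1
    (30 * C * (‖a'‖ + ‖b'‖ + 1) * K) θc Y (fun z => E z - e) O k n := by
  obtain ⟨k, hk⟩ := exists_limit_offdiag h hC hC0 hp hq hY hθ
  obtain ⟨e, he⟩ := exists_limit_diag h hC hC0 hw hp hE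
  obtain ⟨n, hn⟩ := exists_limit_diag h hC hC0 hw' hq hO
  have hK := hw.one_le
  have hm : 0 ≤ C * (‖a'‖ + ‖b'‖ + 1) := by positivity
  have h1 : 10 * C * (‖a'‖ + ‖b'‖ + 1) ≤ 30 * C * (‖a'‖ + ‖b'‖ + 1) * K := by nlinarith
  have h3 : 30 * C * (‖a'‖ + ‖b'‖ + 1) ≤ 30 * C * (‖a'‖ + ‖b'‖ + 1) * K := by nlinarith
  have mem : ∀ ξ ∈ strip s1 θc 0 (π / 2), ξ ∈ strip s1 θ (-(π / 2)) (π / 2) :=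
    fun ξ hξ => ⟨hξ.1, abs_le.1 (hθ ξ hξ).1⟩
  have mem' : ∀ ξ ∈ strip s1 θc 0 (π / 2), ξ ∈ strip s1 θ' (-(π / 2)) (π / 2) :=
    fun ξ hξ => ⟨hξ.1, abs_le.1 (hθ ξ hξ).2⟩
  refine ⟨k, e, n, he, ⟨fun ξ hξ => (hk ξ hξ).trans ?_, fun ξ hξ => he ξ (mem ξ hξ),
    fun ξ hξ => hn ξ (mem' ξ hξ), fun ξ hξ v => ?_, fun ξ hξ v => ?_, fun ξ hξ v => ?_⟩⟩
  · gcongr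
  · rw [(hY _).fderiv]
    refine (dform_offdiag_le h hC hC0 hp hq hξ.1 (hθ ξ hξ).1 (hθ ξ hξ).2 v).trans ?_
    gcongr
  · rw [fderiv_sub_const, (hE _).fderiv]
    refine (dform_diag_le h hC hC0 hp hξ.1 (hθ ξ hξ).1 v).trans ?_
    rw [wt]
    gcongr
  · rw [(hO _).fderiv]
    refine (dform_diag_le h hC hC0 hq hξ.1 (hθ ξ hξ).2 v).trans ?_
    rw [wt]
    gcongr

theorem tendsto_exp_neg_mul {f : ℝ → ℂ} {w : ℝ → ℝ} (hw : ∃ W, ∀ᶠ s in atTop, w s ≤ W)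
    (h : ∀ s, s1 ≤ s → ‖f s - k‖ ≤ C * rexp (-s) * w s) (hC : 0 ≤ C) : Tendsto f atTop (𝓝 k) := by
  obtain ⟨W, hW⟩ := hw
  rw [tendsto_iff_norm_sub_tendsto_zero]
  refine squeeze_zero' (Eventually.of_forall fun _ => norm_nonneg _) (g := fun s =>
    C * rexp (-s) * W) ?_ (by simpa using (tendsto_C_exp_neg C).mul_const W)
  filter_upwards [hW, eventually_ge_atTop s1] with s h1 h2
  refine (h s h2).trans ?_
  gcongr

theorem wt_ray_le (h : IsRay c1 c2 κ j θc) (hκ : 0 < κ) (a b : ℂ) (θ : ℝ)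
    (hc : 0 < Real.cos (2 * (θ - θc))) : ∃ W, ∀ᶠ s : ℝ in atTop, wt c1 c2 a b j (s + θ * I) ≤ W :=
    by
  refine ⟨1, ?_⟩
  filter_upwards [(tendsto_expo_ray h hκ a b θ hc).eventually_ge_atTop 0] with s hs
  rw [wt, Real.exp_le_one_iff]
  linarith

theorem mem_strip_ray {α β : ℝ} (hs : s1 ≤ s) (h1 : α ≤ θ - θc) (h2 : θ - θc ≤ β) : (s + θ * I : ℂ)
    ∈ strip s1 θc α β := by
  simp [strip, hs, h1]; linarith

theorem OnArc.tendsto_Y {Y : ℂ → ℂ} (h : OnArc c1 c2 a b a' b' s1 C θ Y E O k n) (hC : 0 ≤ C)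
    (h1 : θ ≤ φ) (h2 : φ ≤ θ + π / 2) : Tendsto
    (fun s : ℝ => Y (exp (s + φ * I)) - lin a' b' (s + φ * I)) atTop (𝓝 k) := by
  refine tendsto_exp_neg_mul (s1 := s1) (w := fun _ => 1) ⟨1, by simp⟩ (fun s hs => ?_) hC
  simpa using h.Y_le _ (mem_strip_ray hs (by linarith) (by linarith))

theorem onArc_of_tendsto (h : IsVariation A' β a' b' s1 C) (hC : C * rexp (-s1) ≤ 1) (hC0 : 0 ≤ C)
    (hp : IsDom A c1 c2 a b 0 θ s1 C p) (hq : IsDom A c1 c2 a b 1 θ' s1 C q)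
    (hr : IsRay c1 c2 κ 0 θ) (hr' : IsRay c1 c2 κ 1 θ') (hκ : 0 < κ)
    (hw : IsWeight (wt c1 c2 a b 0) s1 θ K) (hw' : IsWeight (wt c1 c2 a b 1) s1 θ' K) {Y : ℂ → ℂ}
    (hY : ∀ z, HasFDerivAt Y (dform β p q z) z) (hE : ∀ z, HasFDerivAt E (dform β p p z) z)
    (hO : ∀ z, HasFDerivAt O (dform β q q z) z) {θy : ℝ}
    (hθ : θ = θc ∧ θ' = θc + π / 2 ∨ θ = θc + π / 2 ∧ θ' = θc)
    (hEl : Tendsto (fun s : ℝ => E (exp (s + θ * I))) atTop (𝓝 0))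
    (hOl : Tendsto (fun s : ℝ => O (exp (s + θ' * I))) atTop (𝓝 n)) (hθy : θc ≤ θy)
    (hθy' : θy ≤ θc + π / 2) (hYl : Tendsto (fun s : ℝ => Y (exp (s + θy * I)) - lin a' b' (s + θy *
    I)) atTop (𝓝 k)) : OnArc c1 c2 a b a' b' s1 (30 * C * (‖a'‖ + ‖b'‖ + 1) * K) θc Y E O k n := by
  have hπ := Real.pi_pos
  have hC' : 0 ≤ 30 * C * (‖a'‖ + ‖b'‖ + 1) * K := by have := hw.one_le; positivity
  obtain ⟨k', e, n', he, harc⟩ := onArc_of_dom h hC hC0 hp hq hw hw' hY hE hO (θc := θc) (by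
    intro ξ hξ
    obtain ⟨-, h1, h2⟩ := hξ
    rcases hθ with ⟨rfl, rfl⟩ | ⟨rfl, rfl⟩
    · exact ⟨abs_le.2 ⟨by linarith, h2⟩, abs_le.2 ⟨by linarith, by linarith⟩⟩
    · exact ⟨abs_le.2 ⟨by linarith, by linarith⟩, abs_le.2 ⟨by linarith, h2⟩⟩)
  have h1 : k' = k := tendsto_nhds_unique (harc.tendsto_Y hC' hθy hθy') hYl
  have h2 : e = 0 := by
    refine tendsto_nhds_unique (tendsto_exp_neg_mul (s1 := s1)
      (wt_ray_le hr hκ a b θ (by simp)) (fun s hs => ?_) hC') hEl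
    simpa using he _ (mem_strip_ray (s := s) (θ := θ) hs (by linarith) (by linarith))
  have h3 : n' = n := by
    refine tendsto_nhds_unique (tendsto_exp_neg_mul (s1 := s1)
      (wt_ray_le hr' hκ a b θ' (by simp)) (fun s hs => ?_) hC') hOl
    have hm : (s + θ' * I : ℂ) ∈ strip s1 θc 0 (π / 2) := by
      rcases hθ with ⟨-, rfl⟩ | ⟨-, rfl⟩ <;> exact mem_strip_ray hs (by linarith) (by linarith)
    simpa using harc.O_le _ hm
  subst h1 h2 h3
  simpa using harc

theorem exists_tendsto_diag (h : IsVariation A' β a' b' s1 C) (hC : C * rexp (-s1) ≤ 1)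
    (hC0 : 0 ≤ C) (hr : IsRay c1 c2 κ j θ) (hκ : 0 < κ) (hw : IsWeight (wt c1 c2 a b j) s1 θ K)
    (hp : IsDom A c1 c2 a b j θ s1 C p) (hF : ∀ z, HasFDerivAt F (dform β p p z) z) : ∃ k, Tendsto
    (fun s : ℝ => F (exp (s + θ * I))) atTop (𝓝 k) := by
  have hπ := Real.pi_pos
  obtain ⟨k, hk⟩ := exists_limit_diag h hC hC0 hw hp hF
  have hC' : 0 ≤ 30 * C * (‖a'‖ + ‖b'‖ + 1) * K := by have := hw.one_le; positivity
  refine ⟨k, tendsto_exp_neg_mul (s1 := s1) (wt_ray_le hr hκ a b θ (by simp)) (fun s hs => ?_) hC'⟩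
  simpa using hk _ (mem_strip_ray (s := s) (θ := θ) hs (by linarith) (by linarith))

theorem dform_left (β : MatForm) (p r q : ℂ → Fin 2 → ℂ) (S : ℂ) (z : ℂ) :
    dform β (fun z => p z + S • r z) q z = dform β p q z + S • dform β r q z := by
  ext v
  simp [dform]
  ring

theorem dform_right (β : MatForm) (p r q : ℂ → Fin 2 → ℂ) (S : ℂ) (z : ℂ) :
    dform β q (fun z => p z + S • r z) z = dform β q p z + S • dform β q r z := by
  ext v
  simp [dform]
  ring

theorem Sectors.exists_arcs {v : ℕ → ℂ → Fin 2 → ℂ} (h : Sectors A c1 c2 a b κ Θ m0 s1 C v)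
    (hβ : IsVariation A β a' b' s1 C) {S0 S1 S2 : ℂ} (h2 : ∀ z, v 2 z = v 0 z + S0 • v 1 z)
    (h3 : ∀ z, v 3 z = v 1 z + S1 • v 2 z) (h4 : ∀ z, v 4 z = v 2 z + S2 • v 3 z) (hS : S0 ≠ 0) : ∃
    (C' : ℝ) (Y E O E2 O3 : ℂ → ℂ) (n n3 : ℂ), 0 ≤ C' ∧
    (∀ z, HasFDerivAt Y (dform β (v 0) (v 1) z) z) ∧ (∀ z, HasFDerivAt E (dform β (v 0) (v 0) z) z)
    ∧ (∀ z, HasFDerivAt O (dform β (v 1) (v 1) z) z) ∧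
    (∀ z, E2 z = E z + 2 * S0 * Y z + S0 ^ 2 * O z) ∧
    (∀ z, O3 z = O z + 2 * S1 * (Y z + S0 * O z) + S1 ^ 2 * E2 z) ∧ OnArc c1 c2 a b a' b' s1 C' Θ Y
    E O 0 n ∧ OnArc c1 c2 a b a' b' s1 C' (Θ + π / 2) (fun z => Y z + S0 * O z) E2 O (S0 * n) n ∧
    OnArc c1 c2 a b a' b' s1 C' (Θ + 2 * (π / 2)) (fun z => Y z + S0 * O z + S1 * E2 z) E2 O3
    (S0 * n) n3 ∧ OnArc c1 c2 a b a' b' s1 C' (Θ + 3 * (π / 2))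
    (fun z => Y z + S0 * O z + S1 * E2 z + S2 * O3 z) (fun z => E2 z + 2 * S2 * (Y z + S0 * O z + S1
    * E2 z) + S2 ^ 2 * O3 z) O3 (S0 * n + S2 * n3) n3 ∧ S0 * n + S2 * n3 =
    -(2 * π * (I * (a' - b'))) := by
  have hπ := Real.pi_pos
  have hC0 := h.C_nonneg
  have hCe := h.C_le
  have hκ := h.κ_pos
  have hβd : Differentiable ℝ β := hβ.smooth.differentiable (by simp)
  set K := rexp (2 * (π * m0))
  have prim : ∀ i j, ∃ F : ℂ → ℂ, ∀ z, HasFDerivAt F (dform β (v i) (v j) z) z := fun i j =>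
    exists_primitive_dform hβd (h.dom i).1 (h.dom j).1 h.traceless hβ.traceless hβ.closed
  have D0 : IsDom A c1 c2 a b 0 Θ s1 C (v 0) := by simpa [par] using h.dom 0
  have D1 : IsDom A c1 c2 a b 1 (Θ + π / 2) s1 C (v 1) := by simpa [par] using h.dom 1
  have D2 : IsDom A c1 c2 a b 0 (Θ + 2 * (π / 2)) s1 C (v 2) := by simpa [par] using h.dom 2
  have D3 : IsDom A c1 c2 a b 1 (Θ + 3 * (π / 2)) s1 C (v 3) := by simpa [par] using h.dom 3
  have D4 : IsDom A c1 c2 a b 0 (Θ + 4 * (π / 2)) s1 C (v 4) := by simpa [par] using h.dom 4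
  have R0 : IsRay c1 c2 κ 0 Θ := h.ray
  have R1 : IsRay c1 c2 κ 1 (Θ + π / 2) := by simpa [par] using h.ray.nat 1
  have R2 : IsRay c1 c2 κ 0 (Θ + 2 * (π / 2)) := by simpa [par] using h.ray.nat 2
  have R3 : IsRay c1 c2 κ 1 (Θ + 3 * (π / 2)) := by simpa [par] using h.ray.nat 3
  have R4 : IsRay c1 c2 κ 0 (Θ + 4 * (π / 2)) := by simpa [par] using h.ray.nat 4
  have W0 : IsWeight (wt c1 c2 a b 0) s1 Θ K := by simpa [par] using h.weight 0
  have W1 : IsWeight (wt c1 c2 a b 1) s1 (Θ + π / 2) K := by simpa [par] using h.weight 1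
  have W2 : IsWeight (wt c1 c2 a b 0) s1 (Θ + 2 * (π / 2)) K := by simpa [par] using h.weight 2
  have W3 : IsWeight (wt c1 c2 a b 1) s1 (Θ + 3 * (π / 2)) K := by simpa [par] using h.weight 3
  have W4 : IsWeight (wt c1 c2 a b 0) s1 (Θ + 4 * (π / 2)) K := by simpa [par] using h.weight 4
  have sym := dform_symm hβ.traceless
  have sum {i j k l S} {P Q : ℂ → ℂ} (h : ∀ z, v k z = v i z + S • v j z)
      (hP : ∀ z, HasFDerivAt P (dform β (v i) (v l) z) z)
      (hQ : ∀ z, HasFDerivAt Q (dform β (v j) (v l) z) z) (z : ℂ) :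
      HasFDerivAt (fun z => P z + S * Q z) (dform β (v k) (v l) z) z := by
    rw [funext h, dform_left]
    exact (hP z).add ((hQ z).const_mul _)
  have sq {i j k S} {P Q R : ℂ → ℂ} (h : ∀ z, v k z = v i z + S • v j z)
      (hP : ∀ z, HasFDerivAt P (dform β (v i) (v i) z) z)
      (hQ : ∀ z, HasFDerivAt Q (dform β (v i) (v j) z) z)
      (hR : ∀ z, HasFDerivAt R (dform β (v j) (v j) z) z) (z : ℂ) :
      HasFDerivAt (fun z => P z + 2 * S * Q z + S ^ 2 * R z) (dform β (v k) (v k) z) z := by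
    have : dform β (v k) (v k) z = dform β (v i) (v i) z + (2 * S) • dform β (v i) (v j) z
        + (S ^ 2) • dform β (v j) (v j) z := by
      rw [funext h, dform_left, dform_right, dform_right, sym (v j) (v i)]
      module
    rw [this]
    exact ((hP z).add ((hQ z).const_mul _)).add ((hR z).const_mul _)
  obtain ⟨y, hy⟩ := prim 0 1
  obtain ⟨e, he⟩ := prim 0 0
  obtain ⟨o, ho⟩ := prim 1 1
  obtain ⟨ke, hke⟩ := exists_tendsto_diag hβ hCe hC0 R0 hκ W0 D0 he
  obtain ⟨ky, hky⟩ := exists_limit_offdiag hβ hCe hC0 D0 D1 hy (θc := Θ) (by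
    intro ξ hξ
    obtain ⟨-, h1, h2⟩ := hξ
    exact ⟨abs_le.2 ⟨by linarith, h2⟩, abs_le.2 ⟨by linarith, by linarith⟩⟩)
  set Y : ℂ → ℂ := fun z => y z - ky with hYdef
  set E : ℂ → ℂ := fun z => e z - ke
  have hY : ∀ z, HasFDerivAt Y (dform β (v 0) (v 1) z) z := fun z => (hy z).sub_const _
  have hE : ∀ z, HasFDerivAt E (dform β (v 0) (v 0) z) z := fun z => (he z).sub_const _
  obtain ⟨k2, hk2⟩ := exists_tendsto_diag hβ hCe hC0 R2 hκ W2 D2 (sq h2 hE hY ho)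
  set O : ℂ → ℂ := fun z => o z - k2 / S0 ^ 2 with hOdef
  have hO : ∀ z, HasFDerivAt O (dform β (v 1) (v 1) z) z := fun z => (ho z).sub_const _
  set E2 : ℂ → ℂ := fun z => E z + 2 * S0 * Y z + S0 ^ 2 * O z with hE2def
  have hE2 : ∀ z, HasFDerivAt E2 (dform β (v 2) (v 2) z) z := sq h2 hE hY hO
  have lE0 : Tendsto (fun s : ℝ => E (exp (s + Θ * I))) atTop (𝓝 0) := by
    simpa using hke.sub_const ke
  have lE2 : Tendsto (fun s : ℝ => E2 (exp (s + (Θ + 2 * (π / 2) : ℝ) * I))) atTop (𝓝 0) := by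
    have := hk2.sub_const k2
    rw [sub_self] at this
    refine this.congr fun s => ?_
    simp only [hE2def, hOdef]
    field_simp
    ring
  obtain ⟨n, lO⟩ := exists_tendsto_diag hβ hCe hC0 R1 hκ W1 D1 hO
  have lY : Tendsto (fun s : ℝ => Y (exp (s + Θ * I)) - lin a' b' (s + Θ * I)) atTop (𝓝 0) := by
    refine tendsto_exp_neg_mul (s1 := s1) (C := 30 * C * (‖a'‖ + ‖b'‖ + 1)) (w := fun _ => 1)
      ⟨1, by simp⟩ (fun s hs => ?_) (by positivity)
    have := hky _ (mem_strip_ray (s := s) (θ := Θ) hs (by linarith) (by linarith))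
    simpa [hYdef, sub_right_comm] using this
  have C'0 : 0 ≤ 30 * C * (‖a'‖ + ‖b'‖ + 1) * K := by positivity
  have A0 := onArc_of_tendsto hβ hCe hC0 D0 D1 R0 R1 hκ W0 W1 hY hE hO (θc := Θ) (θy := Θ)
    (Or.inl ⟨rfl, rfl⟩) lE0 lO le_rfl (by linarith) lY
  have hY1 := sum h2 hY hO
  have lY1 := (A0.tendsto_Y C'0 (φ := Θ + π / 2) (by linarith) le_rfl).add (lO.const_mul S0)
  rw [zero_add] at lY1
  have A1 := onArc_of_tendsto hβ hCe hC0 D2 D1 R2 R1 hκ W2 W1 hY1 hE2 hO (θc := Θ + π / 2)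
    (θy := Θ + π / 2) (Or.inr ⟨by ring, rfl⟩) lE2 lO le_rfl (by linarith)
    (lY1.congr fun s => by ring)
  have hY2 : ∀ z, HasFDerivAt (fun z => Y z + S0 * O z + S1 * E2 z) (dform β (v 2) (v 3) z) z := by
    intro z
    rw [funext h3, dform_right]
    exact (hY1 z).add ((hE2 z).const_mul _)
  set O3 : ℂ → ℂ := fun z => O z + 2 * S1 * (Y z + S0 * O z) + S1 ^ 2 * E2 z with hO3def
  have hO3 : ∀ z, HasFDerivAt O3 (dform β (v 3) (v 3) z) z :=
    sq h3 hO (fun z => by rw [sym]; exact hY1 z) hE2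
  obtain ⟨n3, lO3⟩ := exists_tendsto_diag hβ hCe hC0 R3 hκ W3 D3 hO3
  have lY2 := (A1.tendsto_Y C'0 (φ := Θ + 2 * (π / 2)) (by linarith) (by linarith)).add
    (lE2.const_mul S1)
  rw [mul_zero, add_zero] at lY2
  have A2 := onArc_of_tendsto hβ hCe hC0 D2 D3 R2 R3 hκ W2 W3 hY2 hE2 hO3
    (θc := Θ + 2 * (π / 2)) (θy := Θ + 2 * (π / 2)) (Or.inl ⟨rfl, by ring⟩) lE2 lO3
    le_rfl (by linarith) (lY2.congr fun s => by ring)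
  obtain ⟨M, -, hM⟩ := h.monodromy 0
  have w01 := h.wr_succ 0 0
  have hβ0 : S0 + S2 * (1 + S0 * S1) = 0 := by
    have h1 := hM 0
    rw [zero_add, h4, h3, h2] at h1
    have e0 := congrFun h1 0
    have e1 := congrFun h1 1
    simp [par, sg, wr] at w01 e0 e1
    linear_combination v 0 0 0 * e1 - v 0 0 1 * e0 - (S0 + S2 * (1 + S0 * S1)) * w01
  have hE4' : ∀ z, E2 z + 2 * S2 * (Y z + S0 * O z + S1 * E2 z) + S2 ^ 2 * O3 z
      = (1 + S1 * S2) ^ 2 * E z := by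
    intro z
    simp only [hO3def, hE2def]
    linear_combination (2 * (1 + S1 * S2) * Y z + (S0 + S2 * (1 + S0 * S1)) * O z) * hβ0
  have hY3' : ∀ z, Y z + S0 * O z + S1 * E2 z + S2 * O3 z = Y z + (1 + S1 * S2) * S1 * E z := by
    intro z
    simp only [hO3def, hE2def]
    linear_combination (2 * S1 * Y z + (1 + S0 * S1) * O z) * hβ0
  have hper : ∀ s : ℝ, exp (s + (Θ + 4 * (π / 2) : ℝ) * I) = exp (s + Θ * I) := by
    intro s
    rw [show (s : ℂ) + (Θ + 4 * (π / 2) : ℝ) * I = s + Θ * I + 2 * π * I by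
      push_cast; ring, exp_periodic]
  have lE4 := lE0.const_mul ((1 + S1 * S2) ^ 2)
  rw [mul_zero] at lE4
  have lY3 := (A2.tendsto_Y C'0 (φ := Θ + 3 * (π / 2)) (by linarith) (by linarith)).add
    (lO3.const_mul S2)
  have A3 := onArc_of_tendsto hβ hCe hC0 D4 D3 R4 R3 hκ W4 W3
    (sum h4 hY2 hO3) (sq h4 hE2 hY2 hO3) hO3
    (θc := Θ + 3 * (π / 2)) (θy := Θ + 3 * (π / 2)) (Or.inr ⟨by ring, rfl⟩)
    (lE4.congr fun s => by simp only [hE4', hper]) lO3 le_rfl (by linarith)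
    (lY3.congr fun s => by ring)
  refine ⟨_, Y, E, O, E2, O3, n, n3, C'0, hY, hE, hO, fun _ => rfl, fun _ => rfl, A0, A1, A2, A3,
    ?_⟩
  have t1 := A3.tendsto_Y C'0 (φ := Θ + 4 * (π / 2)) (by linarith) (by linarith)
  have t2 : Tendsto (fun s : ℝ => (Y (exp (s + Θ * I)) - lin a' b' (s + Θ * I)
      + (1 + S1 * S2) * S1 * E (exp (s + Θ * I))) + -(2 * π * (I * (a' - b')))) atTop
      (𝓝 (0 + (1 + S1 * S2) * S1 * 0 + -(2 * π * (I * (a' - b'))))) :=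
    (lY.add (lE0.const_mul _)).add_const _
  rw [mul_zero, add_zero, zero_add] at t2
  refine tendsto_nhds_unique t1 (t2.congr fun s => ?_)
  simp only [hY3', hper]
  have : lin a' b' (s + (Θ + 4 * (π / 2) : ℝ) * I)
      = lin a' b' (s + Θ * I) + 2 * π * (I * (a' - b')) := by
    simp [lin, conj_two]
    have : conj (4 : ℂ) = 4 := map_ofNat _ 4
    ring_nf
    simp [this]
    ring
  rw [this]
  ring

/-- The potential, antisymmetrized, of `tr (β1 ∧ β2)`, in terms of primitives of the entries,
evaluated on the tangent vector `w`. -/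
def potential (Y1 E1 O1 Y2 E2 O2 : ℂ → ℂ) (z w : ℂ) : ℂ :=
  Y1 z * fderiv ℝ Y2 z w - Y2 z * fderiv ℝ Y1 z w
    - (E1 z * fderiv ℝ O2 z w - O2 z * fderiv ℝ E1 z w + O1 z * fderiv ℝ E2 z w
      - E2 z * fderiv ℝ O1 z w) / 2

/-- The point of angle `θ` on the circle of radius `e^s`. -/
def circ (s θ : ℝ) : ℂ := exp (s + θ * I)

theorem continuous_circ (s : ℝ) : Continuous (circ s) := by unfold circ; fun_prop

theorem hasDerivAt_circ (s θ : ℝ) : HasDerivAt (circ s) (circ s θ * I) θ := by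
  unfold circ
  have h := (((ofRealCLM.hasDerivAt (x := θ)).mul_const I).const_add (s : ℂ)).cexp
  simpa using h

theorem hasDerivAt_comp_circ (hF : Differentiable ℝ F) (s θ : ℝ) : HasDerivAt
    (fun θ => F (circ s θ)) (fderiv ℝ F (circ s θ) (circ s θ * I)) θ :=
  (hF (circ s θ)).hasFDerivAt.comp_hasDerivAt θ (hasDerivAt_circ s θ)

theorem continuous_fderiv_circ (hF : ContDiff ℝ 2 F) (s : ℝ) : Continuous fun θ : ℝ => fderiv ℝ F
    (circ s θ) (circ s θ * I) :=
  ((hF.continuous_fderiv two_ne_zero).comp (continuous_circ s)).clm_apply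
    ((continuous_circ s).mul continuous_const)

theorem continuous_potential {Y1 E1 O1 Y2 E2 O2 : ℂ → ℂ} (hY1 : ContDiff ℝ 2 Y1)
    (hE1 : ContDiff ℝ 2 E1) (hO1 : ContDiff ℝ 2 O1) (hY2 : ContDiff ℝ 2 Y2)
    (hE2 : ContDiff ℝ 2 E2) (hO2 : ContDiff ℝ 2 O2) (s : ℝ) :
    Continuous fun θ : ℝ => potential Y1 E1 O1 Y2 E2 O2 (circ s θ) (circ s θ * I) := by
  have c : ∀ {F : ℂ → ℂ}, ContDiff ℝ 2 F → Continuous fun θ : ℝ => F (circ s θ) :=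
    fun h => h.continuous.comp (continuous_circ s)
  have d := @continuous_fderiv_circ
  unfold potential
  exact (((c hY1).mul (d hY2 s)).sub ((c hY2).mul (d hY1 s))).sub
    ((((((c hE1).mul (d hO2 s)).sub ((c hO2).mul (d hE1 s))).add
      ((c hO1).mul (d hE2 s))).sub ((c hE2).mul (d hO1 s))).div_const 2)

theorem tendsto_mul_exp_neg (A B : ℝ) :
    Tendsto (fun s : ℝ => (A * s + B) * rexp (-s)) atTop (𝓝 0) := by
  have h1 : Tendsto (fun s : ℝ => s * rexp (-s)) atTop (𝓝 0) := by
    simpa using Real.tendsto_pow_mul_exp_neg_atTop_nhds_zero 1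
  have h2 := (h1.const_mul A).add (tendsto_C_exp_neg B)
  simp only [mul_zero, add_zero] at h2
  exact h2.congr fun s => by ring

theorem norm_mul_sub_mul_le {l : ℂ} {Λ M : ℝ} (hx : ‖x - l‖ ≤ δ) (hy : ‖y - n‖ ≤ δ) (hl : ‖l‖ ≤ Λ)
    (hn : ‖n‖ ≤ M) : ‖x * y - l * n‖ ≤ δ * (M + δ) + Λ * δ := by
  have hδ : 0 ≤ δ := (norm_nonneg _).trans hx
  have hΛ : 0 ≤ Λ := (norm_nonneg _).trans hl
  have e : x * y - l * n = (x - l) * y + l * (y - n) := by ring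
  have hy' : ‖y‖ ≤ M + δ := by have := norm_add_le (y - n) n; rw [sub_add_cancel] at this; linarith
  rw [e]
  refine (norm_add_le _ _).trans ?_
  rw [norm_mul, norm_mul]
  gcongr

set_option maxHeartbeats 1000000 in
theorem arc_integral {b₁ b₂ : ℂ} {Y1 E1 O1 Y2 E2 O2 : ℂ → ℂ} {n1 n2 : ℂ} (hC : 0 ≤ C)
    (h₁ : OnArc c1 c2 a b a1 b₁ s1 C θ Y1 E1 O1 k1 n1)
    (h₂ : OnArc c1 c2 a b a2 b₂ s1 C θ Y2 E2 O2 k2 n2) (hY1 : ContDiff ℝ 2 Y1)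
    (hE1 : ContDiff ℝ 2 E1) (hO1 : ContDiff ℝ 2 O1) (hY2 : ContDiff ℝ 2 Y2) (hE2 : ContDiff ℝ 2 E2)
    (hO2 : ContDiff ℝ 2 O2) : Tendsto (fun s : ℝ => (∫ x in θ..(θ + π / 2), potential Y1 E1 O1 Y2 E2
    O2 (circ s x) (circ s x * I)) - ((π / 2) * (((a1 + b₁) * lin a2 b₂ I - (a2 + b₂) * lin a1 b₁ I)
    * s + (k1 * lin a2 b₂ I - k2 * lin a1 b₁ I)) - ((n1 * E2 (circ s (θ + π / 2)) - n2 * E1 (circ s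
    (θ + π / 2))) - (n1 * E2 (circ s θ) - n2 * E1 (circ s θ))) / 2)) atTop (𝓝 0) := by
  have hπ := Real.pi_pos
  set N1 := lin a1 b₁ I
  set N2 := lin a2 b₂ I
  set M := max ‖N1‖ ‖N2‖
  set m := max (‖a1‖ + ‖b₁‖) (‖a2‖ + ‖b₂‖)
  set k := max ‖k1‖ ‖k2‖
  have hm0 : 0 ≤ m := le_max_of_le_left (by positivity)
  have hk0 : 0 ≤ k := le_max_of_le_left (norm_nonneg _)
  have hM0 : 0 ≤ M := le_max_of_le_left (norm_nonneg _)
  let model : ℝ → ℝ → ℂ := fun s x => ((a1 + b₁) * N2 - (a2 + b₂) * N1) * s + (k1 * N2 - k2 * N1)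
    - (n1 * fderiv ℝ E2 (circ s x) (circ s x * I) - n2 * fderiv ℝ E1 (circ s x) (circ s x * I)) / 2
  let bd : ℝ → ℝ := fun s => (2 * (C * (M + C) + (m * (s + (|θ| + 2)) + k) * C) + 2 * C * C)
    * rexp (-s)
  have hpt : ∀ s, max s1 0 ≤ s → ∀ x ∈ Icc θ (θ + π / 2),
      ‖potential Y1 E1 O1 Y2 E2 O2 (circ s x) (circ s x * I) - model s x‖ ≤ bd s := by
    intro s hs x hx
    have hs0 : 0 ≤ s := (le_max_right _ _).trans hs
    have hs1 : s1 ≤ s := (le_max_left _ _).trans hs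
    set ε := rexp (-s) with hε
    have hε0 : 0 ≤ ε := (Real.exp_pos _).le
    have hε1 : ε ≤ 1 := by rw [hε, Real.exp_le_one_iff]; linarith
    set ξ : ℂ := s + x * I with hξ
    have hmem : ξ ∈ strip s1 θ 0 (π / 2) := mem_strip_ray hs1 (by linarith [hx.1])
      (by linarith [hx.2])
    have hre : ξ.re = s := by simp [hξ]
    have hz : circ s x = exp ξ := rfl
    let D : (ℂ → ℂ) → ℂ := fun F => fderiv ℝ F (circ s x) (circ s x * I)
    set w0 := wt c1 c2 a b 0 ξ with hw0
    set w1 := wt c1 c2 a b 1 ξ with hw1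
    have hww : w0 * w1 = 1 := wt_mul c1 c2 a b 0 ξ
    have hw0' : 0 ≤ w0 := (Real.exp_pos _).le
    have hw1' : 0 ≤ w1 := (Real.exp_pos _).le
    have y1 := h₁.Y_le ξ hmem
    have y2 := h₂.Y_le ξ hmem
    rw [sub_sub] at y1 y2
    have e1 := h₁.E_le ξ hmem
    have e2 := h₂.E_le ξ hmem
    have o1 := h₁.O_le ξ hmem
    have o2 := h₂.O_le ξ hmem
    have dy1 := h₁.dY_le ξ hmem I
    have dy2 := h₂.dY_le ξ hmem I
    have de1 := h₁.dE_le ξ hmem I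
    have de2 := h₂.dE_le ξ hmem I
    have do1 := h₁.dO_le ξ hmem I
    have do2 := h₂.dO_le ξ hmem I
    simp only [hre, norm_I, mul_one, ← hz, ← hε, ← hw0, ← hw1] at y1 y2 e1 e2 o1 o2 dy1 dy2 de1 de2 do1 do2
    have hξn : ‖ξ‖ ≤ s + (|θ| + 2) := by
      refine (norm_add_le _ _).trans ?_
      rw [norm_mul, norm_I, mul_one, norm_real, norm_real,
        Real.norm_of_nonneg hs0, Real.norm_eq_abs]
      have : |x| ≤ |θ| + 2 := by
        rw [abs_le]
        constructor <;> linarith [hx.1, hx.2, Real.pi_le_four, neg_abs_le θ, le_abs_self θ]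
      linarith
    have hl : ∀ (a' b' k' : ℂ), ‖a'‖ + ‖b'‖ ≤ m → ‖k'‖ ≤ k →
        ‖lin a' b' ξ + k'‖ ≤ m * (s + (|θ| + 2)) + k := fun a' b' k' h h' =>
      (norm_add_le _ _).trans (add_le_add ((norm_linear_le a' b' ξ).trans (by gcongr)) h')
    have l1 := hl a1 b₁ k1 (le_max_left _ _) (le_max_left _ _)
    have l2 := hl a2 b₂ k2 (le_max_right _ _) (le_max_right _ _)
    have t1 := norm_mul_sub_mul_le y1 dy2 l1 (le_max_right ‖N1‖ ‖N2‖)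
    have t2 := norm_mul_sub_mul_le y2 dy1 l2 (le_max_left ‖N1‖ ‖N2‖)
    have hεε := mul_le_of_le_one_right (show 0 ≤ C * C * ε by positivity) hε1
    have tE : ∀ {x y : ℂ}, ‖x‖ ≤ C * ε * w0 → ‖y‖ ≤ C * ε * w1 → ‖x * y‖ ≤ C * C * ε := by
      intro x y hx hy
      rw [norm_mul]
      refine (mul_le_mul hx hy (norm_nonneg _) (by positivity)).trans ?_
      linear_combination hεε + C * C * ε * ε * hww
    have hL : (lin a1 b₁ ξ + k1) * N2 - (lin a2 b₂ ξ + k2) * N1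
        = ((a1 + b₁) * N2 - (a2 + b₂) * N1) * s + (k1 * N2 - k2 * N1) := by
      have hlin : ∀ a' b' : ℂ, lin a' b' ξ = (a' + b') * s + lin a' b' I * x := fun a' b' => by
        simp [lin, hξ]; ring
      rw [hlin, hlin]; ring
    have key : potential Y1 E1 O1 Y2 E2 O2 (circ s x) (circ s x * I) - model s x
        = (Y1 (circ s x) * D Y2 - (lin a1 b₁ ξ + k1) * N2)
          - (Y2 (circ s x) * D Y1 - (lin a2 b₂ ξ + k2) * N1)
          - (E1 (circ s x) * D O2 - D E1 * (O2 (circ s x) - n2) + D E2 * (O1 (circ s x) - n1)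
            - E2 (circ s x) * D O1) / 2 := by
      simp only [model, potential, D]
      rw [← hL]
      ring
    rw [key]
    have tri : ∀ x y p q r t : ℂ, ‖x - y - (p - q + r - t) / 2‖
        ≤ ‖x‖ + ‖y‖ + (‖p‖ + ‖q‖ + ‖r‖ + ‖t‖) / 2 := by
      intro x y p q r t
      refine (norm_sub_le _ _).trans (add_le_add (norm_sub_le _ _) ?_)
      rw [norm_div, norm_ofNat]
      gcongr
      exact (norm_sub_le _ _).trans (add_le_add ((norm_add_le _ _).trans
        (add_le_add (norm_sub_le _ _) le_rfl)) le_rfl)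
    refine (tri _ _ _ _ _ _).trans ?_
    have hb : C * ε * (M + C * ε) + (m * (s + (|θ| + 2)) + k) * (C * ε)
        ≤ (C * (M + C) + (m * (s + (|θ| + 2)) + k) * C) * ε := by linear_combination hεε
    simp only [bd]
    linarith [tE e1 do2, tE de1 o2, tE de2 o1, tE e2 do1]
  have hmc : ∀ s, Continuous (model s) := fun s => continuous_const.sub
    (((continuous_const.mul (continuous_fderiv_circ hE2 s)).sub
      (continuous_const.mul (continuous_fderiv_circ hE1 s))).div_const 2)
  have hpc := fun s => continuous_potential hY1 hE1 hO1 hY2 hE2 hO2 s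
  have hmi : ∀ s, (∫ x in θ..(θ + π / 2), model s x)
      = ((π / 2) * (((a1 + b₁) * N2 - (a2 + b₂) * N1) * s + (k1 * N2 - k2 * N1))
        - ((n1 * E2 (circ s (θ + π / 2)) - n2 * E1 (circ s (θ + π / 2)))
          - (n1 * E2 (circ s θ) - n2 * E1 (circ s θ))) / 2) := by
    intro s
    have hd : ∀ x ∈ uIcc θ (θ + π / 2), HasDerivAt
        (fun x : ℝ => (((a1 + b₁) * N2 - (a2 + b₂) * N1) * s + (k1 * N2 - k2 * N1)) * x
          - (n1 * E2 (circ s x) - n2 * E1 (circ s x)) / 2) (model s x) x := by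
      intro x _
      have h1 := ((ofRealCLM.hasDerivAt (x := x)).const_mul
        (((a1 + b₁) * N2 - (a2 + b₂) * N1) * s + (k1 * N2 - k2 * N1)))
      have h2 := (hasDerivAt_comp_circ (hE2.differentiable two_ne_zero) s x).const_mul n1
      have h3 := (hasDerivAt_comp_circ (hE1.differentiable two_ne_zero) s x).const_mul n2
      refine (h1.sub ((h2.sub h3).div_const 2)).congr_deriv ?_
      simp [model]
    rw [intervalIntegral.integral_eq_sub_of_hasDerivAt hd ((hmc s).intervalIntegrable _ _)]
    push_cast
    ring
  have hlim : Tendsto (fun s => bd s * (π / 2)) atTop (𝓝 0) := by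
    have := (tendsto_mul_exp_neg (2 * m * C)
      (2 * (C * (M + C) + (m * (|θ| + 2) + k) * C) + 2 * C * C)).mul_const (π / 2)
    rw [zero_mul] at this
    exact this.congr fun s => by simp only [bd]; ring
  refine squeeze_zero_norm' ?_ hlim
  filter_upwards [eventually_ge_atTop (max s1 0)] with s hs
  rw [← hmi, ← intervalIntegral.integral_sub ((hpc s).intervalIntegrable _ _)
    ((hmc s).intervalIntegrable _ _)]
  refine (intervalIntegral.norm_integral_le_of_norm_le_const (C := bd s) ?_).trans ?_
  · intro x hx; rw [uIoc_of_le (by linarith)] at hx; exact hpt s hs x ⟨hx.1.le, hx.2⟩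
  · rw [add_sub_cancel_left, abs_of_pos (by positivity)]

theorem fderiv_unipotent {Y : ℂ → ℂ} (hY : Differentiable ℝ Y) (hO : Differentiable ℝ O)
    (hE : Differentiable ℝ E) (S : ℂ) (z w : ℂ) : fderiv ℝ (fun z => Y z + S * O z) z w = fderiv ℝ Y
    z w + S * fderiv ℝ O z w ∧ fderiv ℝ (fun z => E z + 2 * S * Y z + S ^ 2 * O z) z w = fderiv ℝ E
    z w + 2 * S * fderiv ℝ Y z w + S ^ 2 * fderiv ℝ O z w := by
  have hY := (hY z).hasFDerivAt
  have hO := (hO z).hasFDerivAt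
  constructor
  · rw [(hY.fun_add (hO.const_mul S)).fderiv]; simp
  · rw [(((hE z).hasFDerivAt.fun_add (hY.const_mul (2 * S))).fun_add
      (hO.const_mul (S ^ 2))).fderiv]; simp

theorem potential_unipotent {Y1 E1 O1 Y2 E2 O2 : ℂ → ℂ} (hY1 : Differentiable ℝ Y1)
    (hE1 : Differentiable ℝ E1) (hO1 : Differentiable ℝ O1) (hY2 : Differentiable ℝ Y2)
    (hE2 : Differentiable ℝ E2) (hO2 : Differentiable ℝ O2) (S z w : ℂ) :
    potential (fun z => Y1 z + S * O1 z) (fun z => E1 z + 2 * S * Y1 z + S ^ 2 * O1 z) O1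
      (fun z => Y2 z + S * O2 z) (fun z => E2 z + 2 * S * Y2 z + S ^ 2 * O2 z) O2 z w
      = potential Y1 E1 O1 Y2 E2 O2 z w := by
  simp only [potential, (fderiv_unipotent hY1 hO1 hE1 S z w).1,
    (fderiv_unipotent hY1 hO1 hE1 S z w).2, (fderiv_unipotent hY2 hO2 hE2 S z w).1,
    (fderiv_unipotent hY2 hO2 hE2 S z w).2]
  ring

theorem potential_swap (Y1 E1 O1 Y2 E2 O2 : ℂ → ℂ) (z w : ℂ) :
    potential Y1 E1 O1 Y2 E2 O2 z w = potential Y1 O1 E1 Y2 O2 E2 z w := by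
  simp only [potential]; ring

theorem wedge_swap (L M : ℂ →L[ℝ] ℂ) : wedge L M = -wedge M L := by simp only [wedge]; ring

theorem trWedge_eq {β1 β2 : MatForm} (h₁ : ∀ z v, β1 z 0 0 v + β1 z 1 1 v = 0)
    (h₂ : ∀ z v, β2 z 0 0 v + β2 z 1 1 v = 0) (z : ℂ) (hpq : wr (p z) (q z) = 1) : trWedge (β1 z)
    (β2 z) = 2 * wedge (dform β1 p q z) (dform β2 p q z) - (wedge (dform β1 p p z) (dform β2 q q z)
    + wedge (dform β1 q q z) (dform β2 p p z)) := by
  have e1 : ∀ v, β1 z 1 1 v = -β1 z 0 0 v := fun v => by linear_combination h₁ z v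
  have e2 : ∀ v, β2 z 1 1 v = -β2 z 0 0 v := fun v => by linear_combination h₂ z v
  simp only [wr] at hpq
  simp only [trWedge, wedge, dform, MatCovector.eval, Matrix.trace, Matrix.diag, Fin.sum_univ_two,
    Matrix.sub_apply, Matrix.mul_apply, Matrix.of_apply, e1, e2, sub_apply, add_apply, smul_apply,
    smul_eq_mul]
  set x := β1 z 0 0 1
  set x' := β1 z 0 0 I
  set y := β1 z 0 1 1
  set y' := β1 z 0 1 I
  set t := β1 z 1 0 1
  set t' := β1 z 1 0 I
  set X := β2 z 0 0 1
  set X' := β2 z 0 0 I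
  set Z := β2 z 0 1 1
  set Z' := β2 z 0 1 I
  set T := β2 z 1 0 1
  set T' := β2 z 1 0 I
  linear_combination -(2 * x * X' - 2 * x' * X + y * T' + t * Z' - y' * T - t' * Z)
    * (p z 0 * q z 1 - p z 1 * q z 0 + 1) * hpq

theorem integral_trWedge {β1 β2 : MatForm} {v0 v₁ : ℂ → Fin 2 → ℂ}
    (h₁ : ∀ z v, β1 z 0 0 v + β1 z 1 1 v = 0) (h₂ : ∀ z v, β2 z 0 0 v + β2 z 1 1 v = 0)
    (hw : ∀ z, wr (v0 z) (v₁ z) = 1) {Y1 E1 O1 Y2 E2 O2 : ℂ → ℂ} (cY1 : ContDiff ℝ 2 Y1)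
    (cE1 : ContDiff ℝ 2 E1) (cO1 : ContDiff ℝ 2 O1) (cY2 : ContDiff ℝ 2 Y2)
    (cE2 : ContDiff ℝ 2 E2) (cO2 : ContDiff ℝ 2 O2)
    (hY1 : ∀ z, fderiv ℝ Y1 z = dform β1 v0 v₁ z) (hE1 : ∀ z, fderiv ℝ E1 z = dform β1 v0 v0 z)
    (hO1 : ∀ z, fderiv ℝ O1 z = dform β1 v₁ v₁ z)
    (hY2 : ∀ z, fderiv ℝ Y2 z = dform β2 v0 v₁ z) (hE2 : ∀ z, fderiv ℝ E2 z = dform β2 v0 v0 z)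
    (hO2 : ∀ z, fderiv ℝ O2 z = dform β2 v₁ v₁ z) (s Θ : ℝ) :
    (∫ z in closedBall (0 : ℂ) (rexp s), trWedge (β1 z) (β2 z))
      = ∫ θ in Θ..Θ + 2 * π, potential Y1 E1 O1 Y2 E2 O2 (circ s θ) (circ s θ * I) := by
  set B := closedBall (0 : ℂ) (rexp s) with hB
  set w : (ℂ → ℂ) → (ℂ → ℂ) → ℂ → ℂ := fun F G z => wedge (fderiv ℝ F z) (fderiv ℝ G z) with hw'
  set t : (ℂ → ℂ) → (ℂ → ℂ) → ℝ → ℂ := fun F G θ =>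
    F (circ s θ) * fderiv ℝ G (circ s θ) (circ s θ * I) with ht
  have ig {F G : ℂ → ℂ} (hF : ContDiff ℝ 2 F) (hG : ContDiff ℝ 2 G) : IntegrableOn (w F G) B := by
    have c1 := fun v : ℂ => (hF.continuous_fderiv two_ne_zero).clm_apply (continuous_const (y := v))
    have c2 := fun v : ℂ => (hG.continuous_fderiv two_ne_zero).clm_apply (continuous_const (y := v))
    exact ContinuousOn.integrableOn_compact (isCompact_closedBall _ _)
      (((c1 _).mul (c2 _)).sub ((c1 _).mul (c2 _))).continuousOn
  have ii {F G : ℂ → ℂ} (hF : ContDiff ℝ 2 F) (hG : ContDiff ℝ 2 G) :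
      IntervalIntegrable (t F G) volume (-π) π :=
    ((hF.continuous.comp (continuous_circ s)).mul
      (continuous_fderiv_circ hG s)).intervalIntegrable _ _
  have e : ∀ z, trWedge (β1 z) (β2 z) = (w Y1 Y2 z - w Y2 Y1 z)
      - (1 / 2 : ℂ) * ((w E1 O2 z - w O2 E1 z) + (w O1 E2 z - w E2 O1 z)) := by
    intro z
    simp only [hw']
    rw [trWedge_eq h₁ h₂ z (hw z), hY1, hY2, hE1, hE2, hO1, hO2,
      wedge_swap (dform β2 v0 v₁ z), wedge_swap (dform β2 v₁ v₁ z), wedge_swap (dform β2 v0 v0 z)]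
    ring
  have st {F G : ℂ → ℂ} (hF : ContDiff ℝ 2 F) (hG : ContDiff ℝ 2 G) :
      (∫ z in B, (w F G z - w G F z)) = ∫ θ in -π..π, (t F G θ - t G F θ) := by
    have st {F G : ℂ → ℂ} (hF : ContDiff ℝ 2 F) (hG : ContDiff ℝ 2 G) :
        (∫ z in B, w F G z) = ∫ θ in -π..π, t F G θ := by
      have hcirc (θ : ℝ) : ((rexp s : ℝ) : ℂ) * exp (θ * I) = circ s θ := by
        rw [circ, exp_add, ofReal_exp]
      simp only [hB, hw', ht]
      rw [stokes_disc (hF.of_le (by norm_num)) hG (Real.exp_pos s).le]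
      simp only [hcirc, mul_comm I]
    refine (integral_sub (ig hF hG) (ig hG hF)).trans ?_
    rw [st hF hG, st hG hF]
    exact (intervalIntegral.integral_sub (ii hF hG) (ii hG hF)).symm
  have ig2 {F G : ℂ → ℂ} (hF : ContDiff ℝ 2 F) (hG : ContDiff ℝ 2 G) := (ig hF hG).sub (ig hG hF)
  have ii2 {F G : ℂ → ℂ} (hF : ContDiff ℝ 2 F) (hG : ContDiff ℝ 2 G) := (ii hF hG).sub (ii hG hF)
  have split : (∫ z in B, trWedge (β1 z) (β2 z))
      = ∫ θ in -π..π, potential Y1 E1 O1 Y2 E2 O2 (circ s θ) (circ s θ * I) := by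
    simp only [e]
    refine (integral_sub (ig2 cY1 cY2) (((ig2 cE1 cO2).add (ig2 cO1 cE2)).const_mul _)).trans ?_
    rw [integral_const_mul]
    refine (congrArg₂ (fun x y : ℂ => x - 1 / 2 * y) (st cY1 cY2) ((integral_add (ig2 cE1 cO2)
      (ig2 cO1 cE2)).trans (congrArg₂ (· + ·) (st cE1 cO2) (st cO1 cE2)))).trans ?_
    rw [← intervalIntegral.integral_add (ii2 cE1 cO2) (ii2 cO1 cE2),
      ← intervalIntegral.integral_const_mul]
    refine (intervalIntegral.integral_sub (ii2 cY1 cY2)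
      (((ii2 cE1 cO2).add (ii2 cO1 cE2)).const_mul _)).symm.trans ?_
    refine intervalIntegral.integral_congr fun θ _ => ?_
    simp only [potential, ht]
    ring
  have hper : Function.Periodic (fun θ : ℝ =>
      potential Y1 E1 O1 Y2 E2 O2 (circ s θ) (circ s θ * I)) (2 * π) := by
    intro θ
    have : circ s (θ + 2 * π) = circ s θ := by
      rw [circ, circ, show (s : ℂ) + ((θ + 2 * π : ℝ) : ℂ) * I = s + θ * I + 2 * π * I by
        push_cast; ring, exp_periodic]
    simp only [this]
  rw [hper.intervalIntegral_add_eq Θ (-π), show -π + 2 * π = π by ring, split]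

/-- `q` is the logarithmic variation of the Stokes multiplier `S`, computed from the primitive of
`(β v0) ∧ v2`. -/
def IsStokesVariation (v : ℕ → ℂ → Fin 2 → ℂ) (β : MatForm) (a' b' : ℂ) (Θ : ℝ) (S q : ℂ) : Prop :=
  ∃ F : ℂ → ℂ, (∀ z, HasFDerivAt F (dform β (v 0) (v 2) z) z) ∧
    Tendsto (fun s => F (circ s Θ) - S * lin a' b' (s + Θ * I)) atTop (𝓝 0) ∧
    Tendsto (fun s => F (circ s (Θ + π)) + S * lin a' b' (s + (Θ + π : ℝ) * I)) atTop (𝓝 (-(S * q)))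

theorem lin_apply (a' b' : ℂ) (s θ : ℝ) :
    lin a' b' (s + θ * I) = (a' + b') * s + lin a' b' I * θ := by
  simp [lin]
  ring

theorem OnArc.tendsto_E {Y : ℂ → ℂ} (h : OnArc c1 c2 a b a' b' s1 C θ Y E O k n) (hC : 0 ≤ C)
    (hr : IsRay c1 c2 κ 0 φ) (hκ : 0 < κ) (h1 : θ ≤ φ) (h2 : φ ≤ θ + π / 2) : Tendsto
    (fun s : ℝ => E (circ s φ)) atTop (𝓝 0) := by
  refine tendsto_exp_neg_mul (s1 := s1) (wt_ray_le hr hκ a b φ (by simp)) (fun s hs => ?_) hC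
  simpa [circ] using h.E_le _ (mem_strip_ray hs (by linarith) (by linarith))

theorem OnArc.tendsto_O {Y : ℂ → ℂ} (h : OnArc c1 c2 a b a' b' s1 C θ Y E O k n) (hC : 0 ≤ C)
    (hr : IsRay c1 c2 κ 1 φ) (hκ : 0 < κ) (h1 : θ ≤ φ) (h2 : φ ≤ θ + π / 2) : Tendsto
    (fun s : ℝ => O (circ s φ)) atTop (𝓝 n) := by
  refine tendsto_exp_neg_mul (s1 := s1) (wt_ray_le hr hκ a b φ (by simp)) (fun s hs => ?_) hC
  simpa [circ] using h.O_le _ (mem_strip_ray hs (by linarith) (by linarith))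

theorem Sectors.tendsto_integral {β1 β2 : MatForm} {b₁ b₂ : ℂ} {v : ℕ → ℂ → Fin 2 → ℂ}
    (h : Sectors A c1 c2 a b κ Θ m0 s1 C v) (hβ1 : IsVariation A β1 a1 b₁ s1 C)
    (hβ2 : IsVariation A β2 a2 b₂ s1 C) {S : ℂ} (hS2 : ∀ z, v 2 z = v 0 z + S • v 1 z) (hS : S ≠ 0)
    : ∃ q1 q2 : ℂ, IsStokesVariation v β1 a1 b₁ Θ S q1 ∧ IsStokesVariation v β2 a2 b₂ Θ S q2 ∧
    Tendsto (fun s : ℝ => (∫ z in closedBall (0 : ℂ) (rexp s), trWedge (β1 z) (β2 z)) - 4 * π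
    * s * ((a1 + b₁) * lin a2 b₂ I - (a2 + b₂) * lin a1 b₁ I)) atTop
    (𝓝 (2 * π * (q1 * lin a2 b₂ I - q2 * lin a1 b₁ I))) := by
  have hπ := Real.pi_pos
  have hκ := h.κ_pos
  obtain ⟨S1, hS3⟩ := h.exists_stokes 1
  obtain ⟨S2, hS4⟩ := h.exists_stokes 2
  obtain ⟨C1, Y, E, O, E', O', n, n', hC₁, hY, hE, hO, eE, eO, A0, A1, A2, A3, hk⟩ :=
    h.exists_arcs hβ1 hS2 hS3 hS4 hS
  obtain ⟨C2, Z, F, U, F', U', p, p', hC2, hZ, hF, hU, eF, eU, B0, B1, B2, B3, hl⟩ :=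
    h.exists_arcs hβ2 hS2 hS3 hS4 hS
  have R0 : IsRay c1 c2 κ 0 Θ := h.ray
  have R1 : IsRay c1 c2 κ 1 (Θ + π / 2) := by simpa [par] using h.ray.nat 1
  have R2 : IsRay c1 c2 κ 0 (Θ + 2 * (π / 2)) := by simpa [par] using h.ray.nat 2
  have R3 : IsRay c1 c2 κ 1 (Θ + 3 * (π / 2)) := by simpa [par] using h.ray.nat 3
  have R4 : IsRay c1 c2 κ 0 (Θ + 4 * (π / 2)) := by simpa [par] using h.ray.nat 4
  have hvar : ∀ {β : MatForm} {a' b' : ℂ} {C' : ℝ} {Y E O E' : ℂ → ℂ} {n : ℂ}, 0 ≤ C' →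
      (∀ z, HasFDerivAt Y (dform β (v 0) (v 1) z) z) →
      (∀ z, HasFDerivAt E (dform β (v 0) (v 0) z) z) →
      (∀ z, E' z = E z + 2 * S * Y z + S ^ 2 * O z) →
      OnArc c1 c2 a b a' b' s1 C' Θ Y E O 0 n →
      OnArc c1 c2 a b a' b' s1 C' (Θ + π / 2) (fun z => Y z + S * O z) E' O (S * n) n →
      IsStokesVariation v β a' b' Θ S (S * n) := by
    intro β a' b' C' Y E O E' n hC' hY hE eE A0 A1
    refine ⟨fun z => E z + S * Y z, fun z => ?_, ?_, ?_⟩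
    · have : v 2 = fun z => v 0 z + S • v 1 z := funext hS2
      rw [this, dform_right]
      exact (hE z).add ((hY z).const_mul S)
    · have h1 := A0.tendsto_E hC' R0 hκ le_rfl (by linarith)
      have h2 := (A0.tendsto_Y hC' (φ := Θ) le_rfl (by linarith)).const_mul S
      have := h1.add h2
      rw [mul_zero, add_zero] at this
      exact this.congr fun s => by simp only [circ]; ring
    · rw [show Θ + 2 * (π / 2) = Θ + π by ring] at R2
      have h1 := A1.tendsto_E hC' R2 hκ (by linarith) (by linarith)
      have h2 := (A1.tendsto_Y hC' (φ := Θ + π) (by linarith) (by linarith)).const_mul S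
      have := h1.sub h2
      rw [zero_sub] at this
      refine this.congr fun s => ?_
      simp only [circ, eE]
      ring
  refine ⟨S * n, S * p, hvar hC₁ hY hE eE A0 A1, hvar hC2 hZ hF eF B0 B1, ?_⟩
  have hAc := h.smooth.continuous
  have cd : ∀ {β : MatForm} {G : ℂ → ℂ} (i j : ℕ), ContDiff ℝ ∞ β →
      (∀ z, HasFDerivAt G (dform β (v i) (v j) z) z) → ContDiff ℝ 2 G := fun i j hβ hG =>
    contDiff_primitive hG (contDiff_dform hAc hβ (h.dom i).1 (h.dom j).1)
  have cY := cd 0 1 hβ1.smooth hY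
  have cE := cd 0 0 hβ1.smooth hE
  have cO := cd 1 1 hβ1.smooth hO
  have cZ := cd 0 1 hβ2.smooth hZ
  have cF := cd 0 0 hβ2.smooth hF
  have cU := cd 1 1 hβ2.smooth hU
  have uY : ∀ {Y O : ℂ → ℂ} (S : ℂ), ContDiff ℝ 2 Y → ContDiff ℝ 2 O →
      ContDiff ℝ 2 fun z => Y z + S * O z := fun S hY hO => hY.add (contDiff_const.mul hO)
  have uE : ∀ {Y O E : ℂ → ℂ} (S : ℂ), ContDiff ℝ 2 Y → ContDiff ℝ 2 O → ContDiff ℝ 2 E →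
      ContDiff ℝ 2 fun z => E z + 2 * S * Y z + S ^ 2 * O z := fun S hY hO hE =>
    (hE.add (contDiff_const.mul hY)).add (contDiff_const.mul hO)
  obtain rfl : E' = fun z => E z + 2 * S * Y z + S ^ 2 * O z := funext eE
  obtain rfl : F' = fun z => F z + 2 * S * Z z + S ^ 2 * U z := funext eF
  have cY1 := uY S cY cO
  have cZ1 := uY S cZ cU
  have cE' := uE S cY cO cE
  have cF' := uE S cZ cU cF
  set Y1 := fun z => Y z + S * O z
  set Z1 := fun z => Z z + S * U z
  set E' := fun z => E z + 2 * S * Y z + S ^ 2 * O z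
  set F' := fun z => F z + 2 * S * Z z + S ^ 2 * U z
  obtain rfl : O' = fun z => O z + 2 * S1 * Y1 z + S1 ^ 2 * E' z := funext eO
  obtain rfl : U' = fun z => U z + 2 * S1 * Z1 z + S1 ^ 2 * F' z := funext eU
  have cY2 := uY S1 cY1 cE'
  have cZ2 := uY S1 cZ1 cF'
  have cO' := uE S1 cY1 cE' cO
  have cU' := uE S1 cZ1 cF' cU
  set Y2 := fun z => Y1 z + S1 * E' z
  set Z2 := fun z => Z1 z + S1 * F' z
  set O' := fun z => O z + 2 * S1 * Y1 z + S1 ^ 2 * E' z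
  set U' := fun z => U z + 2 * S1 * Z1 z + S1 ^ 2 * F' z
  have cY3 := uY S2 cY2 cO'
  have cZ3 := uY S2 cZ2 cU'
  have cE3 := uE S2 cY2 cO' cE'
  have cF3 := uE S2 cZ2 cU' cF'
  set Y3 := fun z => Y2 z + S2 * O' z
  set Z3 := fun z => Z2 z + S2 * U' z
  set E3 := fun z => E' z + 2 * S2 * Y2 z + S2 ^ 2 * O' z
  set F3 := fun z => F' z + 2 * S2 * Z2 z + S2 ^ 2 * U' z
  have df : ∀ {G : ℂ → ℂ}, ContDiff ℝ 2 G → Differentiable ℝ G := fun h =>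
    h.differentiable two_ne_zero
  have mono : ∀ {a' b' : ℂ} {C' θ : ℝ} {Y E O : ℂ → ℂ} {k n : ℂ}, C' ≤ max C1 C2 →
      OnArc c1 c2 a b a' b' s1 C' θ Y E O k n →
      OnArc c1 c2 a b a' b' s1 (max C1 C2) θ Y E O k n := by
    intro a' b' C' θ Y E O k n hle h
    have h0 : ∀ ξ, 0 ≤ wt c1 c2 a b 0 ξ := fun ξ => (Real.exp_pos _).le
    have h1 : ∀ ξ, 0 ≤ wt c1 c2 a b 1 ξ := fun ξ => (Real.exp_pos _).le
    refine ⟨fun ξ hξ => (h.Y_le ξ hξ).trans ?_, fun ξ hξ => (h.E_le ξ hξ).trans ?_,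
      fun ξ hξ => (h.O_le ξ hξ).trans ?_, fun ξ hξ w => (h.dY_le ξ hξ w).trans ?_,
      fun ξ hξ w => (h.dE_le ξ hξ w).trans ?_, fun ξ hξ w => (h.dO_le ξ hξ w).trans ?_⟩ <;>
    have := h0 ξ <;> have := h1 ξ <;> gcongr
  have hC : 0 ≤ max C1 C2 := le_max_of_le_left hC₁
  replace A0 := mono (le_max_left C1 C2) A0
  replace A1 := mono (le_max_left C1 C2) A1
  replace A2 := mono (le_max_left C1 C2) A2
  replace A3 := mono (le_max_left C1 C2) A3
  replace B0 := mono (le_max_right C1 C2) B0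
  replace B1 := mono (le_max_right C1 C2) B1
  replace B2 := mono (le_max_right C1 C2) B2
  replace B3 := mono (le_max_right C1 C2) B3
  have I0 := arc_integral hC A0 B0 cY cE cO cZ cF cU
  have I1 := arc_integral hC A1 B1 cY1 cE' cO cZ1 cF' cU
  have I2 := arc_integral hC A2 B2 cY2 cE' cO' cZ2 cF' cU'
  have I3 := arc_integral hC A3 B3 cY3 cE3 cO' cZ3 cF3 cU'
  have p1 : ∀ z w, potential Y1 E' O Z1 F' U z w = potential Y E O Z F U z w :=
    potential_unipotent (df cY) (df cE) (df cO) (df cZ) (df cF) (df cU) S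
  have p2 : ∀ z w, potential Y2 E' O' Z2 F' U' z w = potential Y E O Z F U z w := by
    intro z w
    rw [potential_swap, ← p1, potential_swap Y1]
    exact potential_unipotent (df cY1) (df cO) (df cE') (df cZ1) (df cU) (df cF') S1 z w
  have p3 : ∀ z w, potential Y3 E3 O' Z3 F3 U' z w = potential Y E O Z F U z w := by
    intro z w
    rw [← p2]
    exact potential_unipotent (df cY2) (df cE') (df cO') (df cZ2) (df cF') (df cU') S2 z w
  simp only [p1] at I1
  simp only [p2] at I2
  simp only [p3] at I3
  rw [show Θ + π / 2 + π / 2 = Θ + 2 * (π / 2) by ring] at I1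
  rw [show Θ + 2 * (π / 2) + π / 2 = Θ + 3 * (π / 2) by ring] at I2
  rw [show Θ + 3 * (π / 2) + π / 2 = Θ + 4 * (π / 2) by ring] at I3
  have tE0 := A0.tendsto_E hC R0 hκ le_rfl (by linarith)
  have tF0 := B0.tendsto_E hC R0 hκ le_rfl (by linarith)
  have tE2 := A1.tendsto_E hC R2 hκ (by linarith) (by linarith)
  have tF2 := B1.tendsto_E hC R2 hκ (by linarith) (by linarith)
  have tE4 := A3.tendsto_E hC R4 hκ (by linarith) (by linarith)
  have tF4 := B3.tendsto_E hC R4 hκ (by linarith) (by linarith)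
  have tO1 := A0.tendsto_O hC R1 hκ (by linarith) (by linarith)
  have tU1 := B0.tendsto_O hC R1 hκ (by linarith) (by linarith)
  have tO3 := A2.tendsto_O hC R3 hκ (by linarith) (by linarith)
  have tU3 := B2.tendsto_O hC R3 hκ (by linarith) (by linarith)
  have tY1 := A0.tendsto_Y hC (φ := Θ + π / 2) (by linarith) (by linarith)
  have tZ1 := B0.tendsto_Y hC (φ := Θ + π / 2) (by linarith) (by linarith)
  have tY3 := A2.tendsto_Y hC (φ := Θ + 3 * (π / 2)) (by linarith) (by linarith)
  have tZ3 := B2.tendsto_Y hC (φ := Θ + 3 * (π / 2)) (by linarith) (by linarith)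
  set N1 := lin a1 b₁ I with hN1
  set N2 := lin a2 b₂ I with hN2
  rw [show I * (a1 - b₁) = N1 by simp [hN1, lin]; ring] at hk
  rw [show I * (a2 - b₂) = N2 by simp [hN2, lin]; ring] at hl
  have W : ∀ {f g : ℝ → ℂ} {x y : ℂ} (n p : ℂ), Tendsto f atTop (𝓝 x) → Tendsto g atTop (𝓝 y) →
      Tendsto (fun s => n * g s - p * f s) atTop (𝓝 (n * y - p * x)) := fun n p hf hg =>
    (hg.const_mul n).sub (hf.const_mul p)
  have total := ((((I0.add I1).add I2).add I3).add
    ((((W n p tE0 tF0).sub (W n p tE2 tF2)).add ((W n' p' tE2 tF2).sub (W n' p' tE4 tF4))).const_mul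
      (1 / 2))).add (((((W n p tO1 tU1).const_mul (S ^ 2 / 2)).add ((W n p tY1 tZ1).const_mul S)).add
      ((W n' p' tO3 tU3).const_mul (S2 ^ 2 / 2))).add ((W n' p' tY3 tZ3).const_mul S2))
  refine (total.congr fun s => ?_).trans (le_of_eq (congrArg 𝓝 ?_))
  · set P : ℝ → ℂ := fun x => potential Y E O Z F U (circ s x) (circ s x * I)
    have hint : (∫ z in closedBall (0 : ℂ) (rexp s), trWedge (β1 z) (β2 z))
        = (∫ x in Θ..(Θ + π / 2), P x) + (∫ x in (Θ + π / 2)..(Θ + 2 * (π / 2)), P x)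
        + (∫ x in (Θ + 2 * (π / 2))..(Θ + 3 * (π / 2)), P x)
        + ∫ x in (Θ + 3 * (π / 2))..(Θ + 4 * (π / 2)), P x := by
      have hi : ∀ x y : ℝ, IntervalIntegrable P volume x y :=
        (continuous_potential cY cE cO cZ cF cU s).intervalIntegrable
      rw [intervalIntegral.integral_add_adjacent_intervals (hi _ _) (hi _ _),
        intervalIntegral.integral_add_adjacent_intervals (hi _ _) (hi _ _),
        intervalIntegral.integral_add_adjacent_intervals (hi _ _) (hi _ _),
        show Θ + 4 * (π / 2) = Θ + 2 * π by ring]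
      refine integral_trWedge hβ1.traceless hβ2.traceless (v0 := v 0) (v₁ := v 1)
        (fun z => ?_) cY cE cO cZ cF cU
        (fun z => (hY z).fderiv) (fun z => (hE z).fderiv) (fun z => (hO z).fderiv)
        (fun z => (hZ z).fderiv) (fun z => (hF z).fderiv) (fun z => (hU z).fderiv) s Θ
      rw [h.wr_succ 0 z]
      simp [par, sg]
    rw [hint]
    simp only [lin_apply, ← hN1, ← hN2]
    have u1 z : E' z = E z + 2 * S * Y z + S ^ 2 * O z := rfl
    have u2 z : F' z = F z + 2 * S * Z z + S ^ 2 * U z := rfl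
    have u3 z : E3 z = E' z + 2 * S2 * Y2 z + S2 ^ 2 * O' z := rfl
    have u4 z : F3 z = F' z + 2 * S2 * Z2 z + S2 ^ 2 * U' z := rfl
    rw [u1 (circ s (Θ + π / 2)), u2 (circ s (Θ + π / 2)),
      u3 (circ s (Θ + 3 * (π / 2))), u4 (circ s (Θ + 3 * (π / 2)))]
    have v (Y : ℂ → ℂ) (θ : ℝ) : Y (exp (s + θ * I)) = Y (circ s θ) := rfl
    rw [v Y, v Z, v Y2, v Z2]
    push_cast
    clear_value Y1 Z1 E' F' Y2 Z2 O' U' Y3 Z3 E3 F3 N1 N2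
    linear_combination (-(s : ℂ) * (a2 + b₂) - (π / 2 + Θ + 3 * (π / 2)) * N2) * hk
      + ((s : ℂ) * (a1 + b₁) + (π / 2 + Θ + 3 * (π / 2)) * N1) * hl
  · linear_combination (S * p) * hk - (S * n) * hl

/-! ### Families of flat connections -/

/-- A smooth family of flat traceless connections, with uniform asymptotics. -/
structure FlatFamily (A : ℝ → MatForm) (c1 c2 : ℂ) (a b : ℝ → ℂ) (a' b' : ℂ) (s0 C : ℝ) :
    Prop where
  smooth : ContDiff ℝ ∞ fun p : ℝ × ℂ => A p.1 p.2
  flat : ∀ t z, curvature (A t) z = 0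
  traceless : ∀ t z v, A t z 0 0 v + A t z 1 1 v = 0
  continuous_a : Continuous a
  continuous_b : Continuous b
  hasDerivAt_a : HasDerivAt a a' 0
  hasDerivAt_b : HasDerivAt b b' 0
  C_nonneg : 0 ≤ C
  asymp : ∀ t ∈ Icc (-1 : ℝ) 1, HasAsymp (A t) c1 c2 (a t) (b t) s0 C
  lip : ∀ t ∈ Icc (-1 : ℝ) 1, ∀ ξ : ℂ, s0 ≤ ξ.re → ∀ v i j,
    ‖remd (A t) c1 c2 (a t) (b t) ξ v i j - remd (A 0) c1 c2 (a 0) (b 0) ξ v i j‖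
      ≤ C * |t| * rexp (-ξ.re) * ‖v‖

namespace FlatFamily

variable {A : ℝ → MatForm} {c1 c2 : ℂ} {a b : ℝ → ℂ} {a' b' : ℂ} {s0 C : ℝ}

theorem smooth_apply (h : FlatFamily A c1 c2 a b a' b' s0 C) (t : ℝ) : ContDiff ℝ ∞ (A t) :=
  h.smooth.comp (contDiff_const.prodMk contDiff_id)

theorem isVariation (h : FlatFamily A c1 c2 a b a' b' s0 C) :
    IsVariation (A 0) (dotForm A) a' b' s0 C where
  smooth := contDiff_dotForm h.smooth
  traceless := dotForm_traceless h.smooth h.traceless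
  closed := dotForm_closed h.smooth h.flat
  asymp := by
    intro ξ hξ v i j
    have h1 := hasDerivAt_entry h.smooth (exp ξ) i j (exp ξ * v)
    have h2 : HasDerivAt (fun t => expoD c1 c2 (a t) (b t) ξ v * matH i j)
        ((a' * v + b' * conj v) * matH i j) 0 :=
      (((h.hasDerivAt_a.mul_const v).add (h.hasDerivAt_b.mul_const (conj v))).const_add
        (c1 * exp (2 * ξ) * v + c2 * exp (2 * conj ξ) * conj v)).mul_const (matH i j)
    have hC := h.C_nonneg
    refine (h1.sub h2).le_of_lip' (by positivity) ?_
    filter_upwards [Icc_mem_nhds (show (-1 : ℝ) < 0 by norm_num) one_pos] with t ht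
    refine (h.lip t ht ξ hξ v i j).trans (le_of_eq ?_)
    rw [sub_zero, Real.norm_eq_abs]
    ring

theorem exists_dom (h : FlatFamily A c1 c2 a b a' b' s0 C) (hκ : 0 < κ) (hray : IsRay c1 c2 κ 0 Θ) :
    ∃ (s1 C1 : ℝ) (ψ : ℕ → ℝ → ℂ → Fin 2 → ℂ), s0 ≤ s1 ∧ 0 ≤ C1 ∧ ∀ k, ∀ t ∈ Icc (-1 : ℝ) 1, IsDom
    (A t) c1 c2 (a t) (b t) (par k) (Θ + k * (π / 2)) s1 C1 (ψ k t) := by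
  obtain ⟨m1, hm1⟩ := (isCompact_Icc (a := (-1 : ℝ)) (b := 1)).exists_bound_of_continuousOn
    h.continuous_a.continuousOn
  obtain ⟨m2, hm2⟩ := (isCompact_Icc (a := (-1 : ℝ)) (b := 1)).exists_bound_of_continuousOn
    h.continuous_b.continuousOn
  set m0 := max m1 m2
  set K := rexp (2 * (π * m0)) with hK
  have e1 : ∀ᶠ s : ℝ in atTop, m0 ≤ κ * rexp (2 * s) :=
    ((Real.tendsto_exp_atTop.comp (tendsto_id.const_mul_atTop two_pos)).const_mul_atTop
      hκ).eventually_ge_atTop m0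
  have e2 : ∀ᶠ s : ℝ in atTop, 8 * K * (C * rexp (-s)) ≤ 1 := by
    have := (tendsto_C_exp_neg C).const_mul (8 * K)
    rw [mul_zero] at this
    exact this.eventually_le_const one_pos
  obtain ⟨s1, hs1, hs2, hs3⟩ := (e1.and (e2.and (eventually_ge_atTop s0))).exists
  have hC := h.C_nonneg
  have key : ∀ (k : ℕ) (t : ℝ), ∃ ψ, t ∈ Icc (-1 : ℝ) 1 →
      IsDom (A t) c1 c2 (a t) (b t) (par k) (Θ + k * (π / 2)) s1 (10 * K ^ 2 * C) ψ := by
    intro k t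
    by_cases ht : t ∈ Icc (-1 : ℝ) 1
    · obtain ⟨ψ, hψ⟩ := _root_.exists_dom (h.smooth_apply t) (h.flat t) (h.traceless t)
        (h.asymp t ht) hC (hray.nat k) hκ ((hm1 t ht).trans (le_max_left _ _))
        ((hm2 t ht).trans (le_max_right _ _)) hs3 hK hs1 hs2
      exact ⟨ψ, fun _ => hψ⟩
    · exact ⟨0, fun h => absurd h ht⟩
  choose ψ hψ using key
  exact ⟨s1, 10 * K ^ 2 * C, ψ, hs3, by positivity, hψ⟩

end FlatFamily

/-- The connection form with the two basis vectors exchanged if `i = 1`. -/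
def shift (i : Fin 2) (A : MatForm) : MatForm := fun z j k => A z (i + j) (i + k)

theorem matH_shift (i j k : Fin 2) : matH (i + j) (i + k) = sg i * matH j k := by
  fin_cases i <;> fin_cases j <;> fin_cases k <;> simp [matH, sg]

theorem curvature_apply (A : MatForm) (z : ℂ) (i j : Fin 2) :
    curvature A z i j = fderiv ℝ A z 1 i j I - fderiv ℝ A z I i j 1
      + ((A z i 0 1 * A z 0 j I + A z i 1 1 * A z 1 j I)
        - (A z i 0 I * A z 0 j 1 + A z i 1 I * A z 1 j 1)) := by
  simp [curvature, MatCovector.eval, Matrix.mul_apply, Fin.sum_univ_two]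

/-- Exchange of basis vectors, as a linear map. -/
def shiftL (i : Fin 2) : MatCovector →L[ℝ] MatCovector :=
  ContinuousLinearMap.pi fun j => ContinuousLinearMap.pi fun k =>
    (ContinuousLinearMap.proj (R := ℝ) (φ := fun _ : Fin 2 => ℂ →L[ℝ] ℂ) (i + k)).comp
      (ContinuousLinearMap.proj (R := ℝ) (φ := fun _ : Fin 2 => Fin 2 → ℂ →L[ℝ] ℂ) (i + j))

theorem curvature_shift (hA : Differentiable ℝ A) (i : Fin 2) (h : ∀ z, curvature A z = 0) (z : ℂ) :
    curvature (shift i A) z = 0 := by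
  have hd : fderiv ℝ (shift i A) z = (shiftL i).comp (fderiv ℝ A z) :=
    ((shiftL i).hasFDerivAt.comp z (hA z).hasFDerivAt).fderiv
  ext j k
  have := congrFun (congrFun (h z) (i + j)) (i + k)
  rw [curvature_apply] at this
  rw [curvature_apply, hd]
  simp only [ContinuousLinearMap.comp_apply, shiftL, ContinuousLinearMap.pi_apply,
    ContinuousLinearMap.proj_apply, shift]
  refine Eq.trans ?_ this
  fin_cases i
  · simp
  · simp; ring

theorem singularPart_exp (ζ m : ℂ) (m3 : ℝ) (ξ v : ℂ) :
    singularPart ζ m m3 (exp (-ξ)) (-(exp (-ξ) * v))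
      = expoD ζ⁻¹ ζ (ζ⁻¹ * m - m3 / 2) (ζ * conj m + m3 / 2) ξ v := by
  have hc : conj (exp (-ξ)) = exp (-conj ξ) := by rw [← exp_conj]; simp
  have h1 : ∀ x : ℂ, exp (2 * x) = (exp (-x))⁻¹ ^ 2 := fun x => by
    rw [exp_neg, inv_inv, ← exp_nat_mul]; simp
  have hne := fun x : ℂ => exp_ne_zero (-x)
  simp only [singularPart, expoD, h1, map_neg, map_mul, hc]
  have := hne ξ
  have := hne (conj ξ)
  field_simp
  ring

theorem FramedPath.exists_flatFamily {D : FramedConnection ζ} (P : FramedPath D) (i : Fin 2) : ∃ s0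
    C, FlatFamily (fun t => shift i (P.conn t).A) (sg i * ζ⁻¹) (sg i * ζ)
    (fun t => sg i * (ζ⁻¹ * (P.conn t).m - (P.conn t).m3 / 2))
    (fun t => sg i * (ζ * conj (P.conn t).m + (P.conn t).m3 / 2)) (sg i * (ζ⁻¹ * deriv (fun t =>
    (P.conn t).m) 0 - deriv (fun t => (P.conn t).m3) 0 / 2)) (sg i * (ζ * conj (deriv (fun t =>
    (P.conn t).m) 0) + deriv (fun t => (P.conn t).m3) 0 / 2)) s0 C := by
  obtain ⟨ρ, hρ, B, hB, hfr⟩ := P.framed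
  set U : Set (ℝ × ℂ) := univ ×ˢ ball 0 ρ
  set K : Set (ℝ × ℂ) := Icc (-1 : ℝ) 1 ×ˢ closedBall 0 (ρ / 2)
  have hKU : K ⊆ U := prod_mono (subset_univ _) (Metric.closedBall_subset_ball (by linarith))
  have hUo : IsOpen U := isOpen_univ.prod Metric.isOpen_ball
  have hKc : IsCompact K := isCompact_Icc.prod (isCompact_closedBall _ _)
  have hKv : Convex ℝ K := (convex_Icc _ _).prod (convex_closedBall _ _)
  obtain ⟨M1, hM1⟩ := hKc.exists_bound_of_continuousOn (hB.continuousOn.mono hKU)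
  obtain ⟨M2, hM2⟩ := hKc.exists_bound_of_continuousOn
    ((hB.continuousOn_fderiv_of_isOpen hUo (by simp)).mono hKU)
  have hL : ∀ t ∈ Icc (-1 : ℝ) 1, ∀ w : ℂ, ‖w‖ ≤ ρ / 2 → ‖B t w - B 0 w‖ ≤ M2 * |t| := by
    intro t ht w hw
    have hw' : w ∈ closedBall (0 : ℂ) (ρ / 2) := by simpa using hw
    have := hKv.norm_image_sub_le_of_norm_fderiv_le (f := fun p : ℝ × ℂ => B p.1 p.2)
      (fun p hp => ((hB.contDiffAt (hUo.mem_nhds (hKU hp))).differentiableAt (by simp)))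
      hM2 (x := ((0 : ℝ), w)) (y := (t, w)) ⟨by norm_num, hw'⟩ ⟨ht, hw'⟩
    simpa [Prod.norm_def] using this
  set C := max (max M1 M2) 0
  have hM₁C : M1 ≤ C := (le_max_left _ _).trans (le_max_left _ _)
  have hM₂C : M2 ≤ C := (le_max_right _ _).trans (le_max_left _ _)
  set s0 := -Real.log (ρ / 2)
  have hw : ∀ ξ : ℂ, s0 ≤ ξ.re → ‖exp (-ξ)‖ ≤ ρ / 2 := by
    intro ξ hξ
    rw [norm_exp, ← Real.exp_log (show 0 < ρ / 2 by linarith), Real.exp_le_exp]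
    simp
    linarith
  have hrem : ∀ (t : ℝ) (ξ : ℂ), s0 ≤ ξ.re → ∀ v j k,
      remd (shift i (P.conn t).A) (sg i * ζ⁻¹) (sg i * ζ)
        (sg i * (ζ⁻¹ * (P.conn t).m - (P.conn t).m3 / 2))
        (sg i * (ζ * conj (P.conn t).m + (P.conn t).m3 / 2)) ξ v j k
      = B t (exp (-ξ)) (i + j) (i + k) (-(exp (-ξ) * v)) := by
    intro t ξ hξ v j k
    have h1 := hfr t (exp (-ξ)) (exp_ne_zero _) ((hw ξ hξ).trans_lt (by linarith)) (-(exp (-ξ) * v))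
    have h2 := congrFun (congrFun h1 (i + j)) (i + k)
    rw [singularPart_exp] at h2
    have e : -(-(exp (-ξ) * v) / exp (-ξ) ^ 2) = exp ξ * v := by
      rw [exp_neg]
      have := exp_ne_zero ξ
      field_simp
    rw [e, ← exp_neg, neg_neg] at h2
    simp only [MatCovector.eval, Matrix.of_apply, Matrix.add_apply, Matrix.smul_apply,
      smul_eq_mul, matH_shift] at h2
    simp only [remd, shift, h2, expoD]
    ring
  have happ : ∀ (T : MatCovector) (j k : Fin 2) (ξ v : ℂ),
      ‖T j k (-(exp (-ξ) * v))‖ ≤ ‖T‖ * rexp (-ξ.re) * ‖v‖ := by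
    intro T j k ξ v
    refine ((T j k).le_opNorm _).trans ?_
    rw [norm_neg, norm_mul, norm_exp, neg_re, ← mul_assoc]
    gcongr
    exact (norm_le_pi_norm (T j) k).trans (norm_le_pi_norm T j)
  have hd : ∀ t, ContDiff ℝ ∞ (P.conn t).A := fun t => (P.conn t).smooth
  have hdm : HasDerivAt (fun t => (P.conn t).m) (deriv (fun t => (P.conn t).m) 0) 0 :=
    (P.smooth_m.differentiable (by simp) 0).hasDerivAt
  have hdm3 : HasDerivAt (fun t => ((P.conn t).m3 : ℂ)) ((deriv (fun t => (P.conn t).m3) 0 : ℝ) : ℂ) 0 :=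
    (P.smooth_m3.differentiable (by simp) 0).hasDerivAt.ofReal_comp
  have cm := P.smooth_m.continuous
  have cm3 := P.smooth_m3.continuous
  refine ⟨s0, C, ?_, fun t z => ?_, fun t z v => ?_, ?_, ?_, ?_, ?_, le_max_right _ _, ?_, ?_⟩
  · exact (shiftL i).contDiff.comp P.smooth
  · exact curvature_shift ((hd t).differentiable (by simp)) i (P.conn t).flat z
  · have := (P.conn t).traceless z v
    simp only [Matrix.trace, Matrix.diag, Fin.sum_univ_two, MatCovector.eval, Matrix.of_apply] at this
    fin_cases i
    · simpa [shift] using this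
    · simpa [shift, add_comm] using this
  · fun_prop
  · fun_prop
  · exact ((hdm.const_mul _).sub (hdm3.div_const 2)).const_mul _
  · exact ((hdm.star.const_mul _).add (hdm3.div_const 2)).const_mul _
  · intro t ht ξ hξ v j k
    have := hrem t ξ hξ v j k
    rw [remd] at this
    rw [this]
    refine (happ _ _ _ _ _).trans ?_
    gcongr
    exact (hM1 (t, exp (-ξ)) ⟨ht, by simpa using hw ξ hξ⟩).trans hM₁C
  · intro t ht ξ hξ v j k
    rw [hrem t ξ hξ, hrem 0 ξ hξ]
    refine (happ (B t (exp (-ξ)) - B 0 (exp (-ξ))) _ _ _ _).trans ?_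
    gcongr
    refine (hL t ht _ (hw ξ hξ)).trans ?_
    gcongr

/-! ### The variation of a Stokes multiplier -/

theorem norm_sub_limit_le {f f' : ℝ → ℂ} {D : ℝ} {L : ℂ} (hf : ∀ s, s1 ≤ s → HasDerivAt f (f' s) s)
    (hb : ∀ s, s1 ≤ s → ‖f' s‖ ≤ D * rexp (-s)) (hL : Tendsto f atTop (𝓝 L)) (hs : s1 ≤ s) : ‖f s -
    L‖ ≤ D * rexp (-s) := by
  have hD := nonneg_of_mul_nonneg_left ((norm_nonneg _).trans (hb s hs)) (Real.exp_pos _)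
  have key : ∀ S, s ≤ S → ‖f S - f s‖ ≤ D * rexp (-s) := by
    intro S hS
    have hder : ∀ x : ℝ, HasDerivAt (fun x => D * (rexp (-s) - rexp (-x))) (D * rexp (-x)) x :=
      fun x => ((((hasDerivAt_id x).neg.exp).const_sub _).const_mul D).congr_deriv (by simp)
    have hf := fun x (hx : s ≤ x) => (hf x (hs.trans hx)).sub_const (f s)
    have := image_norm_le_of_norm_deriv_right_le_deriv_boundary'
      (fun x hx => (hf x hx.1).continuousAt.continuousWithinAt)
      (fun x hx => (hf x hx.1).hasDerivWithinAt) (by simp)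
      (fun x _ => (hder x).continuousAt.continuousWithinAt) (fun x _ => (hder x).hasDerivWithinAt)
      (fun x hx => hb x (hs.trans hx.1)) (right_mem_Icc.2 hS)
    refine this.trans ?_
    gcongr
    linarith [Real.exp_pos (-S)]
  rw [norm_sub_rev]
  refine le_of_tendsto (hL.sub_const (f s)).norm ?_
  filter_upwards [eventually_ge_atTop s] with S hS using key S hS

theorem hasDerivAt_wr_gauged {P Q : ℂ → Fin 2 → ℂ} (hP : IsFlat A P) (hQ : IsFlat A' Q)
    (htr : ∀ z v, A z 0 0 v + A z 1 1 v = 0) (htr' : ∀ z v, A' z 0 0 v + A' z 1 1 v = 0)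
    (c1 c2 a b a0 b0 : ℂ) (j : Fin 2) {c : ℝ → ℂ} {c' : ℂ} (h : HasDerivAt c c' s)
    {p q : ℝ → Fin 2 → ℂ} (hp : p = fun s => gauged (expo c1 c2 a b) j P (c s))
    (hq : q = fun s => gauged (expo c1 c2 a0 b0) (j + 1) Q (c s)) {d : Fin 2 → Fin 2 → ℂ}
    (hd : d = fun i k => remd A c1 c2 a b (c s) c' i k - remd A' c1 c2 a0 b0 (c s) c' i k) :
    HasDerivAt (fun s => wr (p s) (q s)) (-2 * ((a - a0) * c' + (b - b0) * conj c') *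
      (p s (j + 1) * q s j) - d 0 0 * (p s 0 * q s 1) - d 0 1 * (p s 1 * q s 1) +
      d 1 0 * (p s 0 * q s 0) + d 1 1 * (p s 1 * q s 0)) s := by
  subst hp hq hd
  have p := fun i => hasDerivAt_gauged hP c1 c2 a b j i h
  have q := fun i => hasDerivAt_gauged hQ c1 c2 a0 b0 (j + 1) i h
  have e1 : remd A c1 c2 a b (c s) c' 1 1 = -remd A c1 c2 a b (c s) c' 0 0 := by
    simp only [remd, matH]; simp; linear_combination htr (exp (c s)) (exp (c s) * c')
  have e2 : remd A' c1 c2 a0 b0 (c s) c' 1 1 = -remd A' c1 c2 a0 b0 (c s) c' 0 0 := by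
    simp only [remd, matH]; simp; linear_combination htr' (exp (c s)) (exp (c s) * c')
  refine (((p 0).mul (q 1)).sub ((p 1).mul (q 0))).congr_deriv ?_
  simp only [e1, e2]
  fin_cases j <;> simp [sg, expoD] <;> ring

theorem norm_wr_gauged_sub_le {P Q : ℂ → Fin 2 → ℂ} (hP : IsFlat A P) (hQ : IsFlat A' Q)
    (htr : ∀ z v, A z 0 0 v + A z 1 1 v = 0) (htr' : ∀ z v, A' z 0 0 v + A' z 1 1 v = 0)
    {a0 b0 L : ℂ} {M : ℝ} (hδ : 0 ≤ δ) (hM : 1 ≤ M) (ha : ‖a - a0‖ ≤ δ) (hb : ‖b - b0‖ ≤ δ)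
    (hr : ∀ s : ℝ, s1 ≤ s → ∀ i k, ‖remd A c1 c2 a b (s + θ * I) 1 i k -
      remd A' c1 c2 a0 b0 (s + θ * I) 1 i k‖ ≤ δ * rexp (-s)) {p q : ℝ → Fin 2 → ℂ}
    (ep : p = fun s : ℝ => gauged (expo c1 c2 a b) j P (s + θ * I))
    (eq : q = fun s : ℝ => gauged (expo c1 c2 a0 b0) (j + 1) Q (s + θ * I))
    (hp : ∀ s, s1 ≤ s → ∀ i, ‖p s i‖ ≤ M) (hq : ∀ s, s1 ≤ s → ∀ i, ‖q s i‖ ≤ M)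
    (hpq : ∀ s, s1 ≤ s → ‖p s (j + 1) * q s j‖ ≤ M ^ 2 * rexp (-s))
    (hL : Tendsto (fun s => wr (p s) (q s)) atTop (𝓝 L)) (hs : s1 ≤ s) :
    ‖wr (p s) (q s) - L‖ ≤ 8 * M ^ 2 * δ * rexp (-s) := by
  refine norm_sub_limit_le (fun s _ => hasDerivAt_wr_gauged hP hQ htr htr' c1 c2 a b a0 b0 j
    (c := fun s : ℝ => (s + θ * I : ℂ)) (c' := 1) (ofRealCLM.hasDerivAt.add_const _) ep eq rfl) (fun s hs => ?_) hL hs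
  have e := Real.exp_pos (-s)
  have ht : ∀ {x : ℂ} i k, ‖x‖ ≤ δ * rexp (-s) → ‖x * (p s i * q s k)‖ ≤ δ * rexp (-s) * M ^ 2 := by
    intro x i k h
    rw [norm_mul, norm_mul, sq]
    exact mul_le_mul h (mul_le_mul (hp s hs _) (hq s hs _) (norm_nonneg _) (by linarith))
      (by positivity) (by positivity)
  have h0 : ‖-2 * ((a - a0) * 1 + (b - b0) * conj 1) * (p s (j + 1) * q s j)‖
      ≤ 2 * (δ + δ) * (M ^ 2 * rexp (-s)) := by
    rw [norm_mul, norm_mul]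
    refine mul_le_mul (mul_le_mul (by simp) ?_ (norm_nonneg _) (by norm_num)) (hpq s hs)
      (norm_nonneg _) (by positivity)
    simpa using (norm_add_le _ _).trans (add_le_add ha hb)
  have hr := hr s hs
  refine (norm_add_le _ _).trans ((add_le_add ((norm_add_le _ _).trans (add_le_add
    ((norm_sub_le _ _).trans (add_le_add ((norm_sub_le _ _).trans (add_le_add h0
    (ht 0 1 (hr 0 0)))) (ht 1 1 (hr 0 1)))) (ht 0 0 (hr 1 0))))
    (ht 1 0 (hr 1 1))).trans (le_of_eq ?_))
  ring

theorem wr_three {x y z : Fin 2 → ℂ} (h : wr x y = 1) (h' : wr y z = -1) : z = x + wr x z • y := by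
  simp only [wr] at h h'
  ext i
  fin_cases i <;> simp [wr]
  exacts [by linear_combination (-z 0) * h - x 0 * h', by linear_combination (-z 1) * h - x 1 * h']

theorem grow_bound {θ1 : ℝ} {φ : ℂ → Fin 2 → ℂ} (h0 : IsDom A c1 c2 a b 0 θ0 s1 C ψ)
    (h1 : IsDom A c1 c2 a b 1 θ1 s1 C φ) (hθ0 : |θ - θ0| ≤ π / 2) (hθ1 : |θ - θ1| ≤ π / 2)
    (hC : 0 ≤ C) (e : ∀ z, χ z = ψ z + k • φ z) (hs : s1 ≤ s) (hs0 : 0 ≤ s)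
    (hg : 0 ≤ (expo c1 c2 a b (s + θ * I)).re) (i : Fin 2) : ‖gauged (expo c1 c2 a b) 1 χ
    (s + θ * I) i‖ ≤ (1 + C) * (1 + ‖k‖) := by
  set g := expo c1 c2 a b
  have e2 : gauged g 1 χ (s + θ * I) i = exp (-(2 * g (s + θ * I))) * gauged g 0 ψ (s + θ * I) i
      + k * gauged g 1 φ (s + θ * I) i := by
    have : exp (-(2 * g (s + θ * I))) * exp (g (s + θ * I)) = exp (-g (s + θ * I)) := by
      rw [← exp_add]; congr 1; ring
    simp [gauged, e, sg]
    linear_combination (-ψ (exp (s + θ * I)) i) * this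
  have hle : rexp (-s) ≤ 1 := Real.exp_le_one_iff.2 (by linarith)
  have bd : ∀ {j : Fin 2} {ψ : ℂ → Fin 2 → ℂ} {θ0 : ℝ}, IsDom A c1 c2 a b j θ0 s1 C ψ →
      |θ - θ0| ≤ π / 2 → ∀ i, ‖gauged g j ψ (s + θ * I) i‖ ≤ 1 + C := by
    intro j ψ θ0 h hθ i
    have := h.2 (s + θ * I) (by simpa using hs) (by simpa using hθ)
    rw [show (s + θ * I : ℂ).re = s by simp] at this
    have hC1 : C * rexp (-s) ≤ C := mul_le_of_le_one_right hC hle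
    refine (norm_le_pi_norm _ i).trans (norm_le_of_pair (j := j) ?_ ?_)
    · have h2 := norm_add_le (gauged g j ψ (s + θ * I) j - 1) 1
      simp only [sub_add_cancel, norm_one] at h2
      linarith [this.1]
    · linarith [this.2]
  rw [e2]
  refine (norm_add_le _ _).trans ?_
  rw [norm_mul, norm_mul, norm_exp]
  have h3 : rexp (-(2 * g (s + θ * I))).re ≤ 1 := by rw [Real.exp_le_one_iff]; simp; linarith
  have h4 := mul_le_mul h3 (bd h0 hθ0 i) (norm_nonneg _) zero_le_one
  have h5 := mul_le_mul_of_nonneg_left (bd h1 hθ1 i) (norm_nonneg k)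
  linarith

theorem grow_tendsto {θ1 : ℝ} {φ : ℂ → Fin 2 → ℂ} (hray : IsRay c1 c2 κ 0 θ0) (hκ : 0 < κ)
    (h0 : IsDom A c1 c2 a b 0 θ0 s1 C ψ) (h1 : IsDom A c1 c2 a b 1 θ1 s1' C' φ)
    (hθ0 : |θ - θ0| ≤ π / 2) (hθ1 : |θ - θ1| ≤ π / 2) (hc : 0 < Real.cos (2 * (θ - θ0)))
    (e : ∀ z, χ z = ψ z + k • φ z) : Tendsto
    (fun s : ℝ => gauged (expo c1 c2 a b) 1 χ (s + θ * I) 0) atTop (𝓝 0) ∧ Tendsto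
    (fun s : ℝ => gauged (expo c1 c2 a b) 1 χ (s + θ * I) 1) atTop (𝓝 k) := by
  set g := expo c1 c2 a b with hgdef
  have e2 : ∀ (s : ℝ) i, exp (-(2 * g (s + θ * I))) * gauged g 0 ψ (s + θ * I) i
      + k * gauged g 1 φ (s + θ * I) i = gauged g 1 χ (s + θ * I) i := by
    intro s i
    have : exp (-(2 * g (s + θ * I))) * exp (g (s + θ * I)) = exp (-g (s + θ * I)) := by
      rw [← exp_add]; congr 1; ring
    simp [gauged, e, sg]
    linear_combination (ψ (exp (s + θ * I)) i) * this
  have hexp : Tendsto (fun s : ℝ => exp (-(2 * g (s + θ * I)))) atTop (𝓝 0) := by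
    rw [tendsto_zero_iff_norm_tendsto_zero]
    simp only [norm_exp]
    exact Real.tendsto_exp_atBot.comp ((tendsto_neg_atTop_atBot.comp ((tendsto_expo_ray hray hκ a b
      θ hc).const_mul_atTop two_pos)).congr fun s => by simp [sg, hgdef])
  obtain ⟨t1, t0⟩ := h0.tendsto hθ0
  obtain ⟨u1, u0⟩ := h1.tendsto hθ1
  constructor
  · have := (hexp.mul t1).add (u0.const_mul k)
    simp only [zero_mul, mul_zero, add_zero] at this
    exact this.congr fun s => e2 s 0
  · have := (hexp.mul t0).add (u1.const_mul k)
    simp only [zero_mul, zero_add, mul_one] at this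
    exact this.congr fun s => e2 s 1

theorem norm_dform_le (β : MatForm) (p q : ℂ → Fin 2 → ℂ) (z v : ℂ) {P Q : ℝ}
    (hp : ∀ i, ‖p z i‖ ≤ P) (hq : ∀ i, ‖q z i‖ ≤ Q) :
    ‖dform β p q z v‖ ≤ 4 * (P * Q) * (‖β z‖ * ‖v‖) := by
  have hP : 0 ≤ P := (norm_nonneg _).trans (hp 0)
  have ht : ∀ i j k l, ‖p z i * q z j * β z k l v‖ ≤ P * Q * (‖β z‖ * ‖v‖) := by
    intro i j k l
    rw [norm_mul, norm_mul]
    refine mul_le_mul (mul_le_mul (hp i) (hq j) (norm_nonneg _) hP)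
      (((β z k l).le_opNorm v).trans ?_) (norm_nonneg _)
      (mul_nonneg hP ((norm_nonneg _).trans (hq 0)))
    gcongr
    exact (norm_le_pi_norm (β z k) l).trans (norm_le_pi_norm (β z) k)
  simp only [dform, sub_apply, add_apply, smul_apply, smul_eq_mul]
  refine (norm_sub_le _ _).trans ((add_le_add ((norm_sub_le _ _).trans (add_le_add
    ((norm_add_le _ _).trans (add_le_add (ht 0 1 0 0) (ht 1 1 0 1))) (ht 0 0 1 0)))
    (ht 1 0 1 1)).trans (le_of_eq ?_))
  ring

theorem continuous_dform (hβ : Continuous β) (hp : Continuous p) (hq : Continuous q) : Continuous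
    (dform β p q) := by
  have h1 : ∀ i, Continuous fun z => p z i := fun i => (continuous_apply i).comp hp
  have h2 : ∀ i, Continuous fun z => q z i := fun i => (continuous_apply i).comp hq
  have h3 : ∀ i j, Continuous fun z => β z i j := fun i j =>
    (continuous_apply j).comp ((continuous_apply i).comp hβ)
  exact (((((h1 0).mul (h2 1)).smul (h3 0 0)).add (((h1 1).mul (h2 1)).smul (h3 0 1))).sub
    (((h1 0).mul (h2 0)).smul (h3 1 0))).sub (((h1 1).mul (h2 0)).smul (h3 1 1))

namespace FlatFamily

variable {A : ℝ → MatForm} {c1 c2 : ℂ} {a b : ℝ → ℂ} {a' b' : ℂ} {s0 C : ℝ}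

theorem tendsto_wr_sub (hA : ContDiff ℝ ∞ fun p : ℝ × ℂ => A p.1 p.2)
    (hflat : ∀ t z, curvature (A t) z = 0) (htr : ∀ t z v, A t z 0 0 v + A t z 1 1 v = 0)
    {ψ : ℝ → ℂ → Fin 2 → ℂ} (hψ : ∀ t ∈ Icc (-1 : ℝ) 1, IsFlat (A t) (ψ t)) (hχ : IsFlat (A 0) χ)
    (hlim : ∀ z, Tendsto (fun t => ψ t z) (𝓝 0) (𝓝 (ψ 0 z)))
    (hF : ∀ z, HasFDerivAt F (dform (dotForm A) (ψ 0) χ z) z) (z0 z2 : ℂ) : Tendsto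
    (fun t : ℝ => (t : ℂ)⁻¹ * (wr (ψ t z2) (χ z2) - wr (ψ t z0) (χ z0))) (𝓝[≠] 0)
    (𝓝 (-(F z2 - F z0))) := by
  have hAt : ∀ t, ContDiff ℝ ∞ (A t) := fun t => hA.comp (contDiff_const.prodMk contDiff_id)
  have hIcc : ∀ᶠ t : ℝ in 𝓝 0, t ∈ Icc (-1 : ℝ) 1 :=
    Icc_mem_nhds (show (-1 : ℝ) < 0 by norm_num) one_pos
  set γ : ℝ → ℂ := fun τ => z0 + τ * (z2 - z0) with hγ
  have hγd : ∀ τ : ℝ, HasDerivAt γ (z2 - z0) τ := fun τ =>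
    ((ofRealCLM.hasDerivAt.mul_const (z2 - z0)).const_add z0).congr_deriv (by simp)
  have hγc : Continuous γ := continuous_iff_continuousAt.2 fun τ => (hγd τ).continuousAt
  have hγ0 : γ 0 = z0 := by simp [hγ]
  have hγ1 : γ 1 = z2 := by simp [hγ]
  set v := z2 - z0
  obtain ⟨R, hR⟩ := (isCompact_Icc (a := (0 : ℝ)) (b := 1)).exists_bound_of_continuousOn
    hγc.continuousOn
  obtain ⟨M1, hM1⟩ : ∃ M, ∀ᶠ t in 𝓝 (0 : ℝ), ∀ z : ℂ, ‖z‖ ≤ R → ∀ i, ‖ψ t z i‖ ≤ M := by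
    choose φ0 φ1 hφ e0 e1 using fun t => exists_fundPair (hAt t) (hflat t) (htr t)
    obtain ⟨K0, hK0⟩ := norm_flat_le hA.continuous (fun t => (hφ t).flat₀) e0 R
    obtain ⟨K1, hK1⟩ := norm_flat_le hA.continuous (fun t => (hφ t).flat₁) e1 R
    set P := ‖ψ 0 0‖ + 1
    refine ⟨P * K0 + P * K1, ?_⟩
    filter_upwards [hIcc, (hlim 0).norm.eventually_le_const (lt_add_one ‖ψ 0 0‖)] with t ht hb z hz i
    have h1 := congrFun (congrFun ((hφ t).eq_sec (htr t) (hψ t ht) 0) z) i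
    have hp : ∀ i, ‖coeffs (φ0 t) (φ1 t) 0 (ψ t 0) i‖ ≤ P := by
      intro i
      refine le_trans ?_ ((norm_le_pi_norm (ψ t 0) i).trans hb)
      simp only [coeffs, e0, e1]
      fin_cases i <;> simp [wr]
    rw [h1]
    refine (norm_add_le _ _).trans ?_
    simp only [Pi.smul_apply, smul_eq_mul, norm_mul]
    have k0 := (norm_le_pi_norm (φ0 t z) i).trans (hK0 t ht z hz)
    have k1 := (norm_le_pi_norm (φ1 t z) i).trans (hK1 t ht z hz)
    have hP : 0 ≤ P := by positivity
    exact add_le_add (mul_le_mul (hp 0) k0 (norm_nonneg _) hP)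
      (mul_le_mul (hp 1) k1 (norm_nonneg _) hP)
  obtain ⟨M2, hM2⟩ : ∃ M, ∀ τ ∈ Icc (0 : ℝ) 1, ‖χ (γ τ)‖ ≤ M :=
    isCompact_Icc.exists_bound_of_continuousOn (hχ.continuous.comp hγc).continuousOn
  set K : Set (ℝ × ℂ) := Icc (-1 : ℝ) 1 ×ˢ closedBall 0 R
  have hKc : IsCompact K := isCompact_Icc.prod (isCompact_closedBall _ _)
  have hKv : Convex ℝ K := (convex_Icc _ _).prod (convex_closedBall _ _)
  obtain ⟨M3, hM3⟩ := hKc.exists_bound_of_continuousOn (hA.continuous_fderiv (by simp)).continuousOn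
  have hL : ∀ t ∈ Icc (-1 : ℝ) 1, ∀ w : ℂ, ‖w‖ ≤ R → ‖A t w - A 0 w‖ ≤ M3 * |t| := by
    intro t ht w hw
    have hw' : w ∈ closedBall (0 : ℂ) R := by simpa using hw
    have := hKv.norm_image_sub_le_of_norm_fderiv_le (fun p _ => hA.differentiable (by simp) p)
      hM3 (x := ((0 : ℝ), w)) (y := (t, w)) ⟨by norm_num, hw'⟩ ⟨ht, hw'⟩
    simpa [Prod.norm_def] using this
  have cI : ∀ t ∈ Icc (-1 : ℝ) 1,
      Continuous fun τ => -((t : ℂ)⁻¹ * dform (A t - A 0) (ψ t) χ (γ τ) v) := fun t ht =>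
    ((((continuous_dform ((hAt t).continuous.sub (hAt 0).continuous) (hψ t ht).continuous
      hχ.continuous).comp hγc).clm_apply continuous_const).const_mul _).neg
  have hI : ∀ᶠ t : ℝ in 𝓝[≠] 0, (t : ℂ)⁻¹ * (wr (ψ t z2) (χ z2) - wr (ψ t z0) (χ z0))
      = ∫ τ in (0 : ℝ)..1, -((t : ℂ)⁻¹ * dform (A t - A 0) (ψ t) χ (γ τ) v) := by
    filter_upwards [nhdsWithin_le_nhds hIcc] with t ht
    have hd : ∀ τ : ℝ, HasDerivAt (fun τ => (t : ℂ)⁻¹ * wr (ψ t (γ τ)) (χ (γ τ)))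
        (-((t : ℂ)⁻¹ * dform (A t - A 0) (ψ t) χ (γ τ) v)) τ := fun τ =>
      (((hasFDerivAt_wr (hψ t ht) hχ (htr 0) (γ τ)).comp_hasDerivAt τ (hγd τ)).const_mul
        _).congr_deriv (by simp [dform]; ring)
    rw [intervalIntegral.integral_eq_sub_of_hasDerivAt (fun τ _ => hd τ)
      ((cI t ht).intervalIntegrable _ _), hγ0, hγ1, mul_sub]
  have h0 : (0 : ℝ) ∈ Icc (-1 : ℝ) 1 := by norm_num
  have hE : -(F z2 - F z0) = ∫ τ in (0 : ℝ)..1, -(dform (dotForm A) (ψ 0) χ (γ τ) v) := by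
    rw [intervalIntegral.integral_eq_sub_of_hasDerivAt (f := fun τ => -F (γ τ))
      (fun τ _ => ((hF (γ τ)).comp_hasDerivAt τ (hγd τ)).fun_neg), hγ0, hγ1]
    · ring
    · exact (((continuous_dform (contDiff_dotForm hA).continuous (hψ 0 h0).continuous
        hχ.continuous).comp hγc).clm_apply continuous_const).neg.intervalIntegrable _ _
  rw [hE]
  refine Tendsto.congr' (hI.mono fun _ h => h.symm) ?_
  refine intervalIntegral.tendsto_integral_filter_of_dominated_convergence
    (fun _ => 4 * (M1 * M2) * (M3 * ‖v‖)) ?_ ?_ intervalIntegrable_const ?_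
  · filter_upwards [nhdsWithin_le_nhds hIcc] with t ht; exact (cI t ht).aestronglyMeasurable
  · filter_upwards [nhdsWithin_le_nhds hIcc, nhdsWithin_le_nhds hM1, self_mem_nhdsWithin]
      with t ht hb ht0
    refine Eventually.of_forall fun τ hτ => ?_
    rw [uIoc_of_le zero_le_one] at hτ
    have hτ' : τ ∈ Icc (0 : ℝ) 1 := ⟨hτ.1.le, hτ.2⟩
    have ht0' : 0 < |t| := abs_pos.2 ht0
    have h1 := norm_dform_le (A t - A 0) (ψ t) χ (γ τ) v (hb (γ τ) (hR τ hτ'))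
      (fun i => (norm_le_pi_norm _ i).trans (hM2 τ hτ'))
    have h2 := hL t ht (γ τ) (hR τ hτ')
    have hM12 : 0 ≤ M1 * M2 := mul_nonneg ((norm_nonneg _).trans (hb (γ τ) (hR τ hτ') 0))
      ((norm_nonneg _).trans (hM2 τ hτ'))
    rw [norm_neg, norm_mul, norm_inv, norm_real, Real.norm_eq_abs, inv_mul_le_iff₀ ht0']
    refine h1.trans ?_
    have h3 : ‖(A t - A 0) (γ τ)‖ * ‖v‖ ≤ M3 * |t| * ‖v‖ := by gcongr; exact h2
    refine (mul_le_mul_of_nonneg_left h3 (by linarith)).trans (le_of_eq ?_)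
    ring
  · refine Eventually.of_forall fun τ _ => ?_
    have hs : ∀ i k, Tendsto (fun t : ℝ => (t : ℂ)⁻¹ * (A t (γ τ) i k v - A 0 (γ τ) i k v))
        (𝓝[≠] 0) (𝓝 (dotForm A (γ τ) i k v)) := by
      intro i k
      simpa [real_smul] using (hasDerivAt_entry hA (γ τ) i k v).tendsto_slope_zero
    have hp : ∀ i, Tendsto (fun t => ψ t (γ τ) i) (𝓝[≠] 0) (𝓝 (ψ 0 (γ τ) i)) := fun i =>
      ((continuous_apply i).tendsto _).comp ((hlim (γ τ)).mono_left nhdsWithin_le_nhds)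
    have m := fun i k j l => ((hp i).mul_const (χ (γ τ) k)).mul (hs j l)
    refine ((((m 0 1 0 0).add (m 1 1 0 1)).sub (m 0 0 1 0)).sub (m 1 0 1 1)).neg.congr fun t => ?_
    simp only [dform, sub_apply, add_apply, smul_apply, smul_eq_mul, Pi.sub_apply]
    ring

end FlatFamily

namespace FlatFamily

variable {A : ℝ → MatForm} {c1 c2 : ℂ} {a b : ℝ → ℂ} {a' b' : ℂ} {s0 C : ℝ}

theorem eventually_re_expo_nonneg {c1 c2 : ℂ} (hκ : 0 < κ) (hr : IsRay c1 c2 κ 0 θ) (m0 : ℝ) : ∀ᶠ s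
    : ℝ in atTop, ∀ a b : ℂ, ‖a‖ ≤ m0 → ‖b‖ ≤ m0 → 0 ≤ (expo c1 c2 a b (s + θ * I)).re := by
  have h1 : Tendsto (fun s : ℝ => (s + |θ|) * rexp (-(2 * s))) atTop (𝓝 0) := by
    have t2 := tendsto_id.const_mul_atTop (two_pos : (0 : ℝ) < 2)
    have := (((Real.tendsto_pow_mul_exp_neg_atTop_nhds_zero 1).comp t2).div_const 2).add
      ((Real.tendsto_exp_neg_atTop_nhds_zero.comp t2).const_mul |θ|)
    simp only [zero_div, mul_zero, add_zero] at this
    refine this.congr fun s => ?_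
    simp
    ring
  have h2 := h1.const_mul (2 * m0)
  rw [mul_zero] at h2
  filter_upwards [h2.eventually_le_const hκ, eventually_ge_atTop 0] with s hs hs0 a b ha hb
  have e := re_expo_of_isRay hr a b s 0
  simp only [ofReal_zero, add_zero, mul_zero, Real.cos_zero, mul_one] at e
  rw [show sg 0 = 1 from rfl, one_mul, one_mul] at e
  rw [e]
  have h3 : |(a + b).re * s| ≤ 2 * m0 * s := by
    rw [abs_mul, abs_of_nonneg hs0]
    gcongr
    exact (abs_re_le_norm _).trans ((norm_add_le _ _).trans (by linarith))
  have h4 : |(a - b).im * θ| ≤ 2 * m0 * |θ| := by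
    rw [abs_mul]
    gcongr
    exact (abs_im_le_norm _).trans ((norm_sub_le _ _).trans (by linarith))
  have h5 : 2 * m0 * (s + |θ|) ≤ κ * rexp (2 * s) := by
    have e : rexp (-(2 * s)) * rexp (2 * s) = 1 := by rw [← Real.exp_add]; simp
    linear_combination mul_le_mul_of_nonneg_right hs (Real.exp_pos (2 * s)).le
      - (2 * m0 * (s + |θ|)) * e
  linarith [(abs_le.1 h3).1, (abs_le.1 h4).2]

theorem wr_gauged_eq (c1 c2 a b a0 b0 : ℂ) (j : Fin 2) (P Q : ℂ → Fin 2 → ℂ) (ξ : ℂ) :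
    wr (gauged (expo c1 c2 a b) j P ξ) (gauged (expo c1 c2 a0 b0) (j + 1) Q ξ)
      = exp (sg j * ((a - a0) * ξ + (b - b0) * conj ξ)) * wr (P (exp ξ)) (Q (exp ξ)) := by
  have : exp (sg j * expo c1 c2 a b ξ) * exp (sg (j + 1) * expo c1 c2 a0 b0 ξ)
      = exp (sg j * ((a - a0) * ξ + (b - b0) * conj ξ)) := by
    rw [← exp_add, sg_succ]
    congr 1
    simp only [expo]
    push_cast
    ring
  simp only [wr, gauged, ← this]
  ring

set_option maxHeartbeats 1000000 in
theorem hasDerivAt_stokes (h : FlatFamily A c1 c2 a b a' b' s0 C) (hκ : 0 < κ)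
    (hray : IsRay c1 c2 κ 0 Θ) {C1 : ℝ} {ψ : ℕ → ℝ → ℂ → Fin 2 → ℂ} (hs₁ : s0 ≤ s1) (hC₁ : 0 ≤ C1)
    (hψ : ∀ k, ∀ t ∈ Icc (-1 : ℝ) 1, IsDom (A t) c1 c2 (a t) (b t) (par k) (Θ + k * (π / 2)) s1 C1
    (ψ k t)) {q : ℂ} (hq : IsStokesVariation (fun k => ψ k 0) (dotForm A) a' b' Θ (wr (ψ 0 0 0) (ψ 2
    0 0)) q) : HasDerivAt (fun t => wr (ψ 0 t 0) (ψ 2 t 0)) (wr (ψ 0 0 0) (ψ 2 0 0) * q) 0 := by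
  have hπ := Real.pi_pos
  set S : ℝ → ℂ := fun t => wr (ψ 0 t 0) (ψ 2 t 0) with hS
  have hI0 : (0 : ℝ) ∈ Icc (-1 : ℝ) 1 := by norm_num
  have hIcc : ∀ᶠ t : ℝ in 𝓝 0, t ∈ Icc (-1 : ℝ) 1 := Icc_mem_nhds (by norm_num) one_pos
  set Θ' := Θ + π with hΘ'
  have e : Θ + ((2 : ℕ) : ℝ) * (π / 2) = Θ' := by rw [hΘ']; push_cast; ring
  have D0 : ∀ t ∈ Icc (-1 : ℝ) 1, IsDom (A t) c1 c2 (a t) (b t) 0 Θ s1 C1 (ψ 0 t) := fun t ht => by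
    simpa [par] using hψ 0 t ht
  have D1 : ∀ t ∈ Icc (-1 : ℝ) 1, IsDom (A t) c1 c2 (a t) (b t) 1 (Θ + π / 2) s1 C1 (ψ 1 t) :=
    fun t ht => by simpa [par] using hψ 1 t ht
  have D2 : ∀ t ∈ Icc (-1 : ℝ) 1, IsDom (A t) c1 c2 (a t) (b t) 0 Θ' s1 C1 (ψ 2 t) := fun t ht => by
    have := hψ 2 t ht; rw [e] at this; simpa [par] using this
  have hray' : IsRay c1 c2 κ 0 Θ' := by have := hray.nat 2; rw [e] at this; simpa [par] using this
  have aa : ∀ x : ℝ, |x - x| ≤ π / 2 := fun x => by rw [sub_self, abs_zero]; positivity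
  have a01 : |Θ - (Θ + π / 2)| ≤ π / 2 := by rw [abs_le]; constructor <;> linarith
  have a21 : |Θ' - (Θ + π / 2)| ≤ π / 2 := by rw [abs_le]; constructor <;> linarith
  have a12 : |Θ + π / 2 - Θ'| ≤ π / 2 := by rwa [abs_sub_comm]
  have three : ∀ t ∈ Icc (-1 : ℝ) 1, ∀ z, ψ 2 t z = ψ 0 t z + S t • ψ 1 t z := by
    intro t ht z
    have e1 : wr (ψ 0 t z) (ψ 1 t z) = 1 := by
      simpa [sg] using (D0 t ht).wr_adjacent (h.traceless t) (D1 t ht) (aa _) a01 z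
    have e2 : wr (ψ 1 t z) (ψ 2 t z) = -1 := by
      simpa [sg] using (D1 t ht).wr_adjacent (h.traceless t) (j := 1) (D2 t ht) (aa _) a12 z
    have := wr_three e1 e2
    rwa [wr_const (D0 t ht).1 (D2 t ht).1 (h.traceless t) z 0] at this
  have three' : ∀ t ∈ Icc (-1 : ℝ) 1, ∀ z, ψ 0 t z = ψ 2 t z + (-S t) • ψ 1 t z := by
    intro t ht z; rw [three t ht z, neg_smul]; abel
  have lim {θ : ℝ} {ψ : ℝ → ℂ → Fin 2 → ℂ} (hr : IsRay c1 c2 κ 0 θ) :=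
    tendsto_dom (ψ := ψ) h.smooth.continuous h.smooth_apply h.flat h.traceless
      h.continuous_a.continuousAt h.continuous_b.continuousAt hr hκ (s1 := s1) (C := C1)
  have lim0 := lim hray D0
  have limS : Tendsto S (𝓝 0) (𝓝 (S 0)) :=
    ((continuous_wr continuous_fst continuous_snd).tendsto (ψ 0 0 0, ψ 2 0 0)).comp
      ((lim0 0).prodMk_nhds (lim hray' D2 0))
  obtain ⟨m1, hm1⟩ := (isCompact_Icc (a := (-1 : ℝ)) (b := 1)).exists_bound_of_continuousOn
    h.continuous_a.continuousOn
  obtain ⟨m2, hm2⟩ := (isCompact_Icc (a := (-1 : ℝ)) (b := 1)).exists_bound_of_continuousOn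
    h.continuous_b.continuousOn
  have hm1 := fun t ht => (hm1 t ht).trans (le_max_left m1 m2)
  have hm2 := fun t ht => (hm2 t ht).trans (le_max_right m1 m2)
  obtain ⟨s2, hs2⟩ := eventually_atTop.1 ((eventually_re_expo_nonneg hκ hray (max m1 m2)).and
    (eventually_re_expo_nonneg hκ hray' (max m1 m2)))
  set s3 := max s2 (max s1 0)
  have l2 : s2 ≤ s3 := le_max_left _ _
  have l1 : s1 ≤ s3 := (le_max_left _ _).trans (le_max_right _ _)
  have l0 : 0 ≤ s3 := (le_max_right _ _).trans (le_max_right _ _)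
  set M := (1 + C1) * (1 + (‖S 0‖ + 1)) with hM
  have hM1 : 1 ≤ M := by have := norm_nonneg (S 0); nlinarith
  have hC₁M : 1 + C1 ≤ M := by have := norm_nonneg (S 0); nlinarith
  obtain ⟨k, hk0, hk⟩ : ∃ k, 0 ≤ k ∧ ∀ᶠ t in 𝓝 (0 : ℝ),
      ‖a t - a 0‖ ≤ k * |t| ∧ ‖b t - b 0‖ ≤ k * |t| := by
    obtain ⟨k1, e1⟩ := h.hasDerivAt_a.isBigO_sub.bound
    obtain ⟨k2, e2⟩ := h.hasDerivAt_b.isBigO_sub.bound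
    refine ⟨max 0 (max k1 k2), le_max_left _ _, ?_⟩
    filter_upwards [e1, e2] with t h1 h2
    rw [sub_zero, Real.norm_eq_abs] at h1 h2
    exact ⟨h1.trans (by gcongr; simp), h2.trans (by gcongr; simp)⟩
  set k' := max k C
  have hk'0 : 0 ≤ k' := le_max_of_le_left hk0
  set D := 8 * M ^ 2 * k' with hD
  have small : ∀ {t : ℝ} {j : Fin 2} {θ : ℝ} {ψ : ℂ → Fin 2 → ℂ},
      IsDom (A t) c1 c2 (a t) (b t) j θ s1 C1 ψ → ∀ s : ℝ, s3 ≤ s →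
      (∀ i, ‖gauged (expo c1 c2 (a t) (b t)) j ψ (s + θ * I) i‖ ≤ M) ∧
      ‖gauged (expo c1 c2 (a t) (b t)) j ψ (s + θ * I) (j + 1)‖ ≤ M * rexp (-s) := by
    intro t j θ ψ hd s hs
    have := hd.2 (s + θ * I) (by simpa using l1.trans hs) (by simpa using aa θ)
    rw [show (s + θ * I : ℂ).re = s by simp] at this
    have hC1 := mul_le_of_le_one_right hC₁ (Real.exp_le_one_iff.2 (show -s ≤ 0 by linarith))
    refine ⟨fun i => (norm_le_pi_norm _ i).trans (norm_le_of_pair (j := j) ?_ ?_),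
      this.2.trans (by gcongr; linarith)⟩
    · have h2 := norm_add_le (gauged (expo c1 c2 (a t) (b t)) j ψ (s + θ * I) j - 1) 1
      simp only [sub_add_cancel, norm_one] at h2
      linarith [this.1]
    · linarith [this.2]
  have hrem : ∀ t ∈ Icc (-1 : ℝ) 1, ∀ (θ s : ℝ), s3 ≤ s → ∀ i j,
      ‖remd (A t) c1 c2 (a t) (b t) (s + θ * I) 1 i j
        - remd (A 0) c1 c2 (a 0) (b 0) (s + θ * I) 1 i j‖ ≤ k' * |t| * rexp (-s) := by
    intro t ht θ s hs i j
    refine (h.lip t ht (s + θ * I) (by simpa using hs₁.trans (l1.trans hs)) 1 i j).trans ?_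
    rw [norm_one, mul_one, show (s + θ * I : ℂ).re = s by simp]
    gcongr
    exact le_max_right _ _
  have hS1 : ∀ᶠ t in 𝓝 (0 : ℝ), ‖S t‖ ≤ ‖S 0‖ + 1 := limS.norm.eventually_le_const (lt_add_one _)
  set E : ℂ → ℝ → ℂ := fun ξ t => (a t - a 0) * ξ + (b t - b 0) * conj ξ with hEdef
  have ray {t : ℝ} (ht : t ∈ Icc (-1 : ℝ) 1) (hkt : ‖a t - a 0‖ ≤ k * |t| ∧ ‖b t - b 0‖ ≤ k * |t|)
      (j : Fin 2) {θ s : ℝ} {L : ℂ} := norm_wr_gauged_sub_le (j := j) (L := L) (s := s) (D0 t ht).1 (D2 0 hI0).1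
    (h.traceless t) (h.traceless 0) (s1 := s3) (M := M) (δ := k' * |t|) (by positivity) hM1
    (hkt.1.trans (by gcongr; exact le_max_left _ _)) (hkt.2.trans (by gcongr; exact le_max_left _ _))
    (hrem t ht θ) rfl rfl
  have ray0 : ∀ᶠ t in 𝓝 (0 : ℝ), ∀ s : ℝ, s3 ≤ s → ‖exp (E (s + Θ * I) t) *
      wr (ψ 0 t (circ s Θ)) (ψ 2 0 (circ s Θ)) - S 0‖ ≤ D * |t| * rexp (-s) := by
    filter_upwards [hIcc, hk] with t ht hkt s hs
    have g1 := grow_tendsto hray hκ (D0 0 hI0) (D1 0 hI0) (aa _) a01 (by simp) (three 0 hI0)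
    obtain ⟨t1, t0⟩ := (D0 t ht).tendsto (aa _)
    have hlim := (t1.mul g1.2).sub (t0.mul g1.1)
    simp only [one_mul, zero_mul, sub_zero] at hlim
    have hg : ∀ s : ℝ, s3 ≤ s → ∀ i,
        ‖gauged (expo c1 c2 (a 0) (b 0)) (0 + 1) (ψ 2 0) (s + Θ * I) i‖ ≤ M := by
      intro s hs i
      refine (grow_bound (D0 0 hI0) (D1 0 hI0) (aa _) a01 hC₁ (three 0 hI0) (l1.trans hs)
        (l0.trans hs) ((hs2 s (l2.trans hs)).1 _ _ (hm1 0 hI0) (hm2 0 hI0)) i).trans ?_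
      rw [hM]
      gcongr
      linarith
    have := ray ht hkt 0 (fun s hs => (small (D0 t ht) s hs).1) hg (fun s hs => ?_) hlim hs
    · rw [wr_gauged_eq] at this
      simp only [sg, if_true, ofReal_one, one_mul] at this
      exact this.trans_eq (by rw [hD]; ring)
    · rw [norm_mul, sq, mul_assoc, mul_comm M (rexp _), ← mul_assoc]
      exact mul_le_mul (small (D0 t ht) s hs).2 (hg s hs 0) (norm_nonneg _) (by positivity)
  have ray2 : ∀ᶠ t in 𝓝 (0 : ℝ), ∀ s : ℝ, s3 ≤ s → ‖exp (-E (s + Θ' * I) t) *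
      wr (ψ 0 t (circ s Θ')) (ψ 2 0 (circ s Θ')) - S t‖ ≤ D * |t| * rexp (-s) := by
    filter_upwards [hIcc, hk, hS1] with t ht hkt hSt s hs
    have g1 := grow_tendsto hray' hκ (D2 t ht) (D1 t ht) (aa _) a21 (by simp) (three' t ht)
    obtain ⟨t1, t0⟩ := (D2 0 hI0).tendsto (aa _)
    have hlim := (g1.1.mul t0).sub (g1.2.mul t1)
    simp only [mul_zero, mul_one, zero_sub, neg_neg] at hlim
    have hg : ∀ s : ℝ, s3 ≤ s → ∀ i,
        ‖gauged (expo c1 c2 (a t) (b t)) 1 (ψ 0 t) (s + Θ' * I) i‖ ≤ M := by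
      intro s hs i
      refine (grow_bound (D2 t ht) (D1 t ht) (aa _) a21 hC₁ (three' t ht) (l1.trans hs)
        (l0.trans hs) ((hs2 s (l2.trans hs)).2 _ _ (hm1 t ht) (hm2 t ht)) i).trans ?_
      rw [hM, norm_neg]
      gcongr
    have := ray ht hkt 1 hg (fun s hs => (small (D2 0 hI0) s hs).1) (fun s hs => ?_) hlim hs
    · rw [wr_gauged_eq] at this
      simp only [sg, one_ne_zero, if_false, ofReal_neg, ofReal_one, neg_mul, one_mul] at this
      exact this.trans_eq (by rw [hD]; ring)
    · rw [norm_mul, sq, mul_assoc]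
      exact mul_le_mul (hg s hs _) (small (D2 0 hI0) s hs).2 (norm_nonneg _) (by positivity)
  obtain ⟨F, hF, hF0, hF2⟩ := hq
  have mid := fun s : ℝ => tendsto_wr_sub h.smooth h.flat h.traceless (fun t ht => (D0 t ht).1)
    (D2 0 hI0).1 lim0 hF (circ s Θ) (circ s Θ')
  have hE : ∀ ξ : ℂ, HasDerivAt (fun t => exp (-E ξ t)) (-lin a' b' ξ) 0 ∧
      HasDerivAt (fun t => exp (E ξ t)) (lin a' b' ξ) 0 := by
    intro ξ
    have e := ((h.hasDerivAt_a.sub_const (a 0)).mul_const ξ).add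
      ((h.hasDerivAt_b.sub_const (b 0)).mul_const (conj ξ))
    exact ⟨e.fun_neg.cexp.congr_deriv (by simp [lin]), e.cexp.congr_deriv (by simp [lin])⟩
  have E0 : ∀ ξ, E ξ 0 = 0 := fun ξ => by simp [hEdef]
  rw [hasDerivAt_iff_tendsto_slope_zero]
  simp only [zero_add, real_smul]
  set X : ℝ → ℝ → ℂ := fun s t => (t : ℝ)⁻¹ * (exp (-E (s + Θ * I) t) - 1) * S 0
    - (t : ℝ)⁻¹ * (exp (E (s + Θ' * I) t) - 1) * S t + (t : ℂ)⁻¹ *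
      (wr (ψ 0 t (circ s Θ')) (ψ 2 0 (circ s Θ')) - wr (ψ 0 t (circ s Θ)) (ψ 2 0 (circ s Θ))) with hX
  have limX : ∀ s : ℝ, Tendsto (X s) (𝓝[≠] 0) (𝓝 (-lin a' b' (s + Θ * I) * S 0
      - lin a' b' (s + Θ' * I) * S 0 + -(F (circ s Θ') - F (circ s Θ)))) := by
    intro s
    have e1 := (hE (s + Θ * I)).1.tendsto_slope_zero
    have e2 := (hE (s + Θ' * I)).2.tendsto_slope_zero
    simp only [zero_add, real_smul, E0, neg_zero, exp_zero] at e1 e2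
    exact ((e1.mul_const (S 0)).sub (e2.mul (limS.mono_left nhdsWithin_le_nhds))).add (mid s)
  have limL : Tendsto (fun s : ℝ => -lin a' b' (s + Θ * I) * S 0
      - lin a' b' (s + Θ' * I) * S 0 + -(F (circ s Θ') - F (circ s Θ))) atTop (𝓝 (S 0 * q)) := by
    have := hF0.sub hF2
    rw [zero_sub, neg_neg] at this
    refine this.congr fun s => ?_
    simp only [circ, hS]
    ring
  have close : ∀ s : ℝ, s3 ≤ s → ∀ᶠ t in 𝓝[≠] (0 : ℝ),
      ‖(t : ℝ)⁻¹ * (S t - S 0) - X s t‖ ≤ 4 * D * rexp (-s) := by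
    intro s hs
    have n1 := (hE (s + Θ * I)).1.continuousAt.norm.tendsto
    have n2 := (hE (s + Θ' * I)).2.continuousAt.norm.tendsto
    simp only [E0, neg_zero, exp_zero, norm_one] at n1 n2
    filter_upwards [nhdsWithin_le_nhds (n1.eventually_le_const one_lt_two),
      nhdsWithin_le_nhds (n2.eventually_le_const one_lt_two), nhdsWithin_le_nhds ray0,
      nhdsWithin_le_nhds ray2, self_mem_nhdsWithin] with t h1 h2 h3 h4 ht0
    set x := E (s + Θ * I) t
    set y := E (s + Θ' * I) t
    set W := wr (ψ 0 t (circ s Θ)) (ψ 2 0 (circ s Θ))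
    set W' := wr (ψ 0 t (circ s Θ')) (ψ 2 0 (circ s Θ'))
    have hx : exp (-x) * exp x = 1 := by rw [← exp_add]; simp
    have hy : exp y * exp (-y) = 1 := by rw [← exp_add]; simp
    have e : (t : ℝ)⁻¹ * (S t - S 0) - X s t
        = (t : ℂ)⁻¹ * (exp (-x) * (exp x * W - S 0) - exp y * (exp (-y) * W' - S t)) := by
      simp only [hX]
      push_cast
      linear_combination (t : ℂ)⁻¹ * (W' * hy - W * hx)
    rw [e, norm_mul, norm_inv, norm_real, Real.norm_eq_abs, inv_mul_le_iff₀ (abs_pos.2 ht0)]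
    refine (norm_sub_le _ _).trans ?_
    rw [norm_mul, norm_mul]
    linarith [mul_le_mul h1 (h3 s hs) (norm_nonneg _) zero_le_two,
      mul_le_mul h2 (h4 s hs) (norm_nonneg _) zero_le_two]
  rw [Metric.tendsto_nhds]
  intro ε hε
  obtain ⟨s, hs1, hs2, hs3⟩ := (((tendsto_C_exp_neg (4 * D)).eventually_lt_const
    (show 0 < ε / 3 by positivity)).and ((Metric.tendsto_nhds.1 limL (ε / 3) (by positivity)).and
    (eventually_ge_atTop s3))).exists
  filter_upwards [Metric.tendsto_nhds.1 (limX s) (ε / 3) (by positivity), close s hs3] with t h1 h2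
  rw [← dist_eq_norm] at h2
  exact (dist_triangle4 _ (X s t) _ _).trans_lt (by linarith)

end FlatFamily

/-! ### A trajectory that joins the two ends of the spectral curve -/

/-- The imaginary part of `(1 + iT) (X + sinh X)` at `X = r - iv`. -/
def stripHeight (T r v : ℝ) : ℝ := T * (r + Real.sinh r * Real.cos v) - v - Real.cosh r * Real.sin v

theorem continuous_stripHeight (T : ℝ) : Continuous fun p : ℝ × ℝ => stripHeight T p.1 p.2 := by
  have h1 := Real.continuous_sinh
  have h2 := Real.continuous_cosh
  unfold stripHeight
  fun_prop

theorem sub_mul_cos_pos {v : ℝ} (h0 : 0 < v) (hπ : v < π) : 0 < Real.sin v - v * Real.cos v := by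
  have hs := Real.sin_pos_of_pos_of_lt_pi h0 hπ
  rcases lt_or_ge v (π / 2) with h | h
  · have hc := Real.cos_pos_of_mem_Ioo ⟨by linarith, h⟩
    have := Real.lt_tan h0 h
    rw [Real.tan_eq_sin_div_cos, lt_div_iff₀ hc] at this
    linarith
  · have hc := Real.cos_nonpos_of_pi_div_two_le_of_le h (by linarith); nlinarith

theorem exists_stripRoot (hT : 0 ≤ T) (hr : 0 ≤ r) : ∃ v ∈ Ico 0 π, stripHeight T r v = 0 ∧
    (∀ w ∈ Ico 0 v, 0 < stripHeight T r w) ∧ ∀ w ∈ Ioo v π, stripHeight T r w < 0 := by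
  have hπ := Real.pi_pos
  rcases (mul_nonneg hT hr).eq_or_lt with h | h
  · have e : ∀ w, stripHeight T r w = -w - Real.cosh r * Real.sin w := by
      intro w
      rcases mul_eq_zero.1 h.symm with rfl | rfl <;> simp [stripHeight]
    refine ⟨0, ⟨le_rfl, hπ⟩, by simp [e], fun w hw => absurd hw.2 (not_lt.2 hw.1), fun w hw => ?_⟩
    rw [e]
    have := mul_pos (Real.cosh_pos r) (Real.sin_pos_of_pos_of_lt_pi hw.1 hw.2)
    linarith [hw.1]
  · have hT' : 0 < T := by
      rcases hT.eq_or_lt with h' | h'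
      · rw [← h'] at h; simp at h
      · exact h'
    have hr' : 0 < r := by
      rcases hr.eq_or_lt with h' | h'
      · rw [← h'] at h; simp at h
      · exact h'
    have hsinh : r < Real.sinh r := Real.self_lt_sinh_iff.2 hr'
    have hcont : Continuous fun v => stripHeight T r v :=
      (continuous_stripHeight T).comp (Continuous.prodMk_right r)
    have n0 : 0 < stripHeight T r 0 := by
      simp only [stripHeight, Real.cos_zero, Real.sin_zero]
      have : 0 < T * (r + Real.sinh r * 1) := mul_pos hT' (by linarith)
      linarith
    have nπ : stripHeight T r π < 0 := by
      simp only [stripHeight, Real.cos_pi, Real.sin_pi]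
      have : T * (r + Real.sinh r * -1) ≤ 0 := mul_nonpos_of_nonneg_of_nonpos hT (by linarith)
      linarith
    obtain ⟨v, hv, hv0⟩ := intermediate_value_Ioo' hπ.le hcont.continuousOn ⟨nπ, n0⟩
    set k : ℝ → ℝ := fun v => (T * (r + Real.sinh r * Real.cos v) - v) / Real.sin v with hk
    have hanti : StrictAntiOn k (Ioo 0 π) := by
      have hd : ∀ w ∈ Ioo 0 π, HasDerivAt k (((T * (Real.sinh r * -Real.sin w) - 1)
          * Real.sin w - (T * (r + Real.sinh r * Real.cos w) - w) * Real.cos w)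
          / Real.sin w ^ 2) w := fun w hw =>
        (((((Real.hasDerivAt_cos w).const_mul (Real.sinh r)).const_add r).const_mul T).sub
          (hasDerivAt_id w)).div (Real.hasDerivAt_sin w)
          (Real.sin_pos_of_pos_of_lt_pi hw.1 hw.2).ne'
      refine strictAntiOn_of_deriv_neg (convex_Ioo _ _)
        (fun w hw => (hd w hw).continuousAt.continuousWithinAt) (fun w hw => ?_)
      rw [interior_Ioo] at hw
      rw [(hd w hw).deriv]
      refine div_neg_of_neg_of_pos ?_ (pow_pos (Real.sin_pos_of_pos_of_lt_pi hw.1 hw.2) 2)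
      have h1 := sub_mul_cos_pos hw.1 hw.2
      have h2 : 0 < T * (Real.sinh r + r * Real.cos w) := by
        refine mul_pos hT' ?_
        nlinarith [Real.neg_one_le_cos w]
      have h3 := Real.sin_sq_add_cos_sq w
      linear_combination h1 + h2 - T * Real.sinh r * h3
    have e : ∀ w ∈ Ioo 0 π, stripHeight T r w = Real.sin w * (k w - Real.cosh r) := by
      intro w hw
      have := (Real.sin_pos_of_pos_of_lt_pi hw.1 hw.2).ne'
      simp only [hk, stripHeight]
      field_simp
    have kv : k v = Real.cosh r := by
      replace hv0 : stripHeight T r v = 0 := hv0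
      rw [e v hv] at hv0
      rcases mul_eq_zero.1 hv0 with h | h
      · exact absurd h (Real.sin_pos_of_pos_of_lt_pi hv.1 hv.2).ne'
      · linarith
    refine ⟨v, ⟨hv.1.le, hv.2⟩, hv0, fun w hw => ?_, fun w hw => ?_⟩
    · rcases hw.1.eq_or_lt with rfl | h0
      · exact n0
      · have hw' : w ∈ Ioo 0 π := ⟨h0, hw.2.trans hv.2⟩
        rw [e w hw']
        have := hanti hw' hv hw.2
        exact mul_pos (Real.sin_pos_of_pos_of_lt_pi hw'.1 hw'.2) (by linarith)
    · have hw' : w ∈ Ioo 0 π := ⟨hv.1.trans hw.1, hw.2⟩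
      rw [e w hw']
      have := hanti hv hw' hw.1
      exact mul_neg_of_pos_of_neg (Real.sin_pos_of_pos_of_lt_pi hw'.1 hw'.2) (by linarith)

/-- The zero of `stripHeight T r` in `[0, π)`. -/
def stripRoot (T r : ℝ) : ℝ := if h : 0 ≤ T ∧ 0 ≤ r then (exists_stripRoot h.1 h.2).choose else 0

theorem stripRoot_spec (hT : 0 ≤ T) (hr : 0 ≤ r) : stripRoot T r ∈ Ico 0 π ∧ stripHeight T r
    (stripRoot T r) = 0 ∧ (∀ w ∈ Ico 0 (stripRoot T r), 0 < stripHeight T r w) ∧ ∀ w ∈ Ioo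
    (stripRoot T r) π, stripHeight T r w < 0 := by
  rw [stripRoot, dif_pos ⟨hT, hr⟩]
  exact (exists_stripRoot hT hr).choose_spec

theorem stripRoot_lt {v : ℝ} (hT : 0 ≤ T) (hr : 0 ≤ r) (hv : 0 ≤ v) (h : stripHeight T r v < 0) :
    stripRoot T r < v := by
  obtain ⟨h1, h2, h3, h4⟩ := stripRoot_spec hT hr
  by_contra! hle
  rcases hle.eq_or_lt with rfl | hlt
  · linarith
  · linarith [h3 v ⟨hv, hlt⟩]

theorem lt_stripRoot {v : ℝ} (hT : 0 ≤ T) (hr : 0 ≤ r) (hv : v < π) (h : 0 < stripHeight T r v) : v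
    < stripRoot T r := by
  obtain ⟨h1, h2, h3, h4⟩ := stripRoot_spec hT hr
  by_contra! hle
  rcases hle.eq_or_lt with rfl | hlt
  · linarith
  · linarith [h4 v ⟨hlt, hv⟩]

theorem tendsto_stripRoot (hT : 0 ≤ T) {l : Filter ℝ} {v0 : ℝ} (hl : ∀ᶠ r in l, 0 ≤ r) (h0 : 0 ≤ v0)
    (hπ : v0 < π) (hup : ∀ v ∈ Ioo v0 π, ∀ᶠ r in l, stripHeight T r v < 0)
    (hlo : ∀ v ∈ Ico 0 v0, ∀ᶠ r in l, 0 < stripHeight T r v) : Tendsto (stripRoot T) l (𝓝 v0) := by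
  rw [tendsto_order]
  refine ⟨fun v hv => ?_, fun v hv => ?_⟩
  · rcases lt_or_ge v 0 with h | h
    · filter_upwards [hl] with r hr using h.trans_le (stripRoot_spec hT hr).1.1
    · filter_upwards [hl, hlo v ⟨h, hv⟩] with r hr h' using lt_stripRoot hT hr (hv.trans hπ) h'
  · obtain ⟨w, hw1, hw2⟩ := exists_between (lt_min hv hπ)
    filter_upwards [hl, hup w ⟨hw1, hw2.trans_le (min_le_right _ _)⟩] with r hr h'
    exact (stripRoot_lt hT hr (h0.trans hw1.le) h').trans (hw2.trans_le (min_le_left _ _))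

theorem continuousOn_stripRoot (hT : 0 ≤ T) : ContinuousOn (stripRoot T) (Ici 0) := by
  intro r0 hr0
  obtain ⟨h1, h2, h3, h4⟩ := stripRoot_spec hT hr0
  have hc : ∀ v, Tendsto (fun r => stripHeight T r v) (𝓝[Ici 0] r0) (𝓝 (stripHeight T r0 v)) :=
    fun v => (((continuous_stripHeight T).comp (Continuous.prodMk_left v)).tendsto r0).mono_left
      nhdsWithin_le_nhds
  exact tendsto_stripRoot hT self_mem_nhdsWithin h1.1 h1.2
    (fun v hv => (hc v).eventually_lt_const (h4 v hv))
    (fun v hv => (hc v).eventually_const_lt (h3 v hv))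

theorem tendsto_stripRoot_atTop (hT : 0 ≤ T) : Tendsto (stripRoot T) atTop (𝓝 (Real.arctan T)) := by
  have h1 := Real.arctan_lt_pi_div_two T
  have hπ := Real.pi_pos
  have h0 := Real.arctan_nonneg.2 hT
  have hcos : 0 < Real.cos (Real.arctan T) := Real.cos_arctan_pos T
  have hlim : ∀ v, Tendsto (fun r => rexp (-r) * stripHeight T r v) atTop
      (𝓝 (Real.sin (Real.arctan T - v) / (2 * Real.cos (Real.arctan T)))) := by
    intro v
    have e1 := Real.tendsto_exp_neg_atTop_nhds_zero
    have e2 : Tendsto (fun r : ℝ => r * rexp (-r)) atTop (𝓝 0) := by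
      simpa using Real.tendsto_pow_mul_exp_neg_atTop_nhds_zero 1
    have hv : Real.sin (Real.arctan T - v) / (2 * Real.cos (Real.arctan T))
        = (T * Real.cos v - Real.sin v) / 2 := by
      have hs : Real.sin (Real.arctan T) = T * Real.cos (Real.arctan T) := by
        have := Real.tan_arctan T
        rw [Real.tan_eq_sin_div_cos, div_eq_iff hcos.ne'] at this
        exact this
      rw [Real.sin_sub, hs]
      field_simp
    rw [hv]
    have h := ((e2.const_mul T).sub (e1.const_mul v)).add (((e1.mul e1).const_mul
      (-(T * Real.cos v + Real.sin v) / 2)).add_const ((T * Real.cos v - Real.sin v) / 2))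
    simp only [mul_zero, sub_zero, zero_add] at h
    refine h.congr fun r => ?_
    have : rexp (-r) * rexp r = 1 := by rw [← Real.exp_add]; simp
    rw [stripHeight, Real.sinh_eq, Real.cosh_eq]
    linear_combination (-(T * Real.cos v - Real.sin v) / 2) * this
  have pos : ∀ {x r : ℝ}, 0 < rexp (-r) * x → 0 < x := fun {x r} h =>
    pos_of_mul_pos_right h (Real.exp_pos (-r)).le
  refine tendsto_stripRoot hT (eventually_ge_atTop 0) h0 (by linarith) (fun v hv => ?_)
    (fun v hv => ?_)
  · have : Real.sin (Real.arctan T - v) / (2 * Real.cos (Real.arctan T)) < 0 :=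
      div_neg_of_neg_of_pos (Real.sin_neg_of_neg_of_neg_pi_lt (by linarith [hv.1])
        (by linarith [hv.2])) (by positivity)
    filter_upwards [(hlim v).eventually_lt_const this] with r hr
    have := pos (x := -stripHeight T r v) (r := r) (by linarith)
    linarith
  · have : 0 < Real.sin (Real.arctan T - v) / (2 * Real.cos (Real.arctan T)) :=
      div_pos (Real.sin_pos_of_pos_of_lt_pi (by linarith [hv.2]) (by linarith [hv.1]))
        (by positivity)
    filter_upwards [(hlim v).eventually_const_lt this] with r hr using pos hr

/-- The half of the trajectory `Im ((1 + iT) (X + sinh X)) = 0` in `Re X ≥ 0`, `|Im X| < π`. -/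
def stripCurve (T r : ℝ) : ℂ := r + (if 0 ≤ T then -stripRoot T r else stripRoot (-T) r : ℝ) * I

theorem stripCurve_re (T r : ℝ) : (stripCurve T r).re = r := by simp [stripCurve]

theorem stripCurve_im (T r : ℝ) :
    (stripCurve T r).im = if 0 ≤ T then -stripRoot T r else stripRoot (-T) r := by
  simp only [stripCurve, add_im, ofReal_im, mul_im, ofReal_re, I_im, mul_one, I_re, mul_zero,
    add_zero, zero_add]

theorem continuousOn_stripCurve (T : ℝ) : ContinuousOn (stripCurve T) (Ici 0) := by
  unfold stripCurve
  split_ifs with h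
  · exact continuous_ofReal.continuousOn.add ((continuous_ofReal.comp_continuousOn
      (continuousOn_stripRoot h).neg).mul continuousOn_const)
  · exact continuous_ofReal.continuousOn.add ((continuous_ofReal.comp_continuousOn
      (continuousOn_stripRoot (by linarith))).mul continuousOn_const)

theorem tendsto_stripCurve_im (T : ℝ) :
    Tendsto (fun r => (stripCurve T r).im) atTop (𝓝 (-Real.arctan T)) := by
  simp only [stripCurve_im]
  split_ifs with h
  · exact (tendsto_stripRoot_atTop h).neg
  · have := tendsto_stripRoot_atTop (T := -T) (by linarith); rwa [Real.arctan_neg] at this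

theorem sinh_re_im (X : ℂ) : (sinh X).re = Real.sinh X.re * Real.cos X.im ∧
    (sinh X).im = Real.cosh X.re * Real.sin X.im := by
  have h : sinh X = (Real.sinh X.re * Real.cos X.im : ℝ) + (Real.cosh X.re * Real.sin X.im : ℝ) * I := by
    conv_lhs => rw [← re_add_im X]
    rw [sinh_add, sinh_mul_I, cosh_mul_I]
    push_cast
    ring
  rw [h]
  constructor <;> simp [-ofReal_mul]

theorem im_stripCurve (hc : 0 < c.re) (hr : 0 ≤ r) : (c * (stripCurve (c.im / c.re) r + sinh
    (stripCurve (c.im / c.re) r))).im = 0 := by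
  set T := c.im / c.re with hT
  have hci : c.im = T * c.re := by rw [hT]; field_simp
  rw [mul_im, add_re, add_im, (sinh_re_im _).1, (sinh_re_im _).2, stripCurve_re, stripCurve_im, hci]
  split_ifs with h
  · have := (stripRoot_spec h hr).2.1
    rw [stripHeight] at this
    rw [Real.cos_neg, Real.sin_neg]
    linear_combination c.re * this
  · have := (stripRoot_spec (T := -T) (by linarith) hr).2.1
    rw [stripHeight] at this
    linear_combination -c.re * this

theorem stripCurve_zero (T : ℝ) : stripCurve T 0 = 0 := by
  have key : ∀ T : ℝ, 0 ≤ T → stripRoot T 0 = 0 := by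
    intro T hT
    obtain ⟨h1, h2, -, -⟩ := stripRoot_spec hT (le_refl 0)
    simp only [stripHeight, Real.sinh_zero, zero_mul, add_zero, mul_zero, Real.cosh_zero, one_mul,
      zero_sub] at h2
    have := Real.sin_nonneg_of_nonneg_of_le_pi h1.1 h1.2.le
    linarith [h1.1]
  rw [stripCurve]
  split_ifs with h
  · simp [key T h]
  · simp [key (-T) (by linarith)]

/-! ### A region that avoids the spectral network -/

/-- The imaginary part of `(2 / η) ∫ s dz` at `z = κ sinh (X / 2)`, where `κ² = 2m` and
`c = m / η`. -/
def height (c X : ℂ) : ℝ := (c * (X + sinh X)).im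

theorem continuous_height (c : ℂ) : Continuous (height c) := by
  have := continuous_sinh
  unfold height
  fun_prop

theorem cos_height_eq (hc : c.re ≠ 0) {X : ℂ} (h : sinh (X / 2) = sinh (Y / 2)) : Real.cos
    (height c X / c.re) = Real.cos (height c Y / c.re) := by
  have h' : sin (X / 2 * I) = sin (Y / 2 * I) := by rw [sin_mul_I, sin_mul_I, h]
  obtain ⟨k, hk | hk⟩ := sin_eq_sin_iff.1 h'
  · have e : Y * I = X * I + (2 * k : ℤ) * (2 * π) := by push_cast; linear_combination 2 * hk
    have hs : sinh Y = sinh X := by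
      have : sinh Y * I = sinh X * I := by rw [← sin_mul_I, e, sin_add_int_mul_two_pi, sin_mul_I]
      exact mul_right_cancel₀ I_ne_zero this
    have hY : Y = X - ((2 * k : ℤ) * (2 * π) : ℝ) * I := by
      push_cast at e ⊢
      linear_combination (-I) * e + (Y - X) * I_mul_I
    have hh : height c Y / c.re = height c X / c.re - (2 * k : ℤ) * (2 * π) := by
      rw [div_eq_iff hc, sub_mul, div_mul_cancel₀ _ hc, height, hs, hY, height]
      simp only [mul_im, add_im, add_re, sub_im, sub_re, ofReal_re, ofReal_im, re_ofReal_mul, I_im, I_re]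
      ring
    rw [hh, Real.cos_sub_int_mul_two_pi]
  · have e : Y * I = (2 * k + 1 : ℤ) * (2 * π) - X * I := by push_cast; linear_combination 2 * hk
    have hs : sinh Y = -sinh X := by
      have : sinh Y * I = -sinh X * I := by
        rw [← sin_mul_I, e, sin_int_mul_two_pi_sub, sin_mul_I, neg_mul]
      exact mul_right_cancel₀ I_ne_zero this
    have hY : Y = -X - ((2 * k + 1 : ℤ) * (2 * π) : ℝ) * I := by
      push_cast at e ⊢
      linear_combination (-I) * e + (Y + X) * I_mul_I
    have hh : height c Y / c.re = -(height c X / c.re) - (2 * k + 1 : ℤ) * (2 * π) := by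
      rw [div_eq_iff hc, sub_mul, neg_mul, div_mul_cancel₀ _ hc, height, hs, hY, height]
      simp only [mul_im, add_im, add_re, sub_im, sub_re, ofReal_re, ofReal_im, re_ofReal_mul, I_im, I_re,
        neg_re, neg_im]
      ring
    rw [hh, Real.cos_sub_int_mul_two_pi, Real.cos_neg]

theorem exists_sinh_eq (w : ℂ) : ∃ X : ℂ, sinh (X / 2) = w := by
  obtain ⟨y, hy⟩ := sin_surjective (w * I)
  refine ⟨-(2 * (y * I)), mul_right_cancel₀ I_ne_zero ?_⟩
  rw [← hy, ← sin_mul_I]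
  congr 1
  linear_combination (-y) * I_mul_I

/-- The function `cos (height c X / Re c)` of the point `z = κ sinh (X / 2)`. -/
def levelCos (c κ z : ℂ) : ℝ := Real.cos (height c (exists_sinh_eq (z / κ)).choose / c.re)

theorem levelCos_eq {κ : ℂ} (hc : c.re ≠ 0) (hκ : κ ≠ 0) (X : ℂ) : levelCos c κ (κ * sinh (X / 2)) =
    Real.cos (height c X / c.re) := by
  refine cos_height_eq hc ?_
  rw [(exists_sinh_eq _).choose_spec, mul_div_cancel_left₀ _ hκ]

theorem continuous_levelCos {κ : ℂ} (hc : c.re ≠ 0) (hκ : κ ≠ 0) : Continuous (levelCos c κ) := by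
  set p : ℂ → ℂ := fun X => κ * sinh (X / 2) with hp
  have hd : Differentiable ℂ p := by
    simp only [hp]
    exact (differentiable_sinh.comp (differentiable_id.div_const 2)).const_mul κ
  have hsurj : Function.Surjective p := by
    intro z
    obtain ⟨X, hX⟩ := exists_sinh_eq (z / κ)
    exact ⟨X, by simp only [hp, hX]; field_simp⟩
  have hopen : IsOpenMap p := by
    rcases AnalyticOnNhd.is_constant_or_isOpenMap (g := p) (fun z _ => hd.analyticAt z) with
      ⟨w, hw⟩ | h
    · obtain ⟨X, hX⟩ := hsurj (w + 1); rw [hw] at hX; simp at hX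
    · exact h
  have hq := hopen.isQuotientMap hd.continuous hsurj
  rw [hq.continuous_iff]
  have e : levelCos c κ ∘ p = fun X => Real.cos (height c X / c.re) :=
    funext fun X => levelCos_eq hc hκ X
  rw [e]
  exact Real.continuous_cos.comp ((continuous_height c).div_const _)

theorem hasDerivAt_levelCos {κ : ℂ} (hη : η ≠ 0) (hcdef : c = m / η) (hc : c.re ≠ 0)
    (hκ : κ ^ 2 = 2 * m) (hκ0 : κ ≠ 0) {γ : ℝ → ℂ} {γ' : ℂ} (hγ : HasDerivAt γ γ' t) {x : ℝ}
    (hx : 0 < x) (hw : (γ t ^ 2 + 2 * m) * γ' ^ 2 / η ^ 2 = x) : HasDerivAt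
    (fun t => levelCos c κ (γ t)) 0 t := by
  obtain ⟨X, hX⟩ := exists_sinh_eq (γ t / κ)
  have hX' : κ * sinh (X / 2) = γ t := by rw [hX]; field_simp
  set p : ℂ → ℂ := fun X => κ * sinh (X / 2)
  have hpd : HasStrictDerivAt p (κ * (cosh (X / 2) * (1 / 2))) X :=
    ((hasStrictDerivAt_id X).div_const 2).csinh.const_mul κ
  have hs2 : (κ * cosh (X / 2)) ^ 2 = γ t ^ 2 + 2 * m := by
    have := cosh_sq_sub_sinh_sq (X / 2)
    rw [← hX', ← hκ]
    linear_combination κ ^ 2 * this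
  have hcosh : cosh (X / 2) ≠ 0 := by
    intro h0
    rw [h0, mul_zero] at hs2
    rw [← hs2] at hw
    simp only [ne_eq, OfNat.ofNat_ne_zero, not_false_eq_true, zero_pow, zero_mul, zero_div] at hw
    exact hx.ne (by exact_mod_cast hw)
  have hpd0 : κ * (cosh (X / 2) * (1 / 2)) ≠ 0 := by simp [hκ0, hcosh]
  set g := hpd.localInverse p _ X hpd0
  have hg : HasDerivAt g (κ * (cosh (X / 2) * (1 / 2)))⁻¹ (γ t) := by
    have := (hpd.to_localInverse hpd0).hasDerivAt
    rwa [show p X = γ t from hX'] at this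
  have hgX : g (γ t) = X := by rw [← hX']; exact (hpd.eventually_left_inverse hpd0).self_of_nhds
  have hright : ∀ᶠ z in 𝓝 (γ t), p (g z) = z := by
    have := hpd.eventually_right_inverse hpd0
    rwa [show p X = γ t from hX'] at this
  have heq : (fun t => levelCos c κ (γ t)) =ᶠ[𝓝 t]
      fun t => Real.cos (height c (g (γ t)) / c.re) := by
    filter_upwards [hγ.continuousAt.eventually hright] with τ hτ
    rw [← levelCos_eq hc hκ0]
    exact congrArg _ hτ.symm
  have hW : HasDerivAt (fun t => c * (g (γ t) + sinh (g (γ t)))) (2 * (κ * cosh (X / 2) * γ' / η)) t := by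
    have e1 : HasDerivAt (fun t => g (γ t)) ((κ * (cosh (X / 2) * (1 / 2)))⁻¹ * γ') t :=
      hg.comp t hγ
    have e2 := (e1.add ((hasDerivAt_sinh _).comp t e1)).const_mul c
    rw [hgX] at e2
    refine e2.congr_deriv ?_
    have h2 : cosh X = 2 * cosh (X / 2) ^ 2 - 1 := by
      have := cosh_sq_sub_sinh_sq (X / 2)
      rw [show X = 2 * (X / 2) by ring, cosh_two_mul, show 2 * (X / 2) / 2 = X / 2 by ring]
      linear_combination (-1 : ℂ) * this
    have hm : m = κ ^ 2 / 2 := by rw [hκ]; ring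
    rw [h2, hcdef, hm]
    field_simp
    ring
  have him : (2 * (κ * cosh (X / 2) * γ' / η)).im = 0 := by
    set y := κ * cosh (X / 2) * γ' / η with hy
    have hy2 : y ^ 2 = x := by rw [← hw, ← hs2, hy]; ring
    have h1 := congrArg im hy2
    have h2 := congrArg re hy2
    rw [sq] at h1 h2
    simp only [mul_im, mul_re, ofReal_im, ofReal_re] at h1 h2
    have h3 : y.re * y.im = 0 := by linarith
    rcases mul_eq_zero.1 h3 with h | h
    · rw [h] at h2; nlinarith [mul_self_nonneg y.im]
    · simp [h]
  have hh : HasDerivAt (fun t => height c (g (γ t))) 0 t := by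
    have := (imCLM.hasFDerivAt.comp_hasDerivAt t hW)
    refine this.congr_deriv ?_
    simpa using him
  refine HasDerivAt.congr_of_eventuallyEq ?_ heq
  exact ((hh.div_const c.re).cos).congr_deriv (by simp)

theorem notMem_network {κ : ℂ} (hη : η ≠ 0) (hcdef : c = m / η) (hc : 0 < c.re) (hκ : κ ^ 2 = 2 * m)
    (hκ0 : κ ≠ 0) {X : ℂ} (hX : |height c X| < π * c.re) : κ * sinh (X / 2) ∉ network η m := by
  have hπ := Real.pi_pos
  have hlt : -1 < levelCos c κ (κ * sinh (X / 2)) := by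
    rw [levelCos_eq hc.ne' hκ0, ← Real.cos_abs, ← Real.cos_pi]
    refine Real.cos_lt_cos_of_nonneg_of_le_pi (abs_nonneg _) le_rfl ?_
    rw [abs_div, abs_of_pos hc, div_lt_iff₀ hc]
    exact hX
  have hbr : ∀ z : ℂ, z ^ 2 + 2 * m = 0 → levelCos c κ z = -1 := by
    intro z hz
    obtain ⟨Y, hY⟩ := exists_sinh_eq (z / κ)
    have hY' : κ * sinh (Y / 2) = z := by rw [hY]; field_simp
    rw [← hY', levelCos_eq hc.ne' hκ0]
    have hch : cosh (Y / 2) = 0 := by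
      have := cosh_sq_sub_sinh_sq (Y / 2)
      have h2 : κ ^ 2 * cosh (Y / 2) ^ 2 = 0 := by
        rw [← hκ, ← hY'] at hz
        linear_combination κ ^ 2 * this + hz
      rcases mul_eq_zero.1 h2 with h | h
      · exact absurd h (pow_ne_zero 2 hκ0)
      · exact pow_eq_zero_iff two_ne_zero |>.1 h
    have hcos : cos (Y / 2 * I) = 0 := by rw [cos_mul_I, hch]
    obtain ⟨k, hk⟩ := cos_eq_zero_iff.1 hcos
    have hYe : Y = ((-((2 * k + 1) * π) : ℝ) : ℂ) * I := by
      push_cast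
      linear_combination (-2 * I) * hk + Y * I_mul_I
    have hsh : sinh Y = 0 := by rw [show Y = 2 * (Y / 2) by ring, sinh_two_mul, hch, mul_zero]
    rw [height, hsh, add_zero, hYe, mul_im]
    simp only [im_ofReal_mul, re_ofReal_mul, I_im, I_re]
    have e : (c.re * (-((2 * k + 1) * π) * 1) + c.im * (-((2 * k + 1) * π) * 0)) / c.re
        = -(π + k * (2 * π)) := by
      field_simp
      ring
    rw [e, Real.cos_neg, Real.cos_add_int_mul_two_pi, Real.cos_pi]
  rintro (h | ⟨γ, ⟨hcont, h0, hγ⟩, h1⟩)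
  · exact hlt.ne' (hbr _ h)
  · have hconst : ∀ ε ∈ Ioc (0 : ℝ) 1, levelCos c κ (γ 1) = levelCos c κ (γ ε) := by
      intro ε hε
      have hd : ∀ t ∈ Icc ε 1, HasDerivAt (fun t => levelCos c κ (γ t)) 0 t := by
        intro t ht
        obtain ⟨hd, x, hx, hw⟩ := hγ t ⟨hε.1.trans_le ht.1, ht.2⟩
        exact hasDerivAt_levelCos hη hcdef hc.ne' hκ hκ0 hd.hasDerivAt hx hw
      exact constant_of_has_deriv_right_zero (fun t ht => (hd t ht).continuousAt.continuousWithinAt)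
        (fun t ht => (hd t ⟨ht.1, ht.2.le⟩).hasDerivWithinAt) 1 ⟨hε.2, le_rfl⟩
    have hlim : Tendsto (fun ε => levelCos c κ (γ ε)) (𝓝[>] 0) (𝓝 (levelCos c κ (γ 0))) := by
      refine ((continuous_levelCos hc.ne' hκ0).tendsto _).comp ?_
      have := hcont 0 ⟨le_rfl, zero_le_one⟩
      refine this.mono_left ?_
      rw [← nhdsWithin_Ioc_eq_nhdsGT (zero_lt_one' ℝ)]
      exact nhdsWithin_mono _ Ioc_subset_Icc_self
    have hlim' : Tendsto (fun ε => levelCos c κ (γ ε)) (𝓝[>] 0) (𝓝 (levelCos c κ (γ 1))) := by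
      refine tendsto_const_nhds.congr' ?_
      filter_upwards [Ioc_mem_nhdsGT (zero_lt_one' ℝ)] with ε hε using hconst ε hε
    have := tendsto_nhds_unique hlim' hlim
    rw [hbr _ h0, h1] at this
    exact hlt.ne' this

/-! ### The identifications of the spectral curves -/

theorem le_of_gap {d : ℝ → ℝ} (hd : Continuous d) (h0 : d 0 ≤ 1 / 4)
    (hgap : ∀ t, |t| ≤ δ → d t ≤ 1 / 2 → d t ≤ 1 / 4) {t : ℝ} (ht : |t| ≤ δ) : d t ≤ 1 / 4 := by
  by_contra! hlt
  have h12 : 1 / 2 < d t := by by_contra! h; exact (hgap t ht h).not_gt hlt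
  have hI : (3 / 8 : ℝ) ∈ uIcc (d 0) (d t) := by rw [mem_uIcc]; left; constructor <;> linarith
  obtain ⟨s, hs, hds⟩ := intermediate_value_uIcc (a := 0) (b := t) hd.continuousOn hI
  have hs' : |s| ≤ δ := by
    have : |s - 0| ≤ |t - 0| := abs_sub_left_of_mem_uIcc hs
    simp only [sub_zero] at this
    linarith
  have := hgap s hs' (by rw [hds]; norm_num)
  rw [hds] at this
  norm_num at this

namespace AbelianPath

variable {ζ : ℂ} {a : FramedAbelianConnection ζ} (Q : AbelianPath a)

theorem φ_ne_zero (t : ℝ) (hu : u ≠ 0) : Q.φ t u ≠ 0 := (Q.φ_bijOn t).mapsTo hu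

theorem contDiffAt_φ (t : ℝ) (hu : u ≠ 0) : ContDiffAt ℝ ∞ (fun p : ℝ × ℂ => Q.φ p.1 p.2) (t, u) :=
    by
  refine Q.φ_smooth.contDiffAt ((isOpen_ne.preimage continuous_snd).mem_nhds ?_)
  exact hu

theorem contDiffAt_φ_slice (t : ℝ) (hu : u ≠ 0) : ContDiffAt ℝ ∞ (Q.φ t) u :=
  (Q.contDiffAt_φ t hu).comp u (contDiffAt_const.prodMk contDiffAt_id)

theorem continuous_φ_left (hu : u ≠ 0) : Continuous fun t => Q.φ t u :=
  continuous_iff_continuousAt.2 fun t =>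
    ContinuousAt.comp (f := fun t => (t, u)) (g := fun p : ℝ × ℂ => Q.φ p.1 p.2)
      (Q.contDiffAt_φ t hu).continuousAt (continuousAt_id.prodMk continuousAt_const)

theorem ratio_eq {m' f : ℂ} (hu : u ≠ 0) (hf : f ≠ 0) (h : proj m' f = proj m u) : f / u *
    (f / u - 1) * u ^ 2 = 2 * (m' - m * (f / u)) := by
  simp only [proj, spectralPoint] at h
  field_simp at h ⊢
  linear_combination h

theorem ratio_large {h m' : ℂ} {M : ℝ} (hm : ‖m‖ ≤ M) (hm' : ‖m'‖ ≤ M) (hu : u ≠ 0)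
    (e : h * (h - 1) * u ^ 2 = 2 * (m' - m * h)) (hh : ‖h - 1‖ ≤ 1 / 2) : ‖h - 1‖ ≤ 10 * M / ‖u‖ ^ 2
    := by
  have hu' : 0 < ‖u‖ ^ 2 := by positivity
  have h1 : 1 / 2 ≤ ‖h‖ := by
    have := norm_sub_norm_le (1 : ℂ) (1 - h)
    rw [norm_one, norm_sub_rev, sub_sub_cancel] at this
    linarith
  have h2 : ‖h‖ ≤ 3 / 2 := by
    have := norm_add_le (h - 1) 1
    rw [sub_add_cancel, norm_one] at this
    linarith
  have h3 := congrArg norm e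
  rw [norm_mul, norm_mul, norm_pow, norm_mul] at h3
  have h4 : ‖m' - m * h‖ ≤ M + M * (3 / 2) := by
    refine (norm_sub_le _ _).trans (add_le_add hm' ?_)
    rw [norm_mul]
    exact mul_le_mul hm h2 (norm_nonneg _) ((norm_nonneg _).trans hm)
  rw [le_div_iff₀ hu']
  have h5 : 1 / 2 * (‖h - 1‖ * ‖u‖ ^ 2) ≤ ‖h‖ * (‖h - 1‖ * ‖u‖ ^ 2) := by gcongr
  have h6 : ‖(2 : ℂ)‖ = 2 := by simp
  rw [h6] at h3
  nlinarith

theorem ratio_small {h m' : ℂ} (hm : m ≠ 0) (e : h * (h - 1) * u ^ 2 = 2 * (m' - m * h))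
    (hh : ‖h - 1‖ ≤ 1 / 2) : ‖h - m' / m‖ ≤ ‖u‖ ^ 2 / ‖m‖ := by
  have hm0 : 0 < ‖m‖ := norm_pos_iff.2 hm
  have h2 : ‖h‖ ≤ 3 / 2 := by
    have := norm_add_le (h - 1) 1
    rw [sub_add_cancel, norm_one] at this
    linarith
  have e2 : h - m' / m = -(h * (h - 1) * u ^ 2 / (2 * m)) := by rw [e]; field_simp; ring
  rw [e2, norm_neg, norm_div, norm_mul, norm_mul, norm_mul, norm_pow]
  have h6 : ‖(2 : ℂ)‖ = 2 := by simp
  rw [h6, div_le_div_iff₀ (by positivity) hm0]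
  have h7 : ‖h‖ * ‖h - 1‖ ≤ 2 := by nlinarith [norm_nonneg h, norm_nonneg (h - 1)]
  have h8 : 0 ≤ ‖u‖ ^ 2 * ‖m‖ := by positivity
  nlinarith

theorem exists_close (hm : Continuous fun t => (Q.conn t).m) :
    ∃ δ > 0, ∀ t, |t| ≤ δ → ∀ u, u ≠ 0 → ‖Q.φ t u / u - 1‖ ≤ 1 / 4 := by
  obtain ⟨K, hK, hfr⟩ := Q.framed
  have hm0 : (Q.conn 0).m = a.m := by rw [Q.base]
  have ha := a.m_ne_zero
  have ha0 : 0 < ‖a.m‖ := norm_pos_iff.2 ha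
  obtain ⟨M, hM⟩ := (isCompact_Icc (a := (-1 : ℝ)) (b := 1)).exists_bound_of_continuousOn
    hm.continuousOn
  have hMa : ‖a.m‖ ≤ M := by rw [← hm0]; exact hM 0 (by norm_num)
  have hMpos : 0 < M := ha0.trans_le hMa
  have hd0 : ∀ u : ℂ, u ≠ 0 → ‖Q.φ 0 u / u - 1‖ ≤ 1 / 4 := by
    intro u hu
    rw [Q.φ_zero u hu, div_self hu]
    norm_num
  have hdc : ∀ u : ℂ, u ≠ 0 → Continuous fun t => ‖Q.φ t u / u - 1‖ := fun u hu =>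
    (((Q.continuous_φ_left hu).div_const u).sub continuous_const).norm
  obtain ⟨δ1, hδ1, hδ1'⟩ : ∃ δ > 0, ∀ t, |t| ≤ δ → ‖(Q.conn t).m / a.m - 1‖ ≤ 1 / 8 := by
    have hc : ContinuousAt (fun t => ‖(Q.conn t).m / a.m - 1‖) 0 :=
      ((hm.div_const a.m).sub continuous_const).norm.continuousAt
    have : ∀ᶠ t in 𝓝 (0 : ℝ), ‖(Q.conn t).m / a.m - 1‖ ≤ 1 / 8 := by
      refine hc.tendsto.eventually_le_const ?_
      rw [hm0, div_self ha]
      norm_num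
    obtain ⟨δ, hδ, h⟩ := Metric.eventually_nhds_iff.1 this
    exact ⟨δ / 2, by positivity, fun t ht => h (by rw [Real.dist_eq, sub_zero]; linarith)⟩
  set δ2 := min δ1 1
  have hδ₂0 : 0 < δ2 := lt_min hδ1 one_pos
  set R := max (K + 1) (7 * (M + 1))
  have hlarge : ∀ t, |t| ≤ δ2 → ∀ u, R ≤ ‖u‖ → ‖Q.φ t u / u - 1‖ ≤ 1 / 4 := by
    intro t ht u hu
    have hu1 : 7 * (M + 1) ≤ ‖u‖ := (le_max_right _ _).trans hu
    have hu0 : u ≠ 0 := norm_pos_iff.1 (by linarith)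
    refine le_of_gap (hdc u hu0) (hd0 u hu0) (fun s hs hh => ?_) ht
    have hs1 : s ∈ Icc (-1 : ℝ) 1 := abs_le.1 (hs.trans (min_le_right _ _))
    have hp := ((hfr s u hu0).1 (by linarith [le_max_left (K + 1) (7 * (M + 1))])).1
    refine (ratio_large hMa (hM s hs1) hu0 (ratio_eq hu0 (Q.φ_ne_zero s hu0) hp) hh).trans ?_
    rw [div_le_iff₀ (by positivity)]
    nlinarith
  set r := min (K⁻¹ / 2) (min 1 (‖a.m‖ / 8))
  have hr0 : 0 < r := by positivity
  have hsmall : ∀ t, |t| ≤ δ2 → ∀ u, u ≠ 0 → ‖u‖ ≤ r → ‖Q.φ t u / u - 1‖ ≤ 1 / 4 := by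
    intro t ht u hu0 hu
    refine le_of_gap (hdc u hu0) (hd0 u hu0) (fun s hs hh => ?_) ht
    have hKr : ‖u‖ < K⁻¹ := by
      have : 0 < K⁻¹ := by positivity
      linarith [hu.trans (min_le_left _ _)]
    have hp := ((hfr s u hu0).2 hKr).1
    have h1 := ratio_small ha (ratio_eq hu0 (Q.φ_ne_zero s hu0) hp) hh
    have h2 := hδ1' s (hs.trans (min_le_left _ _))
    have h3 : ‖u‖ ^ 2 / ‖a.m‖ ≤ 1 / 8 := by
      have hu1 : ‖u‖ ≤ 1 := hu.trans ((min_le_right _ _).trans (min_le_left _ _))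
      have hu2 : ‖u‖ ≤ ‖a.m‖ / 8 := hu.trans ((min_le_right _ _).trans (min_le_right _ _))
      rw [div_le_iff₀ ha0]
      nlinarith [norm_nonneg u]
    have h4 := norm_add_le (Q.φ s u / u - (Q.conn s).m / a.m) ((Q.conn s).m / a.m - 1)
    rw [sub_add_sub_cancel] at h4
    linarith
  have hKc : IsCompact (closedBall (0 : ℂ) R \ ball 0 r) :=
    (isCompact_closedBall _ _).diff Metric.isOpen_ball
  have hmid := hKc.eventually_forall_of_forall_eventually (x₀ := (0 : ℝ))
    (P := fun t u => ‖Q.φ t u / u - 1‖ ≤ 1 / 4) (fun u hu => by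
      have hu0 : u ≠ 0 := by rintro rfl; exact hu.2 (Metric.mem_ball_self hr0)
      have hc : ContinuousAt (fun p : ℝ × ℂ => ‖Q.φ p.1 p.2 / p.2 - 1‖) (0, u) :=
        (((Q.contDiffAt_φ 0 hu0).continuousAt.div continuousAt_snd hu0).sub continuousAt_const).norm
      refine hc.tendsto.eventually_le_const ?_
      rw [Q.φ_zero u hu0, div_self hu0]
      norm_num)
  obtain ⟨δ3, hδ3, hmid⟩ := Metric.eventually_nhds_iff.1 hmid
  refine ⟨min δ2 (δ3 / 2), by positivity, fun t ht u hu => ?_⟩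
  have ht2 : |t| ≤ δ2 := ht.trans (min_le_left _ _)
  rcases le_total R ‖u‖ with h | h
  · exact hlarge t ht2 u h
  rcases le_or_gt ‖u‖ r with h' | h'
  · exact hsmall t ht2 u hu h'
  · refine hmid ?_ u ⟨by simpa using h, by simpa using h'.le⟩
    rw [Real.dist_eq, sub_zero]
    linarith [ht.trans (min_le_right _ _)]

/-- The inverse of the identification. -/
def φinv (t : ℝ) : ℂ → ℂ := Function.invFunOn (Q.φ t) {0}ᶜ

theorem φinv_ne_zero (t : ℝ) (hu : u ≠ 0) : Q.φinv t u ≠ 0 :=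
  Function.invFunOn_mem ((Q.φ_bijOn t).surjOn hu)

theorem φ_φinv (t : ℝ) (hu : u ≠ 0) : Q.φ t (Q.φinv t u) = u :=
  Function.invFunOn_eq ((Q.φ_bijOn t).surjOn hu)

theorem φinv_φ (t : ℝ) (hu : u ≠ 0) : Q.φinv t (Q.φ t u) = u :=
  (Q.φ_bijOn t).injOn (Q.φinv_ne_zero t (Q.φ_ne_zero t hu)) hu (Q.φ_φinv t (Q.φ_ne_zero t hu))

theorem differentiableAt_φinv (t : ℝ) (hu : u ≠ 0) : DifferentiableAt ℝ (Q.φinv t) u := by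
  have hw0 := Q.φinv_ne_zero t hu
  let e : ℂ ≃L[ℝ] ℂ := (LinearEquiv.ofInjectiveEndo (fderiv ℝ (Q.φ t) (Q.φinv t u) : ℂ →ₗ[ℝ] ℂ)
    (Q.φ_immersion t _ hw0)).toContinuousLinearEquiv
  have hstrict : HasStrictFDerivAt (Q.φ t) (e : ℂ →L[ℝ] ℂ) (Q.φinv t u) :=
    (Q.contDiffAt_φ_slice t hw0).hasStrictFDerivAt (by simp)
  have := hstrict.to_local_left_inverse (g := Q.φinv t) (by
    filter_upwards [isOpen_ne.mem_nhds hw0] with x hx using Q.φinv_φ t hx)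
  rw [Q.φ_φinv t hu] at this
  exact this.hasFDerivAt.differentiableAt

theorem φ_mem_unbranched (t : ℝ) (hu : u ∈ unbranched a.m) : Q.φ t u ∈ unbranched (Q.conn t).m := by
  refine ⟨Q.φ_ne_zero t hu.1, fun h => ?_⟩
  obtain ⟨b, hb, -⟩ := Q.branch
  have hm := a.m_ne_zero
  have hb0 : b ≠ 0 := by
    rintro rfl
    simp only [ne_eq, OfNat.ofNat_ne_zero, not_false_eq_true, zero_pow] at hb
    apply hm
    linear_combination (1 / 2 : ℂ) * hb
  have hnb0 : -b ≠ 0 := neg_ne_zero.2 hb0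
  have hnb : (-b) ^ 2 = -(2 * a.m) := by rw [neg_sq, hb]
  have h1 := Q.φ_branch t b hb
  have h2 := Q.φ_branch t (-b) hnb
  have hinj := (Q.φ_bijOn t).injOn
  have key : ∀ x, x ≠ 0 → x ^ 2 = -(2 * a.m) → Q.φ t u ≠ Q.φ t x := fun x hx hx2 he =>
    hu.2 (by rw [hinj hu.1 hx he, hx2])
  have e1 : Q.φ t u = -Q.φ t b := by
    rcases sq_eq_sq_iff_eq_or_eq_neg.1 (h.trans h1.symm) with e | e
    · exact absurd e (key b hb0 hb)
    · exact e
  have e2 : Q.φ t u = -Q.φ t (-b) := by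
    rcases sq_eq_sq_iff_eq_or_eq_neg.1 (h.trans h2.symm) with e | e
    · exact absurd e (key (-b) hnb0 hnb)
    · exact e
  have e3 : Q.φ t b = Q.φ t (-b) := neg_injective (e1.symm.trans e2)
  have := hinj hb0 hnb0 e3
  exact hb0 (self_eq_neg.1 this)

end AbelianPath

/-! ### The spectral curve in a logarithmic coordinate -/

/-- A logarithm of `sinh` on the right half plane. -/
def lsinh (Y : ℂ) : ℂ := Y - log 2 + log (1 - exp (-(2 * Y)))

theorem re_one_sub_exp_pos (hY : 0 < Y.re) : 0 < (1 - exp (-(2 * Y))).re := by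
  have h1 : ‖exp (-(2 * Y))‖ < 1 := by rw [norm_exp, Real.exp_lt_one_iff]; simpa using hY
  have h2 := (re_le_norm (exp (-(2 * Y)))).trans_lt h1
  simpa using h2

theorem one_sub_exp_ne_zero (hY : 0 < Y.re) : 1 - exp (-(2 * Y)) ≠ 0 := fun h => by
  have := re_one_sub_exp_pos hY
  rw [h] at this
  exact lt_irrefl _ this

theorem two_sinh_eq (Y : ℂ) : 2 * sinh Y = exp Y * (1 - exp (-(2 * Y))) := by
  have : exp Y * exp (-(2 * Y)) = exp (-Y) := by rw [← exp_add]; ring_nf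
  rw [two_sinh, mul_sub, this, mul_one]

theorem exp_lsinh (hY : 0 < Y.re) : exp (lsinh Y) = sinh Y := by
  rw [lsinh, exp_add, exp_sub, exp_log two_ne_zero, exp_log (one_sub_exp_ne_zero hY)]
  linear_combination -(1 / 2 : ℂ) * two_sinh_eq Y

theorem sinh_ne_zero (hY : 0 < Y.re) : sinh Y ≠ 0 := by rw [← exp_lsinh hY]; exact exp_ne_zero _

theorem hasDerivAt_lsinh (hY : 0 < Y.re) : HasDerivAt lsinh (cosh Y / sinh Y) Y := by
  have h1 : HasDerivAt (fun Y : ℂ => 1 - exp (-(2 * Y))) (2 * exp (-(2 * Y))) Y := by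
    have := ((hasDerivAt_id Y).const_mul 2).fun_neg.cexp.const_sub 1
    exact this.congr_deriv (by simp; ring)
  refine (((hasDerivAt_id Y).sub_const (log 2)).add
    (h1.clog (Or.inl (re_one_sub_exp_pos hY)))).congr_deriv ?_
  have e1 := two_sinh_eq Y
  have e2 : exp Y * exp (-(2 * Y)) = exp (-Y) := by rw [← exp_add]; ring_nf
  have e3 := two_cosh Y
  have hs := sinh_ne_zero hY
  have hn := one_sub_exp_ne_zero hY
  have hY0 := exp_ne_zero Y
  rw [eq_div_iff hs]
  field_simp
  have e4 : exp Y * (1 + exp (-(2 * Y))) = 2 * cosh Y := by rw [mul_add, e2, e3, mul_one]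
  apply mul_left_cancel₀ hY0
  apply mul_left_cancel₀ (two_ne_zero (α := ℂ))
  linear_combination (exp Y * (1 + exp (-(2 * Y)))) * e1 + exp Y * (1 - exp (-(2 * Y))) * e4

theorem abs_im_lsinh_sub_le (hY : 0 < Y.re) : |(lsinh Y).im - Y.im| ≤ π / 2 := by
  have h : (lsinh Y).im - Y.im = arg (1 - exp (-(2 * Y))) := by simp [lsinh, log_im]
  rw [h]
  exact abs_arg_le_pi_div_two_iff.2 (re_one_sub_exp_pos hY).le

theorem tendsto_lsinh_sub {l : Filter ℝ} {Y : ℝ → ℂ} (h : Tendsto (fun r => (Y r).re) l atTop) :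
    Tendsto (fun r => lsinh (Y r) - Y r) l (𝓝 (-log 2)) := by
  have h1 : Tendsto (fun r => exp (-(2 * Y r))) l (𝓝 0) := by
    rw [tendsto_zero_iff_norm_tendsto_zero]
    simp only [norm_exp]
    refine Real.tendsto_exp_atBot.comp ?_
    have := (h.const_mul_atTop (zero_lt_two' ℝ))
    exact (tendsto_neg_atTop_atBot.comp this).congr fun r => by simp
  have h2 : Tendsto (fun r => log (1 - exp (-(2 * Y r)))) l (𝓝 0) := by
    have hc : ContinuousAt (fun x : ℂ => log (1 - x)) 0 :=
      (continuousAt_const.sub continuousAt_id).clog (by simp)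
    simpa [Function.comp_def] using hc.tendsto.comp h1
  have h3 := h2.add_const (-log 2)
  rw [zero_add] at h3
  refine h3.congr fun r => ?_
  simp only [lsinh]
  ring

theorem lsinh_add_pi_I (Y : ℂ) : lsinh (π * I + Y) = π * I + lsinh Y := by
  have : exp (-(2 * (π * I + Y))) = exp (-(2 * Y)) := by
    rw [show -(2 * (π * I + Y)) = -(2 * Y) - 2 * π * I by ring, exp_sub, exp_two_pi_mul_I, div_one]
  simp only [lsinh, this]
  ring

/-- The half turn that exchanges the two sheets. -/
def turn (p : Fin 2) : ℂ := if p = 0 then 0 else π * I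

/-- The coordinate `log z` near the puncture `∞₋` (`p = 0`) and `∞₊` (`p = 1`), as a function of
the coordinate `Y` on the spectral curve in which `u = exp (lam + Y)`. -/
def endLog (lam : ℂ) (p : Fin 2) (Y : ℂ) : ℂ := lam + lsinh (turn p + sg p * Y)

theorem sinh_turn (p : Fin 2) (Y : ℂ) :
    sinh (turn p + sg p * Y) = sinh Y ∧ cosh (turn p + sg p * Y) = sg p * cosh Y := by
  fin_cases p
  · simp [turn, sg]
  · have h1 : (π * I + -Y : ℂ) = -Y + π * I := add_comm _ _
    simp [turn, sg, h1, sinh_add, cosh_add, cosh_mul_I, sinh_mul_I]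

theorem re_turn (p : Fin 2) (Y : ℂ) : (turn p + sg p * Y).re = sg p * Y.re := by
  fin_cases p <;> simp [turn, sg]

theorem exp_endLog (lam : ℂ) {p : Fin 2} (hY : 0 < sg p * Y.re) : exp (endLog lam p Y) = exp lam *
    sinh Y := by
  rw [endLog, exp_add, exp_lsinh (by rwa [re_turn]), (sinh_turn p Y).1]

theorem ofReal_sg_mul_self (p : Fin 2) : (sg p : ℂ) * sg p = 1 := mod_cast sg_mul_self p

theorem hasDerivAt_endLog (lam : ℂ) {p : Fin 2} (hY : 0 < sg p * Y.re) : HasDerivAt (endLog lam p)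
    (cosh Y / sinh Y) Y := by
  have h1 : HasDerivAt (fun Y : ℂ => turn p + sg p * Y) (sg p) Y := by
    simpa using ((hasDerivAt_id Y).const_mul (sg p : ℂ)).const_add (turn p)
  have h2 := (hasDerivAt_lsinh (Y := turn p + sg p * Y) (by rwa [re_turn])).comp Y h1
  refine (h2.const_add lam).congr_deriv ?_
  rw [(sinh_turn p Y).1, (sinh_turn p Y).2]
  linear_combination (cosh Y / sinh Y) * ofReal_sg_mul_self p

theorem endLog_zero_add (lam Y : ℂ) :
    endLog lam 0 (Y + 2 * π * I) = endLog lam 0 Y + 2 * π * I := by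
  have := lsinh_add_pi_I (π * I + Y)
  rw [lsinh_add_pi_I Y] at this
  simp only [endLog, turn, sg, if_true, ofReal_one, one_mul, zero_add]
  rw [show Y + 2 * π * I = π * I + (π * I + Y) by ring, this]
  ring

section Curve

variable {lam m : ℂ} (hlam : exp (2 * lam) = 2 * m)
include hlam

theorem proj_exp (Y : ℂ) : proj m (exp (lam + Y)) = exp lam * sinh Y := by
  have h1 : exp (2 * lam) = exp lam * exp lam := by rw [← exp_add, two_mul]
  have hl := exp_ne_zero lam
  have hY := exp_ne_zero Y
  simp only [proj, spectralPoint, ← hlam, h1, exp_add, sinh, exp_neg]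
  field_simp

theorem projDeriv_exp (Y : ℂ) : projDeriv m (exp (lam + Y)) * exp (lam + Y) = exp lam * cosh Y := by
  have h1 : exp (2 * lam) = exp lam * exp lam := by rw [← exp_add, two_mul]
  have hl := exp_ne_zero lam
  have hY := exp_ne_zero Y
  simp only [projDeriv, ← hlam, h1, exp_add, cosh, exp_neg]
  field_simp

theorem liftedSingularPart_exp (ζ m' : ℂ) (m3 : ℝ) (hξ : exp ξ = exp lam * sinh Y) (v : ℂ) :
    liftedSingularPart ζ m' m3 m (exp (lam + Y)) (exp (lam + Y) * v) = expoD ζ⁻¹ ζ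
    (ζ⁻¹ * m' - m3 / 2) (ζ * conj m' + m3 / 2) ξ (cosh Y / sinh Y * v) := by
  have hl := exp_ne_zero lam
  have hs : sinh Y ≠ 0 := fun h => exp_ne_zero ξ (by rw [hξ, h, mul_zero])
  rw [liftedSingularPart, ← singularPart_exp, ← mul_assoc, projDeriv_exp hlam, proj_exp hlam,
    exp_neg, hξ]
  congr 1
  field_simp

theorem mem_unbranched_exp {p : Fin 2} (hY : 0 < sg p * Y.re) : exp (lam + Y) ∈ unbranched m := by
  refine ⟨exp_ne_zero _, fun h => ?_⟩
  rw [← hlam, ← exp_nat_mul, ← neg_eq_iff_eq_neg] at h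
  have := congrArg norm h
  rw [norm_neg, norm_exp, norm_exp, Real.exp_eq_exp] at this
  simp at this
  rw [this, mul_zero] at hY
  exact lt_irrefl _ hY

end Curve

theorem hasFDerivAt_expo_comp (c1 c2 a b : ℂ) {f' : ℂ} (hf : HasDerivAt f f' Y) : ∃ L : ℂ →L[ℝ] ℂ,
    HasFDerivAt (fun Y => expo c1 c2 a b (f Y)) L Y ∧ ∀ v, L v = expoD c1 c2 a b (f Y) (f' * v) :=
    by
  have h1 : HasFDerivAt f (f' • (1 : ℂ →L[ℝ] ℂ)) Y := by
    refine hf.hasFDerivAt.restrictScalars ℝ |>.congr_fderiv ?_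
    ext; simp [mul_comm]
  have h2 : DifferentiableAt ℝ (fun ξ => expo c1 c2 a b ξ) (f Y) := by
    have hc : DifferentiableAt ℝ (fun ξ : ℂ => conj ξ) (f Y) := conjCLE.differentiableAt
    have he : ∀ g : ℂ → ℂ, DifferentiableAt ℝ g (f Y) → DifferentiableAt ℝ (fun ξ => exp (g ξ)) (f Y) :=
      fun g hg => hg.cexp
    simp only [expo]
    have h1 := ((he _ (differentiableAt_id.const_mul 2)).const_mul c1).add
      ((he _ (hc.const_mul 2)).const_mul c2)
    have h2 := (differentiableAt_id.const_mul a).add (hc.const_mul b)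
    exact ((h1.mul_const (2⁻¹ : ℂ)).add h2).congr_of_eventuallyEq
      (Eventually.of_forall fun ξ => by simp [div_eq_mul_inv])
  refine ⟨_, h2.hasFDerivAt.comp Y h1, fun v => ?_⟩
  have h3 : HasDerivAt (fun s : ℝ => f Y + s * (f' * v)) (f' * v) 0 := by
    simpa using (ofRealCLM.hasDerivAt (x := 0)).mul_const (f' * v)  |>.const_add (f Y)
  have h4 := hasDerivAt_expo c1 c2 a b h3
  have h2' := h2.hasFDerivAt
  rw [show f Y = f Y + ((0 : ℝ) : ℂ) * (f' * v) by simp] at h2'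
  have h5 := h2'.comp_hasDerivAt (0 : ℝ) h3
  have := h5.unique h4
  simpa using this

theorem closed_pullback {α : CForm} (hα : DifferentiableAt ℝ α (f x))
    (hcl : fderiv ℝ α (f x) 1 I = fderiv ℝ α (f x) I 1) (hf : ContDiffAt ℝ ∞ f x) : fderiv ℝ
    (fun y => (α (f y)).comp (fderiv ℝ f y)) x 1 I = fderiv ℝ
    (fun y => (α (f y)).comp (fderiv ℝ f y)) x I 1 := by
  have hf1 : HasFDerivAt f (fderiv ℝ f x) x := (hf.differentiableAt (by simp)).hasFDerivAt
  have hf2 : DifferentiableAt ℝ (fderiv ℝ f) x :=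
    (hf.fderiv_right (m := 1) (by norm_cast)).differentiableAt one_ne_zero
  have hsym : IsSymmSndFDerivAt ℝ f x := hf.isSymmSndFDerivAt (by simp; exact WithTop.coe_le_coe.2 le_top)
  have h := (hα.hasFDerivAt.comp x hf1).clm_comp hf2.hasFDerivAt
  have e : ∀ p q, fderiv ℝ α (f x) p q = fderiv ℝ α (f x) q p := fun p q => by
    have := antisymm_eq_zero (B := fun p q => fderiv ℝ α (f x) p q - fderiv ℝ α (f x) q p)
      (by intros; simp; ring) (by intros; simp only [map_smul, smul_apply, smul_sub])
      (by intros; ring) (by rw [hcl, sub_self]) p q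
    exact sub_eq_zero.1 this
  have h' := h.fderiv
  simp only [Function.comp_def] at h'
  rw [h']
  simp only [add_apply, ContinuousLinearMap.comp_apply, ContinuousLinearMap.compL_apply,
    ContinuousLinearMap.flip_apply]
  rw [hsym.eq 1 I, e]

/-! ### Closed forms on the spectral curve in the logarithmic coordinate -/

theorem exists_primitive {β : CForm} (hd : Differentiable ℝ β)
    (hcl : ∀ z, fderiv ℝ β z 1 I = fderiv ℝ β z I 1) : ∃ F : ℂ → ℂ, ∀ z, HasFDerivAt F (β z) z := by
  obtain ⟨F, hF⟩ := convex_univ.exists_forall_hasFDerivAt_of_fderiv_symmetric isOpen_univ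
    hd.differentiableOn (fun z _ x y => by
      have := antisymm_eq_zero (B := fun p q => fderiv ℝ β z p q - fderiv ℝ β z q p)
        (by intros; simp; ring) (by intros; simp only [map_smul, smul_apply, smul_sub])
        (by intros; ring) (by rw [hcl, sub_self]) x y
      exact sub_eq_zero.1 this)
  exact ⟨F, fun z => hF z (mem_univ z)⟩

/-- Multiplication by a complex number as a real-linear map. -/
def mulL (c : ℂ) : ℂ →L[ℝ] ℂ := ContinuousLinearMap.mul ℝ ℂ c

@[simp] theorem mulL_apply (c v : ℂ) : mulL c v = c * v := rfl

theorem hasFDerivAt_mulL {f' : ℂ} (h : HasDerivAt f f' x) : HasFDerivAt f (mulL f') x := by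
  refine (h.hasFDerivAt.restrictScalars ℝ).congr_fderiv ?_
  ext v; simp [mul_comm]

theorem hasFDerivAt_mulL_comp {g : ℂ → ℂ} {g' : ℂ} (h : HasDerivAt g g' x) : HasFDerivAt
    (fun Y => mulL (g Y)) ((ContinuousLinearMap.mul ℝ ℂ).comp (mulL g')) x :=
  (ContinuousLinearMap.mul ℝ ℂ).hasFDerivAt.comp x (hasFDerivAt_mulL h)

theorem hasDerivAt_exp_add (lam Y : ℂ) : HasDerivAt (fun Y => exp (lam + Y)) (exp (lam + Y)) Y := by
  simpa using ((hasDerivAt_id Y).const_add lam).cexp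

/-- The pullback of a form under `Y ↦ exp (lam + Y)`. -/
def pull (lam : ℂ) (β : CForm) : CForm := fun Y =>
  (β (exp (lam + Y))).comp (mulL (exp (lam + Y)))

theorem contDiffAt_pull {β : ℝ → CForm}
    (h : ContDiffAt ℝ ∞ (fun p : ℝ × ℂ => β p.1 p.2) (t, exp (lam + Y))) : ContDiffAt ℝ ∞
    (fun p : ℝ × ℂ => pull lam (β p.1) p.2) (t, Y) := by
  have h1 : ContDiffAt ℝ ∞ (fun p : ℝ × ℂ => exp (lam + p.2)) (t, Y) :=
    (contDiffAt_const.add contDiffAt_snd).cexp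
  have h2 : ContDiffAt ℝ ∞ (fun p : ℝ × ℂ => β p.1 (exp (lam + p.2))) (t, Y) :=
    ContDiffAt.comp (t, Y) (f := fun p : ℝ × ℂ => (p.1, exp (lam + p.2))) h
      (contDiffAt_fst.prodMk h1)
  exact h2.clm_comp ((ContinuousLinearMap.mul ℝ ℂ).contDiff.contDiffAt.comp (t, Y) h1)

theorem closed_pull {β : CForm} (hβ : DifferentiableAt ℝ β (exp (lam + Y))) (hcl : fderiv ℝ β (exp
    (lam + Y)) 1 I = fderiv ℝ β (exp (lam + Y)) I 1) : fderiv ℝ (pull lam β) Y 1 I = fderiv ℝ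
    (pull lam β) Y I 1 := by
  have e : pull lam β = fun y => (β ((fun Y => exp (lam + Y)) y)).comp
      (fderiv ℝ (fun Y => exp (lam + Y)) y) := funext fun y => by
    rw [(hasFDerivAt_mulL (hasDerivAt_exp_add lam y)).fderiv, pull]
  rw [e]
  exact closed_pullback hβ hcl (contDiffAt_const.add contDiffAt_id).cexp

theorem isOpen_unbranched (m : ℂ) : IsOpen (unbranched m) :=
  isOpen_ne.inter (isOpen_ne_fun (by fun_prop) continuous_const)

theorem eq_of_end {p : Fin 2} (hF : ∀ Y, y0 < sg p * Y.re → HasFDerivAt F (0 : ℂ →L[ℝ] ℂ) Y)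
    {Y' : ℂ} (hY : y0 < sg p * Y.re) (hY' : y0 < sg p * Y'.re) : F Y = F Y' := by
  have ho : IsOpen {Y : ℂ | y0 < sg p * Y.re} := isOpen_lt (by fun_prop) (by fun_prop)
  have hc : Convex ℝ {Y : ℂ | y0 < sg p * Y.re} := fun x hx y hy s t hs ht hst => by
    have := convex_Ioi y0 hx hy hs ht hst
    simp only [mem_Ioi, smul_eq_mul, mem_ofPred_eq, add_re, real_smul, re_ofReal_mul] at *
    linarith
  exact ho.is_const_of_fderiv_eq_zero hc.isPreconnected
    (fun Z hZ => (hF Z hZ).differentiableAt.differentiableWithinAt)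
    (fun Z hZ => (hF Z hZ).fderiv) hY hY'

theorem eq_of_end_expoD {p : Fin 2} (hy0 : 0 ≤ y0) (hF : ∀ Y, y0 < sg p * Y.re → ∃ L : ℂ →L[ℝ] ℂ,
    HasFDerivAt F L Y ∧ ∀ v, L v = sg p * expoD c1 c2 a b (endLog lam p Y) (cosh Y / sinh Y * v))
    {Y' : ℂ} (hY : y0 < sg p * Y.re) (hY' : y0 < sg p * Y'.re) : F Y - sg p * expo c1 c2 a b
    (endLog lam p Y) = F Y' - sg p * expo c1 c2 a b (endLog lam p Y') := by
  refine eq_of_end (F := fun Y => F Y - sg p * expo c1 c2 a b (endLog lam p Y))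
    (fun Z hZ => ?_) hY hY'
  obtain ⟨L, hL, e⟩ := hF Z hZ
  obtain ⟨M, hM, e'⟩ := hasFDerivAt_expo_comp c1 c2 a b (hasDerivAt_endLog lam (hy0.trans_lt hZ))
  refine (hL.fun_sub (hM.const_mul (sg p : ℂ))).congr_fderiv ?_
  ext v
  simp [e, e']

/-- The coefficient in `β = dG` for a variation `β` of framed almost-flat connections. -/
structure LogPrimitive (lam m : ℂ) (β : CForm) (a' b' k : ℂ) (y0 : ℝ) (G : ℂ → ℂ) : Prop where
  smooth : ContDiff ℝ ∞ G
  fderiv_eq : ∀ Y, exp (lam + Y) ∈ unbranched m → fderiv ℝ G Y = pull lam β Y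
  ends : ∀ (p : Fin 2) (Y : ℂ), y0 < sg p * Y.re →
    G Y = sg p * lin a' b' (endLog lam p Y) + if p = 0 then 0 else k
  period : ∀ Y, G (Y + 2 * π * I) = G Y + 2 * π * lin a' b' I

namespace AbelianPath

variable {ζ : ℂ} {a : FramedAbelianConnection ζ} (Q : AbelianPath a)

/-- The connection form at time `t` on the curve of `a`. -/
def form (t : ℝ) : CForm := fun u => ((Q.conn t).α (Q.φ t u)).comp (fderiv ℝ (Q.φ t) u)

/-- The coefficient of `dξ` in the framed form. -/
def coeffA (t : ℝ) : ℂ := ζ⁻¹ * (Q.conn t).m - (Q.conn t).m3 / 2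

/-- The coefficient of `dξ̄` in the framed form. -/
def coeffB (t : ℝ) : ℂ := ζ * conj (Q.conn t).m + (Q.conn t).m3 / 2

theorem contDiffAt_form (t : ℝ) (hu : u ∈ unbranched a.m) : ContDiffAt ℝ ∞
    (fun p : ℝ × ℂ => Q.form p.1 p.2) (t, u) :=
  Q.smooth.contDiffAt (((isOpen_unbranched a.m).preimage continuous_snd).mem_nhds hu)

theorem differentiableAt_form (t : ℝ) (hu : u ∈ unbranched a.m) : DifferentiableAt ℝ (Q.form t) u :=
  ((Q.contDiffAt_form t hu).comp u (f := fun u => (t, u))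
    (contDiffAt_const.prodMk contDiffAt_id)).differentiableAt (by simp)

theorem closed_form (t : ℝ) (hu : u ∈ unbranched a.m) : fderiv ℝ (Q.form t) u 1 I = fderiv ℝ
    (Q.form t) u I 1 := by
  have h := Q.φ_mem_unbranched t hu
  exact closed_pullback (((Q.conn t).smooth.contDiffAt
    ((isOpen_unbranched _).mem_nhds h)).differentiableAt (by simp))
    (sub_eq_zero.1 ((Q.conn t).flat _ h)) (Q.contDiffAt_φ_slice t hu.1)

theorem exists_form_branch : ∃ b : ℂ, b ^ 2 = -(2 * a.m) ∧ ∀ p : Fin 2,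
    ∀ᶠ u in 𝓝 (sg p * b), u ≠ sg p * b →
      ∀ t v, Q.form t u v = sg p * (v / (2 * (u - sg p * b))) := by
  obtain ⟨b, hb, r, hr, h⟩ := Q.branch
  refine ⟨b, hb, fun p => ?_⟩
  filter_upwards [Metric.ball_mem_nhds _ hr] with u hu hne t v
  have := h t (u - sg p * b) (sub_ne_zero.2 hne) (by rwa [← dist_eq_norm]) v
  fin_cases p
  · simpa [form, sg] using this.1
  · simpa [form, sg] using this.2

/-- The form relative to its value at time zero extends over the branch points. -/
def logForm (lam : ℂ) (t : ℝ) : CForm := fun Y => open Classical in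
  if exp (lam + Y) ∈ unbranched a.m then pull lam (fun u => Q.form t u - Q.form 0 u) Y else 0

theorem not_mem_unbranched (hb : b ^ 2 = -(2 * a.m)) (hu : u ≠ 0) (h : u ∉ unbranched a.m) : ∃ p :
    Fin 2, u = sg p * b := by
  have : u ^ 2 = b ^ 2 := by rw [hb]; by_contra hne; exact h ⟨hu, hne⟩
  rcases sq_eq_sq_iff_eq_or_eq_neg.1 this with e | e
  · exact ⟨0, by simp [sg, e]⟩
  · exact ⟨1, by simp [sg, e]⟩

theorem logForm_of_mem (h : exp (lam + Y) ∈ unbranched a.m) (t : ℝ) : Q.logForm lam t Y = pull lam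
    (fun u => Q.form t u - Q.form 0 u) Y := if_pos h

theorem eventually_mem (h : exp (lam + Y) ∈ unbranched a.m) : ∀ᶠ Z in 𝓝 Y, exp (lam + Z) ∈
    unbranched a.m :=
  (hasDerivAt_exp_add lam Y).continuousAt.tendsto.eventually ((isOpen_unbranched _).mem_nhds h)

theorem eventually_logForm_eq_zero (h : exp (lam + Y) ∉ unbranched a.m) : ∀ᶠ Z in 𝓝 Y, ∀ t,
    Q.logForm lam t Z = 0 := by
  obtain ⟨b, hb, hbr⟩ := Q.exists_form_branch
  obtain ⟨p, hp⟩ := not_mem_unbranched hb (exp_ne_zero _) h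
  have := hbr p
  rw [← hp] at this
  filter_upwards [(hasDerivAt_exp_add lam Y).continuousAt.tendsto.eventually this] with Z hZ t
  rw [logForm]
  split_ifs with hm
  · have hne : exp (lam + Z) ≠ exp (lam + Y) := fun e => h (e ▸ hm)
    ext v
    simp [pull, hZ hne]
  · rfl

theorem contDiff_logForm (lam : ℂ) : ContDiff ℝ ∞ fun p : ℝ × ℂ => Q.logForm lam p.1 p.2 := by
  refine contDiff_iff_contDiffAt.2 fun ⟨t, Y⟩ => ?_
  have hs : Tendsto (fun p : ℝ × ℂ => p.2) (𝓝 (t, Y)) (𝓝 Y) := continuous_snd.tendsto _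
  by_cases h : exp (lam + Y) ∈ unbranched a.m
  · refine (contDiffAt_pull (β := fun t u => Q.form t u - Q.form 0 u)
      ((Q.contDiffAt_form t h).sub ?_)).congr_of_eventuallyEq ?_
    · exact (Q.contDiffAt_form 0 h).comp (t, exp (lam + Y))
        (f := fun p : ℝ × ℂ => ((0 : ℝ), p.2)) (contDiffAt_const.prodMk contDiffAt_snd)
    · filter_upwards [hs.eventually (eventually_mem h)] with p hp using Q.logForm_of_mem hp _
  · refine (contDiffAt_const (c := 0)).congr_of_eventuallyEq ?_
    filter_upwards [hs.eventually (Q.eventually_logForm_eq_zero h)] with p hp using hp _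

theorem contDiff_logForm_slice (lam : ℂ) (t : ℝ) : ContDiff ℝ ∞ (Q.logForm lam t) :=
  (Q.contDiff_logForm lam).comp (contDiff_const.prodMk contDiff_id)

theorem closed_logForm (lam : ℂ) (t : ℝ) (Y : ℂ) :
    fderiv ℝ (Q.logForm lam t) Y 1 I = fderiv ℝ (Q.logForm lam t) Y I 1 := by
  by_cases h : exp (lam + Y) ∈ unbranched a.m
  · rw [EventuallyEq.fderiv_eq ((eventually_mem h).mono fun Z hZ => Q.logForm_of_mem hZ t)]
    have h1 := Q.differentiableAt_form t h
    have h0 := Q.differentiableAt_form 0 h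
    refine closed_pull (h1.fun_sub h0) ?_
    rw [fderiv_fun_sub h1 h0]
    simp only [sub_apply, Q.closed_form _ h]
  · rw [EventuallyEq.fderiv_eq (f₁ := Q.logForm lam t) (f := fun _ => 0)
      ((Q.eventually_logForm_eq_zero h).mono fun Z hZ => hZ t)]
    simp

/-- The derivative of `logForm` at time zero. -/
def logVar (lam : ℂ) : CForm := fun Y => deriv (fun t => Q.logForm lam t Y) 0

theorem contDiff_logVar (lam : ℂ) : ContDiff ℝ ∞ (Q.logVar lam) :=
  contDiff_iff_contDiffAt.2 fun Y => contDiffAt_deriv_slice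
    (f := fun p : ℝ × ℂ => Q.logForm lam p.1 p.2) (x := Y) (Q.contDiff_logForm lam).contDiffAt

theorem hasDerivAt_logForm (lam Y v : ℂ) :
    HasDerivAt (fun t => Q.logForm lam t Y v) (Q.logVar lam Y v) 0 := by
  have h := hasDerivAt_slice (f := fun p : ℝ × ℂ => Q.logForm lam p.1 p.2) (x := Y)
    (Q.contDiff_logForm lam).contDiffAt
  have h' := h.clm_apply (hasDerivAt_const (0 : ℝ) v)
  simp only [map_zero, add_zero] at h'
  exact h'

theorem closed_logVar (lam Y : ℂ) :
    fderiv ℝ (Q.logVar lam) Y 1 I = fderiv ℝ (Q.logVar lam) Y I 1 := by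
  have h : ∀ v w : ℂ, HasDerivAt (fun t => fderiv ℝ (Q.logForm lam t) Y v w)
      (fderiv ℝ (Q.logVar lam) Y v w) 0 := fun v w => by
    have h := hasDerivAt_fderiv_slice (f := fun p : ℝ × ℂ => Q.logForm lam p.1 p.2) (x := Y)
      (Q.contDiff_logForm lam).contDiffAt v
    have h' := h.clm_apply (hasDerivAt_const (0 : ℝ) w)
    simp only [map_zero, add_zero] at h'
    exact h'
  refine (h 1 I).unique ((h I 1).congr_of_eventuallyEq (Eventually.of_forall fun t => ?_))
  exact Q.closed_logForm lam t Y

theorem logVar_of_mem (h : exp (lam + Y) ∈ unbranched a.m) : Q.logVar lam Y = pull lam Q.variation Y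
    := by
  have h1 := hasDerivAt_slice (f := fun p : ℝ × ℂ => Q.form p.1 p.2) (x := exp (lam + Y))
    (Q.contDiffAt_form 0 h)
  ext1 v
  refine (Q.hasDerivAt_logForm lam Y v).unique ?_
  have h2 := (h1.sub_const (Q.form 0 (exp (lam + Y)))).clm_apply
    (hasDerivAt_const (0 : ℝ) (exp (lam + Y) * v))
  simp only [map_zero, add_zero] at h2
  refine h2.congr_of_eventuallyEq (Eventually.of_forall fun t => ?_)
  simp only [Q.logForm_of_mem h]
  rfl

theorem logVar_period (lam Y : ℂ) : Q.logVar lam (Y + 2 * π * I) = Q.logVar lam Y := by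
  have : exp (lam + (Y + 2 * π * I)) = exp (lam + Y) := by rw [← add_assoc]; exact exp_periodic _
  simp only [logVar, logForm, pull]
  rw [this]

end AbelianPath

/-! ### Primitives and parallel sections of framed almost-flat connections -/

/-- A point near a puncture. -/
def endPt (y0 : ℝ) (p : Fin 2) : ℂ := ((sg p * (y0 + 1) : ℝ) : ℂ)

theorem lt_endPt (y0 : ℝ) (p : Fin 2) : y0 < sg p * (endPt y0 p).re := by
  rw [endPt, ofReal_re, ← mul_assoc, sg_mul_self]
  linarith

theorem expo_zero (a b ξ : ℂ) : expo 0 0 a b ξ = lin a b ξ := by simp [expo, lin]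

theorem expoD_zero (a b ξ v : ℂ) : expoD 0 0 a b ξ v = lin a b v := by simp [expoD, lin]

theorem expo_sub (c1 c2 a b a' b' ξ : ℂ) :
    expo c1 c2 a b ξ - expo c1 c2 a' b' ξ = lin (a - a') (b - b') ξ := by
  simp only [expo, lin]; ring

theorem hasDerivAt_integral_of_contDiff {f : ℝ × ℝ → ℂ} (hf : ContDiff ℝ 1 f) :
    HasDerivAt (fun t => ∫ s in (0 : ℝ)..1, f (t, s))
      (∫ s in (0 : ℝ)..1, fderiv ℝ f (0, s) (1, 0)) 0 := by
  have hc : Continuous fun p : ℝ × ℝ => fderiv ℝ f p (1, 0) :=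
    (hf.continuous_fderiv one_ne_zero).clm_apply continuous_const
  obtain ⟨M, hM⟩ := (isCompact_Icc.prod isCompact_Icc :
    IsCompact (Icc (-1 : ℝ) 1 ×ˢ Icc (0 : ℝ) 1)).exists_bound_of_continuousOn hc.continuousOn
  have hs : ∀ t, Continuous fun s => f (t, s) := fun t =>
    hf.continuous.comp (Continuous.prodMk_right t)
  refine (intervalIntegral.hasDerivAt_integral_of_dominated_loc_of_deriv_le
    (F := fun t s => f (t, s)) (F' := fun t s => fderiv ℝ f (t, s) (1, 0)) (bound := fun _ => M)
    (Icc_mem_nhds (by norm_num) (by norm_num) : Icc (-1 : ℝ) 1 ∈ 𝓝 0)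
    (Eventually.of_forall fun t => (hs t).aestronglyMeasurable) ((hs 0).intervalIntegrable _ _)
    (hc.comp (Continuous.prodMk_right (0 : ℝ))).aestronglyMeasurable
    (Eventually.of_forall fun s h t ht => hM (t, s) ⟨ht, ?_⟩) intervalIntegrable_const
    (Eventually.of_forall fun s _ t _ => ?_)).2
  · rw [uIoc_of_le zero_le_one] at h; exact Ioc_subset_Icc_self h
  · exact (hf.differentiable one_ne_zero (t, s)).hasFDerivAt.comp_hasDerivAt t
      ((hasDerivAt_id t).prodMk (hasDerivAt_const t s))

theorem integral_segment {β : CForm} (hF : ∀ z, HasFDerivAt F (β z) z) (hβ : Continuous β) (x y : ℂ)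
    : ∫ s in (0 : ℝ)..1, β (x + s * (y - x)) (y - x) = F y - F x := by
  have hd : ∀ s : ℝ, HasDerivAt (fun s : ℝ => x + s * (y - x)) (y - x) s := fun s => by
    simpa using ((ofRealCLM.hasDerivAt (x := s)).mul_const (y - x)).const_add x
  rw [intervalIntegral.integral_eq_sub_of_hasDerivAt
    (f := fun s : ℝ => F (x + s * (y - x))) (fun s _ => (hF _).comp_hasDerivAt s (hd s))]
  · simp
  · exact ((hβ.comp (by fun_prop)).clm_apply continuous_const).intervalIntegrable _ _

namespace AbelianPath

variable {ζ : ℂ} {a : FramedAbelianConnection ζ} (Q : AbelianPath a)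

theorem exists_form_end (hlam : exp (2 * lam) = 2 * a.m) : ∃ y0 : ℝ, 0 ≤ y0 ∧ ∀ (t : ℝ) (p : Fin 2)
    (Y : ℂ), y0 < sg p * Y.re → proj (Q.conn t).m (Q.φ t (exp (lam + Y))) = proj a.m (exp (lam + Y))
    ∧ ∀ v, pull lam (Q.form t) Y v = sg p * expoD ζ⁻¹ ζ (Q.coeffA t) (Q.coeffB t) (endLog lam p Y)
    (cosh Y / sinh Y * v) := by
  obtain ⟨K, hK, h⟩ := Q.framed
  refine ⟨|Real.log K| + |lam.re|, by positivity, fun t p Y hY => ?_⟩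
  have h0 : 0 < sg p * Y.re := (by positivity : 0 ≤ |Real.log K| + |lam.re|).trans_lt hY
  have hl := liftedSingularPart_exp hlam ζ (Q.conn t).m (Q.conn t).m3 (exp_endLog lam h0)
  have hlog := abs_le.1 (le_refl |Real.log K|)
  have hre := abs_le.1 (le_refl |lam.re|)
  have hn : ‖exp (lam + Y)‖ = rexp (lam.re + Y.re) := by rw [norm_exp, add_re]
  fin_cases p
  · have hu : K < ‖exp (lam + Y)‖ := by
      rw [hn, ← Real.log_lt_iff_lt_exp hK]
      simp [sg] at hY
      linarith
    obtain ⟨h1, h2⟩ := (h t _ (exp_ne_zero _)).1 hu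
    exact ⟨h1, fun v => (h2 _).trans ((hl v).trans (by simp [sg, coeffA, coeffB]))⟩
  · have hu : ‖exp (lam + Y)‖ < K⁻¹ := by
      rw [hn, ← Real.lt_log_iff_exp_lt (inv_pos.2 hK), Real.log_inv]
      simp [sg] at hY
      linarith
    obtain ⟨h1, h2⟩ := (h t _ (exp_ne_zero _)).2 hu
    exact ⟨h1, fun v => (h2 _).trans ((congrArg _ (hl v)).trans (by simp [sg, coeffA, coeffB]))⟩

theorem exists_parallel_zero (hy0 : 0 ≤ y0) (hlam : exp (2 * lam) = 2 * a.m) (hend : ∀ (p : Fin 2)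
    (Y : ℂ), y0 < sg p * Y.re → ∀ v, pull lam (Q.form 0) Y v = sg p * expoD ζ⁻¹ ζ (Q.coeffA 0)
    (Q.coeffB 0) (endLog lam p Y) (cosh Y / sinh Y * v)) : ∃ (E : ℂ → ℂ) (d : Fin 2 → ℂ),
    (∀ p, d p ≠ 0) ∧ (∀ Y, exp (lam + Y) ∈ unbranched a.m → E Y ≠ 0 ∧ HasFDerivAt E ((2 * E Y) •
    pull lam (Q.form 0) Y) Y) ∧ ∀ (p : Fin 2) (Y : ℂ), y0 < sg p * Y.re → E Y = d p * exp
    (sg p * (2 * expo ζ⁻¹ ζ (Q.coeffA 0) (Q.coeffB 0) (endLog lam p Y))) := by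
  classical
  obtain ⟨b, hb, hbr⟩ := Q.exists_form_branch
  have hb0 : b ≠ 0 := by rintro rfl; apply a.m_ne_zero; linear_combination (1 / 2 : ℂ) * hb
  set U : ℂ → ℂ := fun Y => exp (lam + Y) with hU
  have hUd : ∀ Y, HasDerivAt U (U Y) Y := hasDerivAt_exp_add lam
  have hU0 : ∀ Y, U Y ≠ 0 := fun Y => exp_ne_zero _
  have hne : ∀ Y, U Y ∈ unbranched a.m → U Y + b ≠ 0 ∧ U Y - b ≠ 0 := fun Y h =>
    ⟨fun e => h.2 (by rw [eq_neg_of_add_eq_zero_left e, neg_sq, hb]),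
      fun e => h.2 (by rw [sub_eq_zero.1 e, hb])⟩
  have hq : ∀ c Y, U Y + c ≠ 0 → HasDerivAt (fun Y => U Y / (U Y + c))
      ((U Y * (U Y + c) - U Y * U Y) / (U Y + c) ^ 2) Y := fun c Y h =>
    (hUd Y).div ((hUd Y).add_const c) h
  set B : CForm := fun Y => (if U Y ∈ unbranched a.m then (2 : ℝ) • pull lam (Q.form 0) Y else 0)
    + mulL (U Y / (U Y + b) - U Y / (U Y + -b)) with hB
  have hmul : ∀ {g : ℂ → ℂ} {g' Y : ℂ}, HasDerivAt g g' Y → ∀ {F : CForm},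
      F =ᶠ[𝓝 Y] (fun Y => mulL (g Y)) →
      DifferentiableAt ℝ F Y ∧ fderiv ℝ F Y 1 I = fderiv ℝ F Y I 1 := fun h F e => by
    have h2 := (hasFDerivAt_mulL_comp h).congr_of_eventuallyEq e
    refine ⟨h2.differentiableAt, ?_⟩
    rw [h2.fderiv]
    simp
  have hBY : ∀ Y, DifferentiableAt ℝ B Y ∧ fderiv ℝ B Y 1 I = fderiv ℝ B Y I 1 := by
    intro Y
    by_cases h : U Y ∈ unbranched a.m
    · obtain ⟨m1, m2⟩ := hne Y h
      have hg := (hq b Y m1).fun_sub (hq (-b) Y (by rwa [← sub_eq_add_neg]))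
      obtain ⟨d2, s2⟩ := hmul hg EventuallyEq.rfl
      have d1 : DifferentiableAt ℝ (pull lam (Q.form 0)) Y :=
        ((contDiffAt_pull (β := fun _ => Q.form 0) (t := 0)
          ((Q.contDiffAt_form 0 h).comp (0, U Y) (f := fun p : ℝ × ℂ => ((0 : ℝ), p.2))
            (contDiffAt_const.prodMk contDiffAt_snd))).comp Y (f := fun Y => ((0 : ℝ), Y))
          (contDiffAt_const.prodMk contDiffAt_id)).differentiableAt (by simp)
      have s1 := closed_pull (Q.differentiableAt_form 0 h) (Q.closed_form 0 h)
      have e : B =ᶠ[𝓝 Y] fun Y => (2 : ℝ) • pull lam (Q.form 0) Y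
          + mulL (U Y / (U Y + b) - U Y / (U Y + -b)) := by
        filter_upwards [eventually_mem h] with Z hZ
        simp only [hB]
        rw [if_pos hZ]
      have d3 := (d1.const_smul (2 : ℝ)).hasFDerivAt.add d2.hasFDerivAt
      have d4 := d3.congr_of_eventuallyEq e
      refine ⟨d4.differentiableAt, ?_⟩
      rw [d4.fderiv, fderiv_const_smul d1]
      simp only [add_apply, smul_apply, s1, s2]
    · obtain ⟨p, hp⟩ := not_mem_unbranched hb (hU0 Y) h
      have hp0 : U Y + sg p * b ≠ 0 := by
        rw [hp, ← two_mul]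
        exact mul_ne_zero two_ne_zero (hp ▸ hU0 Y)
      refine hmul ((hq _ Y hp0).const_mul (sg p : ℂ)) ?_
      have hev := hbr p
      rw [← hp] at hev
      filter_upwards [(hUd Y).continuousAt.tendsto.eventually hev,
        (hUd Y).continuousAt.tendsto.eventually
          ((((continuous_id.add continuous_const).continuousAt (x := U Y)).eventually_ne hp0))]
        with Z hZ hZp
      have hcase : (if U Z ∈ unbranched a.m then (2 : ℝ) • pull lam (Q.form 0) Z else 0)
          = mulL (sg p * (U Z / (U Z + -(sg p * b)))) := by
        split_ifs with hm
        · have hne' : U Z ≠ U Y := fun e => h (e ▸ hm)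
          have hne2 : U Z + -(sg p * b) ≠ 0 := by
            rw [← hp, ← sub_eq_add_neg]; exact sub_ne_zero.2 hne'
          ext v
          have e1 := hZ hne' 0 (U Z * v)
          simp only [hU] at e1 hp hne2 ⊢
          simp only [smul_apply, pull, ContinuousLinearMap.comp_apply, mulL_apply, e1, hp,
            ← sub_eq_add_neg, real_smul] at hne2 ⊢
          push_cast
          field_simp
        · obtain ⟨p', hp'⟩ := not_mem_unbranched hb (hU0 Z) hm
          have : U Z + -(sg p * b) = 0 := by
            by_cases hpp : p' = p
            · rw [hp', hpp, add_neg_cancel]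
            · exfalso
              apply hZp
              rw [hp']
              fin_cases p <;> fin_cases p' <;> simp_all [sg]
          rw [this]
          ext; simp
      simp only [hB]
      rw [hcase]
      ext v
      fin_cases p
      · simp [sg]; ring
      · simp [sg]; ring
  obtain ⟨F, hF⟩ := exists_primitive (fun Y => (hBY Y).1) (fun Y => (hBY Y).2)
  set E : ℂ → ℂ := fun Y => (U Y - b) / (U Y + b) * exp (F Y) with hE
  have hEY : ∀ Y, U Y ∈ unbranched a.m → E Y ≠ 0 ∧
      HasFDerivAt E ((2 * E Y) • pull lam (Q.form 0) Y) Y := by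
    intro Y h
    obtain ⟨m1, m2⟩ := hne Y h
    refine ⟨mul_ne_zero (div_ne_zero m2 m1) (exp_ne_zero _), ?_⟩
    have h1 := hasFDerivAt_mulL (((hUd Y).sub_const b).fun_div ((hUd Y).add_const b) m1)
    refine (h1.mul (hF Y).cexp).congr_fderiv ?_
    have m3 : U Y + -b ≠ 0 := by rwa [← sub_eq_add_neg]
    ext v
    simp only [hB, if_pos h, hE]
    simp only [add_apply, smul_apply, mulL_apply, real_smul, smul_eq_mul]
    push_cast
    field_simp
    ring
  refine ⟨E, fun p => E (endPt y0 p) * exp (-(sg p *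
      (2 * expo ζ⁻¹ ζ (Q.coeffA 0) (Q.coeffB 0) (endLog lam p (endPt y0 p))))), fun p => ?_, hEY,
    fun p Y hY => ?_⟩
  · exact mul_ne_zero (hEY _ (mem_unbranched_exp hlam (hy0.trans_lt (lt_endPt y0 p)))).1
      (exp_ne_zero _)
  · have := eq_of_end (F := fun Y => E Y * exp (-(sg p *
      (2 * expo ζ⁻¹ ζ (Q.coeffA 0) (Q.coeffB 0) (endLog lam p Y))))) (fun Z hZ => ?_) hY
      (lt_endPt y0 p)
    · beta_reduce; rw [← this, mul_assoc, ← exp_add, neg_add_cancel, exp_zero, mul_one]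
    · obtain ⟨L, hL, e⟩ := hasFDerivAt_expo_comp ζ⁻¹ ζ (Q.coeffA 0) (Q.coeffB 0)
        (hasDerivAt_endLog lam (hy0.trans_lt hZ))
      refine ((hEY Z (mem_unbranched_exp hlam (hy0.trans_lt hZ))).2.mul
        ((hL.const_mul 2).const_mul (sg p : ℂ)).fun_neg.cexp).congr_fderiv ?_
      ext v
      simp only [add_apply, smul_apply, smul_eq_mul, hend p Z hZ v, neg_apply, e, zero_apply]
      ring

end AbelianPath

theorem hasDerivAt_lin_left {A B : ℝ → ℂ} (hA : HasDerivAt A a' 0) (hB : HasDerivAt B b' 0) (ξ : ℂ)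
    : HasDerivAt (fun t => lin (A t - A 0) (B t - B 0) ξ) (lin a' b' ξ) 0 :=
  ((hA.sub_const (A 0)).mul_const ξ).add ((hB.sub_const (B 0)).mul_const (conj ξ))

namespace AbelianPath

variable {ζ : ℂ} {a : FramedAbelianConnection ζ}

/-- Squares of parallel sections of a path of framed almost-flat connections. -/
structure ParallelFamily (Q : AbelianPath a) (lam k : ℂ) (y0 : ℝ) (E : ℝ → ℂ → ℂ)
    (d : Fin 2 → ℂ) (j : ℝ → ℂ) : Prop where
  ne_zero : ∀ p, d p ≠ 0
  hasDerivAt : HasDerivAt j (2 * k) 0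
  parallel : ∀ t Y, exp (lam + Y) ∈ unbranched a.m →
    E t Y ≠ 0 ∧ HasFDerivAt (E t) ((2 * E t Y) • pull lam (Q.form t) Y) Y
  ends : ∀ (t : ℝ) (p : Fin 2) (Y : ℂ), y0 < sg p * Y.re →
    E t Y = d p * exp ((if p = 0 then 0 else j t)
      + sg p * (2 * expo ζ⁻¹ ζ (Q.coeffA t) (Q.coeffB t) (endLog lam p Y)))
  proj_eq : ∀ (t : ℝ) (p : Fin 2) (Y : ℂ), y0 < sg p * Y.re →
    proj (Q.conn t).m (Q.φ t (exp (lam + Y))) = proj a.m (exp (lam + Y))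

theorem exists_logPrimitive (Q : AbelianPath a) (hlam : exp (2 * lam) = 2 * a.m)
    (ha : HasDerivAt Q.coeffA a' 0) (hb : HasDerivAt Q.coeffB b' 0) : ∃ (y0 : ℝ) (k : ℂ) (G : ℂ → ℂ)
    (E : ℝ → ℂ → ℂ) (d : Fin 2 → ℂ) (j : ℝ → ℂ), 0 ≤ y0 ∧ LogPrimitive lam a.m Q.variation a' b' k
    y0 G ∧ Q.ParallelFamily lam k y0 E d j := by
  obtain ⟨y0, hy0, hend⟩ := Q.exists_form_end hlam
  obtain ⟨E0, d, hd, hE0, hE₀e⟩ := Q.exists_parallel_zero hy0 hlam fun p Y hY => (hend 0 p Y hY).2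
  set L : ℝ → ℂ → ℂ := fun t =>
    lin (Q.coeffA t - Q.coeffA 0) (Q.coeffB t - Q.coeffB 0) with hL
  have hmem : ∀ {p : Fin 2} {Y : ℂ}, y0 < sg p * Y.re → exp (lam + Y) ∈ unbranched a.m :=
    fun h => mem_unbranched_exp hlam (hy0.trans_lt h)
  have hlog : ∀ t (p : Fin 2) Y, y0 < sg p * Y.re → ∀ v,
      Q.logForm lam t Y v = sg p * L t (cosh Y / sinh Y * v) := by
    intro t p Y hY v
    have h1 := (hend t p Y hY).2 v
    have h0 := (hend 0 p Y hY).2 v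
    simp only [pull, ContinuousLinearMap.comp_apply] at h1 h0
    simp only [Q.logForm_of_mem (hmem hY), pull, ContinuousLinearMap.comp_apply, sub_apply, h1, h0,
      expoD, hL, lin]
    ring
  have hvar : ∀ (p : Fin 2) Y, y0 < sg p * Y.re → ∀ v,
      Q.logVar lam Y v = sg p * lin a' b' (cosh Y / sinh Y * v) := fun p Y hY v =>
    (Q.hasDerivAt_logForm lam Y v).unique (((hasDerivAt_lin_left ha hb _).const_mul
      (sg p : ℂ)).congr_of_eventuallyEq (Eventually.of_forall fun t => hlog t p Y hY v))
  have hc : ∀ t, Continuous (Q.logForm lam t) := fun t => (Q.contDiff_logForm_slice lam t).continuous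
  set e : Fin 2 → ℂ := endPt y0
  have hep : ∀ p, y0 < sg p * (e p).re := lt_endPt y0
  choose H0 hH0 using fun t => exists_primitive
    ((Q.contDiff_logForm_slice lam t).differentiable (by simp)) (Q.closed_logForm lam t)
  have hH₀e : ∀ t p Y, y0 < sg p * Y.re → H0 t Y - sg p * L t (endLog lam p Y)
      = H0 t (e p) - sg p * L t (endLog lam p (e p)) := by
    intro t p Y hY
    have := eq_of_end_expoD (lam := lam) (c1 := 0) (c2 := 0)
      (a := Q.coeffA t - Q.coeffA 0) (b := Q.coeffB t - Q.coeffB 0) hy0 (fun Z hZ => ⟨_, hH0 t Z, fun v => by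
      rw [hlog t p Z hZ, expoD_zero]⟩) hY (hep p)
    simpa only [expo_zero] using this
  obtain ⟨G0, hG0⟩ := exists_primitive ((Q.contDiff_logVar lam).differentiable (by simp))
    (Q.closed_logVar lam)
  have hG₀e : ∀ p Y, y0 < sg p * Y.re → G0 Y - sg p * lin a' b' (endLog lam p Y)
      = G0 (e p) - sg p * lin a' b' (endLog lam p (e p)) := by
    intro p Y hY
    have := eq_of_end_expoD (lam := lam) (c1 := 0) (c2 := 0) (a := a') (b := b') hy0
      (fun Z hZ => ⟨_, hG0 Z, fun v => by
      rw [hvar p Z hZ, expoD_zero]⟩) hY (hep p)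
    simpa only [expo_zero] using this
  set h : ℝ → ℂ := fun t => H0 t (e 1) - H0 t (e 0)
    + (L t (endLog lam 0 (e 0)) + L t (endLog lam 1 (e 1))) with hh
  set k : ℂ := G0 (e 1) - G0 (e 0)
    + (lin a' b' (endLog lam 0 (e 0)) + lin a' b' (endLog lam 1 (e 1))) with hk
  have hderiv : HasDerivAt h k 0 := by
    refine HasDerivAt.add ?_ ((hasDerivAt_lin_left ha hb _).add (hasDerivAt_lin_left ha hb _))
    have hf : ContDiff ℝ 1 fun p : ℝ × ℝ =>
        Q.logForm lam p.1 (e 0 + p.2 * (e 1 - e 0)) (e 1 - e 0) := by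
      have h1 : ContDiff ℝ ∞ fun p : ℝ × ℝ => (p.1, e 0 + p.2 * (e 1 - e 0)) :=
        contDiff_fst.prodMk (contDiff_const.add
          ((ofRealCLM.contDiff.comp contDiff_snd).mul contDiff_const))
      exact (((Q.contDiff_logForm lam).comp h1).clm_apply contDiff_const).of_le (by norm_cast)
    have h2 := hasDerivAt_integral_of_contDiff hf
    have h3 : ∀ s : ℝ, fderiv ℝ (fun p : ℝ × ℝ =>
        Q.logForm lam p.1 (e 0 + p.2 * (e 1 - e 0)) (e 1 - e 0)) (0, s) (1, 0)
        = Q.logVar lam (e 0 + s * (e 1 - e 0)) (e 1 - e 0) := fun s =>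
      ((hf.differentiable one_ne_zero (0, s)).hasFDerivAt.comp_hasDerivAt (0 : ℝ)
        ((hasDerivAt_id (0 : ℝ)).prodMk (hasDerivAt_const 0 s))).unique
        (Q.hasDerivAt_logForm lam (e 0 + s * (e 1 - e 0)) (e 1 - e 0))
    simp only [h3, integral_segment hG0 (Q.contDiff_logVar lam).continuous] at h2
    refine h2.congr_of_eventuallyEq (Eventually.of_forall fun t => ?_)
    exact (integral_segment (hH0 t) (hc t) _ _).symm
  set G : ℂ → ℂ := fun Y => G0 Y + (lin a' b' (endLog lam 0 (e 0)) - G0 (e 0)) with hG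
  have hGd : ∀ Y, HasFDerivAt G (Q.logVar lam Y) Y := fun Y => (hG0 Y).add_const _
  have hGe : ∀ (p : Fin 2) (Y : ℂ), y0 < sg p * Y.re →
      G Y = sg p * lin a' b' (endLog lam p Y) + if p = 0 then 0 else k := by
    intro p Y hY
    have := hG₀e p Y hY
    simp only [hG]
    fin_cases p
    · simp [sg] at this ⊢; linear_combination this
    · simp [sg, hk] at this ⊢; linear_combination this
  refine ⟨y0, k, G, fun t Y => E0 Y * exp (2 * (H0 t Y + (L t (endLog lam 0 (e 0)) - H0 t (e 0)))),
    d, fun t => 2 * h t, hy0, ⟨?_, fun Y hY => ?_, hGe, fun Y => ?_⟩, ⟨hd, hderiv.const_mul 2,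
    fun t Y hY => ⟨mul_ne_zero (hE0 Y hY).1 (exp_ne_zero _), ?_⟩, fun t p Y hY => ?_,
    fun t p Y hY => (hend t p Y hY).1⟩⟩
  · refine contDiff_infty_iff_fderiv.2 ⟨fun Y => (hGd Y).differentiableAt, ?_⟩
    rw [funext fun Y => (hGd Y).fderiv]
    exact Q.contDiff_logVar lam
  · rw [(hGd Y).fderiv, Q.logVar_of_mem hY]
  · have hd : ∀ Y, HasFDerivAt (fun Y => G (Y + 2 * π * I) - G Y) (0 : ℂ →L[ℝ] ℂ) Y := by
      intro Y
      have h1 := (hGd (Y + 2 * π * I)).comp Y ((hasFDerivAt_id Y).add_const _)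
      refine (h1.sub (hGd Y)).congr_fderiv ?_
      rw [Q.logVar_period]
      ext; simp
    have h2 := is_const_of_fderiv_eq_zero (𝕜 := ℝ) (fun Y => (hd Y).differentiableAt)
      (fun Y => (hd Y).fderiv) Y (e 0)
    have h3 : y0 < sg 0 * (e 0 + 2 * π * I).re := by simpa using hep 0
    simp only [hGe 0 _ h3, hGe 0 _ (hep 0), endLog_zero_add] at h2
    rw [← sub_eq_iff_eq_add', h2]
    simp [sg, lin, conj_two]
    ring
  · refine ((hE0 Y hY).2.mul (((hH0 t Y).add_const
      (L t (endLog lam 0 (e 0)) - H0 t (e 0))).const_mul 2).cexp).congr_fderiv ?_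
    ext v
    simp only [Q.logForm_of_mem hY, pull, add_apply, smul_apply, ContinuousLinearMap.comp_apply,
      sub_apply, smul_eq_mul]
    ring
  · have h1 := hH₀e t p Y hY
    have h2 := expo_sub ζ⁻¹ ζ (Q.coeffA t) (Q.coeffB t) (Q.coeffA 0) (Q.coeffB 0) (endLog lam p Y)
    change _ = L t (endLog lam p Y) at h2
    rw [hE₀e p Y hY, mul_assoc, ← exp_add]
    congr 2
    fin_cases p
    · simp [sg] at h1 h2 ⊢; linear_combination 2 * h1 - 2 * h2
    · simp [sg, hh] at h1 h2 ⊢; linear_combination 2 * h1 + 2 * h2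

end AbelianPath

/-! ### Transport of the abelianizing sections off the network -/

theorem network_sg (i : Fin 2) (η m : ℂ) : network (sg i * η) m = network η m := by
  have : ((sg i : ℂ) * η) ^ 2 = η ^ 2 := by rw [mul_pow, sq (sg i : ℂ), ofReal_sg_mul_self, one_mul]
  simp only [network, IsWallArc, this]

theorem mem_unbranched_of_offNetwork (h : u ∈ offNetwork η m) : u ∈ unbranched m := by
  refine ⟨h.1, fun hu => h.2 (Or.inl ?_)⟩
  have hs := (sheet_eq_zero_iff h.1).2 hu
  have hu0 := h.1
  simp only [sheet, spectralPoint] at hs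
  simp only [proj, spectralPoint]
  have e : ((u - 2 * m / u) / 2) ^ 2 + 2 * m = ((u + 2 * m / u) / 2) ^ 2 := by field_simp; ring
  rw [e, hs]; ring

theorem hasFDerivAt_wr_section {D : FramedConnection ζ} {a : FramedAbelianConnection ζ}
    {e : ℂ → Fin 2 → ℂ} (h : AbelianizationData η D a e) (hψ : IsFlat (shift i D.A) ψ)
    (hu : u ∈ offNetwork η D.m) : HasFDerivAt (fun u => wr (fun j => e u (i + j)) (ψ (proj D.m u)))
    (wr (fun j => e u (i + j)) (ψ (proj D.m u)) • a.α u) u := by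
  have he : ∀ j, HasFDerivAt (fun u => e u j)
      ((ContinuousLinearMap.proj j).comp (fderiv ℝ e u)) u := fun j =>
    hasFDerivAt_pi'.1 ((h.smooth u hu).differentiableAt (by simp)).hasFDerivAt j
  have hp := hasFDerivAt_mulL (hasDerivAt_proj D.m hu.1)
  have hs : ∀ j, HasFDerivAt (fun u => ψ (proj D.m u) j) _ u := fun j => (hψ _ j).comp u hp
  refine ((he (i + 0)).mul (hs 1)).fun_sub ((he (i + 1)).mul (hs 0)) |>.congr_fderiv ?_
  ext v
  have hpar := fun j => congrFun (h.parallel u hu v) j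
  have htr := D.traceless (proj D.m u) (projDeriv D.m u * v)
  simp only [MatCovector.eval, Matrix.trace_fin_two, Matrix.of_apply] at htr
  have h0 := hpar 0
  have h1 := hpar 1
  simp only [Pi.add_apply, Pi.smul_apply, Matrix.mulVec, dotProduct, Fin.sum_univ_two,
    MatCovector.eval, Matrix.of_apply, smul_eq_mul] at h0 h1
  set B := D.A (proj D.m u)
  set x := projDeriv D.m u * v
  simp only [sub_apply, add_apply, smul_apply, ContinuousLinearMap.comp_apply, neg_apply,
    ContinuousLinearMap.proj_apply, mulL_apply, smul_eq_mul, wr, shift]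
  fin_cases i
  · simp only [Fin.zero_eta, zero_add, add_zero]
    linear_combination ψ (proj D.m u) 1 * h0 - ψ (proj D.m u) 0 * h1
      - (e u 0 * ψ (proj D.m u) 1 - e u 1 * ψ (proj D.m u) 0) * htr
  · simp only [Fin.mk_one, add_zero, show (1 : Fin 2) + 1 = 0 from rfl]
    linear_combination ψ (proj D.m u) 1 * h1 - ψ (proj D.m u) 0 * h0
      - (e u 1 * ψ (proj D.m u) 1 - e u 0 * ψ (proj D.m u) 0) * htr

/-- The point of the spectral curve over `exp lam * sinh (X / 2)`, on the sheet `i`. -/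
def stripPt (lam : ℂ) (i : Fin 2) (X : ℂ) : ℂ := exp (lam + (turn i + sg i * (X / 2)))

theorem hasFDerivAt_stripPt (lam : ℂ) (i : Fin 2) (X : ℂ) :
    HasFDerivAt (stripPt lam i) (mulL (stripPt lam i X * (sg i / 2))) X := by
  refine hasFDerivAt_mulL ?_
  have h := ((((hasDerivAt_id X).div_const 2).const_mul (sg i : ℂ)).const_add (turn i)).const_add lam
  exact h.cexp.congr_deriv (by simp only [stripPt, id]; ring)

namespace AbelianPath

variable {ζ : ℂ} {a : FramedAbelianConnection ζ}

/-- The logarithmic coordinate of the point of the curve of `a` that corresponds to a point of the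
strip. -/
def stripLog (Q : AbelianPath a) (t : ℝ) (lam lam' : ℂ) (i : Fin 2) (X : ℂ) : ℂ :=
  lam' - lam + (turn i + sg i * (X / 2)) - log (stripPt lam' i X / Q.φinv t (stripPt lam' i X))

theorem norm_ratio_sub_one (Q : AbelianPath a) (hδ : ∀ u, u ≠ 0 → ‖Q.φ t u / u - 1‖ ≤ 1 / 4)
    (hu : u ≠ 0) : ‖u / Q.φinv t u - 1‖ ≤ 1 / 4 := by
  have := hδ _ (Q.φinv_ne_zero t hu)
  rwa [Q.φ_φinv t hu] at this

theorem exp_stripLog (Q : AbelianPath a) (t : ℝ) (lam lam' : ℂ) (i : Fin 2) (X : ℂ) :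
    exp (lam + Q.stripLog t lam lam' i X) = Q.φinv t (stripPt lam' i X) := by
  have hu : stripPt lam' i X ≠ 0 := exp_ne_zero _
  have hv := Q.φinv_ne_zero t hu
  rw [stripLog, show ∀ x y : ℂ, lam + (lam' - lam + x - y) = lam' + x - y by intros; ring,
    exp_sub, exp_log (div_ne_zero hu hv)]
  change stripPt lam' i X / _ = _
  field_simp

theorem ParallelFamily.strip_const {Q : AbelianPath a} {lam' : ℂ} {E : ℝ → ℂ → ℂ} {d : Fin 2 → ℂ}
    {j : ℝ → ℂ} (h : Q.ParallelFamily lam k y0 E d j) {C : FramedConnection ζ} {e : ℂ → Fin 2 → ℂ}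
    (hab : AbelianizationData η C (Q.conn t) e) (hm : (Q.conn t).m = C.m)
    (hδ : ∀ u, u ≠ 0 → ‖Q.φ t u / u - 1‖ ≤ 1 / 4) (hlam' : exp (2 * lam') = 2 * C.m) (hη : η ≠ 0)
    (hc : c = C.m / (sg i * η)) (hc0 : 0 < c.re) (hψ : IsFlat (shift i C.A) ψ) : ∃ f0 : ℂ, ∀ r : ℝ,
    0 ≤ r → ∀ q : Fin 2, stripPt lam' i (sg q * stripCurve (c.im / c.re) r) ∈ offNetwork η C.m ∧ wr
    (fun j => e (stripPt lam' i (sg q * stripCurve (c.im / c.re) r)) (i + j))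
    (ψ (exp lam' * sinh (sg q * stripCurve (c.im / c.re) r / 2))) ^ 2 = f0 * E t
    (Q.stripLog t lam lam' i (sg q * stripCurve (c.im / c.re) r)) := by
  set U : Set ℂ := {X | |height c X| < π * c.re} with hU
  have hUo : IsOpen U := isOpen_lt (continuous_height c).abs continuous_const
  have hη' : (sg i : ℂ) * η ≠ 0 := mul_ne_zero (by
    intro h0; have := ofReal_sg_mul_self i; rw [h0] at this; simp at this) hη
  have hpr : ∀ X, proj C.m (stripPt lam' i X) = exp lam' * sinh (X / 2) := fun X => by
    rw [stripPt, proj_exp hlam', (sinh_turn i _).1]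
  have hoff : ∀ X ∈ U, stripPt lam' i X ∈ offNetwork η C.m := fun X hX => by
    refine ⟨exp_ne_zero _, ?_⟩
    rw [hpr, ← network_sg i]
    refine notMem_network hη' hc hc0 ?_ (exp_ne_zero _) hX
    rw [← hlam', sq, ← exp_add, two_mul]
  set u : ℂ → ℂ := stripPt lam' i
  set w : ℂ → ℂ := fun X => wr (fun j => e (u X) (i + j)) (ψ (proj C.m (u X)))
  set Y : ℂ → ℂ := Q.stripLog t lam lam' i
  have hu0 : ∀ X, u X ≠ 0 := fun X => exp_ne_zero _
  have hYe : ∀ X, exp (lam + Y X) = Q.φinv t (u X) := Q.exp_stripLog t lam lam' i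
  have key : ∀ X ∈ U, E t (Y X) ≠ 0 ∧
      HasFDerivAt (fun X => w X ^ 2 / E t (Y X)) (0 : ℂ →L[ℝ] ℂ) X := by
    intro X hX
    have hmem : exp (lam + Y X) ∈ unbranched a.m := by
      have h1 := mem_unbranched_of_offNetwork (hoff X hX)
      refine ⟨exp_ne_zero _, fun h2 => h1.2 ?_⟩
      have h3 := Q.φ_branch t _ h2
      rwa [hYe, Q.φ_φinv t (hu0 X), hm] at h3
    obtain ⟨hE0, hE⟩ := h.parallel t _ hmem
    have hud := hasFDerivAt_stripPt lam' i X
    have hv : DifferentiableAt ℝ (fun X => Q.φinv t (u X)) X :=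
      (Q.differentiableAt_φinv t (hu0 X)).comp X hud.differentiableAt
    have hsl : u X / Q.φinv t (u X) ∈ slitPlane := by
      have h1 := Q.norm_ratio_sub_one hδ (hu0 X)
      have h2 := (abs_le.1 ((abs_re_le_norm _).trans h1)).1
      left
      simp only [sub_re, one_re] at h2
      linarith
    have hYd : DifferentiableAt ℝ Y X := by
      have h1 : DifferentiableAt ℝ (fun X => u X / Q.φinv t (u X)) X :=
        (hud.differentiableAt.mul (hv.inv (Q.φinv_ne_zero t (hu0 X)))).congr_of_eventuallyEq
          (Eventually.of_forall fun X => div_eq_mul_inv _ _)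
      have h2 := (hasFDerivAt_mulL (hasDerivAt_log hsl)).differentiableAt.comp X h1
      have h3 : DifferentiableAt ℝ (fun X : ℂ => lam' - lam + (turn i + sg i * (X / 2))) X := by
        fun_prop
      exact h3.sub h2
    have hYF := hYd.hasFDerivAt
    set M := fderiv ℝ Y X
    have hφ : ∀ v, fderiv ℝ (Q.φ t) (exp (lam + Y X)) (exp (lam + Y X) * M v)
        = u X * (sg i / 2) * v := by
      have h1 := ((hasFDerivAt_mulL (hasDerivAt_exp_add lam (Y X))).comp X hYF)
      have h2 := ((Q.contDiffAt_φ_slice t hmem.1).differentiableAt (by simp)).hasFDerivAt.comp X h1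
      have h3 := h2.unique (hud.congr_of_eventuallyEq (Eventually.of_forall fun X => by
        simp only [Function.comp_apply, hYe, Q.φ_φinv t (hu0 X)]; rfl))
      intro v
      exact DFunLike.congr_fun h3 v
    have hwd : HasFDerivAt w _ X := (hasFDerivAt_wr_section hab hψ (hoff X hX)).comp X hud
    have hEd := hE.comp X hYF
    refine ⟨hE0, ?_⟩
    have hinv := (hasFDerivAt_mulL (hasDerivAt_inv hE0)).comp X hEd
    refine ((hwd.mul hwd).mul hinv).congr_of_eventuallyEq (Eventually.of_forall fun Z => ?_)
      |>.congr_fderiv ?_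
    · simp only [Pi.mul_apply, Function.comp_apply, div_eq_mul_inv, sq]
    · ext v
      have h4 := hφ v
      simp only [add_apply, smul_apply, ContinuousLinearMap.comp_apply, mulL_apply, smul_eq_mul,
        pull, form, h4, zero_apply, Pi.mul_apply, Function.comp_apply]
      rw [hYe, Q.φ_φinv t (hu0 X)]
      change w X * w X * (-(E t (Y X) ^ 2)⁻¹ * (2 * E t (Y X)
        * ((Q.conn t).α (u X)) (u X * (sg i / 2) * v))) + (E t (Y X))⁻¹
        * (w X * (w X * ((Q.conn t).α (u X)) (u X * (sg i / 2) * v))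
          + w X * (w X * ((Q.conn t).α (u X)) (u X * (sg i / 2) * v))) = 0
      field_simp
      ring
  have hT := continuousOn_stripCurve (c.im / c.re)
  have hcurve : ∀ r : ℝ, 0 ≤ r → ∀ q : Fin 2,
      (sg q : ℂ) * stripCurve (c.im / c.re) r ∈ connectedComponentIn U 0 := by
    intro r hr q
    have hpre : IsPreconnected ((fun r : ℝ => (sg q : ℂ) * stripCurve (c.im / c.re) r) '' Ici 0) :=
      isPreconnected_Ici.image _ (continuousOn_const.mul hT)
    refine hpre.subset_connectedComponentIn ⟨0, self_mem_Ici, ?_⟩ ?_ ⟨r, hr, rfl⟩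
    · simp [stripCurve_zero]
    · rintro _ ⟨s, hs, rfl⟩
      have h0 := im_stripCurve hc0 (r := s) hs
      have : height c (sg q * stripCurve (c.im / c.re) s) = 0 := by
        fin_cases q
        · simpa [sg, height] using h0
        · have e : c * (-stripCurve (c.im / c.re) s + -sinh (stripCurve (c.im / c.re) s))
            = -(c * (stripCurve (c.im / c.re) s + sinh (stripCurve (c.im / c.re) s))) := by ring
          simp [sg, height, sinh_neg, e, h0]
      simp only [hU, mem_ofPred_eq, this, abs_zero]
      positivity
  have hsub := connectedComponentIn_subset U (0 : ℂ)
  refine ⟨w 0 ^ 2 / E t (Y 0), fun r hr q => ⟨hoff _ (hsub (hcurve r hr q)), ?_⟩⟩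
  have hconst := hUo.connectedComponentIn.is_const_of_fderiv_eq_zero (𝕜 := ℝ)
    (f := fun X => w X ^ 2 / E t (Y X)) (x := sg q * stripCurve (c.im / c.re) r) (y := 0)
    isPreconnected_connectedComponentIn
    (fun X hX => (key X (hsub hX)).2.differentiableAt.differentiableWithinAt)
    (fun X hX => (key X (hsub hX)).2.fderiv) (hcurve r hr q)
    (by simpa [stripCurve_zero] using hcurve 0 le_rfl 0)
  rw [← hconst, ← hpr, div_mul_cancel₀ _ (key _ (hsub (hcurve r hr q))).1]

end AbelianPath

/-! ### The Stokes multiplier and the framed almost-flat connection -/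

section Limits

variable {A : MatForm} {c1 c2 a b : ℂ} {s1 C : ℝ} {ξ : ℝ → ℂ}

theorem IsDom.norm_sub_le (h : IsDom A c1 c2 a b j θ s1 C ψ) (hz : s1 ≤ z.re)
    (hθ : |z.im - θ| ≤ π / 2) (i : Fin 2) : ‖gauged (expo c1 c2 a b) j ψ z i - if i = j then 1 else
    0‖ ≤ C * rexp (-z.re) := by
  obtain ⟨h1, h2⟩ := h.2 z hz hθ
  by_cases hij : i = j
  · simpa [hij] using h1
  · have : i = j + 1 := by fin_cases i <;> fin_cases j <;> simp_all
    rw [if_neg hij, sub_zero, this]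
    exact h2

theorem IsDom.tendsto_gauged (h : IsDom A c1 c2 a b j θ s1 C ψ)
    (hre : Tendsto (fun r => (ξ r).re) atTop atTop) (hθ : ∀ᶠ r in atTop, |(ξ r).im - θ| ≤ π / 2)
    (i : Fin 2) : Tendsto (fun r => gauged (expo c1 c2 a b) j ψ (ξ r) i) atTop
    (𝓝 (if i = j then 1 else 0)) := by
  rw [tendsto_iff_norm_sub_tendsto_zero]
  refine squeeze_zero' (Eventually.of_forall fun _ => norm_nonneg _) ?_
    ((tendsto_C_exp_neg C).comp hre)
  filter_upwards [hθ, hre.eventually_ge_atTop s1] with r h1 h2 using h.norm_sub_le h2 h1 i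

theorem tendsto_re_expo (hray : IsRay c1 c2 κ 0 θ0) (hκ : 0 < κ)
    (hre : Tendsto (fun r => (ξ r).re) atTop atTop) (him : Tendsto (fun r => (ξ r).im) atTop (𝓝 φ))
    (hφ : |φ - θ0| < π / 4) : Tendsto (fun r => (expo c1 c2 a b (ξ r)).re) atTop atTop := by
  have hcos : 0 < Real.cos (2 * (φ - θ0)) := by
    apply Real.cos_pos_of_mem_Ioo
    obtain ⟨h1, h2⟩ := abs_lt.1 hφ
    constructor <;> linarith
  have e1 : Tendsto (fun r => rexp (-(2 * (ξ r).re))) atTop (𝓝 0) :=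
    Real.tendsto_exp_neg_atTop_nhds_zero.comp (hre.const_mul_atTop (zero_lt_two' ℝ))
  have e2 : Tendsto (fun r => (ξ r).re * rexp (-(2 * (ξ r).re))) atTop (𝓝 0) := by
    have := ((Real.tendsto_pow_mul_exp_neg_atTop_nhds_zero 1).comp
      (hre.const_mul_atTop (zero_lt_two' ℝ))).const_mul (1 / 2)
    rw [mul_zero] at this
    refine this.congr fun r => ?_
    simp only [Function.comp_apply, pow_one]; ring
  have e3 : Tendsto (fun r => Real.cos (2 * ((ξ r).im - θ0))) atTop (𝓝 (Real.cos (2 * (φ - θ0)))) :=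
    (Real.continuous_cos.tendsto _).comp ((him.sub_const θ0).const_mul 2)
  have e4 := (e3.const_mul κ).add ((e2.const_mul (a + b).re).sub ((him.const_mul (a - b).im).mul e1))
  have e5 := (Real.tendsto_exp_atTop.comp (hre.const_mul_atTop (zero_lt_two' ℝ))).atTop_mul_pos
    (by rw [mul_zero, mul_zero, sub_zero, add_zero]; positivity) e4
  refine e5.congr fun r => ?_
  have h := re_expo_of_isRay hray a b (ξ r).re ((ξ r).im - θ0)
  have hx : ((ξ r).re : ℂ) + (θ0 + ((ξ r).im - θ0 : ℝ)) * I = ξ r := by apply Complex.ext <;> simp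
  rw [hx] at h
  simp only [sg, if_true, one_mul] at h
  rw [h]
  have hE : rexp (2 * (ξ r).re) * rexp (-(2 * (ξ r).re)) = 1 := by
    rw [← Real.exp_add, add_neg_cancel, Real.exp_zero]
  simp only [Function.comp_apply]
  linear_combination ((a + b).re * (ξ r).re - (a - b).im * (ξ r).im) * hE

theorem grow_limit (hray : IsRay c1 c2 κ 0 θ0) (hκ : 0 < κ)
    (hre : Tendsto (fun r => (ξ r).re) atTop atTop) (him : Tendsto (fun r => (ξ r).im) atTop (𝓝 φ))
    (hφ : |φ - θ0| < π / 4) {x y1 y2 v : ℂ → Fin 2 → ℂ} {S1 : ℂ}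
    (hx : IsDom A c1 c2 a b 0 θ0 s1 C x) (hy1 : IsDom A c1 c2 a b 1 (θ0 + π / 2) s1 C y1)
    (hy2 : IsDom A c1 c2 a b 1 (θ0 - π / 2) s1 C y2) (e1 : ∀ z, y1 z = y2 z + S1 • x z)
    (e : ∀ z, v z = x z + k • y1 z) (i : Fin 2) : Tendsto
    (fun r => gauged (expo c1 c2 a b) 1 v (ξ r) i) atTop (𝓝 (if i = 1 then k else 0)) := by
  have hπ := Real.pi_pos
  set g := expo c1 c2 a b
  have hang : ∀ᶠ r in atTop, |(ξ r).im - θ0| < π / 4 :=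
    ((him.sub_const θ0).abs).eventually_lt_const hφ
  have hx0 := hx.tendsto_gauged hre (hang.mono fun r h => by linarith) i
  have hε : Tendsto (fun r => exp (-(2 * g (ξ r)))) atTop (𝓝 0) := by
    rw [tendsto_zero_iff_norm_tendsto_zero]
    simp only [norm_exp]
    refine Real.tendsto_exp_atBot.comp ((tendsto_neg_atTop_atBot.comp
      ((tendsto_re_expo (a := a) (b := b) hray hκ hre him hφ).const_mul_atTop
        (zero_lt_two' ℝ))).congr fun r => ?_)
    simp [g]
  have hsw : ∀ z, exp (-(2 * g z)) * exp (g z) = exp (-g z) := fun z => by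
    rw [← exp_add]; congr 1; ring
  have hx1 : Tendsto (fun r => gauged g 1 x (ξ r) i) atTop (𝓝 0) := by
    have := hε.mul hx0
    rw [zero_mul] at this
    refine this.congr fun r => ?_
    simp only [gauged, sg]
    simp
    rw [← mul_assoc, hsw]
  have hy : Tendsto (fun r => gauged g 1 y1 (ξ r) i) atTop (𝓝 (if i = 1 then 1 else 0)) := by
    rw [tendsto_iff_norm_sub_tendsto_zero]
    have hb := ((tendsto_C_exp_neg C).comp hre).add (hx1.norm.const_mul ‖S1‖)
    rw [norm_zero, mul_zero, add_zero] at hb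
    refine squeeze_zero' (Eventually.of_forall fun _ => norm_nonneg _) ?_ hb
    filter_upwards [hang, hre.eventually_ge_atTop s1] with r h1 h2
    obtain ⟨h3, h4⟩ := abs_lt.1 h1
    simp only [Function.comp_apply]
    rcases le_total θ0 (ξ r).im with h | h
    · refine (hy1.norm_sub_le h2 ?_ i).trans (le_add_of_nonneg_right (by positivity))
      exact abs_le.2 ⟨by linarith, by linarith⟩
    · have e2 : gauged g 1 y1 (ξ r) i = gauged g 1 y2 (ξ r) i + S1 * gauged g 1 x (ξ r) i := by
        simp only [gauged, e1, Pi.add_apply, Pi.smul_apply, smul_eq_mul]; ring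
      rw [e2, add_sub_right_comm, ← norm_mul]
      exact (norm_add_le _ _).trans (add_le_add (hy2.norm_sub_le h2
        (abs_le.2 ⟨by linarith, by linarith⟩) i) le_rfl)
  have := hx1.add (hy.const_mul k)
  rw [zero_add, mul_ite, mul_one, mul_zero] at this
  refine this.congr fun r => ?_
  simp only [gauged, e, Pi.add_apply, Pi.smul_apply, smul_eq_mul]
  ring

end Limits

theorem sg_add (i q : Fin 2) : sg (i + q) = sg i * sg q := by
  fin_cases i <;> fin_cases q <;> simp [sg]

theorem expo_smul (s c1 c2 a b ξ : ℂ) :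
    expo (s * c1) (s * c2) (s * a) (s * b) ξ = s * expo c1 c2 a b ξ := by
  simp only [expo]; ring

theorem eq_of_exp_eq (h : exp x = exp y) (him : |x.im - y.im| < 2 * π) : x = y := by
  obtain ⟨n, hn⟩ := exp_eq_exp_iff_exists_int.1 h
  have h1 : x.im - y.im = n * (2 * π) := by rw [hn]; simp
  have hπ := Real.pi_pos
  rw [h1, abs_mul, abs_of_pos (by positivity : 0 < 2 * π)] at him
  have h2 : |(n : ℝ)| < 1 := lt_of_mul_lt_mul_right (by rwa [one_mul]) (by positivity)
  have h3 : n = 0 := by rw [← Int.abs_lt_one_iff]; exact_mod_cast h2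
  rw [hn, h3]; simp

/-- The logarithm of `z` along the two ends of a curve in the strip. -/
def curveLog (lam : ℂ) (T : ℝ) (q : Fin 2) (r : ℝ) : ℂ := lam + turn q + lsinh (stripCurve T r / 2)

theorem exp_curveLog (lam : ℂ) (q : Fin 2) (hr : 0 < (stripCurve T r).re) : exp (curveLog lam T q r)
    = exp lam * sinh (sg q * stripCurve T r / 2) := by
  rw [curveLog, add_assoc, exp_add, exp_add, exp_lsinh (by simpa using hr)]
  fin_cases q
  · simp [turn, sg]
  · simp [turn, sg, neg_div, sinh_neg]

theorem tendsto_curveLog (lam : ℂ) (T : ℝ) (q : Fin 2) :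
    Tendsto (fun r => (curveLog lam T q r).re) atTop atTop ∧
    Tendsto (fun r => (curveLog lam T q r).im) atTop
      (𝓝 (lam.im + (turn q).im - Real.arctan T / 2)) := by
  have hre : Tendsto (fun r => (stripCurve T r / 2).re) atTop atTop := by
    refine (tendsto_id.atTop_div_const (zero_lt_two' ℝ)).congr fun r => ?_
    simp [stripCurve_re]
  have h := tendsto_lsinh_sub hre
  have e : ∀ r, curveLog lam T q r = (lam + turn q) + (lsinh (stripCurve T r / 2)
      - stripCurve T r / 2) + stripCurve T r / 2 := fun r => by rw [curveLog]; ring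
  have h1 := h.const_add (lam + turn q)
  constructor
  · refine (((continuous_re.tendsto _).comp h1).add_atTop hre).congr fun r => ?_
    rw [e]; rfl
  · have h2 := ((continuous_im.tendsto _).comp h1).add ((tendsto_stripCurve_im T).div_const 2)
    convert h2 using 2 with r
    · rw [e]; simp
    · simp [log_im]; ring

theorem norm_log_le (h : ‖z - 1‖ ≤ 1 / 4) : ‖log z‖ ≤ 3 / 8 := by
  have := norm_log_one_add_half_le_self (z := z - 1) (by linarith)
  rw [add_sub_cancel] at this
  linarith

theorem AbelianizationData.tendsto_stripPt {D : FramedConnection ζ} {a : FramedAbelianConnection ζ}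
    {e : ℂ → Fin 2 → ℂ} (h : AbelianizationData η D a e) {q : Fin 2} (hoff : ∀ᶠ r in atTop, stripPt
    lam i (sg q * stripCurve T r) ∈ offNetwork η D.m) (j : Fin 2) : Tendsto
    (fun r => e (stripPt lam i (sg q * stripCurve T r)) (i + j)) atTop (𝓝 (if j = q then 1 else 0))
    := by
  have hn : ∀ r, ‖stripPt lam i (sg q * stripCurve T r)‖
      = rexp (lam.re + sg (i + q) * (r / 2)) := fun r => by
    rw [stripPt, norm_exp, add_re, re_turn, sg_add, mul_assoc]
    congr 3
    simp [stripCurve_re]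
    ring
  have hr2 : Tendsto (fun r : ℝ => r / 2) atTop atTop := tendsto_id.atTop_div_const two_pos
  by_cases hp : i + q = 0
  · have h1 : Tendsto (fun r => stripPt lam i (sg q * stripCurve T r)) atTop
        (Bornology.cobounded ℂ) := by
      rw [← tendsto_norm_atTop_iff_cobounded]
      simp only [hn, hp]
      simp only [sg, if_true, one_mul]
      exact Real.tendsto_exp_atTop.comp (tendsto_atTop_add_const_left _ _ hr2)
    have h2 := tendsto_pi_nhds.1 (h.frame_minus.comp
      (tendsto_inf.2 ⟨h1, tendsto_principal.2 hoff⟩)) (i + j)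
    have e : (![1, 0] : Fin 2 → ℂ) (i + j) = if j = q then 1 else 0 := by
      fin_cases i <;> fin_cases j <;> fin_cases q <;> simp_all
    rwa [e] at h2
  · have h1 : Tendsto (fun r => stripPt lam i (sg q * stripCurve T r)) atTop (𝓝 0) := by
      rw [tendsto_zero_iff_norm_tendsto_zero]
      simp only [hn]
      simp only [sg, hp, if_false]
      refine Real.tendsto_exp_atBot.comp (tendsto_atBot_add_const_left _ _ ?_)
      exact (tendsto_neg_atTop_atBot.comp hr2).congr fun r => by simp
    have h2 := tendsto_pi_nhds.1 (h.frame_plus.comp (tendsto_nhdsWithin_iff.2 ⟨h1, hoff⟩)) (i + j)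
    have e : (![0, 1] : Fin 2 → ℂ) (i + j) = if j = q then 1 else 0 := by
      fin_cases i <;> fin_cases j <;> fin_cases q <;> simp_all
    rwa [e] at h2

namespace AbelianPath

variable {ζ : ℂ} {a : FramedAbelianConnection ζ} {Q : AbelianPath a} {lam lam' k η : ℂ} {y0 : ℝ}
  {E : ℝ → ℂ → ℂ} {d : Fin 2 → ℂ} {j : ℝ → ℂ}

theorem ParallelFamily.eventually_end (h : Q.ParallelFamily lam k y0 E d j)
    (hδ : ∀ u, u ≠ 0 → ‖Q.φ t u / u - 1‖ ≤ 1 / 4) (hy0 : 0 ≤ y0) (hlam : exp (2 * lam) = 2 * a.m)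
    (hlam' : exp (2 * lam') = 2 * (Q.conn t).m) (hnear : ‖lam' - lam‖ ≤ 1) (i q : Fin 2) (T : ℝ) :
    ∀ᶠ r in atTop, E t (Q.stripLog t lam lam' i (sg q * stripCurve T r)) = d (i + q) * exp ((if i +
    q = 0 then 0 else j t) + sg (i + q) * (2 * expo ζ⁻¹ ζ (Q.coeffA t) (Q.coeffB t) (curveLog lam' T
    q r))) := by
  have hπ := Real.pi_gt_three
  filter_upwards [eventually_gt_atTop (2 * y0 + 4)] with r hr
  set X := stripCurve T r
  have hXre : X.re = r := stripCurve_re T r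
  set u := stripPt lam' i (sg q * X) with hu
  have hu0 : u ≠ 0 := exp_ne_zero _
  set δ := lam' - lam - log (u / Q.φinv t u) with hδdef
  have hδn : ‖δ‖ ≤ 11 / 8 := by
    have := norm_log_le (Q.norm_ratio_sub_one hδ hu0)
    exact (norm_sub_le _ _).trans (by linarith)
  set Y := Q.stripLog t lam lam' i (sg q * X) with hY
  have hYe : Y = δ + (turn i + sg i * (sg q * X / 2)) := by rw [hY, hδdef, stripLog]; ring
  have hss := sg_mul_self (i + q)
  have hiq := sg_add i q
  have hssC := ofReal_sg_mul_self (i + q)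
  have hiqC : (sg (i + q) : ℂ) = sg i * sg q := by rw [hiq, ofReal_mul]
  have habs : ∀ x : ℝ, |sg (i + q) * x| = |x| := fun x => by
    rw [abs_mul]; rcases eq_or_ne (i + q) 0 with h0 | h0 <;> simp [sg, h0]
  have hZ : turn (i + q) + sg (i + q) * Y = turn q + (X / 2 + sg (i + q) * δ) := by
    have ht : turn (i + q) + sg (i + q) * turn i = turn q := by
      fin_cases i <;> fin_cases q <;> simp [turn, sg]
    rw [hYe, ← ht]
    linear_combination (X / 2) * hssC - (sg (i + q) * (X / 2)) * hiqC
  have hYre : y0 < sg (i + q) * Y.re := by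
    have h1 := congrArg re hZ
    have h2 : (turn q).re = 0 := by fin_cases q <;> simp [turn]
    rw [re_turn, add_re, add_re, re_ofReal_mul, h2, zero_add,
      show (X / 2).re = r / 2 by simp [hXre]] at h1
    have h3 := (abs_le.1 ((habs δ.re).le.trans ((abs_re_le_norm δ).trans hδn))).1
    linarith
  rw [h.ends t _ _ hYre]
  have hX2 : 0 < (X / 2).re := by simp [hXre]; linarith
  have hlog : endLog lam (i + q) Y = curveLog lam' T q r := by
    refine eq_of_exp_eq ?_ ?_
    · have h1 := h.proj_eq t _ _ hYre
      have h2 := exp_stripLog Q t lam lam' i (sg q * X)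
      have h5 : proj (Q.conn t).m u = exp lam' * sinh (sg q * X / 2) := by
        rw [hu, stripPt, proj_exp hlam', (sinh_turn i _).1]
      rw [h2, Q.φ_φinv t hu0, h5, ← h2, proj_exp hlam] at h1
      rw [exp_endLog lam (hy0.trans_lt hYre), ← h1, exp_curveLog lam' q (by rw [hXre]; linarith)]
    · have h1 := abs_im_lsinh_sub_le (Y := turn (i + q) + sg (i + q) * Y)
        (by rw [re_turn]; linarith)
      have h2 := abs_im_lsinh_sub_le hX2
      have h3 := (habs δ.im).le.trans ((abs_im_le_norm δ).trans hδn)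
      have h4 := (abs_im_le_norm _).trans hnear
      rw [sub_im] at h4
      simp only [endLog, curveLog, add_im]
      rw [hZ] at h1 ⊢
      simp only [add_im, im_ofReal_mul] at h1
      rw [abs_le] at h1 h2 h3 h4
      rw [abs_lt]
      constructor <;> linarith [h1.1, h1.2, h2.1, h2.2, h3.1, h3.2, h4.1, h4.2]
  rw [hlog]

theorem ParallelFamily.sq_stokes (h : Q.ParallelFamily lam k y0 E d j) {C : FramedConnection ζ}
    {e : ℂ → Fin 2 → ℂ} (hab : AbelianizationData η C (Q.conn t) e) (hm : (Q.conn t).m = C.m)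
    (hδ : ∀ u, u ≠ 0 → ‖Q.φ t u / u - 1‖ ≤ 1 / 4) (hy0 : 0 ≤ y0) (hlam : exp (2 * lam) = 2 * a.m)
    (hlam' : exp (2 * lam') = 2 * C.m) (hnear : ‖lam' - lam‖ ≤ 1) (hη : η ≠ 0)
    (hc : c = C.m / (sg i * η)) (hc0 : 0 < c.re) (hψ : IsFlat (shift i C.A) ψ) {S : ℂ} (hlim : ∀ q l
    : Fin 2, Tendsto (fun r => gauged (expo (sg i * ζ⁻¹) (sg i * ζ) (sg i * Q.coeffA t) (sg i *
    Q.coeffB t)) (q + 1) ψ (curveLog lam' (c.im / c.re) q r) l) atTop (𝓝 (if l = q + 1 then (if q =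
    0 then S else 1) else 0))) : S ^ 2 * (d (i + 1) * exp (if i = 0 then j t else 0)) = d i * exp
    (if i = 0 then 0 else j t) := by
  set T := c.im / c.re
  set g := expo (sg i * ζ⁻¹) (sg i * ζ) (sg i * Q.coeffA t) (sg i * Q.coeffB t)
  obtain ⟨f0, hf0⟩ := h.strip_const (lam' := lam') hab hm hδ hlam' hη hc hc0 hψ
  have key : ∀ q : Fin 2, (if q = 0 then S else 1) ^ 2
      = f0 * (d (i + q) * exp (if i + q = 0 then 0 else j t)) := by
    intro q
    have hx := hab.tendsto_stripPt (lam := lam') (i := i) (q := q) (T := T)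
      (by filter_upwards [eventually_ge_atTop 0] with r hr using (hf0 r hr q).1)
    have hw := ((hx 0).mul (hlim q 1)).sub ((hx 1).mul (hlim q 0)) |>.pow 2
    have hval : ((if (0 : Fin 2) = q then (1 : ℂ) else 0)
        * (if (1 : Fin 2) = q + 1 then (if q = 0 then S else 1) else 0)
        - (if (1 : Fin 2) = q then 1 else 0)
        * (if (0 : Fin 2) = q + 1 then (if q = 0 then S else 1) else 0)) ^ 2
        = (if q = 0 then S else 1) ^ 2 := by
      fin_cases q <;> simp
    rw [hval] at hw
    refine tendsto_nhds_unique (hw.congr' ?_) tendsto_const_nhds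
    filter_upwards [h.eventually_end hδ hy0 hlam (hm ▸ hlam') hnear i q T,
      eventually_gt_atTop 0] with r h1 hr
    have h2 := (hf0 r hr.le q).2
    rw [h1, ← exp_curveLog lam' q (by rwa [stripCurve_re])] at h2
    set ξ := curveLog lam' T q r
    have hgs : g ξ = sg i * expo ζ⁻¹ ζ (Q.coeffA t) (Q.coeffB t) ξ := expo_smul _ _ _ _ _ _
    have hE : exp (sg (q + 1) * g ξ) ^ 2
        * exp (sg (i + q) * (2 * expo ζ⁻¹ ζ (Q.coeffA t) (Q.coeffB t) ξ)) = 1 := by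
      rw [← exp_nat_mul, ← exp_add, hgs, sg_succ, sg_add]
      push_cast
      ring_nf
      exact exp_zero
    simp only [wr] at h2
    simp only [gauged]
    rw [exp_add] at h2
    linear_combination (exp (sg (q + 1) * g ξ) ^ 2) * h2
      + f0 * (d (i + q) * exp (if i + q = 0 then 0 else j t)) * hE
  have h0 := key 0
  have h1 := key 1
  simp only [if_true, add_zero, one_ne_zero, if_false, one_pow] at h0 h1
  have hi : (if i + 1 = 0 then 0 else j t) = if i = 0 then j t else 0 := by
    fin_cases i <;> simp
  rw [hi] at h1
  rw [h0]
  linear_combination (-(d i * exp (if i = 0 then 0 else j t))) * h1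

end AbelianPath

/-! ### The regularized integral on the spectral curve -/

theorem det_mulL (c : ℂ) : (mulL c).det = ‖c‖ ^ 2 := by
  have : (mulL c).det = Algebra.norm ℝ c := (Algebra.norm_apply ℝ c).symm
  rw [this, Algebra.norm_complex_apply, normSq_eq_norm_sq]

theorem integral_logCoord (lam : ℂ) {S : Set ℂ} (hS : MeasurableSet S) (g : ℂ → ℂ) :
    ∫ u in {u | u ≠ 0 ∧ u ∈ S}, g u = ∫ Y in {Y : ℂ | Y.im ∈ Ioc (-π) π ∧ exp (lam + Y) ∈ S},
        (‖exp (lam + Y)‖ : ℂ) ^ 2 * g (exp (lam + Y)) := by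
  set A : Set ℂ := {Y : ℂ | Y.im ∈ Ioc (-π) π ∧ exp (lam + Y) ∈ S}
  have hA : MeasurableSet A := (measurable_im measurableSet_Ioc).inter
    ((show Measurable fun Y => exp (lam + Y) by fun_prop) hS)
  have himg : {u | u ≠ 0 ∧ u ∈ S} = (fun Y => exp (lam + Y)) '' A := by
    ext u
    constructor
    · rintro ⟨h0, hu⟩
      have e : exp (lam + log (u * exp (-lam))) = u := by
        rw [exp_add, exp_log (mul_ne_zero h0 (exp_ne_zero _)), mul_comm u,
          ← mul_assoc, ← exp_add, add_neg_cancel, exp_zero, one_mul]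
      exact ⟨_, ⟨⟨neg_pi_lt_log_im _, log_im_le_pi _⟩, by rwa [e]⟩, e⟩
    · rintro ⟨Y, hY, rfl⟩; exact ⟨exp_ne_zero _, hY.2⟩
  rw [himg, integral_image_eq_integral_abs_det_fderiv_smul volume hA
    (fun Y _ => (hasFDerivAt_mulL (hasDerivAt_exp_add lam Y)).hasFDerivWithinAt)
    (fun Y hY Z hZ e => by
      simp only [exp_add] at e
      exact exp_inj_of_neg_pi_lt_of_le_pi hY.1.1 hY.1.2 hZ.1.1 hZ.1.2
        (mul_left_cancel₀ (exp_ne_zero lam) e))]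
  simp only [det_mulL, abs_pow, abs_norm, real_smul, ofReal_pow]

/-- A rectangle in the logarithmic coordinate. -/
def box (T : ℝ) : Set ℂ := {Y | Y.re ∈ Ioc (-T) T ∧ Y.im ∈ Ioc (-π) π}

theorem measurableSet_box (T : ℝ) : MeasurableSet (box T) :=
  (measurable_re measurableSet_Ioc).inter (measurable_im measurableSet_Ioc)

theorem isBounded_box (T : ℝ) : Bornology.IsBounded (box T) :=
  (Metric.isBounded_Ioc (-T) T).reProdIm (Metric.isBounded_Ioc (-π) π)

theorem integrableOn_box {W : ℂ → ℂ} (hW : Continuous W) (T : ℝ) : IntegrableOn W (box T) :=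
  (hW.continuousOn.integrableOn_compact (isBounded_box T).isCompact_closure).mono_set subset_closure

theorem integral_box {W : ℂ → ℂ} (hW : Continuous W) (hT : 0 ≤ T) : ∫ Y in box T, W Y = ∫ x in
    -T..T, ∫ y in -π..π, W (x + y * I) := by
  have hπ : -π ≤ π := by linarith [Real.pi_pos]
  have hc : Continuous fun p : ℝ × ℝ => W (p.1 + p.2 * I) := by fun_prop
  have h := volume_preserving_equiv_real_prod.setIntegral_preimage_emb
    measurableEquivRealProd.measurableEmbedding
    (fun p : ℝ × ℝ => W (p.1 + p.2 * I)) (Ioc (-T) T ×ˢ Ioc (-π) π)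
  simp only [measurableEquivRealProd_apply, re_add_im] at h
  rw [intervalIntegral.integral_of_le (by linarith)]
  simp_rw [intervalIntegral.integral_of_le hπ]
  rw [← setIntegral_prod (f := fun p : ℝ × ℝ => W (p.1 + p.2 * I))
    ((hc.continuousOn.integrableOn_compact (isCompact_Icc.prod isCompact_Icc)).mono_set
      (prod_mono Ioc_subset_Icc_self Ioc_subset_Icc_self))]
  exact h

theorem stokes_box (hF : ContDiff ℝ ∞ F) (hG : ContDiff ℝ ∞ G) {f g : ℂ}
    (pF : ∀ Y, F (Y + 2 * π * I) = F Y + f) (pG : ∀ Y, G (Y + 2 * π * I) = G Y + g) (hT : 0 ≤ T) : ∫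
    Y in box T, wedge (fderiv ℝ F Y) (fderiv ℝ G Y) =
    (∫ y in -π..π, F (T + y * I) * fderiv ℝ G (T + y * I) I) -
    (∫ y in -π..π, F (-T + y * I) * fderiv ℝ G (-T + y * I) I) - f *
    (G (T - π * I) - G (-T - π * I)) := by
  have cF := hF.continuous_fderiv (by simp)
  have cG := hG.continuous_fderiv (by simp)
  rw [integral_box (continuous_wedge cF cG) hT]
  have hm : ContDiff ℝ ∞ fun p : ℝ × ℝ => (p.1 + p.2 * I : ℂ) :=
    (ofRealCLM.contDiff.comp contDiff_fst).add
      ((ofRealCLM.contDiff.comp contDiff_snd).mul contDiff_const)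
  have hmd : ∀ p : ℝ × ℝ, HasFDerivAt (fun p : ℝ × ℝ => (p.1 + p.2 * I : ℂ))
      (ofRealCLM.comp (ContinuousLinearMap.fst ℝ ℝ ℝ)
        + I • ofRealCLM.comp (ContinuousLinearMap.snd ℝ ℝ ℝ)) p := fun p =>
    (ofRealCLM.hasFDerivAt.comp p hasFDerivAt_fst).add
      ((ofRealCLM.hasFDerivAt.comp p hasFDerivAt_snd).mul_const I)
  have hd : ∀ {F : ℂ → ℂ}, ContDiff ℝ ∞ F → ∀ p v : ℝ × ℝ,
      fderiv ℝ (fun p : ℝ × ℝ => F (p.1 + p.2 * I)) p v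
        = fderiv ℝ F (p.1 + p.2 * I) (v.1 + v.2 * I) := fun h p v => by
    have := ((h.differentiable (by simp) _).hasFDerivAt).comp p (hmd p)
    simp only [Function.comp_def] at this
    rw [this.fderiv]
    simp [mul_comm]
  have key := stokes_rect ((hF.comp hm).of_le (by norm_cast))
    ((hG.comp hm).of_le (WithTop.coe_le_coe.2 le_top)) (-T) T (-π) π
  simp only [Function.comp_def, hd hF, hd hG] at key
  simp only [ofReal_one, ofReal_zero, zero_mul, add_zero, one_mul, zero_add, ofReal_neg] at key
  simp only [wedge]
  rw [key]
  have e : ∀ x : ℝ, (x + π * I : ℂ) = x + -π * I + 2 * π * I := fun x => by ring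
  have pG' : ∀ Y, fderiv ℝ G (Y + 2 * π * I) = fderiv ℝ G Y := fun Y => by
    have h1 := (hG.differentiable (by simp) (Y + 2 * π * I)).hasFDerivAt.comp Y
      ((hasFDerivAt_id Y).add_const (2 * π * I))
    have h2 := ((hG.differentiable (by simp) Y).hasFDerivAt.add_const g).unique
      (h1.congr_of_eventuallyEq (Eventually.of_forall fun Z => (pG Z).symm))
    rw [h2]; ext; simp
  have hx : ∀ x : ℝ, HasDerivAt (fun x : ℝ => G (x + -π * I))
      (fderiv ℝ G (x + -π * I) 1) x := fun x =>
    (hG.differentiable (by simp) _).hasFDerivAt.comp_hasDerivAt x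
      ((ofRealCLM.hasDerivAt (x := x)).add_const _)
  have hcx : Continuous fun x : ℝ => fderiv ℝ G (x + -π * I) 1 :=
    (cG.comp (by fun_prop)).clm_apply continuous_const
  have hcF : Continuous fun x : ℝ => F (x + -π * I) := hF.continuous.comp (by fun_prop)
  have h1 := intervalIntegral.integral_eq_sub_of_hasDerivAt (a := -T) (b := T) (fun x _ => hx x)
    (hcx.intervalIntegrable _ _)
  simp only [e, pF, pG', add_mul]
  rw [intervalIntegral.integral_add (Continuous.intervalIntegrable (by fun_prop) _ _)
    (Continuous.intervalIntegrable (by fun_prop) _ _), intervalIntegral.integral_const_mul, h1]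
  push_cast
  simp only [neg_mul, ← sub_eq_add_neg]
  ring

theorem wedge_comp_mulL (L M : ℂ →L[ℝ] ℂ) (c : ℂ) :
    wedge (L.comp (mulL c)) (M.comp (mulL c)) = ‖c‖ ^ 2 * wedge L M := by
  simpa [wedge, mul_comm c I] using wedge_mul L M c 1

theorem norm_coth_sub_one_le {X : ℂ} (hX : 1 ≤ X.re) :
    ‖log (1 - exp (-(2 * X)))‖ ≤ 2 * rexp (-(2 * X.re)) ∧
      ‖cosh X / sinh X - 1‖ ≤ 4 * rexp (-(2 * X.re)) := by
  have he : ‖exp (-(2 * X))‖ = rexp (-(2 * X.re)) := by rw [norm_exp]; simp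
  have h2 : rexp (-(2 * X.re)) ≤ 1 / 2 := by
    rw [Real.exp_neg, one_div]
    gcongr
    linarith [Real.add_one_le_exp (2 * X.re)]
  have hX0 : 0 < X.re := by linarith
  have hn := one_sub_exp_ne_zero hX0
  constructor
  · have := norm_log_one_add_half_le_self (z := -exp (-(2 * X))) (by rw [norm_neg, he]; exact h2)
    rw [← sub_eq_add_neg, norm_neg, he] at this
    linarith [Real.exp_pos (-(2 * X.re))]
  · have e : cosh X / sinh X - 1 = 2 * exp (-(2 * X)) / (1 - exp (-(2 * X))) := by
      have e2 : exp X * exp (-(2 * X)) = exp (-X) := by rw [← exp_add]; ring_nf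
      have e3 := cosh_sub_sinh X
      rw [div_sub_one (sinh_ne_zero hX0), div_eq_div_iff (sinh_ne_zero hX0) hn]
      linear_combination (1 - exp (-(2 * X))) * e3 - (1 - exp (-(2 * X))) * e2
        - exp (-(2 * X)) * two_sinh_eq X
    have hl : 1 / 2 ≤ ‖1 - exp (-(2 * X))‖ := by
      have := norm_sub_norm_le 1 (exp (-(2 * X)))
      rw [norm_one, he] at this
      linarith
    rw [e, norm_div, norm_mul, he, norm_ofNat, div_le_iff₀ (by linarith)]
    nlinarith [Real.exp_pos (-(2 * X.re))]

/-- The value of a primitive at the edge `re Y = ± T` of a box, without its linear part. -/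
def edgeVal (lam a' b' k : ℂ) (p : Fin 2) (T : ℝ) : ℂ :=
  sg p * lin a' b' (lam + turn p + (T - log 2)) + if p = 0 then 0 else k

theorem LogPrimitive.fderiv_end {β : CForm} (h : LogPrimitive lam m β a' b' k y0 G) {p : Fin 2}
    (hY : y0 < sg p * Y.re) (hY0 : 0 < sg p * Y.re) (v : ℂ) : fderiv ℝ G Y v = sg p * lin a' b'
    (cosh Y / sinh Y * v) := by
  have h1 := ((hasFDerivAt_lin a' b' (endLog lam p Y)).comp Y
    (hasFDerivAt_mulL (hasDerivAt_endLog lam hY0))).const_mul (sg p : ℂ)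
  have h2 := h1.add_const (if p = 0 then 0 else k)
  have hev : ∀ᶠ Z : ℂ in 𝓝 Y, y0 < sg p * Z.re :=
    (continuous_const.mul continuous_re).continuousAt.eventually_const_lt hY
  rw [(h2.congr_of_eventuallyEq (hev.mono fun Z hZ => h.ends p Z hZ)).fderiv]
  simp [lin, mul_add]

theorem LogPrimitive.edge {β : CForm} (h : LogPrimitive lam m β a' b' k y0 G) (p : Fin 2)
    (hT : y0 < T) (hT1 : 1 ≤ T) (hY : sg p * Y.re = T) : ‖G Y -
    (edgeVal lam a' b' k p T + lin a' b' I * Y.im)‖ ≤ (‖a'‖ + ‖b'‖) * (2 * rexp (-(2 * T))) ∧ ∀ v,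
    ‖fderiv ℝ G Y v - lin a' b' v‖ ≤ (‖a'‖ + ‖b'‖) * (4 * rexp (-(2 * T)) * ‖v‖) := by
  have hss := ofReal_sg_mul_self p
  have hn : ‖(sg p : ℂ)‖ = 1 := by fin_cases p <;> simp [sg]
  have hre : (turn p + sg p * Y).re = T := by rw [re_turn, hY]
  have hX := norm_coth_sub_one_le (hT1.trans hre.ge)
  rw [hre] at hX
  have hYd : sg p * Y = T + sg p * Y.im * I := by
    rw [← hY]; push_cast
    linear_combination (sg p : ℂ) * (re_add_im Y).symm
  constructor
  · have e : G Y - (edgeVal lam a' b' k p T + lin a' b' I * Y.im)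
        = sg p * lin a' b' (log (1 - exp (-(2 * (turn p + sg p * Y))))) := by
      rw [h.ends p Y (by rw [hY]; exact hT), edgeVal, endLog, lsinh]
      generalize log (1 - exp (-(2 * (turn p + sg p * Y)))) = L
      rw [hYd]
      simp only [lin, map_add, map_sub, map_mul, conj_ofReal, conj_I]
      linear_combination (a' * I - b' * I) * Y.im * hss
    rw [e, norm_mul, hn, one_mul]
    exact (norm_linear_le _ _ _).trans (mul_le_mul_of_nonneg_left hX.1 (by positivity))
  · intro v
    have e : fderiv ℝ G Y v - lin a' b' v = sg p * lin a' b' (sg p *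
        ((cosh (turn p + sg p * Y) / sinh (turn p + sg p * Y) - 1) * v)) := by
      rw [h.fderiv_end (hT.trans_eq hY.symm) (by linarith), (sinh_turn p Y).1, (sinh_turn p Y).2]
      generalize sinh Y = x, cosh Y = y
      simp only [lin, map_mul, map_sub, map_div₀, conj_ofReal, map_one]
      linear_combination ((a' * v + b' * conj v) - (sg p : ℂ) * a' * (y / x) * v
        - (sg p : ℂ) * b' * (conj y / conj x) * conj v) * hss
    rw [e, norm_mul, hn, one_mul]
    refine (norm_linear_le _ _ _).trans (mul_le_mul_of_nonneg_left ?_ (by positivity))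
    rw [norm_mul, hn, one_mul, norm_mul]
    gcongr
    exact hX.2

theorem tendsto_edge_integral {β1 β2 : CForm} {b₁ b₂ : ℂ} {G1 G2 : ℂ → ℂ}
    (h₁ : LogPrimitive lam m β1 a1 b₁ k1 y1 G1) (h₂ : LogPrimitive lam m β2 a2 b₂ k2 y2 G2)
    (p : Fin 2) : Tendsto (fun T : ℝ => (∫ y in -π..π, G1 (sg p * T + y * I) * fderiv ℝ G2 (sg p * T
    + y * I) I) - 2 * π * (edgeVal lam a1 b₁ k1 p T * lin a2 b₂ I)) atTop (𝓝 0) := by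
  set N1 := lin a1 b₁ I
  set N2 := lin a2 b₂ I
  set M1 := ‖a1‖ + ‖b₁‖
  set M2 := ‖a2‖ + ‖b₂‖
  set V := edgeVal lam a1 b₁ k1 p
  set ε : ℝ → ℝ := fun T => rexp (-(2 * T))
  have hε : Tendsto ε atTop (𝓝 0) :=
    Real.tendsto_exp_neg_atTop_nhds_zero.comp (tendsto_id.const_mul_atTop two_pos)
  have hTε : Tendsto (fun T => T * ε T) atTop (𝓝 0) := by
    have := ((Real.tendsto_pow_mul_exp_neg_atTop_nhds_zero 1).comp
      (tendsto_id.const_mul_atTop (zero_lt_two' ℝ))).const_mul (1 / 2)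
    rw [mul_zero] at this
    refine this.congr fun T => ?_
    simp [ε]
    ring
  have hV : Tendsto (fun T => ‖V T‖ * ε T) atTop (𝓝 0) := by
    have h3 := (((continuous_ofReal.tendsto _).comp hε).const_mul (V 0)).add
      (((continuous_ofReal.tendsto _).comp hTε).const_mul (sg p * (a1 + b₁)))
    simp only [ofReal_zero, mul_zero, add_zero] at h3
    refine (norm_zero (E := ℂ) ▸ h3.norm).congr fun T => ?_
    have e : V T = V 0 + sg p * (a1 + b₁) * T := by
      simp only [V, edgeVal, lin, map_add, map_sub, conj_ofReal, ofReal_zero, map_zero]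
      ring
    have hn : ‖(ε T : ℂ)‖ = ε T := by rw [norm_real, Real.norm_of_nonneg (Real.exp_pos _).le]
    rw [e]
    conv_rhs => rw [← hn, ← norm_mul]
    congr 1
    simp only [Function.comp_apply, ofReal_mul]
    ring
  set B : ℝ → ℝ := fun T => M1 * (2 * ε T) * (‖N2‖ + M2 * (4 * ε T))
    + (‖V T‖ + ‖N1‖ * π) * (M2 * (4 * ε T))
  have hB : Tendsto (fun T => B T * |π - -π|) atTop (𝓝 0) := by
    have h3 := ((((hε.const_mul 2).const_mul M1).mul
      (((hε.const_mul 4).const_mul M2).const_add ‖N2‖)).add ((hV.const_mul (4 * M2)).add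
        (hε.const_mul (4 * M2 * (‖N1‖ * π))))).mul_const |π - -π|
    simp only [mul_zero, zero_mul, add_zero] at h3
    refine h3.congr fun T => ?_
    simp only [B]; ring
  refine squeeze_zero_norm' ?_ hB
  filter_upwards [eventually_gt_atTop y1, eventually_gt_atTop y2, eventually_ge_atTop 1]
    with T hT1 hT2 hT
  have hI : ∫ y in -π..π, (V T + N1 * (y : ℝ)) * N2 = 2 * π * (V T * N2) := by
    have : ∀ y : ℝ, (V T + N1 * y) * N2 = V T * N2 + N1 * N2 * y := fun y => by ring
    simp only [this]
    rw [intervalIntegral.integral_add (by simp) (Continuous.intervalIntegrable (by fun_prop) _ _),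
      intervalIntegral.integral_const_mul (N1 * N2), intervalIntegral.integral_ofReal]
    simp
    ring
  have cG := h₁.smooth.continuous
  have cD := h₂.smooth.continuous_fderiv (by simp)
  rw [← hI, ← intervalIntegral.integral_sub (Continuous.intervalIntegrable (by fun_prop) _ _)
    (Continuous.intervalIntegrable (by fun_prop) _ _)]
  refine intervalIntegral.norm_integral_le_of_norm_le_const fun y hy => ?_
  rw [uIoc_of_le (by linarith [Real.pi_pos])] at hy
  have hre : sg p * (sg p * T + y * I : ℂ).re = T := by simp [← mul_assoc, sg_mul_self]
  have hT' := hT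
  have e1 := (h₁.edge p hT1 hT hre).1
  have e2 := (h₂.edge p hT2 hT hre).2 I
  rw [show (sg p * T + y * I : ℂ).im = y by simp] at e1
  rw [norm_I, mul_one] at e2
  generalize G1 (sg p * T + y * I) = g at *
  generalize fderiv ℝ G2 (sg p * T + y * I) I = d at *
  have hd : ‖d‖ ≤ ‖N2‖ + M2 * (4 * ε T) := by
    have := norm_add_le N2 (d - N2)
    rw [add_sub_cancel] at this
    exact this.trans (by gcongr)
  have hl : ‖V T + N1 * y‖ ≤ ‖V T‖ + ‖N1‖ * π := by
    refine (norm_add_le _ _).trans ?_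
    rw [norm_mul, norm_real]
    gcongr
    exact abs_le.2 ⟨hy.1.le, hy.2⟩
  have e : g * d - (V T + N1 * y) * N2
      = (g - (V T + N1 * y)) * d + (V T + N1 * y) * (d - N2) := by ring
  rw [e]
  refine (norm_add_le _ _).trans ?_
  rw [norm_mul, norm_mul]
  exact add_le_add (by gcongr) (by gcongr)

theorem tendsto_log_exp_add (c : ℝ) : Tendsto (fun τ => Real.log (rexp τ + c) - τ) atTop (𝓝 0) := by
  have h1 : Tendsto (fun τ => Real.log (1 + c * rexp (-τ))) atTop (𝓝 0) := by
    have h := (Real.tendsto_exp_neg_atTop_nhds_zero.const_mul c).const_add 1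
    rw [mul_zero, add_zero] at h
    simpa using h.log one_ne_zero
  refine h1.congr' ?_
  filter_upwards [Real.tendsto_exp_atTop.eventually_gt_atTop (-c)] with τ hτ
  have e : 1 + c * rexp (-τ) = (rexp τ + c) / rexp τ := by rw [Real.exp_neg]; field_simp
  rw [e, Real.log_div (by linarith) (Real.exp_ne_zero _), Real.log_exp]

theorem norm_sinh_bounds (Y : ℂ) :
    (rexp |Y.re| - 1) / 2 ≤ ‖sinh Y‖ ∧ ‖sinh Y‖ ≤ (rexp |Y.re| + 1) / 2 := by
  have h0 : ‖sinh Y‖ = ‖exp Y - exp (-Y)‖ / 2 := by rw [sinh, norm_div, norm_ofNat]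
  have h1 := norm_sub_le (exp Y) (exp (-Y))
  have h2 := abs_norm_sub_norm_le (exp Y) (exp (-Y))
  simp only [norm_exp, neg_re] at h1 h2
  have h3 := abs_le.1 h2
  rw [h0]
  rcases le_total 0 Y.re with h | h
  · have : rexp (-Y.re) ≤ 1 := Real.exp_le_one_iff.2 (by linarith)
    rw [abs_of_nonneg h]
    constructor <;> linarith
  · have : rexp Y.re ≤ 1 := Real.exp_le_one_iff.2 h; rw [abs_of_nonpos h]; constructor <;> linarith

theorem LogPrimitive.integral_eq (hlam : exp (2 * lam) = 2 * m) {β1 β2 : CForm} {b₁ b₂ : ℂ}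
    {G1 G2 : ℂ → ℂ} (h₁ : LogPrimitive lam m β1 a1 b₁ k1 y1 G1)
    (h₂ : LogPrimitive lam m β2 a2 b₂ k2 y2 G2) (c : ℝ) : ∫ u in {u : ℂ | u ≠ 0 ∧ ‖proj m u‖ ≤ c},
    wedge (β1 u) (β2 u) = ∫ Y in {Y : ℂ | Y.im ∈ Ioc (-π) π ∧ ‖exp lam * sinh Y‖ ≤ c}, wedge
    (fderiv ℝ G1 Y) (fderiv ℝ G2 Y) := by
  have hp : Measurable fun u => ‖proj m u‖ := by unfold proj spectralPoint; fun_prop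
  have h := integral_logCoord lam (S := {u | ‖proj m u‖ ≤ c}) (hp measurableSet_Iic)
    (fun u => wedge (β1 u) (β2 u))
  simp only [mem_ofPred_eq, proj_exp hlam] at h
  refine h.trans (integral_congr_ae (ae_restrict_of_ae ?_))
  have h0 : volume (LinearMap.ker reLm : Set ℂ) = 0 :=
    Measure.addHaar_submodule volume _ fun h => by
      have := (LinearMap.mem_ker (f := reLm)).1 (h ▸ Submodule.mem_top (x := (1 : ℂ)))
      simp at this
  filter_upwards [compl_mem_ae_iff.2 h0] with Y hY
  have hY0 : Y.re ≠ 0 := hY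
  have hb : exp (lam + Y) ∈ unbranched m := by
    rcases hY0.lt_or_gt with h | h
    · exact mem_unbranched_exp hlam (p := 1) (by simpa [sg] using h)
    · exact mem_unbranched_exp hlam (p := 0) (by simpa [sg] using h)
  rw [h₁.fderiv_eq _ hb, h₂.fderiv_eq _ hb, pull, pull, wedge_comp_mulL]

theorem LogPrimitive.norm_fderiv_le {β : CForm} (h : LogPrimitive lam m β a' b' k y0 G)
    (hY : y0 < |Y.re|) (hY1 : 1 ≤ |Y.re|) {v : ℂ} (hv : ‖v‖ = 1) : ‖fderiv ℝ G Y v‖ ≤ (‖a'‖ + ‖b'‖)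
    * 5 := by
  have key : ∀ p : Fin 2, sg p * Y.re = |Y.re| → ‖fderiv ℝ G Y v‖ ≤ (‖a'‖ + ‖b'‖) * 5 := by
    intro p hp
    have h1 := (h.edge p hY hY1 hp).2 v
    have h2 := norm_linear_le a' b' v
    have h3 := norm_add_le (lin a' b' v) (fderiv ℝ G Y v - lin a' b' v)
    have h4 : rexp (-(2 * |Y.re|)) ≤ 1 := Real.exp_le_one_iff.2 (by linarith)
    rw [hv, mul_one] at h1 h2
    rw [add_sub_cancel] at h3
    have h5 : (‖a'‖ + ‖b'‖) * (4 * rexp (-(2 * |Y.re|))) ≤ (‖a'‖ + ‖b'‖) * 4 :=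
      mul_le_mul_of_nonneg_left (by linarith) (by positivity)
    change ‖lin a' b' v‖ ≤ _ at h2
    linarith
  rcases le_total 0 Y.re with h0 | h0
  · exact key 0 (by simp [sg, abs_of_nonneg h0])
  · exact key 1 (by simp [sg, abs_of_nonpos h0])

theorem measureReal_box (hT : 0 ≤ T) : volume.real (box T) = 4 * π * T := by
  have h := integral_box (W := fun _ => 1) continuous_const hT
  rw [setIntegral_const] at h
  have h' : (volume.real (box T) : ℂ) = (4 * π * T : ℝ) := by
    rw [← mul_one (volume.real (box T) : ℂ), ← real_smul, h]
    simp
    ring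
  exact_mod_cast h'

theorem LogPrimitive.tendsto_box {β1 β2 : CForm} {b₁ b₂ : ℂ} {G1 G2 : ℂ → ℂ}
    (h₁ : LogPrimitive lam m β1 a1 b₁ k1 y1 G1) (h₂ : LogPrimitive lam m β2 a2 b₂ k2 y2 G2) :
    Tendsto (fun T : ℝ => (∫ Y in box T, wedge (fderiv ℝ G1 Y) (fderiv ℝ G2 Y)) - 4 * π * (T +
    lam.re - Real.log 2) * ((a1 + b₁) * lin a2 b₂ I - (a2 + b₂) * lin a1 b₁ I)) atTop
    (𝓝 (2 * π * (lin a1 b₁ I * k2 - k1 * lin a2 b₂ I))) := by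
  have hε : Tendsto (fun T : ℝ => (‖a2‖ + ‖b₂‖) * (2 * rexp (-(2 * T)))) atTop (𝓝 0) := by
    have := ((Real.tendsto_exp_neg_atTop_nhds_zero.comp
      (tendsto_id.const_mul_atTop (zero_lt_two' ℝ))).const_mul 2).const_mul (‖a2‖ + ‖b₂‖)
    simpa using this
  have hg : ∀ p : Fin 2, Tendsto (fun T : ℝ => G2 (sg p * T + (-π : ℝ) * I)
      - (edgeVal lam a2 b₂ k2 p T + lin a2 b₂ I * (-π : ℝ))) atTop (𝓝 0) := fun p => by
    refine squeeze_zero_norm' ?_ hε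
    filter_upwards [eventually_gt_atTop y2, eventually_ge_atTop 1] with T hT hT1
    have := (h₂.edge p (Y := sg p * T + (-π : ℝ) * I) hT hT1 (by simp [← mul_assoc, sg_mul_self])).1
    rwa [show (sg p * T + (-π : ℝ) * I : ℂ).im = -π by simp] at this
  have hlim := (((tendsto_edge_integral h₁ h₂ 0).sub (tendsto_edge_integral h₁ h₂ 1)).sub
    (((hg 0).sub (hg 1)).const_mul (2 * π * lin a1 b₁ I))).add_const
    (2 * π * (lin a1 b₁ I * k2 - k1 * lin a2 b₂ I))
  simp only [sub_zero, mul_zero, zero_add] at hlim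
  refine hlim.congr' ?_
  filter_upwards [eventually_ge_atTop 0] with T hT
  rw [stokes_box h₁.smooth h₂.smooth h₁.period h₂.period hT]
  simp only [edgeVal, turn, sg, Fin.isValue, ↓reduceIte, one_ne_zero, ofReal_one, ofReal_neg,
    one_mul, neg_mul, add_zero, sub_eq_add_neg]
  have hl : ((lam.re : ℝ) : ℂ) = (lam + conj lam) / 2 := by rw [add_conj]; simp
  have hlog : conj (log 2) = log 2 := by rw [← ofReal_ofNat, ← ofReal_log zero_le_two, conj_ofReal]
  rw [hl, ofReal_log zero_le_two, ofReal_ofNat]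
  simp only [lin, map_add, map_neg, map_mul, conj_ofReal, conj_I, hlog]
  ring

theorem LogPrimitive.tendsto_integral (hlam : exp (2 * lam) = 2 * m) {β1 β2 : CForm} {b₁ b₂ : ℂ}
    {G1 G2 : ℂ → ℂ} (h₁ : LogPrimitive lam m β1 a1 b₁ k1 y1 G1)
    (h₂ : LogPrimitive lam m β2 a2 b₂ k2 y2 G2) : Tendsto (fun s : ℝ => (∫ u in {u : ℂ | u ≠ 0 ∧
    ‖proj m u‖ ≤ rexp s}, wedge (β1 u) (β2 u)) - 4 * π * s * ((a1 + b₁) * lin a2 b₂ I - (a2 + b₂) *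
    lin a1 b₁ I)) atTop (𝓝 (2 * π * (lin a1 b₁ I * k2 - k1 * lin a2 b₂ I))) := by
  set w := (a1 + b₁) * lin a2 b₂ I - (a2 + b₂) * lin a1 b₁ I
  set W : ℂ → ℂ := fun Y => wedge (fderiv ℝ G1 Y) (fderiv ℝ G2 Y)
  have cW : Continuous W := continuous_wedge (h₁.smooth.continuous_fderiv (by simp))
    (h₂.smooth.continuous_fderiv (by simp))
  set τ : ℝ → ℝ := fun s => s - lam.re + Real.log 2
  set A : ℝ → Set ℂ := fun s =>
    {Y : ℂ | Y.im ∈ Ioc (-π) π ∧ ‖exp lam * sinh Y‖ ≤ rexp s}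
  have hτ : Tendsto τ atTop atTop :=
    tendsto_atTop_add_const_right _ _ (tendsto_atTop_add_const_right _ (-lam.re) tendsto_id)
  set T : ℝ → ℝ := fun s => Real.log (rexp (τ s) + (-1))
  set T' : ℝ → ℝ := fun s => Real.log (rexp (τ s) + 2)
  have hT : Tendsto (fun s => T s - τ s) atTop (𝓝 0) := (tendsto_log_exp_add (-1)).comp hτ
  have hT' : Tendsto (fun s => T' s - τ s) atTop (𝓝 0) := (tendsto_log_exp_add 2).comp hτ
  have hTinf : Tendsto T atTop atTop := by simpa using hT.add_atTop hτ
  have hmain := (h₁.tendsto_box h₂).comp hTinf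
  set C := (‖a1‖ + ‖b₁‖) * 5 * ((‖a2‖ + ‖b₂‖) * 5) * 2
  have hdiff : Tendsto (fun s => (∫ Y in A s, W Y) - ∫ Y in box (T s), W Y) atTop (𝓝 0) := by
    have hb := ((hT'.sub hT).const_mul (4 * π)).const_mul C
    rw [sub_zero, mul_zero, mul_zero] at hb
    refine squeeze_zero_norm' ?_ hb
    filter_upwards [hTinf.eventually_gt_atTop y1, hTinf.eventually_gt_atTop y2,
      hTinf.eventually_ge_atTop 1, hτ.eventually_gt_atTop 0] with s hs₁ hs2 hs hs0
    have hes : rexp (τ s) * rexp lam.re = 2 * rexp s := by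
      simp only [τ]
      rw [← Real.exp_add, mul_comm 2, ← Real.exp_log two_pos, ← Real.exp_add, Real.exp_log two_pos]
      ring_nf
    have hTe : rexp (T s) = rexp (τ s) - 1 := Real.exp_log (by linarith [Real.add_one_le_exp (τ s)])
    have hTe' : rexp (T' s) = rexp (τ s) + 2 := Real.exp_log (by positivity)
    have hA : ∀ Y, ‖exp lam * sinh Y‖ ≤ rexp s ↔ ‖sinh Y‖ ≤ rexp (τ s) / 2 := fun Y => by
      have := Real.exp_pos lam.re
      rw [norm_mul, norm_exp]
      constructor <;> intro <;> nlinarith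
    have hsub : box (T s) ⊆ A s := fun Y hY => by
      refine ⟨hY.2, (hA Y).2 ((norm_sinh_bounds Y).2.trans ?_)⟩
      have := Real.exp_le_exp.2 (abs_le.2 ⟨hY.1.1.le, hY.1.2⟩)
      linarith
    have hsub' : A s ⊆ box (T' s) := fun Y hY => by
      have h1 := (norm_sinh_bounds Y).1.trans ((hA Y).1 hY.2)
      have h2 := abs_lt.1 (Real.exp_lt_exp.1 (show rexp |Y.re| < rexp (T' s) by linarith))
      exact ⟨⟨h2.1, h2.2.le⟩, hY.1⟩
    have hTT : T s ≤ T' s := Real.exp_le_exp.1 (by linarith)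
    have hint := (integrableOn_box cW (T' s)).mono_set hsub'
    have hfin : volume (box (T' s)) ≠ ⊤ := (isBounded_box _).measure_lt_top.ne
    have hfinA : volume (A s \ box (T s)) < ⊤ :=
      ((isBounded_box _).subset (sdiff_subset.trans hsub')).measure_lt_top
    rw [← setIntegral_sdiff (measurableSet_box _) hint hsub]
    have hn : ∀ Y ∈ A s \ box (T s), ‖W Y‖ ≤ C := fun Y hY => by
      have hre : T s ≤ |Y.re| := by
        by_contra! hlt
        exact hY.2 ⟨⟨(abs_lt.1 hlt).1, (abs_lt.1 hlt).2.le⟩, hY.1.1⟩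
      have n1 := fun {v : ℂ} => h₁.norm_fderiv_le (v := v) (hs₁.trans_le hre) (hs.trans hre)
      have n2 := fun {v : ℂ} => h₂.norm_fderiv_le (v := v) (hs2.trans_le hre) (hs.trans hre)
      refine (norm_sub_le _ _).trans ?_
      rw [norm_mul, norm_mul, show C = (‖a1‖ + ‖b₁‖) * 5 * ((‖a2‖ + ‖b₂‖) * 5)
        + (‖a1‖ + ‖b₁‖) * 5 * ((‖a2‖ + ‖b₂‖) * 5) by ring]
      exact add_le_add (mul_le_mul (n1 norm_one) (n2 norm_I) (by positivity) (by positivity))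
        (mul_le_mul (n1 norm_I) (n2 norm_one) (by positivity) (by positivity))
    refine (norm_setIntegral_le_of_norm_le_const hfinA hn).trans
      (mul_le_mul_of_nonneg_left ?_ (by positivity))
    refine (measureReal_mono (sdiff_subset_sdiff_left hsub')
      ((measure_mono sdiff_subset).trans_lt hfin.lt_top).ne).trans ?_
    rw [measureReal_sdiff (hsub.trans hsub') (measurableSet_box _), measureReal_box (by linarith),
      measureReal_box (by linarith)]
    linarith
  have hTc := ((continuous_ofReal.tendsto _).comp hT).const_mul (4 * π * w)
  have := (hmain.add hdiff).add hTc
  rw [ofReal_zero, mul_zero, add_zero, add_zero] at this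
  refine this.congr fun s => ?_
  rw [h₁.integral_eq hlam h₂]
  simp only [Function.comp_apply, ofReal_sub, ofReal_add, τ]
  ring

/-! ### Polar coefficients and the regularized limits -/

theorem IsVariation.hasPolarCoeffs (h : IsVariation A β a' b' s1 C) : HasPolarCoeffs β
    (lin a' b' (-I) • matH) (lin a' b' (-1) • matH) := by
  have key : ∀ (c : ℂ) (i j : Fin 2), ‖c‖ = 1 → (fun w : ℂ => (β w⁻¹).eval (-(c * w / w ^ 2)) i j
      - (lin a' b' (-c) • matH) i j) =O[𝓝[≠] 0] fun w : ℂ => ‖w‖ := fun c i j hc => by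
    refine IsBigO.of_bound C ?_
    filter_upwards [self_mem_nhdsWithin, nhdsWithin_le_nhds
      (Metric.ball_mem_nhds (0 : ℂ) (Real.exp_pos (-s1)))] with w hw hs
    have hw0 : w ≠ 0 := hw
    have h1 := h.asymp (-log w) (by
      rw [neg_re, log_re, le_neg, ← Real.log_exp (-s1)]
      exact Real.log_le_log (norm_pos_iff.2 hw0) (mem_ball_zero_iff.1 hs).le) (-c) i j
    rw [exp_neg, exp_log hw0, neg_re, neg_neg, log_re,
      Real.exp_log (norm_pos_iff.2 hw0), norm_neg, hc, mul_one] at h1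
    rw [norm_norm, show -(c * w / w ^ 2) = w⁻¹ * -c by field_simp]
    exact h1
  refine ⟨⟨_, rfl⟩, ⟨_, rfl⟩, fun i j => ⟨key I i j norm_I, ?_⟩⟩
  simpa using key 1 i j norm_one

theorem LogPrimitive.hasPolarCoeffsAb (hlam : exp (2 * lam) = 2 * m) {β : CForm}
    (h : LogPrimitive lam m β a' b' k y0 G) (hy : 0 ≤ y0) : HasPolarCoeffsAb m β (lin a' b' (-I))
    (lin a' b' (-1)) := by
  have key : ∀ (p : Fin 2) (u c : ℂ), u ≠ 0 → y0 < sg p * (Real.log ‖u‖ - lam.re) →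
      β u (-(c * proj m u / projDeriv m u)) = sg p * lin a' b' (-c) := fun p u c hu hp => by
    set Y := log u - lam
    have hYre : Y.re = Real.log ‖u‖ - lam.re := by rw [sub_re, log_re]
    rw [← hYre] at hp
    have e : u = exp (lam + Y) := by rw [add_sub_cancel, exp_log hu]
    have hb := mem_unbranched_exp hlam (hy.trans_lt hp)
    have hs : sinh Y ≠ 0 := by
      rw [← (sinh_turn p Y).1]
      exact sinh_ne_zero (by rw [re_turn]; linarith)
    have hn := h.fderiv_end hp (by linarith) (-(c * proj m u / projDeriv m u) / u)
    have hd : projDeriv m u ≠ 0 := fun h0 => hb.2 (by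
      rw [← e]
      simp only [projDeriv] at h0
      field_simp at h0
      linear_combination h0)
    have hl := exp_ne_zero lam
    have h1 := proj_exp hlam Y
    have h2 := projDeriv_exp hlam Y
    rw [← e] at h1 h2
    rw [h.fderiv_eq _ hb, pull, ← e, ContinuousLinearMap.comp_apply, mulL_apply,
      mul_div_cancel₀ _ hu] at hn
    rw [hn, ← mul_div_mul_left _ _ hl, ← h1, ← h2]
    congr 2
    have : proj m u ≠ 0 := h1 ▸ mul_ne_zero hl hs
    field_simp
  have key' : ∀ (p : Fin 2) (l : Filter ℂ) (c μ : ℂ), (∀ᶠ u in l, u ≠ 0) →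
      Tendsto (fun u => sg p * Real.log ‖u‖) l atTop → μ = sg p * lin a' b' (-c) →
      (fun u => β u (-(c * proj m u / projDeriv m u)) - μ) =O[l] fun u => ‖proj m u‖⁻¹ := by
    rintro p l c μ hl ht rfl
    refine IsBigO.of_bound 0 ?_
    filter_upwards [hl, ht.eventually_gt_atTop (y0 + sg p * lam.re)] with u hu hp
    rw [key p u c hu (by linarith), sub_self, norm_zero, zero_mul]
  have h0 : ∀ᶠ u : ℂ in Bornology.cobounded ℂ, u ≠ 0 :=
    (tendsto_norm_cobounded_atTop.eventually_gt_atTop 0).mono fun u hu => norm_pos_iff.1 hu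
  have t0 : Tendsto (fun u : ℂ => sg 0 * Real.log ‖u‖) (Bornology.cobounded ℂ) atTop := by
    simpa [sg, Function.comp_def] using Real.tendsto_log_atTop.comp tendsto_norm_cobounded_atTop
  have t1 : Tendsto (fun u : ℂ => sg 1 * Real.log ‖u‖) (𝓝[≠] 0) atTop := by
    simpa [sg, Function.comp_def] using tendsto_neg_atBot_atTop.comp
      (Real.tendsto_log_nhdsGT_zero.comp (tendsto_norm_nhdsNE_zero (E := ℂ)))
  refine ⟨key' 0 _ I _ h0 t0 (by simp [sg]), ?_, ?_, ?_⟩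
  · simpa [sg] using key' 0 _ 1 _ h0 t0 rfl
  · simpa [sg] using key' 1 (𝓝[≠] 0) I _ self_mem_nhdsWithin t1 rfl
  · simpa [sg] using key' 1 (𝓝[≠] 0) 1 _ self_mem_nhdsWithin t1 rfl

theorem tendsto_cutoff {f : ℝ → ℂ} {w Ω : ℂ}
    (h : Tendsto (fun s : ℝ => f (rexp s) - 4 * π * s * w) atTop (𝓝 Ω)) :
    Tendsto (fun R : ℝ => f R⁻¹ - 2 * π * Real.log R * (-2 * w)) (𝓝[>] 0) (𝓝 Ω) := by
  refine (h.comp (tendsto_neg_atBot_atTop.comp Real.tendsto_log_nhdsGT_zero)).congr' ?_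
  filter_upwards [self_mem_nhdsWithin] with R hR
  simp only [Function.comp_apply, Real.exp_neg, Real.exp_log hR, ofReal_neg]
  ring

theorem shift_zero (A : MatForm) : shift 0 A = A := by funext z j k; simp [shift]

theorem trWedge_shift (i : Fin 2) (A B : MatForm) (z : ℂ) :
    trWedge (shift i A z) (shift i B z) = trWedge (A z) (B z) := by
  fin_cases i
  · change trWedge (shift 0 A z) (shift 0 B z) = _; rw [shift_zero, shift_zero]
  · simp [trWedge, MatCovector.eval, shift, Matrix.trace_fin_two, Matrix.mul_apply,
      Fin.sum_univ_two]
    ring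

theorem lin_neg_mul_sub (a1 b₁ a2 b₂ : ℂ) :
    lin a1 b₁ (-I) * lin a2 b₂ (-1) - lin a2 b₂ (-I) * lin a1 b₁ (-1)
      = -((a1 + b₁) * lin a2 b₂ I - (a2 + b₂) * lin a1 b₁ I) := by
  simp [lin]
  ring

/-! ### Variation of the Stokes multiplier along a path -/

theorem isRay_of_exp (hζ : ζ ≠ 0) (h : exp (2 * (Θ * I)) = ζ / ‖ζ‖) : IsRay ζ⁻¹ ζ
    ((‖ζ‖⁻¹ + ‖ζ‖) / 2) 0 Θ := by
  intro s ϑ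
  have hn : (‖ζ‖ : ℂ) ≠ 0 := by simpa using hζ
  have hc : conj ζ = ‖ζ‖ ^ 2 / ζ := by rw [eq_div_iff hζ, conj_mul']
  have e1 : exp (2 * (s + (Θ + ϑ) * I)) = rexp (2 * s) * (ζ / ‖ζ‖ * exp ((2 * ϑ : ℝ) * I)) := by
    rw [← h, ofReal_exp, ← exp_add, ← exp_add]
    push_cast
    ring_nf
  have e2 : exp (2 * conj (s + (Θ + ϑ) * I : ℂ))
      = rexp (2 * s) * (‖ζ‖ / ζ * conj (exp ((2 * ϑ : ℝ) * I))) := by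
    rw [← conj_two, ← map_mul, exp_conj, e1]
    simp only [map_mul, map_div₀, conj_ofReal, hc]
    field_simp
  have e3 : (ζ⁻¹ * exp (2 * (s + (Θ + ϑ) * I)) + ζ * exp (2 * conj (s + (Θ + ϑ) * I : ℂ))) / 2
      = (rexp (2 * s) / 2 : ℝ) * ((‖ζ‖⁻¹ : ℝ) * exp ((2 * ϑ : ℝ) * I)
        + ‖ζ‖ * conj (exp ((2 * ϑ : ℝ) * I))) := by
    rw [e1, e2]
    push_cast
    field_simp
  rw [e3, re_ofReal_mul, add_re, re_ofReal_mul, re_ofReal_mul, conj_re, exp_ofReal_mul_I_re]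
  simp only [sg, ↓reduceIte]
  ring

/-- The logarithm of `√(2m)` along a path on which `m / η` has positive real part. -/
def baseLog (η m : ℂ) : ℂ := (log 2 + log η + log (m / η)) / 2

theorem exp_two_mul_baseLog (hη : η ≠ 0) (hm : m ≠ 0) : exp (2 * baseLog η m) = 2 * m := by
  rw [baseLog, mul_div_cancel₀ _ two_ne_zero, exp_add, exp_add,
    exp_log two_ne_zero, exp_log hη, exp_log (div_ne_zero hm hη)]
  field_simp

theorem im_baseLog (h : 0 < (m / η).re) : (baseLog η m).im - Real.arctan ((m / η).im / (m / η).re) /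
    2 = arg η / 2 := by
  have h1 := abs_lt.1 (abs_arg_lt_pi_div_two_iff.2 (Or.inl h))
  rw [← tan_arg, Real.arctan_tan h1.1 h1.2]
  have : baseLog η m = ((1 / 2 : ℝ) : ℂ) * (log 2 + log η + log (m / η)) := by
    rw [baseLog]; push_cast; ring
  rw [this, im_ofReal_mul, add_im, add_im, log_im, log_im, log_im, ofNat_arg]
  ring

theorem exp_two_mul_angle (hη : η ≠ 0) (hζ : ζ ≠ 0) : exp
    (2 * (((arg η - arg (η / ζ)) / 2 : ℝ) * I)) = ζ / ‖ζ‖ := by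
  have h : ∀ x : ℂ, x ≠ 0 → exp (arg x * I) = x / ‖x‖ := fun x hx => by
    rw [eq_div_iff (by simpa using hx), mul_comm, norm_mul_exp_arg_mul_I]
  rw [show (2 * (((arg η - arg (η / ζ)) / 2 : ℝ) * I) : ℂ) = arg η * I - arg (η / ζ) * I by
    push_cast; ring, exp_sub, h _ hη, h _ (div_ne_zero hη hζ), norm_div]
  have : (‖η‖ : ℂ) ≠ 0 := by simpa using hη
  push_cast
  field_simp

theorem IsDom.mono (h : IsDom A c1 c2 a b j θ s1 C ψ) (hs : s1 ≤ s1') (hC : C ≤ C') : IsDom A c1 c2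
    a b j θ s1' C' ψ :=
  ⟨h.1, fun ξ hξ hθ => (h.2 ξ (hs.trans hξ) hθ).imp (fun h => h.trans (by gcongr))
    (fun h => h.trans (by gcongr))⟩

theorem IsVariation.mono (h : IsVariation A β a' b' s1 C) (hs : s1 ≤ s1') (hC : C ≤ C') :
    IsVariation A β a' b' s1' C' :=
  ⟨h.1, h.2, h.3, fun ξ hξ v i j => (h.4 ξ (hs.trans hξ) v i j).trans (by gcongr)⟩

theorem exists_sectors {v : ℕ → ℂ → Fin 2 → ℂ} (hA : ContDiff ℝ ∞ A) (hf : ∀ z, curvature A z = 0)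
    (ht : ∀ z v, A z 0 0 v + A z 1 1 v = 0) (hκ : 0 < κ) (hr : IsRay c1 c2 κ 0 Θ) (hC' : 0 ≤ C')
    (hC : C ≤ C') (hv : ∀ k, IsDom A c1 c2 a b (par k) (Θ + k * (π / 2)) s1 C (v k)) : ∃ m0 s1', s1
    ≤ s1' ∧ ∀ s ≥ s1', Sectors A c1 c2 a b κ Θ m0 s C' v := by
  have h1 : Tendsto (fun s : ℝ => κ * rexp (2 * s)) atTop atTop :=
    (Real.tendsto_exp_atTop.comp (tendsto_id.const_mul_atTop two_pos)).const_mul_atTop hκ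
  have h2 : Tendsto (fun s : ℝ => C' * rexp (-s)) atTop (𝓝 0) := by
    simpa using Real.tendsto_exp_neg_atTop_nhds_zero.const_mul C'
  obtain ⟨S, hS⟩ := eventually_atTop.1 ((h1.eventually_ge_atTop (max ‖a‖ ‖b‖)).and
    (h2.eventually_le_const one_pos))
  exact ⟨max ‖a‖ ‖b‖, max s1 S, le_max_left _ _, fun s hs => ⟨hA, hf, ht, hκ, hr, le_max_left _ _,
    le_max_right _ _, (hS s ((le_max_right _ _).trans hs)).1, hC',
    (hS s ((le_max_right _ _).trans hs)).2, fun k => (hv k).mono ((le_max_left _ _).trans hs) hC⟩⟩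

theorem dotForm_shift {D : FramedConnection ζ} (P : FramedPath D) (i : Fin 2) : dotForm
    (fun t => shift i (P.conn t).A) = shift i P.variation := by
  funext z
  have hd : DifferentiableAt ℝ (fun t => (P.conn t).A z) 0 :=
    (P.smooth.comp (contDiff_id.prodMk contDiff_const)).differentiable (by simp) 0
  exact ((shiftL i).hasFDerivAt.comp_hasDerivAt 0 hd.hasDerivAt).deriv

theorem sectors_limit {v : ℕ → ℂ → Fin 2 → ℂ} (h : Sectors A c1 c2 a b κ (Θ - π) m0 s1 C v)
    (hray : IsRay c1 c2 κ 0 Θ) (hφ : |φ - Θ| < π / 4) {X : Fin 2 → ℝ → ℂ} (hX : ∀ q, Tendsto (fun r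
    => (X q r).re) atTop atTop ∧ Tendsto (fun r => (X q r).im) atTop (𝓝 (φ + (turn q).im)))
    (q l : Fin 2) : Tendsto (fun r => gauged (expo c1 c2 a b) (q + 1) (v 4) (X q r) l) atTop (𝓝 (if
    l = q + 1 then (if q = 0 then wr (v 2 0) (v 4 0) else 1) else 0)) := by
  have hd := h.dom
  have d1 := hd 1
  have d2 := hd 2
  have d3 := hd 3
  have d4 := hd 4
  simp only [par, zero_add, show (1 + 1 : Fin 2) = 0 from rfl] at d1 d2 d3 d4
  push_cast at d1 d2 d3 d4
  rw [show Θ - π + 1 * (π / 2) = Θ - π / 2 by ring] at d1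
  rw [show Θ - π + 2 * (π / 2) = Θ by ring] at d2
  rw [show Θ - π + 3 * (π / 2) = Θ + π / 2 by ring] at d3
  rw [show Θ - π + 4 * (π / 2) = Θ + π by ring] at d4
  fin_cases q
  · obtain ⟨S1, e1⟩ := h.exists_stokes 1
    obtain ⟨S, e⟩ := h.exists_stokes 2
    have hS : wr (v 2 0) (v 4 0) = S := by
      have := h.wr_succ 2 0
      rw [e 0]
      simp [par, sg, wr] at this ⊢
      linear_combination S * this
    have hX0 := (hX 0).2
    simp only [turn, ↓reduceIte, zero_im, add_zero] at hX0
    simpa [hS] using grow_limit hray h.κ_pos (hX 0).1 hX0 hφ d2 d3 d1 e1 e l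
  · have hev := ((hX 1).2.sub_const (Θ + π)).abs.eventually_le_const (u := π / 2) (by
        rw [show φ + (turn 1).im - (Θ + π) = φ - Θ by simp [turn]]
        linarith [Real.pi_pos])
    simpa using d4.tendsto_gauged (hX 1).1 hev l

theorem stokes_variation (hη : 0 < (η / ζ).re) {D : FramedConnection ζ}
    {a : FramedAbelianConnection ζ} {P : FramedPath D} {Q : AbelianPath a}
    (hab : ∀ t, IsFramedAbelianization η (P.conn t) (Q.conn t))
    (hm : ∀ t, 0 < ((P.conn t).m / (sg i * η)).re) {C0 : ℝ} {v : ℕ → ℂ → Fin 2 → ℂ}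
    (hΘ : Θ = (arg (sg i * η) - arg (η / ζ)) / 2) (hκ : 0 < κ)
    (hray : IsRay (sg i * ζ⁻¹) (sg i * ζ) κ 0 Θ) (hray' : IsRay (sg i * ζ⁻¹) (sg i * ζ) κ 0 (Θ - π))
    (hv : ∀ k, IsDom (shift i D.A) (sg i * ζ⁻¹) (sg i * ζ) (sg i * (ζ⁻¹ * D.m - D.m3 / 2)) (sg i *
    (ζ * conj D.m + D.m3 / 2)) (par k) (Θ + k * (π / 2)) s0 C0 (v k)) : ∃ (a' b' k : ℂ)
    (s1 C y0 : ℝ) (G : ℂ → ℂ), 0 ≤ y0 ∧ IsVariation D.A P.variation a' b' s1 C ∧ IsVariation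
    (shift i D.A) (shift i P.variation) (sg i * a') (sg i * b') s1 C ∧ LogPrimitive
    (baseLog (sg i * η) D.m) a.m Q.variation a' b' k y0 G ∧ wr (v 0 0) (v 2 0) ≠ 0 ∧ ∀ q,
    IsStokesVariation v (shift i P.variation) (sg i * a') (sg i * b') Θ (wr (v 0 0) (v 2 0)) q → q =
    -sg i * k := by
  have hη0 : η ≠ 0 := by rintro rfl; simp at hη
  have hsg : (sg i : ℂ) ≠ 0 := fun h => by simpa [h] using ofReal_sg_mul_self i
  have hη' : (sg i * η : ℂ) ≠ 0 := mul_ne_zero hsg hη0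
  have hQm : ∀ t, (Q.conn t).m = (P.conn t).m := fun t => (hab t).1
  have hA : Q.coeffA = fun t => ζ⁻¹ * (P.conn t).m - (P.conn t).m3 / 2 := by
    funext t; rw [AbelianPath.coeffA, hQm, (hab t).2.1]
  have hB : Q.coeffB = fun t => ζ * conj (P.conn t).m + (P.conn t).m3 / 2 := by
    funext t; rw [AbelianPath.coeffB, hQm, (hab t).2.1]
  have ham : a.m = D.m := by rw [← Q.base, ← P.base, hQm]
  obtain ⟨s1, C, f⟩ := P.exists_flatFamily 0
  obtain ⟨s2, C2, g⟩ := P.exists_flatFamily i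
  have hlam : exp (2 * baseLog (sg i * η) D.m) = 2 * a.m := by
    rw [exp_two_mul_baseLog hη' (ham ▸ a.m_ne_zero), ham]
  have fV := f.isVariation
  have ha := f.hasDerivAt_a
  have hb := f.hasDerivAt_b
  have gV := g.isVariation
  simp only [P.base, shift_zero, sg, ↓reduceIte, ofReal_one, one_mul] at fV ha hb
  simp only [dotForm_shift, P.base] at gV
  generalize ζ⁻¹ * deriv (fun t => (P.conn t).m) 0 - deriv (fun t => (P.conn t).m3) 0 / 2 = a' at *
  generalize ζ * conj (deriv (fun t => (P.conn t).m) 0) + deriv (fun t => (P.conn t).m3) 0 / 2 = b'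
    at *
  obtain ⟨y0, k, G, E, d, j, hy0, hG, hE⟩ := Q.exists_logPrimitive hlam (hA ▸ ha) (hB ▸ hb)
  obtain ⟨s3, C3, ψ, hs₃, hC3, hψ⟩ := g.exists_dom hκ hray'
  have hΘk : ∀ k : ℕ, Θ - π + (k + 2 : ℕ) * (π / 2) = Θ + k * (π / 2) := fun k => by push_cast; ring
  have hψ' : ∀ k, ∀ t ∈ Icc (-1 : ℝ) 1, IsDom (shift i (P.conn t).A) (sg i * ζ⁻¹) (sg i * ζ)
      (sg i * (ζ⁻¹ * (P.conn t).m - (P.conn t).m3 / 2))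
      (sg i * (ζ * conj (P.conn t).m + (P.conn t).m3 / 2)) (par k) (Θ + k * (π / 2)) s3 C3
      (ψ (k + 2) t) := fun k t ht => by
    simpa only [par_add_two, hΘk] using hψ (k + 2) t ht
  have hvψ : ∀ k, ψ (k + 2) 0 = v k := fun k => by
    have h0 := hψ' k 0 (by norm_num)
    simp only [P.base] at h0
    have hs := g.smooth_apply 0
    have hfl := g.flat 0
    have htr := g.traceless 0
    simp only [P.base] at hs hfl htr
    exact h0.unique hs hfl htr (hray.nat k) hκ (hv k)
  set S : ℝ → ℂ := fun t => wr (ψ 2 t 0) (ψ 4 t 0) with hSdef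
  have hS0 : S 0 = wr (v 0 0) (v 2 0) := by simp only [hSdef]; rw [← hvψ 0, ← hvψ 2]
  have hcm : Continuous fun t => (P.conn t).m := P.smooth_m.continuous
  obtain ⟨δ, hδ, hδφ⟩ := Q.exists_close (by simpa only [hQm] using hcm)
  have hlamc : ContinuousAt (fun t => baseLog (sg i * η) (P.conn t).m) 0 :=
    (continuousAt_const.add ((hcm.continuousAt.div_const _).clog (Or.inl (hm 0)))).div_const 2
  have hnear : ∀ᶠ t in 𝓝 0, ‖baseLog (sg i * η) (P.conn t).m - baseLog (sg i * η) D.m‖ ≤ 1 := by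
    refine (hlamc.sub_const (baseLog (sg i * η) D.m)).norm.eventually_le_const ?_
    simp only [P.base, sub_self, norm_zero, zero_lt_one]
  have key : ∀ᶠ t in 𝓝 0, S t ^ 2 * (d (i + 1) * exp (if i = 0 then j t else 0))
      = d i * exp (if i = 0 then 0 else j t) := by
    filter_upwards [hnear, Metric.closedBall_mem_nhds 0 hδ,
      Icc_mem_nhds (show (-1 : ℝ) < 0 by norm_num) one_pos] with t hn ht hI
    obtain ⟨e, he⟩ := (hab t).2.2
    obtain ⟨m0, s, -, hs⟩ := exists_sectors (g.smooth_apply t) (g.flat t) (g.traceless t) hκ hray'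
      hC3 le_rfl (fun k => hψ k t hI)
    have hsec := hs s le_rfl
    refine hE.sq_stokes he (hQm t) (hδφ t (by simpa using ht)) hy0 hlam
      (exp_two_mul_baseLog hη' fun h0 => by simpa [h0] using hm t) hn hη0 rfl (hm t)
      (hψ 4 t hI).1 ?_
    rw [hA, hB]
    refine sectors_limit hsec hray (φ := arg (sg i * η) / 2) ?_ fun q => ?_
    · have := abs_arg_lt_pi_div_two_iff.2 (Or.inl hη)
      rw [hΘ, show arg (sg i * η) / 2 - (arg (sg i * η) - arg (η / ζ)) / 2 = arg (η / ζ) / 2 by ring,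
        abs_div, abs_two]
      linarith
    · rw [← im_baseLog (hm t), sub_add_eq_add_sub]
      exact tendsto_curveLog _ _ q
  have hD : ∀ᶠ t in 𝓝 0, S t ^ 2 = d i / d (i + 1) * exp (-(sg i * j t)) := by
    filter_upwards [key] with t ht
    have h1 := hE.ne_zero (i + 1)
    have h2 := exp_ne_zero (j t)
    fin_cases i <;> simp [sg, exp_neg] at * <;> field_simp <;> linear_combination ht
  have hSne : S 0 ≠ 0 := fun h0 => by
    have := hD.self_of_nhds
    rw [h0, zero_pow two_ne_zero] at this
    exact mul_ne_zero (div_ne_zero (hE.ne_zero _) (hE.ne_zero _)) (exp_ne_zero _) this.symm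
  refine ⟨a', b', k, max s1 s2, max C C2, y0, G, hy0, fV.mono (le_max_left _ _) (le_max_left _ _),
    gV.mono (le_max_right _ _) (le_max_right _ _), hG, hS0 ▸ hSne, fun q hq => ?_⟩
  have hd := g.hasDerivAt_stokes hκ hray (ψ := fun k => ψ (k + 2)) hs₃ hC3 hψ' (q := q) (by
    simpa only [dotForm_shift, hvψ] using hq)
  have h1 := (hd.pow 2).congr_of_eventuallyEq (hD.mono fun t ht => ht.symm)
  have h2 := (((hE.hasDerivAt.const_mul (sg i : ℂ)).neg.cexp).const_mul (d i / d (i + 1))).unique h1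
  have h3 := hD.self_of_nhds
  apply mul_left_cancel₀ (mul_ne_zero two_ne_zero (pow_ne_zero 2 hSne))
  simp only [Nat.cast_ofNat, Nat.add_one_sub_one, pow_one, Pi.neg_apply] at h2
  linear_combination -h2 + 2 * sg i * k * h3

theorem re_div_sg_mul (i : Fin 2) (m η : ℂ) : (m / (sg i * η)).re = sg i * (m / η).re := by
  fin_cases i <;> simp [sg, div_neg]

theorem sg_mul_pos {g : ℝ → ℝ} (hg : Continuous g) (h : ∀ t, g t ≠ 0) (h0 : 0 < sg i * g 0) (t : ℝ)
    : 0 < sg i * g t := by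
  by_contra! hn
  obtain ⟨s, hs⟩ := mem_range_of_exists_le_of_exists_ge (hg.const_mul (sg i)) ⟨t, hn⟩ ⟨0, h0.le⟩
  have : sg i ≠ 0 := fun h => by simp [h] at h0
  exact (mul_ne_zero this (h s)) hs

end

theorem mainTheorem6 (ζ η : ℂ) (hζ : ζ ≠ 0) (hη : 0 < (η / ζ).re)
    (D : FramedConnection ζ) (a : FramedAbelianConnection ζ)
    (P₁ P₂ : FramedPath D) (Q₁ Q₂ : AbelianPath a)
    (hm₁ : ∀ t, ((P₁.conn t).m / η).re ≠ 0) (hm₂ : ∀ t, ((P₂.conn t).m / η).re ≠ 0)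
    (hab₁ : ∀ t, IsFramedAbelianization η (P₁.conn t) (Q₁.conn t))
    (hab₂ : ∀ t, IsFramedAbelianization η (P₂.conn t) (Q₂.conn t)) :
    (∃ ρ : ℂ, IsRegTerm P₁.variation P₂.variation ρ ∧ IsRegTermAb D.m Q₁.variation Q₂.variation ρ) ∧
    ∃ Ω : ℂ, IsRegularizedForm P₁.variation P₂.variation Ω ∧
      IsRegularizedFormAb D.m Q₁.variation Q₂.variation Ω := by
  have hη0 : η ≠ 0 := by rintro rfl; simp at hη
  obtain ⟨i, hi⟩ : ∃ i : Fin 2, 0 < sg i * (D.m / η).re := by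
    have := hm₁ 0
    rw [P₁.base] at this
    rcases this.lt_or_gt with h | h
    · exact ⟨1, by simpa [sg] using h⟩
    · exact ⟨0, by simpa [sg] using h⟩
  have hpos : ∀ P : FramedPath D, (∀ t, ((P.conn t).m / η).re ≠ 0) →
      ∀ t, 0 < ((P.conn t).m / (sg i * η)).re := fun P h t => by
    rw [re_div_sg_mul]
    exact sg_mul_pos (g := fun t => ((P.conn t).m / η).re)
      (continuous_re.comp (P.smooth_m.continuous.div_const _)) h (by rwa [P.base]) t
  have hsg : (sg i : ℂ) ≠ 0 := fun h => by simpa [h] using ofReal_sg_mul_self i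
  have hsi : (sg i : ℂ) * ζ⁻¹ = (sg i * ζ)⁻¹ := by fin_cases i <;> simp [sg]
  obtain ⟨Θ, hΘ⟩ : ∃ Θ : ℝ, Θ = (arg (sg i * η) - arg (η / ζ)) / 2 := ⟨_, rfl⟩
  have hζ' : (sg i * ζ : ℂ) ≠ 0 := mul_ne_zero hsg hζ
  have hex : exp (2 * (Θ * I)) = sg i * ζ / ‖(sg i * ζ : ℂ)‖ := by
    rw [hΘ, ← mul_div_mul_left η ζ hsg]
    exact exp_two_mul_angle (mul_ne_zero hsg hη0) hζ'
  set κ := (‖(sg i * ζ : ℂ)‖⁻¹ + ‖(sg i * ζ : ℂ)‖) / 2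
  have hκ : 0 < κ := by positivity
  have hray : IsRay (sg i * ζ⁻¹) (sg i * ζ) κ 0 Θ := by rw [hsi]; exact isRay_of_exp hζ' hex
  have hray' : IsRay (sg i * ζ⁻¹) (sg i * ζ) κ 0 (Θ - Real.pi) := by
    rw [hsi]
    refine isRay_of_exp hζ' ?_
    rw [← hex, ofReal_sub, sub_mul, mul_sub, exp_sub, ← mul_assoc 2 (Real.pi : ℂ),
      exp_two_pi_mul_I, div_one]
  obtain ⟨s0, C, f⟩ := P₁.exists_flatFamily i
  obtain ⟨s1, C0, ψ, -, hC0, hψ⟩ := f.exists_dom hκ hray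
  have hv := fun k => hψ k 0 (by norm_num)
  have hs := f.smooth_apply 0
  have hfl := f.flat 0
  have htr := f.traceless 0
  simp only [P₁.base] at hv hs hfl htr
  obtain ⟨a1, b₁, k1, s2, C1, y1, G1, hy1, V1, W1, L1, hS, hq1⟩ := stokes_variation hη hab₁
    (hpos P₁ hm₁) hΘ hκ hray hray' hv
  obtain ⟨a2, b₂, k2, s3, C2, y2, G2, hy2, V2, W2, L2, -, hq2⟩ := stokes_variation hη hab₂
    (hpos P₂ hm₂) hΘ hκ hray hray' hv
  obtain ⟨m0, s4, -, hsec⟩ := exists_sectors (C' := max C0 (max C1 C2)) hs hfl htr hκ hray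
    (hC0.trans (le_max_left _ _)) (le_max_left _ _) hv
  have hsec := hsec (max s4 (max s2 s3)) (le_max_left _ _)
  obtain ⟨S, hSS⟩ := hsec.exists_stokes 0
  have hSw : wr (ψ 0 0 0) (ψ 2 0 0) = S := by
    have := hsec.wr_succ 0 0
    rw [hSS 0]
    simp [par, sg, wr] at this ⊢
    linear_combination S * this
  rw [hSw] at hS hq1 hq2
  obtain ⟨q1, q2, h₁, h₂, hlim⟩ := hsec.tendsto_integral
    (W1.mono ((le_max_left _ _).trans (le_max_right _ _))
      ((le_max_left _ _).trans (le_max_right _ _)))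
    (W2.mono ((le_max_right _ _).trans (le_max_right _ _))
      ((le_max_right _ _).trans (le_max_right _ _))) hSS hS
  rw [hq1 q1 h₁, hq2 q2 h₂] at hlim
  have hss := ofReal_sg_mul_self i
  have hlin : ∀ a b : ℂ, lin (sg i * a) (sg i * b) I = sg i * lin a b I := fun a b => by
    simp only [lin]; ring
  have e1 : ((sg i * a1 + sg i * b₁) * (sg i * lin a2 b₂ I)
      - (sg i * a2 + sg i * b₂) * (sg i * lin a1 b₁ I) : ℂ)
      = (a1 + b₁) * lin a2 b₂ I - (a2 + b₂) * lin a1 b₁ I := by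
    linear_combination ((a1 + b₁) * lin a2 b₂ I - (a2 + b₂) * lin a1 b₁ I) * hss
  have e2 : (-sg i * k1 * (sg i * lin a2 b₂ I) - -sg i * k2 * (sg i * lin a1 b₁ I) : ℂ)
      = lin a1 b₁ I * k2 - k1 * lin a2 b₂ I := by
    linear_combination (lin a1 b₁ I * k2 - k1 * lin a2 b₂ I) * hss
  simp only [trWedge_shift, hlin, e1, e2] at hlim
  have ham : a.m = D.m := by rw [← Q₁.base, ← P₁.base, (hab₁ 0).1]
  have hlam : exp (2 * baseLog (sg i * η) D.m) = 2 * a.m := by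
    rw [exp_two_mul_baseLog (mul_ne_zero hsg hη0) (ham ▸ a.m_ne_zero), ham]
  have hlim' := L1.tendsto_integral hlam L2
  have hρ : IsRegTerm P₁.variation P₂.variation
      (-2 * ((a1 + b₁) * lin a2 b₂ I - (a2 + b₂) * lin a1 b₁ I)) := by
    refine ⟨_, _, _, _, V1.hasPolarCoeffs, V2.hasPolarCoeffs, ?_⟩
    rw [neg_mul, ← mul_neg, ← lin_neg_mul_sub]
    simp [matH, Matrix.trace_fin_two]
    ring
  have hρ' : IsRegTermAb D.m Q₁.variation Q₂.variation
      (-2 * ((a1 + b₁) * lin a2 b₂ I - (a2 + b₂) * lin a1 b₁ I)) := by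
    refine ⟨_, _, _, _, ham ▸ L1.hasPolarCoeffsAb hlam hy1, ham ▸ L2.hasPolarCoeffsAb hlam hy2, ?_⟩
    rw [neg_mul, ← mul_neg, ← lin_neg_mul_sub]
  rw [ham] at hlim'
  exact ⟨⟨_, hρ, hρ'⟩, _, ⟨_, hρ, tendsto_cutoff
    (f := fun c => ∫ z in Metric.closedBall 0 c, trWedge (P₁.variation z) (P₂.variation z)) hlim⟩, _, hρ',
    tendsto_cutoff (f := fun c => ∫ u in {u : ℂ | u ≠ 0 ∧ ‖proj D.m u‖ ≤ c},
      wedge (Q₁.variation u) (Q₂.variation u)) hlim'⟩
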